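/- Let $\mathfrak g$ be a Lie superalgebra of type $gl(m,n)$, $B(m,n)=\mathfrak{osp}(2m+1,2n)$ or $D(m,n)=\mathfrak{osp}(2m,2n)$ (with $m=1$, i.e. type $C$, included). Let $\varepsilon_1,\dots,\varepsilon_m,\delta_1,\dots,\delta_n$ be the standard basis of $\mathfrak h^*$, with $(\varepsilon_i,\varepsilon_j)=\delta_{ij}=-(\delta_i,\delta_j)$ and $(\varepsilon_i,\delta_j)=0$, let $\Delta=\Delta_0\cup\Delta_1$ be the set of (even and odd) roots, and let $W_{\mathfrak g}$ be the group generated by the reflections $s_\alpha$, $\alpha\in\Delta_0$. For $w\in W_{\mathfrak g}$ let $\mathrm{sgn}'(w)=(-1)^k$, where $k$ is the number of reflections in roots of $\{\alpha\in\Delta_0\mid \alpha/2\notin\Delta\}$ in an expression of $w$ as a product of reflections in even roots, and for $U\subseteq W_{\mathfrak g}$ and a rational function $Y$ in exponentials put $\check{\mathcal F}_U(Y)=\sum_{w\in U}\mathrm{sgn}'(w)\,w(Y)$. Let $C_{\mathfrak g}=|W_{\mathfrak g}/W^\sharp|$, where $W^\sharp$ is generated by the $s_\alpha$ with $\alpha\in\Delta_0$,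 $h^\vee(\alpha,\alpha)>0$, and $h^\vee$ is the dual Coxeter number (if $h^\vee=0$, by the $s_\alpha$ with $\alpha\in\Delta_0$, $(\alpha,\alpha)>0$). Let $\mathcal B=\{\xi_1>\dots>\xi_{m+n}\}$ be a totally ordered basis of $\mathfrak h^*$ consisting of the $\varepsilon_i$ and $\delta_j$, where in types $B$, $C$, $D$ each of them may be replaced by its negative. Let $\mathcal E$ and $\mathcal D$ be the sets of elements of $\mathcal B$ of the form $\pm\varepsilon_i$, respectively $\pm\delta_j$. Let $\Pi$ be the set of simple roots consisting of the $\xi_i-\xi_{i+1}$, $1\le i<m+n$, together with $\xi_{m+n}$ in type $B$, with $2\xi_{m+n}$ in types $C$, $D$ if $\xi_{m+n}\in\mathcal D$, and with $\xi_{m+n-1}+\xi_{m+n}$ in types $C$, $D$ if $\xi_{m+n}\in\mathcal E$. Let $\Delta^+=\Delta_0^+\cup\Delta_1^+$ be the corresponding set of positive roots. Let $X$ be an arc diagram on $\mathcal B$: a set of $\min(m,n)$ arcs joining pairs of elements of $\mathcal B$, such that the ends of each arc are of different type (one in $\mathcal E$ and one in $\mathcal D$), the arcs do not intersect (end points included),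 and for each arc with ends $v>w$ the interval $[v,w]=\{u\mid v\ge u\ge w\}$ contains as many elements of $\mathcal E$ as of $\mathcal D$. Let $\mathrm{Supp}(X)$ be the set of ends of arcs and $S(X)=\{v-w\mid v>w\text{ joined by an arc}\}$. Put $\rho_X=\frac12\sum_{\alpha\in\Delta_0^+}\alpha-\frac12\sum_{\alpha\in\Delta_1^+}\alpha$, $$\check R_X=\frac{\prod_{\alpha\in\Delta_0^+}(1-e^{-\alpha})}{\prod_{\alpha\in\Delta_1^+}(1-e^{-\alpha})},\qquad \mathcal P(X)=\prod_{\gamma\in S(X)}\frac{\mathrm{ht}\,\gamma+1}{2}\cdot\frac{e^{\rho_X}}{\prod_{\gamma\in S(X)}(1-e^{-[\![\gamma]\!]})},$$ where $\mathrm{ht}$ is the height with respect to $\Pi$, $[\![\gamma]\!]=\sum_{\beta\in S(X),\,\beta\le\gamma}\mathrm{sn}(\gamma)\,\mathrm{sn}(\beta)\,\beta$, $\mathrm{sn}(\beta)=(\beta,\sum_{\xi\in\mathcal E}\xi)$, and $\beta\le\gamma$ means that $\gamma-\beta$ is zero or a sum of positive roots. Let $\mathrm{Supp}(X)\subseteq\mathcal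 B'\subseteq\mathcal B$. Let $\Delta(\mathcal B')$ be the set of roots that are linear combinations of the simple roots lying in the span of $\mathcal B'$. Assume that $\Delta(\mathcal B')$ is irreducible (the set of these simple roots is nonempty and has a connected Dynkin diagram) and that every element of $\mathcal B'$ occurs in one of these simple roots. Let $\Delta_0(\mathcal B')$ be its set of even roots, $W(\mathcal B')$ its Weyl group (generated by the reflections in $\Delta_0(\mathcal B')$), and $W^\sharp(\mathcal B')$ the Weyl group of that one of the two parts of $\Delta_0(\mathcal B')$ (the roots in the span of the $\varepsilon_i$, and those in the span of the $\delta_j$) which is not the smallest one, i.e. has at least as many roots as the other (either part if both have equally many). Let $W_{\mathcal B'}$ be the group of non-signed permutations of $\mathcal B'\cap\mathcal E$ and of $\mathcal B'\cap\mathcal D$. Let $T$ be any set of representatives of $(W_{\mathcal B'}W^\sharp(\mathcal B'))\backslash W(\mathcal B')$, $Z$ any set of representatives of $W_{\mathfrak g}/W(\mathcal B')$, and $W_0=Z\,W_{\mathcal B'}\,W^\sharp(\mathcal B')$. Then $$\check{\mathcal F}_{W_0}(\mathcal P(X))=\frac{C_{\mathfrak g}}{|T|}\,e^{\rho_X}\check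 R_X .$$ -/

import Mathlib

open scoped Pointwise

namespace SuperDenominator

/-! ### Root data of `gl(m,n)`, `B(m,n)`, `D(m,n)` and `C(n)` -/

/-- The types of Lie superalgebras: `gl` is `gl(m,n)`, `B` is `osp(2m+1,2n)` and `D` is
`osp(2m,2n)`.  Type `C` is type `D` with `m = 1`. -/
inductive SuperType
  | gl
  | B
  | D
  deriving DecidableEq

/-- The rational form of `h^*`: the space with basis `ε_1,…,ε_m` (indexed by `Sum.inl`) and
`δ_1,…,δ_n` (indexed by `Sum.inr`). -/
abbrev Weight (m n : ℕ) : Type := Fin m ⊕ Fin n → ℚ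

/-- The basis vector `ε_i` or `δ_j`. -/
def stdVec {m n : ℕ} (a : Fin m ⊕ Fin n) : Weight m n := Pi.single a 1

/-- The invariant form: `(ε_i, ε_j) = δ_ij = -(δ_i, δ_j)`, `(ε_i, δ_j) = 0`. -/
def form {m n : ℕ} (x y : Weight m n) : ℚ :=
  ∑ i : Fin m, x (Sum.inl i) * y (Sum.inl i) - ∑ j : Fin n, x (Sum.inr j) * y (Sum.inr j)

/-- Signs `(s, s')` such that `s e_a + s' e_b` is a root for all `a ≠ b`. -/
def pairSigns : SuperType → Finset (ℚ × ℚ)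
  | .gl => {(1, -1)}
  | .B => {(1, 1), (1, -1), (-1, 1), (-1, -1)}
  | .D => {(1, 1), (1, -1), (-1, 1), (-1, -1)}

/-- The roots `s e_a + s' e_b`, `a ≠ b`, with `e_a, e_b` of the same type (`same = true`)
or of different types (`same = false`). -/
def pairRoots (t : SuperType) (m n : ℕ) (same : Bool) : Finset (Weight m n) :=
  ((Finset.univ.filter fun p : (Fin m ⊕ Fin n) × (Fin m ⊕ Fin n) =>
      p.1 ≠ p.2 ∧ (p.1.isLeft == p.2.isLeft) = same) ×ˢ pairSigns t).image
    fun q => q.2.1 • stdVec q.1.1 + q.2.2 • stdVec q.1.2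

/-- `± c ε_i`. -/
def multEps (m n : ℕ) (c : ℚ) : Finset (Weight m n) :=
  (Finset.univ : Finset (Fin m)).image (fun i => c • stdVec (Sum.inl i)) ∪
  (Finset.univ : Finset (Fin m)).image (fun i => (-c) • stdVec (Sum.inl i))

/-- `± c δ_j`. -/
def multDelta (m n : ℕ) (c : ℚ) : Finset (Weight m n) :=
  (Finset.univ : Finset (Fin n)).image (fun j => c • stdVec (Sum.inr j)) ∪
  (Finset.univ : Finset (Fin n)).image (fun j => (-c) • stdVec (Sum.inr j))

/-- The set `Δ_0` of even roots. -/
def evenRoots (t : SuperType) (m n : ℕ) : Finset (Weight m n) :=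
  pairRoots t m n true ∪
    match t with
    | .gl => ∅
    | .B => multEps m n 1 ∪ multDelta m n 2
    | .D => multDelta m n 2

/-- The set `Δ_1` of odd roots. -/
def oddRoots (t : SuperType) (m n : ℕ) : Finset (Weight m n) :=
  pairRoots t m n false ∪
    match t with
    | .gl => ∅
    | .B => multDelta m n 1
    | .D => ∅

/-- The set `{α ∈ Δ_0 | α / 2 ∉ Δ}`. -/
def evenRootsBar (t : SuperType) (m n : ℕ) : Finset (Weight m n) :=
  (evenRoots t m n).filter fun α => (1 / 2 : ℚ) • α ∉ evenRoots t m n ∪ oddRoots t m n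

/-! ### Weyl groups -/

/-- The linear map `x ↦ x - (2 (x, α) / (α, α)) α`. -/
def reflectionMap {m n : ℕ} (α : Weight m n) : Weight m n →ₗ[ℚ] Weight m n where
  toFun x := x - (2 * form x α / form α α) • α
  map_add' x y := by
    have h : form (x + y) α = form x α + form y α := by
      simp only [form, Pi.add_apply, add_mul, Finset.sum_add_distrib]; ring
    rw [h, mul_add, add_div, add_smul]; abel
  map_smul' c x := by
    have h : form (c • x) α = c * form x α := by
      simp only [form, Pi.smul_apply, smul_eq_mul, mul_assoc, ← Finset.mul_sum]; ring
    rw [h, RingHom.id_apply, smul_sub, smul_smul]; congr 2; ring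

theorem reflectionMap_involutive {m n : ℕ} (α : Weight m n) :
    Function.Involutive (reflectionMap α) := by
  intro x
  by_cases h0 : form α α = 0
  · simp [reflectionMap, h0]
  · have h : form (x - (2 * form x α / form α α) • α) α = -form x α := by
      have : form (x - (2 * form x α / form α α) • α) α
          = form x α - (2 * form x α / form α α) * form α α := by
        simp only [form, Pi.sub_apply, Pi.smul_apply, smul_eq_mul, sub_mul,
          Finset.sum_sub_distrib, mul_assoc, ← Finset.mul_sum]; ring
      rw [this]; field_simp; ring
    change (x - (2 * form x α / form α α) • α) -
      (2 * form (x - (2 * form x α / form α α) • α) α / form α α) • α = x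
    rw [h, mul_neg, neg_div, neg_smul]; abel

/-- The reflection `s_α` with respect to a non-isotropic `α`. -/
def reflection {m n : ℕ} (α : Weight m n) : Weight m n ≃ₗ[ℚ] Weight m n :=
  LinearEquiv.ofInvolutive (reflectionMap α) (reflectionMap_involutive α)

/-- The group generated by the reflections in the elements of `A`. -/
def reflectionGroup {m n : ℕ} (A : Set (Weight m n)) : Subgroup (Weight m n ≃ₗ[ℚ] Weight m n) :=
  Subgroup.closure (reflection '' A)

/-- The Weyl group `W_g`. -/
def weylGroup (t : SuperType) (m n : ℕ) : Subgroup (Weight m n ≃ₗ[ℚ] Weight m n) :=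
  reflectionGroup (evenRoots t m n : Set (Weight m n))

theorem form_stdVec {m n : ℕ} (c : Fin m ⊕ Fin n) (x : Weight m n) :
    form (stdVec c) x = (if c.isLeft = true then 1 else -1) * x c := by
  cases c with
  | inl i =>
    simp [form, stdVec, Pi.single_apply]
  | inr j =>
    simp [form, stdVec, Pi.single_apply]

theorem form_add_smul {m n : ℕ} (s s' : ℚ) (u v x : Weight m n) :
    form (s • u + s' • v) x = s * form u x + s' * form v x := by
  simp only [form, Pi.add_apply, Pi.smul_apply, smul_eq_mul, add_mul, Finset.sum_add_distrib,
    mul_assoc, ← Finset.mul_sum]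
  ring

/-- The finite set of the vectors `± ε_i`, `± δ_j`. -/
def signedVecs (m n : ℕ) : Set (Weight m n) :=
  Set.range (fun p : (Fin m ⊕ Fin n) × ℤˣ => ((p.2 : ℤ) : ℚ) • (stdVec p.1 : Weight m n))

theorem reflection_pair {m n : ℕ} {a b : Fin m ⊕ Fin n} (hab : a ≠ b)
    (ht : a.isLeft = b.isLeft) {s s' : ℚ} (hs : s = 1 ∨ s = -1) (hs' : s' = 1 ∨ s' = -1)
    (c : Fin m ⊕ Fin n) :
    ∃ d, ∃ u : ℤˣ, reflection (s • stdVec a + s' • stdVec b : Weight m n) (stdVec c) =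
      ((u : ℤ) : ℚ) • stdVec d := by
  have hη : ((if a.isLeft = true then 1 else -1 : ℚ)) ≠ 0 := by split_ifs <;> norm_num
  have hna : form (s • stdVec a + s' • stdVec b : Weight m n) (s • stdVec a + s' • stdVec b)
      = 2 * (if a.isLeft = true then 1 else -1 : ℚ) := by
    rw [form_add_smul, form_stdVec, form_stdVec, ← ht]
    have e1 : (s • stdVec a + s' • stdVec b : Weight m n) a = s := by
      simp [stdVec, hab]
    have e2 : (s • stdVec a + s' • stdVec b : Weight m n) b = s' := by
      simp [stdVec, hab.symm]
    rw [e1, e2]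
    rcases hs with rfl | rfl <;> rcases hs' with rfl | rfl <;> ring
  have hr : ∀ x : Weight m n, reflection (s • stdVec a + s' • stdVec b : Weight m n) x =
      x - (2 * form x (s • stdVec a + s' • stdVec b) /
        form (s • stdVec a + s' • stdVec b : Weight m n) (s • stdVec a + s' • stdVec b)) •
          (s • stdVec a + s' • stdVec b) := fun _ => rfl
  rw [hr, hna, form_stdVec]
  by_cases hca : c = a
  · subst hca
    have e1 : (s • stdVec c + s' • stdVec b : Weight m n) c = s := by
      simp [stdVec, hab]
    rw [e1, mul_div_mul_left _ _ two_ne_zero, mul_div_cancel_left₀ _ hη]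
    refine ⟨b, if s = s' then -1 else 1, ?_⟩
    rcases hs with rfl | rfl <;> rcases hs' with rfl | rfl <;> norm_num
  · by_cases hcb : c = b
    · subst hcb
      have e1 : (s • stdVec a + s' • stdVec c : Weight m n) c = s' := by
        simp [stdVec, hab.symm]
      rw [e1, ← ht, mul_div_mul_left _ _ two_ne_zero, mul_div_cancel_left₀ _ hη]
      refine ⟨a, if s = s' then -1 else 1, ?_⟩
      rcases hs with rfl | rfl <;> rcases hs' with rfl | rfl <;> norm_num
    · refine ⟨c, 1, ?_⟩
      have e1 : (s • stdVec a + s' • stdVec b : Weight m n) c = 0 := by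
        simp [stdVec, hca, hcb]
      rw [e1]; simp

theorem reflection_mult {m n : ℕ} {a : Fin m ⊕ Fin n} {s : ℚ} (hs : s ≠ 0)
    (c : Fin m ⊕ Fin n) :
    ∃ d, ∃ u : ℤˣ, reflection (s • stdVec a : Weight m n) (stdVec c) =
      ((u : ℤ) : ℚ) • stdVec d := by
  have hr : ∀ x : Weight m n, reflection (s • stdVec a : Weight m n) x =
      x - (2 * form x (s • stdVec a) / form (s • stdVec a : Weight m n) (s • stdVec a)) •
          (s • stdVec a) := fun _ => rfl
  have h0 := form_add_smul s 0 (stdVec a) 0 (s • stdVec a : Weight m n)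
  simp only [zero_smul, add_zero, zero_mul] at h0
  rw [hr, h0, form_stdVec, form_stdVec]
  refine ⟨c, if c = a then -1 else 1, ?_⟩
  by_cases hca : c = a
  · subst hca
    have e1 : (s • stdVec c : Weight m n) c = s := by simp [stdVec]
    rw [e1, smul_smul]
    have : 2 * ((if c.isLeft = true then 1 else -1 : ℚ) * s) /
        (s * ((if c.isLeft = true then 1 else -1 : ℚ) * s)) * s = 2 := by
      split_ifs <;> field_simp
    rw [this, if_pos rfl]
    ext i
    simp; ring
  · have e1 : (s • stdVec a : Weight m n) c = 0 := by simp [stdVec, hca]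
    rw [e1]; simp [hca]

theorem reflection_even (t : SuperType) {m n : ℕ} {α : Weight m n} (hα : α ∈ evenRoots t m n)
    (c : Fin m ⊕ Fin n) :
    ∃ d, ∃ u : ℤˣ, reflection α (stdVec c) = ((u : ℤ) : ℚ) • stdVec d := by
  have hp : ∀ β ∈ pairRoots t m n true, ∃ d, ∃ u : ℤˣ,
      reflection β (stdVec c) = ((u : ℤ) : ℚ) • stdVec d := by
    intro β hβ
    simp only [pairRoots, Finset.mem_image, Finset.mem_product, Finset.mem_filter,
      Finset.mem_univ, true_and, beq_iff_eq] at hβ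
    obtain ⟨⟨⟨a, b⟩, s, s'⟩, ⟨⟨hab, ht⟩, hs⟩, rfl⟩ := hβ
    have h2 : (s = 1 ∨ s = -1) ∧ (s' = 1 ∨ s' = -1) := by
      cases t <;> simp [pairSigns] at hs <;> grind
    exact reflection_pair hab ht h2.1 h2.2 c
  have he : ∀ k : ℚ, k ≠ 0 → ∀ β ∈ multEps m n k, ∃ d, ∃ u : ℤˣ,
      reflection β (stdVec c) = ((u : ℤ) : ℚ) • stdVec d := by
    intro k hk β hβ
    simp only [multEps, Finset.mem_union, Finset.mem_image, Finset.mem_univ, true_and] at hβ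
    rcases hβ with ⟨i, rfl⟩ | ⟨i, rfl⟩
    · exact reflection_mult hk c
    · exact reflection_mult (neg_ne_zero.2 hk) c
  have hd : ∀ k : ℚ, k ≠ 0 → ∀ β ∈ multDelta m n k, ∃ d, ∃ u : ℤˣ,
      reflection β (stdVec c) = ((u : ℤ) : ℚ) • stdVec d := by
    intro k hk β hβ
    simp only [multDelta, Finset.mem_union, Finset.mem_image, Finset.mem_univ, true_and] at hβ
    rcases hβ with ⟨i, rfl⟩ | ⟨i, rfl⟩
    · exact reflection_mult hk c
    · exact reflection_mult (neg_ne_zero.2 hk) c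
  rcases Finset.mem_union.1 hα with h | h
  · exact hp α h
  · cases t with
    | gl => simp at h
    | B =>
      rcases Finset.mem_union.1 h with h | h
      · exact he 1 one_ne_zero α h
      · exact hd 2 two_ne_zero α h
    | D => exact hd 2 two_ne_zero α h

/-- The Weyl group is finite, so that sums over its subsets are finite sums. -/
theorem weylGroup_finite (t : SuperType) (m n : ℕ) :
    (weylGroup t m n : Set (Weight m n ≃ₗ[ℚ] Weight m n)).Finite := by
  have hR : (signedVecs m n).Finite := Set.finite_range _
  have key : ∀ g ∈ weylGroup t m n, ∀ v ∈ signedVecs m n, g v ∈ signedVecs m n := by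
    have hrefl : ∀ α ∈ evenRoots t m n, ∀ v ∈ signedVecs m n,
        reflection α v ∈ signedVecs m n := by
      rintro α hα _ ⟨⟨a, s⟩, rfl⟩
      obtain ⟨d, u, h⟩ := reflection_even t hα a
      refine ⟨(d, s * u), ?_⟩
      simp only [map_smul, h, smul_smul, Units.val_mul, Int.cast_mul]
    intro g hg
    induction hg using Subgroup.closure_induction'' with
    | mem x hx =>
      obtain ⟨α, hα, rfl⟩ := hx
      exact hrefl α hα
    | inv_mem x hx =>
      obtain ⟨α, hα, rfl⟩ := hx
      have : (reflection α)⁻¹ = reflection α := by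
        rw [inv_eq_iff_mul_eq_one]
        ext1 v
        exact reflectionMap_involutive α v
      rw [this]
      exact hrefl α hα
    | one => exact fun v hv => hv
    | mul x y _ _ hx hy => exact fun v hv => hx _ (hy v hv)
  refine Set.Finite.of_finite_image (f := fun g (a : Fin m ⊕ Fin n) => g (stdVec a))
    ((Set.Finite.pi' fun _ => hR).subset ?_) ?_
  · rintro _ ⟨g, hg, rfl⟩ a
    exact key g hg _ ⟨(a, 1), by simp⟩
  · intro g _ h _ hgh
    apply LinearEquiv.toLinearMap_injective
    apply (Pi.basisFun ℚ (Fin m ⊕ Fin n)).ext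
    intro a
    simpa [stdVec] using congrFun hgh a

/-- The dual Coxeter number, up to a positive factor that depends on the normalization of the
form. -/
def dualCoxeter (t : SuperType) (m n : ℕ) : ℤ :=
  match t with
  | .gl => (m : ℤ) - n
  | .B => 2 * (m : ℤ) - 2 * n - 1
  | .D => 2 * (m : ℤ) - 2 * n - 2

/-- The set `Δ_0^♯ = {α ∈ Δ_0 | h^∨ (α, α) > 0}`; when `h^∨ = 0`, i.e. for `gl(n,n)` and
`D(n+1,n)`, one takes `{α ∈ Δ_0 | (α, α) > 0}`, of type `A_{n-1}`, `D_{n+1}` respectively. -/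
def sharpRoots (t : SuperType) (m n : ℕ) : Finset (Weight m n) :=
  (evenRoots t m n).filter fun α =>
    if dualCoxeter t m n = 0 then 0 < form α α else 0 < (dualCoxeter t m n : ℚ) * form α α

/-- The constant `C_g = |W_g / W^♯|`. -/
noncomputable def constC (t : SuperType) (m n : ℕ) : ℕ :=
  (reflectionGroup (sharpRoots t m n : Set (Weight m n))).relIndex (weylGroup t m n)

open scoped Classical in
/-- `sgn' w = (-1)^k`, where `k` is the number of reflections in roots of `evenRootsBar`
occurring in an expression of `w` as a product of reflections in even roots. -/
noncomputable def sgnPrime (t : SuperType) {m n : ℕ} (w : Weight m n ≃ₗ[ℚ] Weight m n) : ℤ :=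
  if ∃ l : List (Weight m n), (∀ α ∈ l, α ∈ evenRoots t m n) ∧ (l.map reflection).prod = w ∧
      Even (l.countP (· ∈ evenRootsBar t m n))
  then 1 else -1

/-! ### Rational functions in the exponentials -/

/-- The field of fractions of the group algebra of `h^*`. -/
abbrev RatFun (m n : ℕ) : Type := FractionRing (AddMonoidAlgebra ℂ (Weight m n))

/-- The exponential `e^v`. -/
noncomputable def expo {m n : ℕ} (v : Weight m n) : RatFun m n :=
  algebraMap (AddMonoidAlgebra ℂ (Weight m n)) (RatFun m n) (AddMonoidAlgebra.single v 1)

/-- The action of a linear automorphism of `h^*` on rational functions, `w(e^v) = e^{w v}`. -/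
noncomputable def act {m n : ℕ} (w : Weight m n ≃ₗ[ℚ] Weight m n) : RatFun m n ≃+* RatFun m n :=
  IsFractionRing.ringEquivOfRingEquiv
    (AddMonoidAlgebra.domCongr ℂ ℂ w.toAddEquiv).toRingEquiv

/-- The sum `∑_{w ∈ U} sgn'(w) w(Y)` for `U ⊆ W_g`. -/
noncomputable def superSum (t : SuperType) {m n : ℕ} (U : Set (Weight m n ≃ₗ[ℚ] Weight m n))
    (Y : RatFun m n) : RatFun m n :=
  ∑ᶠ w ∈ U, (sgnPrime t w : RatFun m n) * act w Y

/-! ### Ordered bases and sets of positive roots -/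

/-- A totally ordered set `ℬ = {ξ_1 > ξ_2 > … > ξ_{m+n}}`, where `ξ_i` (indexed by
`i : Fin (m + n)`) is, up to sign, one of the `ε`'s and `δ`'s.  In type `gl` no sign is allowed. -/
structure OrderedBasis (t : SuperType) (m n : ℕ) where
  /-- the enumeration in decreasing order -/
  idx : Fin (m + n) ≃ Fin m ⊕ Fin n
  /-- the signs -/
  sign : Fin m ⊕ Fin n → ℤˣ
  sign_gl : t = SuperType.gl → ∀ a, sign a = 1

namespace OrderedBasis

variable {t : SuperType} {m n : ℕ} (X : OrderedBasis t m n)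

/-- The vertex `ξ_i`, an element of `h^*`. -/
def vertex (i : Fin (m + n)) : Weight m n := ((X.sign (X.idx i) : ℤ) : ℚ) • stdVec (X.idx i)

/-- `ξ_i ∈ ℰ` (otherwise `ξ_i ∈ 𝒟`). -/
def inE (i : Fin (m + n)) : Bool := (X.idx i).isLeft

/-- The set of simple roots `Π(ℬ, >)`. -/
def simpleRoots : Finset (Weight m n) :=
  (Finset.univ.filter fun p : Fin (m + n) × Fin (m + n) => p.1.val + 1 = p.2.val).image
      (fun p => X.vertex p.1 - X.vertex p.2) ∪
    match t with
    | .gl => ∅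
    | .B => (Finset.univ.filter fun i : Fin (m + n) => i.val + 1 = m + n).image X.vertex
    | .D =>
      (Finset.univ.filter fun i : Fin (m + n) => i.val + 1 = m + n ∧ X.inE i = false).image
          (fun i => (2 : ℚ) • X.vertex i) ∪
      (Finset.univ.filter fun p : Fin (m + n) × Fin (m + n) =>
          p.1.val + 1 = p.2.val ∧ p.2.val + 1 = m + n ∧ X.inE p.2 = true).image
        (fun p => X.vertex p.1 + X.vertex p.2)

open scoped Classical in
/-- The set `Δ_0^+` of positive even roots. -/
noncomputable def posEven : Finset (Weight m n) :=
  (evenRoots t m n).filter (· ∈ AddSubmonoid.closure (X.simpleRoots : Set (Weight m n)))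

open scoped Classical in
/-- The set `Δ_1^+` of positive odd roots. -/
noncomputable def posOdd : Finset (Weight m n) :=
  (oddRoots t m n).filter (· ∈ AddSubmonoid.closure (X.simpleRoots : Set (Weight m n)))

/-- `ρ = ρ_0 - ρ_1`. -/
noncomputable def rho : Weight m n :=
  (1 / 2 : ℚ) • ∑ α ∈ X.posEven, α - (1 / 2 : ℚ) • ∑ α ∈ X.posOdd, α

/-- The superdenominator. -/
noncomputable def superDenominator : RatFun m n :=
  (∏ α ∈ X.posEven, (1 - expo (-α))) / ∏ α ∈ X.posOdd, (1 - expo (-α))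

/-- `β ≤ γ`: the difference `γ - β` is zero or a sum of positive roots. -/
def le (β γ : Weight m n) : Prop :=
  γ - β ∈ AddSubmonoid.closure ((X.posEven ∪ X.posOdd : Finset (Weight m n)) : Set (Weight m n))

/-- The height of a positive root: the number of summands when it is written as a sum of simple
roots. -/
noncomputable def ht (γ : Weight m n) : ℕ :=
  sInf {k | ∃ s : Multiset (Weight m n),
    (∀ α ∈ s, α ∈ X.simpleRoots) ∧ s.sum = γ ∧ s.card = k}

/-- `sn β = (β, ∑_{ξ ∈ ℰ} ξ)`. -/
def sn (β : Weight m n) : ℚ := form β (∑ i with X.inE i = true, X.vertex i)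

open scoped Classical in
/-- The simple roots that lie in the span of `ℬ'`. -/
noncomputable def simpleRootsIn (B' : Finset (Fin (m + n))) : Finset (Weight m n) :=
  X.simpleRoots.filter (· ∈ Submodule.span ℚ (X.vertex '' (B' : Set (Fin (m + n)))))

open scoped Classical in
/-- The set `Δ_0(ℬ')` of even roots that are linear combinations of the simple roots lying in
the span of `ℬ'`. -/
noncomputable def evenRootsIn (B' : Finset (Fin (m + n))) : Finset (Weight m n) :=
  (evenRoots t m n).filter
    (· ∈ Submodule.span ℚ (X.simpleRootsIn B' : Set (Weight m n)))

/-- Irreducibility of `Δ(ℬ')`: its set of simple roots is not empty and is not the union of two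
nonempty mutually orthogonal disjoint subsets (i.e. the Dynkin diagram is connected). -/
def IrreducibleIn (B' : Finset (Fin (m + n))) : Prop :=
  (X.simpleRootsIn B').Nonempty ∧
    ∀ A ⊆ X.simpleRootsIn B', A.Nonempty → A ≠ X.simpleRootsIn B' →
      ∃ α ∈ A, ∃ β ∈ X.simpleRootsIn B' \ A, form α β ≠ 0

/-- Every element of `ℬ'` occurs in some simple root that lies in the span of `ℬ'`. -/
def CoveredIn (B' : Finset (Fin (m + n))) : Prop :=
  ∀ i ∈ B', ∃ α ∈ X.simpleRootsIn B', α (X.idx i) ≠ 0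

/-- The Weyl group `W(ℬ')` of `Δ(ℬ')`. -/
noncomputable def weylIn (B' : Finset (Fin (m + n))) : Subgroup (Weight m n ≃ₗ[ℚ] Weight m n) :=
  reflectionGroup (X.evenRootsIn B' : Set (Weight m n))

/-- The two parts of `Δ_0(ℬ')`: the roots in the span of the `ε`'s (`c = true`, the even roots of
positive norm), and those in the span of the `δ`'s (`c = false`, those of negative norm). -/
noncomputable def evenPart (B' : Finset (Fin (m + n))) (c : Bool) : Finset (Weight m n) :=
  (X.evenRootsIn B').filter fun α => if c = true then 0 < form α α else form α α < 0

/-- The part `c` of `Δ_0(ℬ')` is not the smallest one: it has at least as many roots as the other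
part.  For `gl(k,l)` and `B(k,l)` with `k = l` both parts qualify; for `D(k,l)` it is `D_k` if
`k > l` and `C_l` if `k ≤ l`. -/
def NotSmallest (B' : Finset (Fin (m + n))) (c : Bool) : Prop :=
  (X.evenPart B' (!c)).card ≤ (X.evenPart B' c).card

/-- The Weyl group of the part `c` of `Δ_0(ℬ')`, to be used as `W^♯(ℬ')` when the part `c` is
not the smallest one. -/
noncomputable def sharpIn (B' : Finset (Fin (m + n))) (c : Bool) :
    Subgroup (Weight m n ≃ₗ[ℚ] Weight m n) :=
  reflectionGroup (X.evenPart B' c : Set (Weight m n))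

/-- The group `W_{ℬ'}` of non-signed permutations of `ℬ' ∩ ℰ` and of `ℬ' ∩ 𝒟`, generated by the
transpositions of two vertices of the same type. -/
def permIn (B' : Finset (Fin (m + n))) : Subgroup (Weight m n ≃ₗ[ℚ] Weight m n) :=
  reflectionGroup {v | ∃ i ∈ B', ∃ j ∈ B', i ≠ j ∧ X.inE i = X.inE j ∧
    v = X.vertex i - X.vertex j}

end OrderedBasis

/-! ### Arc diagrams -/

/-- An arc diagram on an ordered basis; the arc joining `ξ_i > ξ_j` is the pair `(i, j)`. -/
structure ArcDiagram (t : SuperType) (m n : ℕ) extends OrderedBasis t m n where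
  /-- the arcs, with the left end first -/
  arcs : Finset (Fin (m + n) × Fin (m + n))
  lt_of_mem : ∀ a ∈ arcs, a.1 < a.2
  diffType : ∀ a ∈ arcs, toOrderedBasis.inE a.1 ≠ toOrderedBasis.inE a.2
  disjoint : ∀ a ∈ arcs, ∀ b ∈ arcs, a ≠ b → a.1 ≠ b.1 ∧ a.1 ≠ b.2 ∧ a.2 ≠ b.1 ∧ a.2 ≠ b.2
  noCrossing : ∀ a ∈ arcs, ∀ b ∈ arcs, ¬ (a.1 < b.1 ∧ b.1 < a.2 ∧ a.2 < b.2)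
  balanced : ∀ a ∈ arcs,
    ((Finset.Icc a.1 a.2).filter fun i => toOrderedBasis.inE i = true).card =
      ((Finset.Icc a.1 a.2).filter fun i => toOrderedBasis.inE i = false).card
  card_arcs : arcs.card = min m n

namespace ArcDiagram

variable {t : SuperType} {m n : ℕ} (X : ArcDiagram t m n)

/-- The support `Supp(X)`: the ends of the arcs. -/
def supp : Finset (Fin (m + n)) := X.arcs.image Prod.fst ∪ X.arcs.image Prod.snd

/-- The maximal isotropic set `S(X)`. -/
def isoSet : Finset (Weight m n) := X.arcs.image fun a => X.vertex a.1 - X.vertex a.2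

open scoped Classical in
/-- `⟦γ⟧ = ∑_{β ∈ S(X), β ≤ γ} sn γ · sn β · β`. -/
noncomputable def bracket (γ : Weight m n) : Weight m n :=
  ∑ β ∈ X.isoSet with X.le β γ, (X.sn γ * X.sn β) • β

/-- `𝒫(X) = ∏_{γ ∈ S(X)} (ht γ + 1)/2 · e^ρ / ∏_{γ ∈ S(X)} (1 - e^{-⟦γ⟧})`. -/
noncomputable def P : RatFun m n :=
  (∏ γ ∈ X.isoSet, ((X.ht γ : RatFun m n) + 1) / 2) *
    (expo X.rho / ∏ γ ∈ X.isoSet, (1 - expo (-X.bracket γ)))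

end ArcDiagram

/-- `Z` is a set of representatives of the cosets `w H`, `w ∈ G`. -/
def IsLeftReps {Γ : Type*} [Group Γ] (G H : Subgroup Γ) (Z : Set Γ) : Prop :=
  Z ⊆ (G : Set Γ) ∧ ∀ w ∈ G, ∃! z, z ∈ Z ∧ z⁻¹ * w ∈ H

/-- `T` is a set of representatives of the cosets `H w`, `w ∈ G`. -/
def IsRightReps {Γ : Type*} [Group Γ] (H : Set Γ) (G : Subgroup Γ) (T : Set Γ) : Prop :=
  T ⊆ (G : Set Γ) ∧ ∀ w ∈ G, ∃! τ, τ ∈ T ∧ w * τ⁻¹ ∈ H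

end SuperDenominator

namespace SuperDenominator

section Exponentials

variable {m n : ℕ}

instance : CharZero (RatFun m n) :=
  charZero_of_injective_ringHom (f := (algebraMap (AddMonoidAlgebra ℂ (Weight m n))
    (RatFun m n)).comp AddMonoidAlgebra.singleZeroRingHom) (RingHom.injective _)

theorem expo_add (v w : Weight m n) : expo (v + w) = expo v * expo w := by
  simp [expo, ← map_mul, AddMonoidAlgebra.single_mul_single]

@[simp] theorem expo_zero : expo (0 : Weight m n) = 1 := by
  simp [expo, ← AddMonoidAlgebra.one_def]

theorem expo_neg (v : Weight m n) : expo (-v) = (expo v)⁻¹ := by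
  have h : expo (-v) * expo v = 1 := by rw [← expo_add, neg_add_cancel, expo_zero]
  exact eq_inv_of_mul_eq_one_left h

theorem expo_sub (v w : Weight m n) : expo (v - w) = expo v / expo w := by
  rw [sub_eq_add_neg, expo_add, expo_neg, div_eq_mul_inv]

theorem expo_ne_zero (v : Weight m n) : expo v ≠ 0 := by
  intro h
  have : expo v * expo (-v) = 1 := by rw [← expo_add, add_neg_cancel, expo_zero]
  rw [h, zero_mul] at this
  exact zero_ne_one this

theorem expo_injective : Function.Injective (expo : Weight m n → RatFun m n) := by
  intro v w h
  have h' := IsFractionRing.injective (AddMonoidAlgebra ℂ (Weight m n)) (RatFun m n) h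
  exact AddMonoidAlgebra.of_injective (R := ℂ) (M := Weight m n)
    (a₁ := Multiplicative.ofAdd v) (a₂ := Multiplicative.ofAdd w) h'

theorem expo_sum {ι : Type*} (s : Finset ι) (f : ι → Weight m n) :
    expo (∑ i ∈ s, f i) = ∏ i ∈ s, expo (f i) := by
  classical
  induction s using Finset.induction_on with
  | empty => simp
  | insert a s ha ih => rw [Finset.sum_insert ha, Finset.prod_insert ha, expo_add, ih]

theorem one_sub_expo_ne_zero {v : Weight m n} (hv : v ≠ 0) : 1 - expo v ≠ 0 := by
  intro h
  apply hv
  apply expo_injective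
  rw [expo_zero]
  exact (sub_eq_zero.1 h).symm

theorem act_expo (w : Weight m n ≃ₗ[ℚ] Weight m n) (v : Weight m n) :
    act w (expo v) = expo (w v) := by
  rw [act, expo, IsFractionRing.ringEquivOfRingEquiv_algebraMap]
  simp [expo]

theorem ringHom_ext_expo {f g : RatFun m n →+* RatFun m n}
    (hC : ∀ c : ℂ, f (algebraMap _ _ (AddMonoidAlgebra.single (0 : Weight m n) c)) =
      g (algebraMap _ _ (AddMonoidAlgebra.single (0 : Weight m n) c)))
    (h : ∀ v, f (expo v) = g (expo v)) : f = g := by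
  apply IsLocalization.ringHom_ext (nonZeroDivisors (AddMonoidAlgebra ℂ (Weight m n)))
  apply AddMonoidAlgebra.ringHom_ext
  · exact hC
  · exact h

theorem act_const (w : Weight m n ≃ₗ[ℚ] Weight m n) (c : ℂ) :
    act w (algebraMap _ _ (AddMonoidAlgebra.single (0 : Weight m n) c)) =
      algebraMap _ _ (AddMonoidAlgebra.single (0 : Weight m n) c) := by
  rw [act, IsFractionRing.ringEquivOfRingEquiv_algebraMap]
  simp

theorem act_mul (v w : Weight m n ≃ₗ[ℚ] Weight m n) (Y : RatFun m n) :
    act (v * w) Y = act v (act w Y) := by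
  have : (act (v * w)).toRingHom = (act v).toRingHom.comp (act w).toRingHom := by
    apply ringHom_ext_expo
    · intro c; simp [act_const]
    · intro x; simp [act_expo]
  exact RingHom.congr_fun this Y

theorem act_one (Y : RatFun m n) : act 1 Y = Y := by
  have : (act (1 : Weight m n ≃ₗ[ℚ] Weight m n)).toRingHom = RingHom.id _ := by
    apply ringHom_ext_expo
    · intro c; simp [act_const]
    · intro x; simp [act_expo]
  exact RingHom.congr_fun this Y

end Exponentials

section Reflections

variable {m n : ℕ}

theorem reflection_apply (α x : Weight m n) :
    reflection α x = x - (2 * form x α / form α α) • α := rfl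

theorem form_smul_left (c : ℚ) (x y : Weight m n) : form (c • x) y = c * form x y := by
  simp only [form, Pi.smul_apply, smul_eq_mul, mul_sub, Finset.mul_sum, mul_assoc]

theorem form_comm (x y : Weight m n) : form x y = form y x := by
  simp only [form, mul_comm]

theorem form_smul_right (c : ℚ) (x y : Weight m n) : form x (c • y) = c * form x y := by
  rw [form_comm, form_smul_left, form_comm]

theorem form_add_left (x y z : Weight m n) : form (x + y) z = form x z + form y z := by
  simp only [form, Pi.add_apply, add_mul, Finset.sum_add_distrib]; ring

theorem form_add_right (x y z : Weight m n) : form x (y + z) = form x y + form x z := by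
  rw [form_comm, form_add_left, form_comm y, form_comm z]

theorem form_neg_left (x y : Weight m n) : form (-x) y = -form x y := by
  simpa using form_smul_left (-1) x y

theorem form_neg_right (x y : Weight m n) : form x (-y) = -form x y := by
  simpa using form_smul_right (-1) x y

theorem form_sub_left (x y z : Weight m n) : form (x - y) z = form x z - form y z := by
  rw [sub_eq_add_neg, form_add_left, form_neg_left, sub_eq_add_neg]

theorem form_sub_right (x y z : Weight m n) : form x (y - z) = form x y - form x z := by
  rw [sub_eq_add_neg, form_add_right, form_neg_right, sub_eq_add_neg]

theorem reflection_smul {c : ℚ} (hc : c ≠ 0) (α : Weight m n) :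
    reflection (c • α) = reflection α := by
  ext1 x
  simp only [reflection_apply, form_smul_right, form_smul_left, smul_smul]
  by_cases h : form α α = 0
  · simp [h]
  · congr 2; field_simp

theorem reflection_mul_self (α : Weight m n) : reflection α * reflection α = 1 := by
  ext1 v
  exact reflectionMap_involutive α v

theorem reflection_inv (α : Weight m n) : (reflection α)⁻¹ = reflection α := by
  rw [inv_eq_iff_mul_eq_one, reflection_mul_self]

theorem form_reflection (α x y : Weight m n) :
    form (reflection α x) (reflection α y) = form x y := by
  simp only [reflection_apply, form_sub_left, form_sub_right, form_smul_left, form_smul_right]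
  by_cases h : form α α = 0
  · simp [h]
  · rw [form_comm α y]; field_simp; ring

theorem reflection_conj {w : Weight m n ≃ₗ[ℚ] Weight m n}
    (hw : ∀ x y, form (w x) (w y) = form x y) (α : Weight m n) :
    w * reflection α * w⁻¹ = reflection (w α) := by
  ext1 v
  obtain ⟨u, rfl⟩ := w.surjective v
  have h : (w * reflection α * w⁻¹) (w u) = w (reflection α u) := by
    have : w⁻¹ (w u) = u := w.symm_apply_apply u
    simp only [LinearEquiv.mul_apply, this]
  rw [h, reflection_apply, reflection_apply, hw, hw, map_sub, map_smul]

end Reflections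

namespace OrderedBasis

variable {t : SuperType} {m n : ℕ} (X : OrderedBasis t m n)

/-- The vertices form a basis of `h^*`. -/
noncomputable def basis : Module.Basis (Fin (m + n)) ℚ (Weight m n) :=
  ((Pi.basisFun ℚ (Fin m ⊕ Fin n)).unitsSMul
    (fun a => Units.map (Int.castRingHom ℚ).toMonoidHom (X.sign a))).reindex X.idx.symm

theorem basis_apply (i : Fin (m + n)) : X.basis i = X.vertex i := by
  simp [basis, vertex, stdVec, Module.Basis.unitsSMul_apply, Units.smul_def]

/-- The coordinates with respect to the basis of vertices. -/
noncomputable def coord (i : Fin (m + n)) : Weight m n →ₗ[ℚ] ℚ := X.basis.coord i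

theorem coord_vertex (i j : Fin (m + n)) :
    X.coord i (X.vertex j) = if j = i then 1 else 0 := by
  rw [coord, ← basis_apply, Module.Basis.coord_apply, Module.Basis.repr_self,
    Finsupp.single_apply]

theorem sum_coord (v : Weight m n) : ∑ i, X.coord i v • X.vertex i = v := by
  simp only [← basis_apply]
  exact X.basis.sum_repr v

theorem ext_coord {v w : Weight m n} (h : ∀ i, X.coord i v = X.coord i w) : v = w := by
  rw [← X.sum_coord v, ← X.sum_coord w]
  simp [h]

theorem coord_eq (i : Fin (m + n)) (v : Weight m n) :
    X.coord i v = ((X.sign (X.idx i) : ℤ) : ℚ) * v (X.idx i) := by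
  conv_rhs => rw [← X.sum_coord v]
  rw [Finset.sum_apply, Finset.sum_eq_single i]
  · have h : (((X.sign (X.idx i) : ℤ) : ℚ)) * ((X.sign (X.idx i) : ℤ) : ℚ) = 1 := by
      rcases Int.units_eq_one_or (X.sign (X.idx i)) with h | h <;> rw [h] <;> norm_num
    simp only [vertex, stdVec, Pi.smul_apply, Pi.single_eq_same, smul_eq_mul, mul_one]
    linear_combination (-X.coord i v) * h
  · intro j _ hj
    have : X.idx i ≠ X.idx j := fun h => hj (X.idx.injective h).symm
    simp [vertex, stdVec, this]
  · simp

theorem apply_idx_ne_zero (i : Fin (m + n)) (v : Weight m n) :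
    v (X.idx i) ≠ 0 ↔ X.coord i v ≠ 0 := by
  rw [coord_eq]
  rcases Int.units_eq_one_or (X.sign (X.idx i)) with h | h <;> simp [h]

/-- The norm `(ξ_i, ξ_i)`, which is `1` for `ξ_i ∈ ℰ` and `-1` for `ξ_i ∈ 𝒟`. -/
def eta (i : Fin (m + n)) : ℚ := if X.inE i = true then 1 else -1

theorem eta_mul_self (i : Fin (m + n)) : X.eta i * X.eta i = 1 := by
  unfold eta; split_ifs <;> norm_num

theorem eta_ne_zero (i : Fin (m + n)) : X.eta i ≠ 0 := by
  unfold eta; split_ifs <;> norm_num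

theorem form_vertex (i j : Fin (m + n)) :
    form (X.vertex i) (X.vertex j) = if i = j then X.eta i else 0 := by
  rw [vertex, form_smul_left, form_stdVec]
  have h2 : X.vertex j (X.idx i) = if i = j then ((X.sign (X.idx i) : ℤ) : ℚ) else 0 := by
    by_cases h : i = j
    · subst h; simp [vertex, stdVec]
    · have : X.idx i ≠ X.idx j := fun h' => h (X.idx.injective h')
      simp [vertex, stdVec, this, h]
  rw [h2]
  have h : (((X.sign (X.idx i) : ℤ) : ℚ)) * ((X.sign (X.idx i) : ℤ) : ℚ) = 1 := by
    rcases Int.units_eq_one_or (X.sign (X.idx i)) with h | h <;> rw [h] <;> norm_num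
  by_cases h1 : i = j
  · rw [if_pos h1, if_pos h1]
    unfold eta inE
    generalize (if (X.idx i).isLeft = true then (1 : ℚ) else -1) = q
    linear_combination q * h
  · rw [if_neg h1, if_neg h1]; ring

theorem form_vertex_left (i : Fin (m + n)) (v : Weight m n) :
    form (X.vertex i) v = X.eta i * X.coord i v := by
  conv_lhs => rw [← X.sum_coord v]
  have : ∀ s : Finset (Fin (m + n)), form (X.vertex i) (∑ j ∈ s, X.coord j v • X.vertex j)
      = ∑ j ∈ s, if i = j then X.eta i * X.coord j v else 0 := by
    classical
    intro s
    induction s using Finset.induction_on with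
    | empty => simp [form]
    | insert a s ha ih =>
      rw [Finset.sum_insert ha, Finset.sum_insert ha, form_add_right, ih, form_smul_right,
        form_vertex]
      split_ifs <;> ring
  rw [this]; simp

/-- The permutation of the vertices. -/
noncomputable def perm : Equiv.Perm (Fin (m + n)) →* (Weight m n ≃ₗ[ℚ] Weight m n) where
  toFun σ := X.basis.equiv X.basis σ
  map_one' := by
    ext1 v
    refine LinearEquiv.congr_fun (X.basis.ext' (fun i => ?_)) v
    simp
  map_mul' σ τ := by
    refine X.basis.ext' (fun i => ?_)
    simp

@[simp] theorem perm_vertex (σ : Equiv.Perm (Fin (m + n))) (i : Fin (m + n)) :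
    X.perm σ (X.vertex i) = X.vertex (σ i) := by
  have : X.perm σ = X.basis.equiv X.basis σ := rfl
  rw [this, ← basis_apply, Module.Basis.equiv_apply, basis_apply]

theorem equiv_ext {f g : Weight m n ≃ₗ[ℚ] Weight m n}
    (h : ∀ i, f (X.vertex i) = g (X.vertex i)) : f = g :=
  X.basis.ext' (fun i => by simpa only [basis_apply] using h i)

/-- The sign change of the vertex `ξ_i`. -/
noncomputable def flip (i : Fin (m + n)) : Weight m n ≃ₗ[ℚ] Weight m n := reflection (X.vertex i)

theorem flip_vertex (i j : Fin (m + n)) :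
    X.flip i (X.vertex j) = if j = i then -X.vertex j else X.vertex j := by
  rw [flip, reflection_apply, form_vertex, form_vertex, if_pos rfl]
  split_ifs with h
  · subst h
    rw [mul_div_cancel_right₀ _ (X.eta_ne_zero j)]
    rw [two_smul]; abel
  · simp

theorem inE_eq_iff_eta {i j : Fin (m + n)} : X.inE i = X.inE j ↔ X.eta i = X.eta j := by
  unfold eta
  cases X.inE i <;> cases X.inE j <;> norm_num

theorem reflection_vertex_sub {i j : Fin (m + n)} (hij : i ≠ j) (h : X.inE i = X.inE j) :
    reflection (X.vertex i - X.vertex j) = X.perm (Equiv.swap i j) := by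
  apply X.equiv_ext
  intro k
  rw [inE_eq_iff_eta] at h
  have hj := X.eta_ne_zero j
  rw [reflection_apply, perm_vertex]
  simp only [form_sub_left, form_sub_right, form_vertex, if_neg hij, if_neg hij.symm, if_true]
  by_cases hki : k = i
  · subst hki
    rw [Equiv.swap_apply_left, if_pos rfl, if_neg hij, h]
    have : 2 * (X.eta j - 0) / (X.eta j - 0 - (0 - X.eta j)) = 1 := by
      rw [div_eq_iff (fun h0 => hj (by linarith))]; ring
    rw [this, one_smul]; abel
  · by_cases hkj : k = j
    · subst hkj
      rw [Equiv.swap_apply_right, if_pos rfl, if_neg hki, h]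
      have : 2 * (0 - X.eta k) / (X.eta k - 0 - (0 - X.eta k)) = -1 := by
        rw [div_eq_iff (fun h0 => hj (by linarith))]; ring
      rw [this, neg_one_smul]; abel
    · rw [Equiv.swap_apply_of_ne_of_ne hki hkj, if_neg hki, if_neg hkj]
      simp

theorem reflection_vertex_add {i j : Fin (m + n)} (hij : i ≠ j) (h : X.inE i = X.inE j) :
    reflection (X.vertex i + X.vertex j) = X.flip i * X.flip j * X.perm (Equiv.swap i j) := by
  apply X.equiv_ext
  intro k
  rw [inE_eq_iff_eta] at h
  have hj := X.eta_ne_zero j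
  rw [reflection_apply, LinearEquiv.mul_apply, LinearEquiv.mul_apply, perm_vertex]
  simp only [form_add_left, form_add_right, form_vertex, if_neg hij, if_neg hij.symm, if_true]
  by_cases hki : k = i
  · subst hki
    rw [Equiv.swap_apply_left, if_pos rfl, if_neg hij, h, flip_vertex, if_pos rfl, map_neg,
      flip_vertex, if_neg hij.symm]
    have : 2 * (X.eta j + 0) / (X.eta j + 0 + (0 + X.eta j)) = 1 := by
      rw [div_eq_iff (fun h0 => hj (by linarith))]; ring
    rw [this, one_smul]; abel
  · by_cases hkj : k = j
    · subst hkj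
      rw [Equiv.swap_apply_right, if_pos rfl, if_neg hki, h, flip_vertex, if_neg hij,
        flip_vertex, if_pos rfl]
      have : 2 * (0 + X.eta k) / (X.eta k + 0 + (0 + X.eta k)) = 1 := by
        rw [div_eq_iff (fun h0 => hj (by linarith))]; ring
      rw [this, one_smul]; abel
    · rw [Equiv.swap_apply_of_ne_of_ne hki hkj, if_neg hki, if_neg hkj, flip_vertex, if_neg hkj,
        flip_vertex, if_neg hki]
      simp

/-- The exponential of a multiple of a vertex. -/
noncomputable def e (i : Fin (m + n)) (c : ℚ) : RatFun m n := expo (c • X.vertex i)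

theorem e_add (i : Fin (m + n)) (c d : ℚ) : X.e i (c + d) = X.e i c * X.e i d := by
  rw [e, e, e, add_smul, expo_add]

theorem e_neg (i : Fin (m + n)) (c : ℚ) : X.e i (-c) = (X.e i c)⁻¹ := by
  rw [e, e, neg_smul, expo_neg]

theorem e_zero (i : Fin (m + n)) : X.e i 0 = 1 := by rw [e, zero_smul, expo_zero]

theorem e_ne_zero (i : Fin (m + n)) (c : ℚ) : X.e i c ≠ 0 := expo_ne_zero _

theorem expo_eq_prod (v : Weight m n) : expo v = ∏ i, X.e i (X.coord i v) := by
  conv_lhs => rw [← X.sum_coord v]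
  rw [expo_sum]; rfl

@[simp] theorem act_perm_e (σ : Equiv.Perm (Fin (m + n))) (i : Fin (m + n)) (c : ℚ) :
    act (X.perm σ) (X.e i c) = X.e (σ i) c := by
  rw [e, act_expo, map_smul, perm_vertex]; rfl

theorem act_flip_e (i j : Fin (m + n)) (c : ℚ) :
    act (X.flip i) (X.e j c) = if j = i then X.e j (-c) else X.e j c := by
  rw [e, act_expo, map_smul, flip_vertex]
  split_ifs
  · rw [smul_neg, ← neg_smul]; rfl
  · rfl

end OrderedBasis

end SuperDenominator

namespace SuperDenominator

namespace OrderedBasis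

variable {t : SuperType} {m n : ℕ} (X : OrderedBasis t m n)

theorem mem_pairSigns_mul (ht : t ≠ SuperType.gl) (s : ℚ × ℚ) (u v : ℤˣ) :
    (((u : ℤ) : ℚ) * s.1, ((v : ℤ) : ℚ) * s.2) ∈ pairSigns t ↔ s ∈ pairSigns t := by
  obtain ⟨a, b⟩ := s
  rcases Int.units_eq_one_or u with rfl | rfl <;> rcases Int.units_eq_one_or v with rfl | rfl <;>
    cases t <;> simp [pairSigns, neg_eq_iff_eq_neg] at ht ⊢ <;> tauto

theorem mem_pairRoots {same : Bool} {α : Weight m n} :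
    α ∈ pairRoots t m n same ↔ ∃ i j, i ≠ j ∧ (X.inE i == X.inE j) = same ∧
      ∃ s ∈ pairSigns t, α = s.1 • X.vertex i + s.2 • X.vertex j := by
  have key : ∀ i j : Fin (m + n), ∀ s : ℚ × ℚ,
      (((X.sign (X.idx i) : ℤ) : ℚ) * s.1, ((X.sign (X.idx j) : ℤ) : ℚ) * s.2) ∈ pairSigns t ↔
        s ∈ pairSigns t := by
    intro i j s
    by_cases ht : t = SuperType.gl
    · simp [X.sign_gl ht]
    · exact mem_pairSigns_mul ht s _ _
  have h1 : ∀ a, (((X.sign a : ℤ) : ℚ)) * ((X.sign a : ℤ) : ℚ) = 1 := by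
    intro a
    rcases Int.units_eq_one_or (X.sign a) with h | h <;> rw [h] <;> norm_num
  simp only [pairRoots, Finset.mem_image, Finset.mem_product, Finset.mem_filter,
    Finset.mem_univ, true_and]
  constructor
  · rintro ⟨⟨⟨a, b⟩, s⟩, ⟨⟨hab, hs⟩, hsig⟩, rfl⟩
    refine ⟨X.idx.symm a, X.idx.symm b, fun h => hab (X.idx.symm.injective h), ?_, _,
      (key (X.idx.symm a) (X.idx.symm b) s).2 hsig, ?_⟩
    · simpa [inE] using hs
    · simp only [vertex, Equiv.apply_symm_apply, smul_smul]
      congr 2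
      · linear_combination -s.1 * h1 a
      · linear_combination -s.2 * h1 b
  · rintro ⟨i, j, hij, hs, s, hsig, rfl⟩
    refine ⟨⟨⟨X.idx i, X.idx j⟩, _⟩, ⟨⟨fun h => hij (X.idx.injective h), hs⟩,
      (key i j s).2 hsig⟩, ?_⟩
    simp only [vertex, smul_smul, mul_comm]

theorem mem_multEps {c : ℚ} {α : Weight m n} :
    α ∈ multEps m n c ↔ ∃ i, X.inE i = true ∧ (α = c • X.vertex i ∨ α = -(c • X.vertex i)) := by
  simp only [multEps, Finset.mem_union, Finset.mem_image, Finset.mem_univ, true_and]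
  have hv : ∀ i, X.vertex i = stdVec (X.idx i) ∨ X.vertex i = -stdVec (X.idx i) := by
    intro i
    rcases Int.units_eq_one_or (X.sign (X.idx i)) with h | h <;> simp [vertex, h]
  constructor
  · rintro (⟨i, rfl⟩ | ⟨i, rfl⟩) <;>
      refine ⟨X.idx.symm (Sum.inl i), by simp [inE], ?_⟩ <;>
      rcases hv (X.idx.symm (Sum.inl i)) with h | h <;> simp [h]
  · rintro ⟨i, hi, h⟩
    obtain ⟨a, ha⟩ := Sum.isLeft_iff.1 hi
    rcases hv i with h' | h' <;> rw [h', ha] at h <;> rcases h with rfl | rfl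
    · exact Or.inl ⟨a, rfl⟩
    · exact Or.inr ⟨a, by simp⟩
    · exact Or.inr ⟨a, by simp⟩
    · exact Or.inl ⟨a, by simp⟩

theorem mem_multDelta {c : ℚ} {α : Weight m n} :
    α ∈ multDelta m n c ↔
      ∃ i, X.inE i = false ∧ (α = c • X.vertex i ∨ α = -(c • X.vertex i)) := by
  simp only [multDelta, Finset.mem_union, Finset.mem_image, Finset.mem_univ, true_and]
  have hv : ∀ i, X.vertex i = stdVec (X.idx i) ∨ X.vertex i = -stdVec (X.idx i) := by
    intro i
    rcases Int.units_eq_one_or (X.sign (X.idx i)) with h | h <;> simp [vertex, h]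
  constructor
  · rintro (⟨i, rfl⟩ | ⟨i, rfl⟩) <;>
      refine ⟨X.idx.symm (Sum.inr i), by simp [inE], ?_⟩ <;>
      rcases hv (X.idx.symm (Sum.inr i)) with h | h <;> simp [h]
  · rintro ⟨i, hi, h⟩
    obtain ⟨a, ha⟩ := Sum.isRight_iff.1 (show (X.idx i).isRight = true by
      rw [inE] at hi; rw [← Sum.not_isLeft, hi]; exact Bool.false_ne_true)
    rcases hv i with h' | h' <;> rw [h', ha] at h <;> rcases h with rfl | rfl
    · exact Or.inl ⟨a, rfl⟩
    · exact Or.inr ⟨a, by simp⟩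
    · exact Or.inr ⟨a, by simp⟩
    · exact Or.inl ⟨a, by simp⟩

/-! ### Positive roots -/

theorem vertex_sub_mem_closure_of_lt {i j : Fin (m + n)} (hij : i < j) :
    X.vertex i - X.vertex j ∈ AddSubmonoid.closure (X.simpleRoots : Set (Weight m n)) := by
  have key : ∀ k : ℕ, ∀ h : i.val + k < m + n, X.vertex i - X.vertex ⟨i.val + k, h⟩ ∈
      AddSubmonoid.closure (X.simpleRoots : Set (Weight m n)) := by
    intro k
    induction k with
    | zero => intro h; simp
    | succ k ih =>
      intro h
      have h' : i.val + k < m + n := by omega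
      have e : X.vertex i - X.vertex ⟨i.val + (k + 1), h⟩ =
          (X.vertex i - X.vertex ⟨i.val + k, h'⟩) +
            (X.vertex ⟨i.val + k, h'⟩ - X.vertex ⟨i.val + (k + 1), h⟩) := by abel
      rw [e]
      refine add_mem (ih h') (AddSubmonoid.subset_closure ?_)
      rw [Finset.mem_coe, simpleRoots.eq_def, Finset.mem_union]
      left
      exact Finset.mem_image.2 ⟨(⟨i.val + k, h'⟩, ⟨i.val + (k + 1), h⟩),
        Finset.mem_filter.2 ⟨Finset.mem_univ _, by simp; omega⟩, rfl⟩
  have h := key (j.val - i.val) (by have := j.2; omega)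
  have hj : (⟨i.val + (j.val - i.val), by have := j.2; omega⟩ : Fin (m + n)) = j :=
    Fin.ext (by simp; omega)
  rwa [hj] at h

theorem vertex_sub_mem_closure_of_le {i j : Fin (m + n)} (hij : i ≤ j) :
    X.vertex i - X.vertex j ∈ AddSubmonoid.closure (X.simpleRoots : Set (Weight m n)) := by
  rcases hij.eq_or_lt with rfl | h
  · simp
  · exact X.vertex_sub_mem_closure_of_lt h

theorem simpleRoots_B (X : OrderedBasis SuperType.B m n) {i : Fin (m + n)}
    (hi : i.val + 1 = m + n) : X.vertex i ∈ X.simpleRoots := by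
  simp only [simpleRoots, Finset.mem_union, Finset.mem_image, Finset.mem_filter,
    Finset.mem_univ, true_and]
  exact Or.inr ⟨i, hi, rfl⟩

theorem simpleRoots_D (X : OrderedBasis SuperType.D m n) {i : Fin (m + n)}
    (hi : i.val + 1 = m + n) (h : X.inE i = false) : (2 : ℚ) • X.vertex i ∈ X.simpleRoots := by
  simp only [simpleRoots, Finset.mem_union, Finset.mem_image, Finset.mem_filter,
    Finset.mem_univ, true_and]
  exact Or.inr (Or.inl ⟨i, ⟨hi, h⟩, rfl⟩)

theorem simpleRoots_D' (X : OrderedBasis SuperType.D m n) {i j : Fin (m + n)}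
    (hi : i.val + 1 = j.val) (hj : j.val + 1 = m + n) (h : X.inE j = true) :
    X.vertex i + X.vertex j ∈ X.simpleRoots := by
  simp only [simpleRoots, Finset.mem_union, Finset.mem_image, Finset.mem_filter,
    Finset.mem_univ, true_and]
  exact Or.inr (Or.inr ⟨(i, j), ⟨hi, hj, h⟩, rfl⟩)

theorem vertex_mem_closure (X : OrderedBasis SuperType.B m n) (i : Fin (m + n)) :
    X.vertex i ∈ AddSubmonoid.closure (X.simpleRoots : Set (Weight m n)) := by
  have hN : 0 < m + n := i.pos
  let L : Fin (m + n) := ⟨m + n - 1, by omega⟩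
  have h1 : X.vertex L ∈ AddSubmonoid.closure (X.simpleRoots : Set (Weight m n)) :=
    AddSubmonoid.subset_closure (X.simpleRoots_B (by simp [L]; omega))
  have h2 := X.vertex_sub_mem_closure_of_le (i := i) (j := L)
    (by rw [Fin.le_def]; simp [L]; omega)
  simpa using add_mem h2 h1

theorem vertex_add_mem_closure (ht : t ≠ SuperType.gl) {i j : Fin (m + n)}
    (hij : i ≠ j) :
    X.vertex i + X.vertex j ∈ AddSubmonoid.closure (X.simpleRoots : Set (Weight m n)) := by
  cases t with
  | gl => exact absurd rfl ht
  | B => exact add_mem (X.vertex_mem_closure i) (X.vertex_mem_closure j)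
  | D =>
    have hN : 0 < m + n := i.pos
    let L : Fin (m + n) := ⟨m + n - 1, by omega⟩
    have hL : ∀ k : Fin (m + n), k ≤ L := fun k => by rw [Fin.le_def]; simp [L]; omega
    have hLv : L.val + 1 = m + n := by simp [L]; omega
    cases hE : X.inE L with
    | false =>
      have h1 : (2 : ℚ) • X.vertex L ∈ AddSubmonoid.closure (X.simpleRoots : Set (Weight m n)) :=
        AddSubmonoid.subset_closure (X.simpleRoots_D hLv hE)
      have h2 := add_mem (add_mem (X.vertex_sub_mem_closure_of_le (hL i))
        (X.vertex_sub_mem_closure_of_le (hL j))) h1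
      convert h2 using 1
      rw [two_smul]; abel
    | true =>
      wlog hlt : i < j generalizing i j with H
      · rw [add_comm]
        exact H hij.symm (lt_of_le_of_ne (not_lt.1 hlt) hij.symm)
      have hij' : i.val < j.val := hlt
      have hj2 := j.2
      let M : Fin (m + n) := ⟨m + n - 2, by omega⟩
      have h1 : X.vertex M + X.vertex L ∈
          AddSubmonoid.closure (X.simpleRoots : Set (Weight m n)) :=
        AddSubmonoid.subset_closure (X.simpleRoots_D' (by simp [M, L]; omega) hLv hE)
      have hiM : i ≤ M := by rw [Fin.le_def]; simp [M]; omega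
      have h2 := add_mem (add_mem (X.vertex_sub_mem_closure_of_le hiM)
        (X.vertex_sub_mem_closure_of_le (hL j))) h1
      convert h2 using 1
      abel

theorem two_smul_vertex_mem_closure (X : OrderedBasis SuperType.D m n) {i : Fin (m + n)}
    (hi : X.inE i = false) :
    (2 : ℚ) • X.vertex i ∈ AddSubmonoid.closure (X.simpleRoots : Set (Weight m n)) := by
  have hN : 0 < m + n := i.pos
  let L : Fin (m + n) := ⟨m + n - 1, by omega⟩
  have hL : i ≤ L := by rw [Fin.le_def]; simp [L]; omega
  have hLv : L.val + 1 = m + n := by simp [L]; omega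
  by_cases hiL : i = L
  · exact AddSubmonoid.subset_closure (X.simpleRoots_D (by rw [hiL]; exact hLv) hi)
  · have h2 := add_mem (X.vertex_sub_mem_closure_of_le hL)
      (X.vertex_add_mem_closure (by simp) hiL)
    convert h2 using 1
    rw [two_smul]; abel

/-- The linear functional with value `f i` on the vertex `ξ_i`. -/
noncomputable def functional (f : Fin (m + n) → ℚ) : Weight m n →ₗ[ℚ] ℚ :=
  ∑ i, f i • X.coord i

@[simp] theorem functional_vertex (f : Fin (m + n) → ℚ) (i : Fin (m + n)) :
    X.functional f (X.vertex i) = f i := by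
  simp [functional, LinearMap.sum_apply, coord_vertex]

theorem simpleRoots_cases {α : Weight m n} (hα : α ∈ X.simpleRoots) :
    (∃ i j : Fin (m + n), i.val + 1 = j.val ∧ α = X.vertex i - X.vertex j) ∨
    (∃ i : Fin (m + n), t = SuperType.B ∧ i.val + 1 = m + n ∧ α = X.vertex i) ∨
    (∃ i : Fin (m + n), t = SuperType.D ∧ i.val + 1 = m + n ∧ X.inE i = false ∧
      α = (2 : ℚ) • X.vertex i) ∨
    (∃ i j : Fin (m + n), t = SuperType.D ∧ i.val + 1 = j.val ∧ j.val + 1 = m + n ∧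
      X.inE j = true ∧ α = X.vertex i + X.vertex j) := by
  rw [simpleRoots.eq_def, Finset.mem_union] at hα
  rcases hα with h | h
  · left
    simp only [Finset.mem_image, Finset.mem_filter, Finset.mem_univ, true_and, Prod.exists] at h
    obtain ⟨i, j, hij, rfl⟩ := h
    exact ⟨i, j, hij, rfl⟩
  · right
    cases t with
    | gl => simp at h
    | B =>
      left
      simp only [Finset.mem_image, Finset.mem_filter, Finset.mem_univ, true_and] at h
      obtain ⟨i, hi, rfl⟩ := h
      exact ⟨i, rfl, hi, rfl⟩
    | D =>
      right
      simp only [Finset.mem_union, Finset.mem_image, Finset.mem_filter, Finset.mem_univ,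
        true_and, Prod.exists] at h
      rcases h with ⟨i, ⟨hi, hE⟩, rfl⟩ | ⟨i, j, ⟨hi, hj, hE⟩, rfl⟩
      · exact Or.inl ⟨i, rfl, hi, hE, rfl⟩
      · exact Or.inr ⟨i, j, rfl, hi, hj, hE, rfl⟩

theorem functional_nonneg_of_mem_closure {f : Fin (m + n) → ℚ} (hf : Antitone f)
    (h0 : t ≠ SuperType.gl → ∀ i, 0 ≤ f i)
    {v : Weight m n} (hv : v ∈ AddSubmonoid.closure (X.simpleRoots : Set (Weight m n))) :
    0 ≤ X.functional f v := by
  induction hv using AddSubmonoid.closure_induction with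
  | mem x hx =>
    rcases X.simpleRoots_cases hx with ⟨i, j, hij, rfl⟩ | ⟨i, ht, hi, rfl⟩ |
      ⟨i, ht, hi, hE, rfl⟩ | ⟨i, j, ht, hi, hj, hE, rfl⟩
    · simpa using hf (show i ≤ j by rw [Fin.le_def]; omega)
    · simpa using h0 (by simp [ht]) i
    · simpa using h0 (by simp [ht]) i
    · simpa using add_nonneg (h0 (by simp [ht]) i) (h0 (by simp [ht]) j)
  | zero => simp
  | add x y _ _ hx hy => rw [map_add]; exact add_nonneg hx hy

/-- A strictly decreasing positive sequence. -/
def weightSeq (i : Fin (m + n)) : ℚ := (m + n : ℕ) - (i.val : ℚ)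

theorem weightSeq_strictAnti : StrictAnti (weightSeq (m := m) (n := n)) := by
  intro i j h
  have : (i.val : ℚ) < j.val := by exact_mod_cast h
  unfold weightSeq; linarith

theorem weightSeq_pos (i : Fin (m + n)) : 0 < weightSeq i := by
  have : (i.val : ℚ) < (m + n : ℕ) := by exact_mod_cast i.2
  unfold weightSeq; linarith

theorem notMem_closure_of_neg {v : Weight m n} (h : X.functional weightSeq v < 0) :
    v ∉ AddSubmonoid.closure (X.simpleRoots : Set (Weight m n)) := fun hv =>
  not_le.2 h (X.functional_nonneg_of_mem_closure weightSeq_strictAnti.antitone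
    (fun _ i => (weightSeq_pos i).le) hv)

theorem mem_pos_pairRoots {same : Bool} {α : Weight m n} :
    (α ∈ pairRoots t m n same ∧ α ∈ AddSubmonoid.closure (X.simpleRoots : Set (Weight m n))) ↔
      ∃ i j, i < j ∧ (X.inE i == X.inE j) = same ∧
        (α = X.vertex i - X.vertex j ∨ (t ≠ SuperType.gl ∧ α = X.vertex i + X.vertex j)) := by
  rw [X.mem_pairRoots]
  constructor
  · rintro ⟨⟨i, j, hij, hs, s, hsig, rfl⟩, hcl⟩
    have hs' : (X.inE j == X.inE i) = same := by rw [← hs, Bool.beq_comm]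
    have h4 : s = (1, -1) ∨ (t ≠ SuperType.gl ∧ (s = (1, 1) ∨ s = (-1, 1) ∨ s = (-1, -1))) := by
      cases t <;> simp [pairSigns] at hsig ⊢ <;> tauto
    have hneg : ∀ v : Weight m n, X.functional weightSeq v < 0 →
        v ∉ AddSubmonoid.closure (X.simpleRoots : Set (Weight m n)) :=
      fun v => X.notMem_closure_of_neg
    have p1 := weightSeq_pos i
    have p2 := weightSeq_pos j
    rcases h4 with rfl | ⟨ht, rfl | rfl | rfl⟩
    · rcases lt_or_gt_of_ne hij with h | h
      · exact ⟨i, j, h, hs, Or.inl (by simp [sub_eq_add_neg])⟩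
      · exfalso
        refine hneg _ ?_ hcl
        have := weightSeq_strictAnti h
        simp; linarith
    · rcases lt_or_gt_of_ne hij with h | h
      · exact ⟨i, j, h, hs, Or.inr ⟨ht, by simp⟩⟩
      · exact ⟨j, i, h, hs', Or.inr ⟨ht, by simp [add_comm]⟩⟩
    · rcases lt_or_gt_of_ne hij with h | h
      · exfalso
        refine hneg _ ?_ hcl
        have := weightSeq_strictAnti h
        simp; linarith
      · exact ⟨j, i, h, hs', Or.inl (by simp [sub_eq_add_neg, add_comm])⟩
    · exfalso
      refine hneg _ ?_ hcl
      simp; linarith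
  · rintro ⟨i, j, hij, hs, rfl | ⟨ht, rfl⟩⟩
    · refine ⟨⟨i, j, hij.ne, hs, (1, -1), ?_, by simp [sub_eq_add_neg]⟩,
        X.vertex_sub_mem_closure_of_lt hij⟩
      cases t <;> simp [pairSigns]
    · refine ⟨⟨i, j, hij.ne, hs, (1, 1), ?_, by simp⟩, X.vertex_add_mem_closure ht hij.ne⟩
      cases t <;> simp [pairSigns] at ht ⊢

theorem smul_vertex_notMem_closure {c : ℚ} (hc : 0 < c) (i : Fin (m + n)) :
    -(c • X.vertex i) ∉ AddSubmonoid.closure (X.simpleRoots : Set (Weight m n)) := by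
  apply X.notMem_closure_of_neg
  have := mul_pos hc (weightSeq_pos i)
  simp; linarith

/-- The coefficients `c` such that `c ξ_i` is a positive even root. -/
def evenTail (i : Fin (m + n)) : Finset ℚ :=
  match t with
  | .gl => ∅
  | .B => if X.inE i = true then {1} else {2}
  | .D => if X.inE i = true then ∅ else {2}

/-- The coefficients `c` such that `c ξ_i` is a positive odd root. -/
def oddTail (i : Fin (m + n)) : Finset ℚ :=
  match t with
  | .gl => ∅
  | .B => if X.inE i = true then ∅ else {1}
  | .D => ∅

theorem mem_posEven {α : Weight m n} : α ∈ X.posEven ↔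
    (∃ i j, i < j ∧ (X.inE i == X.inE j) = true ∧
        (α = X.vertex i - X.vertex j ∨ (t ≠ SuperType.gl ∧ α = X.vertex i + X.vertex j))) ∨
    ∃ i, ∃ c ∈ X.evenTail i, α = c • X.vertex i := by
  classical
  rw [posEven, Finset.mem_filter, evenRoots.eq_def, Finset.mem_union, or_and_right,
    X.mem_pos_pairRoots]
  refine or_congr_right ?_
  cases t with
  | gl => simp [evenTail]
  | B =>
    simp only [Finset.mem_union, X.mem_multEps, X.mem_multDelta, evenTail]
    constructor
    · rintro ⟨⟨i, hi, rfl | rfl⟩ | ⟨i, hi, rfl | rfl⟩, hcl⟩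
      · exact ⟨i, 1, by simp [hi], rfl⟩
      · exact absurd hcl (X.smul_vertex_notMem_closure one_pos i)
      · exact ⟨i, 2, by simp [hi], rfl⟩
      · exact absurd hcl (X.smul_vertex_notMem_closure two_pos i)
    · rintro ⟨i, c, hc, rfl⟩
      split_ifs at hc with hi
      · rw [Finset.mem_singleton] at hc; subst hc
        exact ⟨Or.inl ⟨i, hi, Or.inl rfl⟩, by rw [one_smul]; exact X.vertex_mem_closure i⟩
      · rw [Finset.mem_singleton] at hc; subst hc
        refine ⟨Or.inr ⟨i, by simpa using hi, Or.inl rfl⟩, ?_⟩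
        rw [two_smul]; exact add_mem (X.vertex_mem_closure i) (X.vertex_mem_closure i)
  | D =>
    simp only [X.mem_multDelta, evenTail]
    constructor
    · rintro ⟨⟨i, hi, rfl | rfl⟩, hcl⟩
      · exact ⟨i, 2, by simp [hi], rfl⟩
      · exact absurd hcl (X.smul_vertex_notMem_closure two_pos i)
    · rintro ⟨i, c, hc, rfl⟩
      split_ifs at hc with hi
      · simp at hc
      · rw [Finset.mem_singleton] at hc; subst hc
        have hi' : X.inE i = false := by simpa using hi
        exact ⟨⟨i, hi', Or.inl rfl⟩, X.two_smul_vertex_mem_closure hi'⟩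

theorem mem_posOdd {α : Weight m n} : α ∈ X.posOdd ↔
    (∃ i j, i < j ∧ (X.inE i == X.inE j) = false ∧
        (α = X.vertex i - X.vertex j ∨ (t ≠ SuperType.gl ∧ α = X.vertex i + X.vertex j))) ∨
    ∃ i, ∃ c ∈ X.oddTail i, α = c • X.vertex i := by
  classical
  rw [posOdd, Finset.mem_filter, oddRoots.eq_def, Finset.mem_union, or_and_right,
    X.mem_pos_pairRoots]
  refine or_congr_right ?_
  cases t with
  | gl => simp [oddTail]
  | B =>
    simp only [X.mem_multDelta, oddTail]
    constructor
    · rintro ⟨⟨i, hi, rfl | rfl⟩, hcl⟩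
      · exact ⟨i, 1, by simp [hi], rfl⟩
      · exact absurd hcl (X.smul_vertex_notMem_closure one_pos i)
    · rintro ⟨i, c, hc, rfl⟩
      split_ifs at hc with hi
      · simp at hc
      · rw [Finset.mem_singleton] at hc; subst hc
        exact ⟨⟨i, by simpa using hi, Or.inl rfl⟩, by rw [one_smul]; exact X.vertex_mem_closure i⟩
  | D => simp [oddTail]

end OrderedBasis

end SuperDenominator

namespace SuperDenominator

namespace OrderedBasis

variable {t : SuperType} {m n : ℕ} (X : OrderedBasis t m n)

@[to_additive]
theorem prod_roots {M : Type*} [CommMonoid M] (same : Bool) (T : Fin (m + n) → Finset ℚ)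
    (hT : ∀ i, ∀ c ∈ T i, 0 < c) (S : Finset (Weight m n))
    (hS : ∀ α, α ∈ S ↔ (∃ i j, i < j ∧ (X.inE i == X.inE j) = same ∧
        (α = X.vertex i - X.vertex j ∨ (t ≠ SuperType.gl ∧ α = X.vertex i + X.vertex j))) ∨
      ∃ i, ∃ c ∈ T i, α = c • X.vertex i) (f : Weight m n → M) :
    ∏ α ∈ S, f α =
      (∏ p : Fin (m + n) × Fin (m + n) with p.1 < p.2 ∧ (X.inE p.1 == X.inE p.2) = same,
        f (X.vertex p.1 - X.vertex p.2)) *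
      (∏ p : Fin (m + n) × Fin (m + n) with p.1 < p.2 ∧ (X.inE p.1 == X.inE p.2) = same,
        if t = SuperType.gl then 1 else f (X.vertex p.1 + X.vertex p.2)) *
      ∏ i, ∏ c ∈ T i, f (c • X.vertex i) := by
  classical
  let P : Finset (Fin (m + n) × Fin (m + n)) :=
    Finset.univ.filter fun p => p.1 < p.2 ∧ (X.inE p.1 == X.inE p.2) = same
  have hP : ∀ p, p ∈ P ↔ p.1 < p.2 ∧ (X.inE p.1 == X.inE p.2) = same := by simp [P]
  let A := P.image fun p => X.vertex p.1 - X.vertex p.2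
  let B := if t = SuperType.gl then ∅ else P.image fun p => X.vertex p.1 + X.vertex p.2
  let Q := Finset.univ.sigma T
  let D := Q.image fun q => q.2 • X.vertex q.1
  have hB : ∀ α, α ∈ B ↔ t ≠ SuperType.gl ∧ ∃ p ∈ P, X.vertex p.1 + X.vertex p.2 = α := by
    intro α
    by_cases ht : t = SuperType.gl <;> simp [B, ht]
  have hS' : S = A ∪ B ∪ D := by
    ext α
    rw [hS, Finset.mem_union, Finset.mem_union, hB]
    simp only [A, D, Q, Finset.mem_image, Finset.mem_sigma, Finset.mem_univ, true_and, hP,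
      Prod.exists, Sigma.exists]
    constructor
    · rintro (⟨i, j, h1, h2, rfl | ⟨ht, rfl⟩⟩ | ⟨i, c, hc, rfl⟩)
      · exact Or.inl (Or.inl ⟨i, j, ⟨h1, h2⟩, rfl⟩)
      · exact Or.inl (Or.inr ⟨ht, i, j, ⟨h1, h2⟩, rfl⟩)
      · exact Or.inr ⟨i, c, hc, rfl⟩
    · rintro ((⟨i, j, ⟨h1, h2⟩, rfl⟩ | ⟨ht, i, j, ⟨h1, h2⟩, rfl⟩) | ⟨i, c, hc, rfl⟩)
      · exact Or.inl ⟨i, j, h1, h2, Or.inl rfl⟩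
      · exact Or.inl ⟨i, j, h1, h2, Or.inr ⟨ht, rfl⟩⟩
      · exact Or.inr ⟨i, c, hc, rfl⟩
  have hsum : ∀ i, X.functional (fun _ => 1) (X.vertex i) = 1 := by simp
  have dAB : Disjoint A B := by
    rw [Finset.disjoint_left]
    intro α hA hB'
    obtain ⟨p, _, rfl⟩ := Finset.mem_image.1 hA
    obtain ⟨_, q, _, h⟩ := (hB _).1 hB'
    have := congrArg (X.functional fun _ => 1) h
    simp only [map_add, map_sub, hsum] at this
    norm_num at this
  have dABD : Disjoint (A ∪ B) D := by
    rw [Finset.disjoint_left]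
    intro α hAB hD
    obtain ⟨⟨k, c⟩, hq, rfl⟩ := Finset.mem_image.1 hD
    have hc : 0 < c := hT k c (by simpa [Q] using hq)
    rcases Finset.mem_union.1 hAB with hA | hB'
    · obtain ⟨p, _, h⟩ := Finset.mem_image.1 hA
      have := congrArg (X.functional fun _ => 1) h
      simp only [map_sub, map_smul, hsum, smul_eq_mul] at this
      linarith
    · obtain ⟨_, p, hp, h⟩ := (hB _).1 hB'
      have hlt := ((hP p).1 hp).1
      have h1 := congrArg (X.coord p.1) h
      have h2 := congrArg (X.coord p.2) h
      simp only [map_add, map_smul, coord_vertex, smul_eq_mul, if_true, if_neg hlt.ne,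
        if_neg hlt.ne'] at h1 h2
      by_cases hk : k = p.1
      · rw [if_neg (hk ▸ hlt.ne)] at h2; norm_num at h2
      · rw [if_neg hk] at h1; norm_num at h1
  have iA : Set.InjOn (fun p : Fin (m + n) × Fin (m + n) => X.vertex p.1 - X.vertex p.2) P := by
    rintro ⟨i, j⟩ hp ⟨k, l⟩ hq h
    have hij := ((hP _).1 hp).1
    have hkl := ((hP _).1 hq).1
    have h1 := congrArg (X.coord i) h
    have h2 := congrArg (X.coord j) h
    simp only [map_sub, coord_vertex, if_true, if_neg hij.ne, if_neg hij.ne'] at h1 h2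
    simp only at hij hkl
    have e1 : k = i := by
      by_contra hne; rw [if_neg hne] at h1; split_ifs at h1 <;> norm_num at h1
    have e2 : l = j := by
      by_contra hne; rw [if_neg hne] at h2; split_ifs at h2 <;> norm_num at h2
    rw [e1, e2]
  have iB : Set.InjOn (fun p : Fin (m + n) × Fin (m + n) => X.vertex p.1 + X.vertex p.2) P := by
    rintro ⟨i, j⟩ hp ⟨k, l⟩ hq h
    have hij := ((hP _).1 hp).1
    have hkl := ((hP _).1 hq).1
    have h1 := congrArg (X.coord i) h
    have h2 := congrArg (X.coord j) h
    simp only [map_add, coord_vertex, if_true, if_neg hij.ne, if_neg hij.ne'] at h1 h2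
    simp only at hij hkl
    have e1 : k = i ∨ l = i := by
      by_contra! hne; rw [if_neg hne.1, if_neg hne.2] at h1; norm_num at h1
    have e2 : k = j ∨ l = j := by
      by_contra! hne; rw [if_neg hne.1, if_neg hne.2] at h2; norm_num at h2
    rcases e1 with rfl | rfl <;> rcases e2 with h | h
    · exact absurd h hij.ne
    · rw [h]
    · rw [h] at hkl; exact absurd hkl (not_lt.2 hij.le)
    · exact absurd h hij.ne
  have iD : Set.InjOn (fun q : (_ : Fin (m + n)) × ℚ => q.2 • X.vertex q.1) Q := by
    rintro ⟨i, c⟩ hp ⟨k, d⟩ hq h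
    have hc : 0 < c := hT i c (by simpa [Q] using hp)
    have h1 := congrArg (X.coord i) h
    simp only [map_smul, coord_vertex, if_true, smul_eq_mul, mul_one] at h1
    have e1 : k = i := by
      by_contra hne; rw [if_neg hne, mul_zero] at h1; exact hc.ne' h1
    subst e1
    rw [if_pos rfl, mul_one] at h1
    rw [h1]
  rw [hS', Finset.prod_union dABD, Finset.prod_union dAB, Finset.prod_image iA,
    Finset.prod_image iD, Finset.prod_sigma]
  congr 2
  by_cases ht : t = SuperType.gl
  · simp [B, ht]
  · simp only [B, if_neg ht]
    rw [Finset.prod_image iB]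

theorem evenTail_pos (i : Fin (m + n)) : ∀ c ∈ X.evenTail i, 0 < c := by
  intro c hc
  cases t <;> cases h : X.inE i <;> simp [evenTail, h] at hc <;> subst hc <;> norm_num

theorem oddTail_pos (i : Fin (m + n)) : ∀ c ∈ X.oddTail i, 0 < c := by
  intro c hc
  cases t <;> cases h : X.inE i <;> simp [oddTail, h] at hc <;> (subst hc; norm_num)

/-! ### The vector `ρ` -/

theorem sum_eta : ∑ i, X.eta i = (m : ℚ) - n := by
  rw [← X.idx.symm.sum_comp]
  simp [eta, inE, sub_eq_add_neg]

/-- The value at the right end of the potential of the ordered basis. -/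
def potEnd (t : SuperType) (m n : ℕ) : ℚ :=
  match t with
  | .gl => (1 + (m - n : ℚ)) / 2
  | .B => 1 / 2
  | .D => 1

/-- A potential `d` with `d (k + 1) = d k + (ξ_k, ξ_k)`, from which `ρ` can be read off. -/
def pot (k : ℕ) : ℚ := potEnd t m n - ∑ l : Fin (m + n) with k ≤ l.val, X.eta l

theorem pot_succ (i : Fin (m + n)) : X.pot (i.val + 1) = X.pot i.val + X.eta i := by
  have : (Finset.univ.filter fun l : Fin (m + n) => i.val ≤ l.val) =
      insert i (Finset.univ.filter fun l : Fin (m + n) => i.val + 1 ≤ l.val) := by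
    ext l
    simp only [Finset.mem_filter, Finset.mem_univ, true_and, Finset.mem_insert, Fin.ext_iff]
    omega
  rw [pot, pot, this, Finset.sum_insert (by simp)]
  ring

theorem pot_last : X.pot (m + n) = potEnd t m n := by
  rw [pot, Finset.sum_eq_zero, sub_zero]
  intro l hl
  have := l.2
  simp only [Finset.mem_filter, Finset.mem_univ, true_and] at hl
  omega

theorem sum_pairs {M : Type*} [AddCommGroup M] [Module ℚ M]
    (g : Fin (m + n) × Fin (m + n) → M) :
    (∑ p : Fin (m + n) × Fin (m + n) with p.1 < p.2 ∧ (X.inE p.1 == X.inE p.2) = true, g p) -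
      ∑ p : Fin (m + n) × Fin (m + n) with p.1 < p.2 ∧ (X.inE p.1 == X.inE p.2) = false, g p
    = ∑ p : Fin (m + n) × Fin (m + n) with p.1 < p.2, (X.eta p.1 * X.eta p.2) • g p := by
  rw [← Finset.filter_filter, ← Finset.filter_filter, Finset.sum_filter,
    Finset.sum_filter (fun p : Fin (m + n) × Fin (m + n) => (X.inE p.1 == X.inE p.2) = false), ← Finset.sum_sub_distrib]
  refine Finset.sum_congr rfl fun p _ => ?_
  unfold eta
  cases X.inE p.1 <;> cases X.inE p.2 <;> simp

theorem sum_lt_eta (k : Fin (m + n)) :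
    ∑ l : Fin (m + n) with l < k, X.eta l =
      (m - n : ℚ) - X.eta k - ∑ l : Fin (m + n) with k < l, X.eta l := by
  rw [← X.sum_eta, ← Finset.sum_filter_add_sum_filter_not Finset.univ (fun l => l < k)]
  have : (Finset.univ.filter fun l : Fin (m + n) => ¬ l < k) =
      insert k (Finset.univ.filter fun l => k < l) := by
    ext l
    simp only [Finset.mem_filter, Finset.mem_univ, true_and, Finset.mem_insert, not_lt]
    constructor
    · intro h; exact (h.eq_or_lt).imp Eq.symm id
    · rintro (rfl | h)
      · exact le_rfl
      · exact h.le
  rw [this, Finset.sum_insert (by simp)]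
  ring

theorem sum_pairs_left (k : Fin (m + n)) :
    (∑ p : Fin (m + n) × Fin (m + n) with p.1 < p.2,
      X.eta p.1 * X.eta p.2 * (if p.1 = k then 1 else 0)) =
      X.eta k * ∑ l : Fin (m + n) with k < l, X.eta l := by
  rw [Finset.sum_filter, Fintype.sum_prod_type, Finset.sum_eq_single k]
  · rw [Finset.mul_sum, Finset.sum_filter]
    simp
  · intro b _ hb
    simp [hb]
  · simp

theorem sum_pairs_right (k : Fin (m + n)) :
    (∑ p : Fin (m + n) × Fin (m + n) with p.1 < p.2,
      X.eta p.1 * X.eta p.2 * (if p.2 = k then 1 else 0)) =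
      X.eta k * ∑ l : Fin (m + n) with l < k, X.eta l := by
  rw [Finset.sum_filter, Fintype.sum_prod_type_right, Finset.sum_eq_single k]
  · rw [Finset.mul_sum, Finset.sum_filter]
    simp [mul_comm]
  · intro b _ hb
    simp [hb]
  · simp

theorem coord_rho (k : Fin (m + n)) :
    X.coord k X.rho = if X.inE k = true then -X.pot k else X.pot (k.val + 1) := by
  have h1 : ∀ f : Weight m n → Weight m n, ∑ α ∈ X.posEven, f α - ∑ α ∈ X.posOdd, f α =
      (∑ p : Fin (m + n) × Fin (m + n) with p.1 < p.2, (X.eta p.1 * X.eta p.2) •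
        f (X.vertex p.1 - X.vertex p.2)) +
      (∑ p : Fin (m + n) × Fin (m + n) with p.1 < p.2, (X.eta p.1 * X.eta p.2) •
        if t = SuperType.gl then 0 else f (X.vertex p.1 + X.vertex p.2)) +
      ∑ i, ((∑ c ∈ X.evenTail i, f (c • X.vertex i)) - ∑ c ∈ X.oddTail i, f (c • X.vertex i)) := by
    intro f
    rw [X.sum_roots true X.evenTail X.evenTail_pos _ (fun α => X.mem_posEven),
      X.sum_roots false X.oddTail X.oddTail_pos _ (fun α => X.mem_posOdd), ← X.sum_pairs,
      ← X.sum_pairs, Finset.sum_sub_distrib]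
    abel
  have h2 : X.rho = (1 / 2 : ℚ) • (∑ α ∈ X.posEven, id α - ∑ α ∈ X.posOdd, id α) := by
    rw [rho, smul_sub]; rfl
  have hpot : X.pot (k.val + 1) = potEnd t m n - ∑ l : Fin (m + n) with k < l, X.eta l := rfl
  have hp := X.pot_succ k
  have hee := X.eta_mul_self k
  rw [h2, h1]
  simp only [map_smul, map_add, map_sum, map_sub, id, coord_vertex, smul_eq_mul, mul_sub,
    Finset.sum_sub_distrib, sum_pairs_left, sum_pairs_right, sum_lt_eta]
  by_cases ht : t = SuperType.gl
  · subst ht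
    have : X.pot k.val = X.pot (k.val + 1) - X.eta k := by rw [hp]; ring
    rw [this, hpot]
    simp only [evenTail, oddTail, potEnd, Finset.sum_empty]
    unfold eta at *
    split_ifs <;> simp <;> ring
  · simp only [if_neg ht, map_add, coord_vertex, mul_add, Finset.sum_add_distrib,
      sum_pairs_left, sum_pairs_right, sum_lt_eta]
    have htail : (∑ x, ∑ c ∈ X.evenTail x, c * (if x = k then 1 else 0)) -
        (∑ x, ∑ c ∈ X.oddTail x, c * (if x = k then 1 else 0)) =
        (∑ c ∈ X.evenTail k, c) - ∑ c ∈ X.oddTail k, c := by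
      congr 1
      · rw [Finset.sum_eq_single k]
        · simp
        · intro b _ hb; simp [hb]
        · simp
      · rw [Finset.sum_eq_single k]
        · simp
        · intro b _ hb; simp [hb]
        · simp
    have : X.pot k.val = X.pot (k.val + 1) - X.eta k := by rw [hp]; ring
    rw [this, hpot]
    have e2 : (∑ c ∈ X.evenTail k, c) - ∑ c ∈ X.oddTail k, c =
        if X.inE k = true then 2 - 2 * potEnd t m n else 2 * potEnd t m n := by
      cases t with
      | gl => exact absurd rfl ht
      | B => cases hE : X.inE k <;> simp [evenTail, oddTail, potEnd, hE] <;> norm_num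
      | D => cases hE : X.inE k <;> simp [evenTail, oddTail, potEnd, hE]
    simp only [← mul_sub, htail, e2]
    unfold eta at *
    split_ifs <;> ring

end OrderedBasis

end SuperDenominator

namespace SuperDenominator

namespace OrderedBasis

variable {t : SuperType} {m n : ℕ} (X : OrderedBasis t m n)

/-! ### The superdenominator as a product over pairs of vertices -/

/-- `e^{v/2} - e^{-v/2}`. -/
noncomputable def br (v : Weight m n) : RatFun m n := expo ((1 / 2 : ℚ) • v) - expo (-((1 / 2 : ℚ) • v))

theorem br_eq (v : Weight m n) : br v = expo ((1 / 2 : ℚ) • v) * (1 - expo (-v)) := by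
  rw [br, mul_sub, mul_one, ← expo_add]
  congr 2
  module

theorem expo_rho_mul_superDenominator :
    expo X.rho * X.superDenominator = (∏ α ∈ X.posEven, br α) / ∏ α ∈ X.posOdd, br α := by
  have h : ∀ S : Finset (Weight m n), ∏ α ∈ S, br α =
      expo ((1 / 2 : ℚ) • ∑ α ∈ S, α) * ∏ α ∈ S, (1 - expo (-α)) := by
    intro S
    rw [Finset.smul_sum, expo_sum, ← Finset.prod_mul_distrib]
    exact Finset.prod_congr rfl fun α _ => br_eq α
  rw [h, h, rho, expo_sub, superDenominator, mul_div_mul_comm]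

/-- The variable attached to a vertex in which the superdenominator factors. -/
noncomputable def V (i : Fin (m + n)) : RatFun m n :=
  if t = SuperType.gl then X.e i 1 else X.e i 1 + X.e i (-1)

/-- The factor of the superdenominator that depends on one vertex only. -/
noncomputable def tailQ (i : Fin (m + n)) : RatFun m n :=
  match t with
  | .gl => X.e i ((1 - X.eta i * (m - n)) / 2)
  | .B => if X.inE i = true then X.e i (1 / 2) - X.e i (-(1 / 2)) else
      X.e i (1 / 2) + X.e i (-(1 / 2))
  | .D => if X.inE i = true then 1 else X.e i 1 - X.e i (-1)

/-- The factor of the superdenominator that depends on the two vertices `ξ_i > ξ_j`. -/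
noncomputable def pairQ (i j : Fin (m + n)) : RatFun m n :=
  if X.inE i = X.inE j then X.V i - X.V j else (X.V i - X.V j)⁻¹

theorem expo_add_smul (i j : Fin (m + n)) (c d : ℚ) :
    expo (c • X.vertex i + d • X.vertex j) = X.e i c * X.e j d := by
  rw [expo_add]; rfl

theorem br_sub (i j : Fin (m + n)) : br (X.vertex i - X.vertex j) =
    X.e i (1 / 2) * X.e j (-(1 / 2)) - X.e i (-(1 / 2)) * X.e j (1 / 2) := by
  rw [br, ← expo_add_smul, ← expo_add_smul]
  congr 2 <;> module

theorem br_add (i j : Fin (m + n)) : br (X.vertex i + X.vertex j) =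
    X.e i (1 / 2) * X.e j (1 / 2) - X.e i (-(1 / 2)) * X.e j (-(1 / 2)) := by
  rw [br, ← expo_add_smul, ← expo_add_smul]
  congr 2 <;> module

theorem e_half_mul_self (i : Fin (m + n)) (c : ℚ) : X.e i (c / 2) * X.e i (c / 2) = X.e i c := by
  rw [← e_add, add_halves]

theorem br_sub_eq (i j : Fin (m + n)) : br (X.vertex i - X.vertex j) =
    expo (-((1 / 2 : ℚ) • (X.vertex i + X.vertex j))) * (X.e i 1 - X.e j 1) := by
  have : -((1 / 2 : ℚ) • (X.vertex i + X.vertex j)) =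
      (-(1 / 2) : ℚ) • X.vertex i + (-(1 / 2) : ℚ) • X.vertex j := by module
  rw [br_sub, this, expo_add_smul, ← X.e_half_mul_self i 1, ← X.e_half_mul_self j 1]
  have hi := X.e_ne_zero i (1 / 2)
  have hj := X.e_ne_zero j (1 / 2)
  rw [e_neg, e_neg]
  field_simp

theorem br_sub_mul_br_add (i j : Fin (m + n)) :
    br (X.vertex i - X.vertex j) * br (X.vertex i + X.vertex j) =
      (X.e i 1 + X.e i (-1)) - (X.e j 1 + X.e j (-1)) := by
  rw [br_sub, br_add, e_neg, e_neg, e_neg, e_neg, ← X.e_half_mul_self i 1,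
    ← X.e_half_mul_self j 1]
  have hi := X.e_ne_zero i (1 / 2)
  have hj := X.e_ne_zero j (1 / 2)
  field_simp
  ring

theorem prod_pairs {M : Type*} [CommGroupWithZero M] (g : Fin (m + n) × Fin (m + n) → M) :
    (∏ p : Fin (m + n) × Fin (m + n) with p.1 < p.2 ∧ (X.inE p.1 == X.inE p.2) = true, g p) /
      ∏ p : Fin (m + n) × Fin (m + n) with p.1 < p.2 ∧ (X.inE p.1 == X.inE p.2) = false, g p
    = ∏ p : Fin (m + n) × Fin (m + n) with p.1 < p.2,
        if X.inE p.1 = X.inE p.2 then g p else (g p)⁻¹ := by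
  rw [← Finset.filter_filter, ← Finset.filter_filter, Finset.prod_filter,
    Finset.prod_filter (fun p : Fin (m + n) × Fin (m + n) => (X.inE p.1 == X.inE p.2) = false),
    ← Finset.prod_div_distrib]
  refine Finset.prod_congr rfl fun p _ => ?_
  cases X.inE p.1 <;> cases X.inE p.2 <;> simp

theorem expo_rho_mul_superDenominator_eq :
    expo X.rho * X.superDenominator = (∏ i, X.tailQ i) *
      ∏ p : Fin (m + n) × Fin (m + n) with p.1 < p.2, X.pairQ p.1 p.2 := by
  rw [expo_rho_mul_superDenominator,
    X.prod_roots true X.evenTail X.evenTail_pos _ (fun α => X.mem_posEven),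
    X.prod_roots false X.oddTail X.oddTail_pos _ (fun α => X.mem_posOdd), mul_div_mul_comm,
    mul_div_mul_comm, X.prod_pairs, X.prod_pairs, ← Finset.prod_div_distrib]
  by_cases ht : t = SuperType.gl
  · subst ht
    have h1 : ∀ p : Fin (m + n) × Fin (m + n), (if X.inE p.1 = X.inE p.2
        then br (X.vertex p.1 - X.vertex p.2) else (br (X.vertex p.1 - X.vertex p.2))⁻¹) =
        expo (-((1 / 2 : ℚ) • (X.eta p.1 * X.eta p.2) • (X.vertex p.1 + X.vertex p.2))) *
          X.pairQ p.1 p.2 := by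
      intro p
      have hu : expo (-((1 / 2 : ℚ) • (-1 : ℚ) • (X.vertex p.1 + X.vertex p.2))) =
          (expo (-((1 / 2 : ℚ) • (X.vertex p.1 + X.vertex p.2))))⁻¹ := by
        rw [← expo_neg]; congr 1; module
      unfold eta pairQ V
      rw [br_sub_eq]
      cases X.inE p.1 <;> cases X.inE p.2 <;>
        simp only [if_true, if_false, Bool.false_eq_true, reduceCtorEq, one_mul, mul_one,
          neg_mul, neg_neg, one_smul, mul_inv] <;> rw [hu]
    simp only [h1, Finset.prod_mul_distrib, evenTail, oddTail, if_true, inv_one, ite_self,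
      Finset.prod_const_one, mul_one, Finset.prod_empty, div_one]
    congr 1
    rw [← expo_sum]
    simp only [tailQ, e]
    rw [← expo_sum]
    congr 1
    apply X.ext_coord
    intro k
    have e1 : ∀ x : Fin (m + n) × Fin (m + n), X.eta x.1 * X.eta x.2 *
        ((if x.1 = k then 1 else 0) + (if x.2 = k then 1 else 0)) =
        X.eta x.1 * X.eta x.2 * (if x.1 = k then 1 else 0) +
        X.eta x.1 * X.eta x.2 * (if x.2 = k then 1 else 0) := fun x => by ring
    simp only [map_sum, map_neg, map_smul, map_add, smul_eq_mul, coord_vertex,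
      Finset.sum_neg_distrib, ← Finset.mul_sum, e1, Finset.sum_add_distrib, sum_pairs_left,
      sum_pairs_right, sum_lt_eta]
    simp only [mul_ite, mul_one, mul_zero, Finset.sum_ite_eq', Finset.mem_univ, if_true]
    linear_combination (1 / 2 : ℚ) * X.eta_mul_self k
  · have h1 : ∀ p : Fin (m + n) × Fin (m + n), X.pairQ p.1 p.2 =
        (if X.inE p.1 = X.inE p.2 then br (X.vertex p.1 - X.vertex p.2)
          else (br (X.vertex p.1 - X.vertex p.2))⁻¹) *
        (if X.inE p.1 = X.inE p.2 then br (X.vertex p.1 + X.vertex p.2)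
          else (br (X.vertex p.1 + X.vertex p.2))⁻¹) := by
      intro p
      unfold pairQ V
      rw [if_neg ht, if_neg ht, ← br_sub_mul_br_add]
      split_ifs
      · rfl
      · rw [mul_inv]
    simp only [h1, Finset.prod_mul_distrib, if_neg ht]
    rw [mul_comm]
    congr 1
    refine Finset.prod_congr rfl fun i _ => ?_
    have hb1 : br ((1 : ℚ) • X.vertex i) = X.e i (1 / 2) - X.e i (-(1 / 2)) := by
      simp only [br, e, smul_smul, ← neg_smul, mul_one]
    have hb2 : br ((2 : ℚ) • X.vertex i) = X.e i 1 - X.e i (-1) := by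
      simp only [br, e, smul_smul, ← neg_smul]; norm_num
    cases t with
    | gl => exact absurd rfl ht
    | B =>
      cases hE : X.inE i
      · simp only [evenTail, oddTail, tailQ, hE, Bool.false_eq_true, if_false,
          Finset.prod_singleton, hb1, hb2]
        have hne : X.e i (1 / 2) - X.e i (-(1 / 2)) ≠ 0 := by
          intro h
          have := congrArg (X.coord i) (expo_injective (sub_eq_zero.1 h))
          simp [coord_vertex] at this
          norm_num at this
        rw [div_eq_iff hne, e_neg, ← X.e_half_mul_self i 1, e_neg]
        field_simp [X.e_ne_zero i]
        ring
      · simp only [evenTail, oddTail, tailQ, hE, if_true,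
          Finset.prod_singleton, hb1, Finset.prod_empty, div_one]
    | D =>
      cases hE : X.inE i
      · simp only [evenTail, oddTail, tailQ, hE, Bool.false_eq_true, if_false,
          Finset.prod_singleton, hb2, Finset.prod_empty, div_one]
      · simp only [evenTail, oddTail, tailQ, hE, if_true, Finset.prod_empty, div_one]

theorem e_injective {i j : Fin (m + n)} {c d : ℚ} (hc : c ≠ 0) (h : X.e i c = X.e j d) :
    i = j ∧ c = d := by
  have := congrArg (X.coord i) (expo_injective h)
  simp only [map_smul, coord_vertex, if_true, smul_eq_mul, mul_one] at this
  by_cases hij : j = i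
  · rw [if_pos hij, mul_one] at this
    exact ⟨hij.symm, this⟩
  · rw [if_neg hij, mul_zero] at this
    exact absurd this hc

theorem V_injective : Function.Injective X.V := by
  intro i j h
  by_cases ht : t = SuperType.gl
  · simp only [V, if_pos ht] at h
    exact (X.e_injective one_ne_zero h).1
  · simp only [V, if_neg ht] at h
    by_contra hij
    have h1 := sub_eq_zero.2 h
    have hi := X.e_ne_zero i 1
    have hj := X.e_ne_zero j 1
    rw [e_neg, e_neg] at h1
    have h2 : (X.e i 1 - X.e j 1) * (X.e i 1 * X.e j 1 - 1) = 0 := by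
      have : (X.e i 1 - X.e j 1) * (X.e i 1 * X.e j 1 - 1) = X.e i 1 * X.e j 1 *
          (X.e i 1 + (X.e i 1)⁻¹ - (X.e j 1 + (X.e j 1)⁻¹)) := by
        field_simp; ring
      rw [this, h1, mul_zero]
    rcases mul_eq_zero.1 h2 with h3 | h3
    · exact hij (X.e_injective one_ne_zero (sub_eq_zero.1 h3)).1
    · have : X.e i 1 = X.e j (-1) := by
        rw [e_neg]; exact eq_inv_of_mul_eq_one_left (sub_eq_zero.1 h3)
      exact hij (X.e_injective one_ne_zero this).1

end OrderedBasis

end SuperDenominator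

namespace SuperDenominator

namespace OrderedBasis

variable {t : SuperType} {m n : ℕ} (X : OrderedBasis t m n)

/-! ### Even roots and their reflections -/

theorem evenRoots_cases {α : Weight m n} (hα : α ∈ evenRoots t m n) :
    (∃ i j, i ≠ j ∧ X.inE i = X.inE j ∧
      ∃ s ∈ pairSigns t, α = s.1 • X.vertex i + s.2 • X.vertex j) ∨
    (∃ i, X.inE i = true ∧ t = SuperType.B ∧
      (α = (1 : ℚ) • X.vertex i ∨ α = -((1 : ℚ) • X.vertex i))) ∨
    (∃ i, X.inE i = false ∧ t ≠ SuperType.gl ∧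
      (α = (2 : ℚ) • X.vertex i ∨ α = -((2 : ℚ) • X.vertex i))) := by
  rw [evenRoots.eq_def, Finset.mem_union] at hα
  rcases hα with h | h
  · obtain ⟨i, j, hij, hs, h⟩ := X.mem_pairRoots.1 h
    exact Or.inl ⟨i, j, hij, by simpa using hs, h⟩
  · right
    cases t with
    | gl => simp at h
    | B =>
      rcases Finset.mem_union.1 h with h | h
      · obtain ⟨i, hi, h⟩ := X.mem_multEps.1 h
        exact Or.inl ⟨i, hi, rfl, h⟩
      · obtain ⟨i, hi, h⟩ := X.mem_multDelta.1 h
        exact Or.inr ⟨i, hi, by simp, h⟩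
    | D =>
      obtain ⟨i, hi, h⟩ := X.mem_multDelta.1 h
      exact Or.inr ⟨i, hi, by simp, h⟩

theorem pair_mem_evenRoots {i j : Fin (m + n)} (hij : i ≠ j) (h : X.inE i = X.inE j)
    {s : ℚ × ℚ} (hs : s ∈ pairSigns t) :
    s.1 • X.vertex i + s.2 • X.vertex j ∈ evenRoots t m n := by
  rw [evenRoots.eq_def, Finset.mem_union]
  exact Or.inl (X.mem_pairRoots.2 ⟨i, j, hij, by simp [h], s, hs, rfl⟩)

theorem sub_mem_evenRoots {i j : Fin (m + n)} (hij : i ≠ j) (h : X.inE i = X.inE j) :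
    X.vertex i - X.vertex j ∈ evenRoots t m n := by
  have := X.pair_mem_evenRoots hij h (s := (1, -1)) (by cases t <;> simp [pairSigns])
  simpa [sub_eq_add_neg] using this

theorem add_mem_evenRoots (ht : t ≠ SuperType.gl) {i j : Fin (m + n)} (hij : i ≠ j)
    (h : X.inE i = X.inE j) :
    X.vertex i + X.vertex j ∈ evenRoots t m n := by
  have := X.pair_mem_evenRoots hij h (s := (1, 1)) (by cases t <;> simp [pairSigns] at ht ⊢)
  simpa using this

theorem vertex_mem_evenRoots (ht : t = SuperType.B) {i : Fin (m + n)} (h : X.inE i = true) :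
    X.vertex i ∈ evenRoots t m n := by
  subst ht
  rw [evenRoots.eq_def, Finset.mem_union]
  exact Or.inr (Finset.mem_union_left _ (X.mem_multEps.2 ⟨i, h, Or.inl (by simp)⟩))

theorem two_smul_vertex_mem_evenRoots (ht : t ≠ SuperType.gl) {i : Fin (m + n)}
    (h : X.inE i = false) : (2 : ℚ) • X.vertex i ∈ evenRoots t m n := by
  rw [evenRoots.eq_def, Finset.mem_union]
  cases t with
  | gl => exact absurd rfl ht
  | B => exact Or.inr (Finset.mem_union_right _ (X.mem_multDelta.2 ⟨i, h, Or.inl rfl⟩))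
  | D => exact Or.inr (X.mem_multDelta.2 ⟨i, h, Or.inl rfl⟩)

theorem reflection_neg (α : Weight m n) : reflection (-α) = reflection α := by
  rw [← reflection_smul (neg_ne_zero.2 one_ne_zero) α, neg_one_smul]

theorem pairSigns_cases {s : ℚ × ℚ} (hs : s ∈ pairSigns t) :
    (s.1 = 1 ∨ s.1 = -1) ∧ (s.2 = -s.1 ∨ (t ≠ SuperType.gl ∧ s.2 = s.1)) := by
  obtain ⟨a, b⟩ := s
  cases t <;> simp [pairSigns] at hs ⊢ <;> grind

theorem reflection_pair_eq {i j : Fin (m + n)} (hij : i ≠ j) (h : X.inE i = X.inE j)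
    {s : ℚ × ℚ} (hs : s ∈ pairSigns t) :
    (s.2 = -s.1 ∧ reflection (s.1 • X.vertex i + s.2 • X.vertex j) = X.perm (Equiv.swap i j)) ∨
    (t ≠ SuperType.gl ∧ s.2 = s.1 ∧ reflection (s.1 • X.vertex i + s.2 • X.vertex j) =
      X.flip i * X.flip j * X.perm (Equiv.swap i j)) := by
  obtain ⟨h1, h2⟩ := pairSigns_cases hs
  have h0 : s.1 ≠ 0 := by rcases h1 with h | h <;> rw [h] <;> norm_num
  rcases h2 with h2 | ⟨ht, h2⟩
  · refine Or.inl ⟨h2, ?_⟩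
    rw [h2, ← X.reflection_vertex_sub hij h, ← reflection_smul h0 (X.vertex i - X.vertex j)]
    congr 1; module
  · refine Or.inr ⟨ht, h2, ?_⟩
    rw [h2, ← X.reflection_vertex_add hij h, ← reflection_smul h0 (X.vertex i + X.vertex j)]
    congr 1; module

theorem reflection_smul_vertex {c : ℚ} (hc : c ≠ 0) {i : Fin (m + n)} {α : Weight m n}
    (h : α = c • X.vertex i ∨ α = -(c • X.vertex i)) : reflection α = X.flip i := by
  rcases h with rfl | rfl
  · rw [reflection_smul hc]; rfl
  · rw [reflection_neg, reflection_smul hc]; rfl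

theorem coord_root {α : Weight m n} (hα : α ∈ evenRoots t m n ∪ oddRoots t m n)
    (k : Fin (m + n)) : ∃ z : ℤ, X.coord k α = z := by
  have hpair : ∀ b, ∀ β ∈ pairRoots t m n b, ∃ z : ℤ, X.coord k β = z := by
    intro b β hβ
    obtain ⟨i, j, _, _, s, hs, rfl⟩ := X.mem_pairRoots.1 hβ
    obtain ⟨h1, h2⟩ := pairSigns_cases hs
    have h1' : ∃ z : ℤ, s.1 = z := by
      rcases h1 with h | h
      · exact ⟨1, by simp [h]⟩
      · exact ⟨-1, by simp [h]⟩
    obtain ⟨z, hz⟩ := h1'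
    have h2' : ∃ z : ℤ, s.2 = z := by
      rcases h2 with h | ⟨_, h⟩
      · exact ⟨-z, by simp [h, hz]⟩
      · exact ⟨z, by simp [h, hz]⟩
    obtain ⟨y, hy⟩ := h2'
    refine ⟨z * (if i = k then 1 else 0) + y * (if j = k then 1 else 0), ?_⟩
    simp [coord_vertex, hz, hy]
  have hsm : ∀ c : ℤ, ∀ i, ∀ β, (β = (c : ℚ) • X.vertex i ∨ β = -((c : ℚ) • X.vertex i)) →
      ∃ z : ℤ, X.coord k β = z := by
    rintro c i β (rfl | rfl)
    · exact ⟨c * (if i = k then 1 else 0), by simp [coord_vertex]⟩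
    · exact ⟨-(c * (if i = k then 1 else 0)), by simp [coord_vertex]⟩
  rw [Finset.mem_union] at hα
  rcases hα with h | h
  · rcases X.evenRoots_cases h with ⟨i, j, hij, hs, s, hsig, rfl⟩ | ⟨i, _, _, h⟩ | ⟨i, _, _, h⟩
    · exact hpair true _ (X.mem_pairRoots.2 ⟨i, j, hij, by simp [hs], s, hsig, rfl⟩)
    · exact hsm 1 i _ (by simpa using h)
    · exact hsm 2 i _ (by simpa using h)
  · rw [oddRoots.eq_def, Finset.mem_union] at h
    rcases h with h | h
    · exact hpair _ _ h
    · cases t with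
      | gl => simp at h
      | B =>
        obtain ⟨i, _, h⟩ := X.mem_multDelta.1 h
        exact hsm 1 i _ (by simpa using h)
      | D => simp at h

theorem half_notMem {α : Weight m n} {k : Fin (m + n)}
    (h : X.coord k α = 1 ∨ X.coord k α = -1) :
    (1 / 2 : ℚ) • α ∉ evenRoots t m n ∪ oddRoots t m n := by
  intro hα
  obtain ⟨z, hz⟩ := X.coord_root hα k
  rw [map_smul, smul_eq_mul] at hz
  rcases h with h | h <;> rw [h] at hz
  · have : (2 * z : ℚ) = 1 := by linarith
    have h2 : (2 * z : ℤ) = 1 := by exact_mod_cast this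
    omega
  · have : (2 * z : ℚ) = -1 := by linarith
    have h2 : (2 * z : ℤ) = -1 := by exact_mod_cast this
    omega

theorem vertex_notMem_D (X : OrderedBasis SuperType.D m n) (i : Fin (m + n)) {α : Weight m n}
    (hα : α = X.vertex i ∨ α = -X.vertex i) :
    α ∉ evenRoots SuperType.D m n ∪ oddRoots SuperType.D m n := by
  intro h
  have hf : X.functional (fun _ => 1) α = 1 ∨ X.functional (fun _ => 1) α = -1 := by
    rcases hα with rfl | rfl <;> simp
  have hpair : ∀ b, ∀ β ∈ pairRoots SuperType.D m n b, X.functional (fun _ => 1) β = 0 ∨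
      X.functional (fun _ => 1) β = 2 ∨ X.functional (fun _ => 1) β = -2 := by
    intro b β hβ
    obtain ⟨i, j, _, _, s, hs, rfl⟩ := X.mem_pairRoots.1 hβ
    simp only [map_add, map_smul, functional_vertex, smul_eq_mul, mul_one]
    obtain ⟨h1, h2⟩ := pairSigns_cases hs
    rcases h1 with h1 | h1 <;> rcases h2 with h2 | ⟨_, h2⟩ <;> rw [h2, h1] <;> norm_num
  have key : X.functional (fun _ => 1) α = 0 ∨ X.functional (fun _ => 1) α = 2 ∨
      X.functional (fun _ => 1) α = -2 := by
    rw [Finset.mem_union] at h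
    rcases h with h | h
    · rcases X.evenRoots_cases h with ⟨i, j, hij, hs, s, hsig, rfl⟩ | ⟨i, _, h, _⟩ | ⟨i, _, _, h⟩
      · exact hpair true _ (X.mem_pairRoots.2 ⟨i, j, hij, by simp [hs], s, hsig, rfl⟩)
      · cases h
      · rcases h with rfl | rfl <;> simp
    · rw [oddRoots.eq_def, Finset.mem_union] at h
      rcases h with h | h
      · exact hpair _ _ h
      · simp at h
  rcases hf with h1 | h1 <;> rw [h1] at key <;> norm_num at key

/-! ### The sign character -/

/-- The value of `sgn'` on the sign change of the vertex `ξ_i`. -/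
def kap (i : Fin (m + n)) : ℚ := if t = SuperType.B ∧ X.inE i = false then 1 else -1

theorem kap_mul_self (i : Fin (m + n)) : X.kap i * X.kap i = 1 := by
  unfold kap; split_ifs <;> norm_num

theorem kap_congr {i j : Fin (m + n)} (h : X.inE i = X.inE j) : X.kap i = X.kap j := by
  unfold kap; rw [h]

/-- The character `sgn'`, in terms of a determinant. -/
noncomputable def chi (w : Weight m n ≃ₗ[ℚ] Weight m n) : ℚ :=
  X.basis.det (fun i => w (X.vertex i)) *
    if t = SuperType.B then
      ∏ i with X.inE i = false, X.functional (fun _ => 1) (w (X.vertex i)) else 1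

theorem chi_one : X.chi 1 = 1 := by
  have : (fun i => (1 : Weight m n ≃ₗ[ℚ] Weight m n) (X.vertex i)) = X.basis := by
    funext i; rw [basis_apply]; rfl
  rw [chi, this, Module.Basis.det_self]
  simp

theorem chi_mul_perm (w : Weight m n ≃ₗ[ℚ] Weight m n) {σ : Equiv.Perm (Fin (m + n))}
    (hσ : ∀ i, X.inE (σ i) = X.inE i) :
    X.chi (w * X.perm σ) = ((Equiv.Perm.sign σ : ℤ) : ℚ) * X.chi w := by
  have h1 : (fun i => (w * X.perm σ) (X.vertex i)) = (fun i => w (X.vertex i)) ∘ σ := by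
    funext i; simp [LinearEquiv.mul_apply]
  have h2 : ∏ i with X.inE i = false, X.functional (fun _ => 1) ((w * X.perm σ) (X.vertex i)) =
      ∏ i with X.inE i = false, X.functional (fun _ => 1) (w (X.vertex i)) := by
    refine Finset.prod_equiv σ (fun i => by simp [hσ]) (fun i _ => ?_)
    simp [LinearEquiv.mul_apply]
  rw [chi, chi, h1, h2, AlternatingMap.map_perm]
  simp only [Units.smul_def, zsmul_eq_mul, mul_assoc]

theorem chi_mul_flip (w : Weight m n ≃ₗ[ℚ] Weight m n) (i : Fin (m + n)) :
    X.chi (w * X.flip i) = X.kap i * X.chi w := by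
  have h1 : (fun k => (w * X.flip i) (X.vertex k)) =
      Function.update (fun k => w (X.vertex k)) i (-(w (X.vertex i))) := by
    funext k
    rw [LinearEquiv.mul_apply, flip_vertex]
    by_cases h : k = i
    · subst h; simp
    · simp [h]
  have h2 : ∏ k with X.inE k = false, X.functional (fun _ => 1) ((w * X.flip i) (X.vertex k)) =
      (if X.inE i = false then -1 else 1) *
      ∏ k with X.inE k = false, X.functional (fun _ => 1) (w (X.vertex k)) := by
    have : ∀ k, X.functional (fun _ => 1) ((w * X.flip i) (X.vertex k)) =
        (if k = i then -1 else 1) * X.functional (fun _ => 1) (w (X.vertex k)) := by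
      intro k
      rw [LinearEquiv.mul_apply, flip_vertex]
      split_ifs <;> simp
    simp only [this, Finset.prod_mul_distrib]
    congr 1
    rw [Finset.prod_ite_eq']
    simp
  rw [chi, chi, h1, h2, AlternatingMap.map_update_neg, Function.update_eq_self, kap]
  by_cases ht : t = SuperType.B
  · by_cases hE : X.inE i = false
    · simp [ht, hE]
    · simp [ht, hE]
  · simp [ht]

theorem inE_swap {i j : Fin (m + n)} (h : X.inE i = X.inE j) (k : Fin (m + n)) :
    X.inE (Equiv.swap i j k) = X.inE k := by
  rw [Equiv.swap_apply_def]
  split_ifs with h1 h2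
  · rw [h1, h]
  · rw [h2, h]
  · rfl

theorem chi_mul_swap (w : Weight m n ≃ₗ[ℚ] Weight m n) {i j : Fin (m + n)} (hij : i ≠ j)
    (h : X.inE i = X.inE j) : X.chi (w * X.perm (Equiv.swap i j)) = -X.chi w := by
  rw [X.chi_mul_perm w (X.inE_swap h), Equiv.Perm.sign_swap hij]
  simp

theorem chi_mul_reflection (w : Weight m n ≃ₗ[ℚ] Weight m n) {α : Weight m n}
    (hα : α ∈ evenRoots t m n) :
    X.chi (w * reflection α) = (if α ∈ evenRootsBar t m n then -1 else 1) * X.chi w := by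
  rcases X.evenRoots_cases hα with ⟨i, j, hij, h, s, hs, rfl⟩ | ⟨i, hi, ht, h⟩ | ⟨i, hi, ht, h⟩
  · have hbar : s.1 • X.vertex i + s.2 • X.vertex j ∈ evenRootsBar t m n := by
      rw [evenRootsBar, Finset.mem_filter]
      refine ⟨hα, X.half_notMem (k := i) ?_⟩
      simpa [coord_vertex, hij.symm] using (pairSigns_cases hs).1
    rw [if_pos hbar]
    rcases X.reflection_pair_eq hij h hs with ⟨_, h'⟩ | ⟨_, _, h'⟩
    · rw [h', X.chi_mul_swap w hij h]; ring
    · rw [h', ← mul_assoc, X.chi_mul_swap _ hij h, ← mul_assoc, chi_mul_flip, chi_mul_flip,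
        X.kap_congr h]
      linear_combination (-X.chi w) * X.kap_mul_self j
  · have hbar : α ∈ evenRootsBar t m n := by
      rw [evenRootsBar, Finset.mem_filter]
      refine ⟨hα, X.half_notMem (k := i) ?_⟩
      rcases h with rfl | rfl <;> simp [coord_vertex]
    rw [if_pos hbar, X.reflection_smul_vertex one_ne_zero h, chi_mul_flip, kap, hi]
    simp
  · rw [X.reflection_smul_vertex two_ne_zero h, chi_mul_flip]
    have hhalf : (1 / 2 : ℚ) • α = X.vertex i ∨ (1 / 2 : ℚ) • α = -X.vertex i := by
      rcases h with rfl | rfl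
      · left; module
      · right; module
    cases t with
    | gl => exact absurd rfl ht
    | B =>
      have hbar : α ∉ evenRootsBar SuperType.B m n := by
        rw [evenRootsBar, Finset.mem_filter]
        rintro ⟨_, h2⟩
        apply h2
        rw [Finset.mem_union]
        right
        rw [oddRoots.eq_def, Finset.mem_union]
        exact Or.inr (X.mem_multDelta.2 ⟨i, hi, by simpa using hhalf⟩)
      rw [if_neg hbar, kap, if_pos ⟨rfl, hi⟩]
    | D =>
      have hbar : α ∈ evenRootsBar SuperType.D m n := by
        rw [evenRootsBar, Finset.mem_filter]
        exact ⟨hα, X.vertex_notMem_D i hhalf⟩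
      rw [if_pos hbar, kap, if_neg (by simp)]

theorem chi_list (l : List (Weight m n)) (hl : ∀ α ∈ l, α ∈ evenRoots t m n)
    (w : Weight m n ≃ₗ[ℚ] Weight m n) :
    X.chi (w * (l.map reflection).prod) =
      (-1) ^ (l.countP (· ∈ evenRootsBar t m n)) * X.chi w := by
  induction l generalizing w with
  | nil => simp
  | cons α l ih =>
    rw [List.map_cons, List.prod_cons, ← mul_assoc,
      ih (fun β hβ => hl β (List.mem_cons_of_mem _ hβ)),
      X.chi_mul_reflection w (hl α List.mem_cons_self), List.countP_cons]
    by_cases h : α ∈ evenRootsBar t m n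
    · simp [h, pow_succ]
    · simp [h]

theorem exists_list_of_mem_weylGroup {w : Weight m n ≃ₗ[ℚ] Weight m n}
    (hw : w ∈ weylGroup t m n) :
    ∃ l : List (Weight m n), (∀ α ∈ l, α ∈ evenRoots t m n) ∧ (l.map reflection).prod = w := by
  induction hw using Subgroup.closure_induction'' with
  | mem x hx =>
    obtain ⟨α, hα, rfl⟩ := hx
    exact ⟨[α], by simpa using hα, by simp⟩
  | inv_mem x hx =>
    obtain ⟨α, hα, rfl⟩ := hx
    exact ⟨[α], by simpa using hα, by simp [reflection_inv]⟩
  | one => exact ⟨[], by simp, by simp⟩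
  | mul x y _ _ hx hy =>
    obtain ⟨l, hl, rfl⟩ := hx
    obtain ⟨l', hl', rfl⟩ := hy
    refine ⟨l ++ l', ?_, by simp⟩
    intro α hα
    rcases List.mem_append.1 hα with h | h
    · exact hl α h
    · exact hl' α h

theorem sgnPrime_eq_chi {w : Weight m n ≃ₗ[ℚ] Weight m n} (hw : w ∈ weylGroup t m n) :
    (sgnPrime t w : ℚ) = X.chi w := by
  obtain ⟨l, hl, hlw⟩ := exists_list_of_mem_weylGroup hw
  have key := X.chi_list l hl 1
  rw [one_mul, hlw, chi_one, mul_one] at key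
  unfold sgnPrime
  split_ifs with h
  · obtain ⟨l', hl', hlw', he⟩ := h
    have key' := X.chi_list l' hl' 1
    rw [one_mul, hlw', chi_one, mul_one] at key'
    rw [key', Even.neg_one_pow (by convert he)]
    simp
  · rw [key, Odd.neg_one_pow]
    · simp
    · rw [← Nat.not_even_iff_odd]
      intro he
      exact h ⟨l, hl, hlw, by convert he⟩

theorem chi_mul {v w : Weight m n ≃ₗ[ℚ] Weight m n} (hw : w ∈ weylGroup t m n) :
    X.chi (v * w) = X.chi v * X.chi w := by
  obtain ⟨l, hl, rfl⟩ := exists_list_of_mem_weylGroup hw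
  have h1 := X.chi_list l hl 1
  rw [one_mul, chi_one, mul_one] at h1
  rw [X.chi_list l hl, h1, mul_comm]

theorem sgnPrime_mul (X : OrderedBasis t m n) {v w : Weight m n ≃ₗ[ℚ] Weight m n} (hv : v ∈ weylGroup t m n)
    (hw : w ∈ weylGroup t m n) : sgnPrime t (v * w) = sgnPrime t v * sgnPrime t w := by
  have : (sgnPrime t (v * w) : ℚ) = (sgnPrime t v * sgnPrime t w : ℤ) := by
    rw [X.sgnPrime_eq_chi (mul_mem hv hw), X.chi_mul hw, Int.cast_mul, X.sgnPrime_eq_chi hv,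
      X.sgnPrime_eq_chi hw]
  exact_mod_cast this

end OrderedBasis

theorem sgnPrime_mul_self (t : SuperType) {m n : ℕ} (w : Weight m n ≃ₗ[ℚ] Weight m n) :
    sgnPrime t w * sgnPrime t w = 1 := by
  unfold sgnPrime; split_ifs <;> norm_num

end SuperDenominator

namespace SuperDenominator

variable {t : SuperType} {m n : ℕ}

/-! ### Alternating sums -/

theorem sum_of_forall_mem_iff {Γ A : Type*} [Group Γ] [AddCommMonoid A] (S H U : Finset Γ)
    (hU : ∀ u, u ∈ U ↔ ∃ s ∈ S, ∃ h ∈ H, s * h = u)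
    (hinj : ∀ s ∈ S, ∀ h ∈ H, ∀ s' ∈ S, ∀ h' ∈ H, s * h = s' * h' → s = s') (f : Γ → A) :
    ∑ u ∈ U, f u = ∑ s ∈ S, ∑ h ∈ H, f (s * h) := by
  rw [← Finset.sum_product']
  symm
  refine Finset.sum_bij (fun p _ => p.1 * p.2) ?_ ?_ ?_ (fun _ _ => rfl)
  · rintro ⟨s, h⟩ hp
    rw [Finset.mem_product] at hp
    exact (hU _).2 ⟨s, hp.1, h, hp.2, rfl⟩
  · rintro ⟨s, h⟩ hp ⟨s', h'⟩ hp' heq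
    rw [Finset.mem_product] at hp hp'
    have := hinj s hp.1 h hp.2 s' hp'.1 h' hp'.2 heq
    simp only at this heq
    subst this
    rw [mul_left_cancel heq]
  · intro u hu
    obtain ⟨s, hs, h, hh, rfl⟩ := (hU u).1 hu
    exact ⟨(s, h), Finset.mem_product.2 ⟨hs, hh⟩, rfl⟩

theorem superSum_eq_sum {U : Set (Weight m n ≃ₗ[ℚ] Weight m n)} (hU : U.Finite) (Y : RatFun m n) :
    superSum t U Y = ∑ w ∈ hU.toFinset, (sgnPrime t w : RatFun m n) * act w Y := by
  rw [superSum, finsum_mem_eq_finite_toFinset_sum _ hU]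

theorem finite_of_subset_weylGroup {U : Set (Weight m n ≃ₗ[ℚ] Weight m n)}
    (h : U ⊆ weylGroup t m n) : U.Finite := (weylGroup_finite t m n).subset h

/-- The alternating sum over a finite set, as an additive map. -/
noncomputable def superSumHom (t : SuperType) {U : Set (Weight m n ≃ₗ[ℚ] Weight m n)}
    (hU : U.Finite) : RatFun m n →+ RatFun m n where
  toFun := superSum t U
  map_zero' := by simp [superSum_eq_sum hU]
  map_add' x y := by
    simp only [superSum_eq_sum hU, map_add, mul_add, Finset.sum_add_distrib]

@[simp] theorem superSumHom_apply {U : Set (Weight m n ≃ₗ[ℚ] Weight m n)}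
    (hU : U.Finite) (Y : RatFun m n) : superSumHom t hU Y = superSum t U Y := rfl

theorem sgnPrime_mul_self_cast (w : Weight m n ≃ₗ[ℚ] Weight m n) :
    (sgnPrime t w : RatFun m n) * sgnPrime t w = 1 := by
  rw [← Int.cast_mul, sgnPrime_mul_self, Int.cast_one]

theorem superSum_mul_left {U : Set (Weight m n ≃ₗ[ℚ] Weight m n)} (hU : U.Finite)
    {c : RatFun m n} (hc : ∀ w ∈ U, act w c = c) (Y : RatFun m n) :
    superSum t U (c * Y) = c * superSum t U Y := by
  rw [superSum_eq_sum hU, superSum_eq_sum hU, Finset.mul_sum]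
  refine Finset.sum_congr rfl fun w hw => ?_
  rw [map_mul, hc w (hU.mem_toFinset.1 hw)]
  ring

theorem superSum_act (X : OrderedBasis t m n) {K : Subgroup (Weight m n ≃ₗ[ℚ] Weight m n)}
    (hK : K ≤ weylGroup t m n) {k : Weight m n ≃ₗ[ℚ] Weight m n} (hk : k ∈ K) (Y : RatFun m n) :
    superSum t (K : Set _) (act k Y) = (sgnPrime t k : RatFun m n) * superSum t (K : Set _) Y := by
  have hU : (K : Set (Weight m n ≃ₗ[ℚ] Weight m n)).Finite := finite_of_subset_weylGroup hK
  rw [superSum_eq_sum hU, superSum_eq_sum hU, Finset.mul_sum]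
  refine Finset.sum_equiv (Equiv.mulRight k) (fun w => ?_) (fun w hw => ?_)
  · simp [Subgroup.mul_mem_cancel_right K hk]
  · have hw' : w ∈ K := by simpa using hw
    simp only [Equiv.coe_mulRight, X.sgnPrime_mul (hK hw') (hK hk), act_mul, Int.cast_mul]
    linear_combination (-(sgnPrime t w : RatFun m n) * act w (act k Y)) *
      sgnPrime_mul_self_cast (t := t) k

theorem act_superSum (X : OrderedBasis t m n) {K : Subgroup (Weight m n ≃ₗ[ℚ] Weight m n)}
    (hK : K ≤ weylGroup t m n) {k : Weight m n ≃ₗ[ℚ] Weight m n} (hk : k ∈ K) (Y : RatFun m n) :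
    act k (superSum t (K : Set _) Y) = (sgnPrime t k : RatFun m n) * superSum t (K : Set _) Y := by
  have hU : (K : Set (Weight m n ≃ₗ[ℚ] Weight m n)).Finite := finite_of_subset_weylGroup hK
  rw [superSum_eq_sum hU, map_sum, Finset.mul_sum]
  refine Finset.sum_equiv (Equiv.mulLeft k) (fun w => ?_) (fun w hw => ?_)
  · simp [Subgroup.mul_mem_cancel_left K hk]
  · have hw' : w ∈ K := by simpa using hw
    simp only [Equiv.coe_mulLeft, X.sgnPrime_mul (hK hk) (hK hw'), act_mul, Int.cast_mul, map_mul,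
      map_intCast]
    linear_combination (-(sgnPrime t w : RatFun m n) * act k (act w Y)) *
      sgnPrime_mul_self_cast (t := t) k

/-- Passing from a sum over representatives to a sum over the whole Weyl group. -/
theorem ncard_mul_superSum (X : OrderedBasis t m n)
    {K H : Subgroup (Weight m n ≃ₗ[ℚ] Weight m n)} (hK : K ≤ weylGroup t m n) (hHK : H ≤ K)
    {Z T : Set (Weight m n ≃ₗ[ℚ] Weight m n)} (hT : IsRightReps (H : Set _) K T)
    (hZ : IsLeftReps (weylGroup t m n) K Z) {Y : RatFun m n}
    (hY : ∀ w ∈ K, act w (superSum t (H : Set _) Y) =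
      (sgnPrime t w : RatFun m n) * superSum t (H : Set _) Y) :
    ((T.ncard : ℕ) : RatFun m n) * superSum t (Z * (H : Set _)) Y =
      superSum t (weylGroup t m n : Set _) Y := by
  classical
  have fW := weylGroup_finite t m n
  have fK : (K : Set (Weight m n ≃ₗ[ℚ] Weight m n)).Finite := finite_of_subset_weylGroup hK
  have fH : (H : Set (Weight m n ≃ₗ[ℚ] Weight m n)).Finite := fK.subset hHK
  have fZ : Z.Finite := fW.subset hZ.1
  have fT : T.Finite := fK.subset hT.1
  have fZH : (Z * (H : Set (Weight m n ≃ₗ[ℚ] Weight m n))).Finite := fZ.mul fH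
  have hsum : ∀ (A : Subgroup (Weight m n ≃ₗ[ℚ] Weight m n))
      (fA : (A : Set (Weight m n ≃ₗ[ℚ] Weight m n)).Finite), A ≤ K → ∀ z ∈ Z,
      ∑ h ∈ fA.toFinset, (sgnPrime t (z * h) : RatFun m n) * act (z * h) Y =
        (sgnPrime t z : RatFun m n) * act z (superSum t (A : Set _) Y) := by
    intro A fA hA z hz
    rw [superSum_eq_sum fA, map_sum, Finset.mul_sum]
    refine Finset.sum_congr rfl fun h hh => ?_
    have hh' : h ∈ A := fA.mem_toFinset.1 hh
    rw [X.sgnPrime_mul (hZ.1 hz) (hK (hA hh')), act_mul, map_mul, map_intCast, Int.cast_mul]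
    ring
  have huniq : ∀ z ∈ Z, ∀ h ∈ K, ∀ z' ∈ Z, ∀ h' ∈ K, z * h = z' * h' → z = z' := by
    intro z hz h hh z' hz' h' hh' heq
    obtain ⟨y, _, hy⟩ := hZ.2 (z * h) (mul_mem (hZ.1 hz) (hK hh))
    rw [hy z ⟨hz, by simpa using hh⟩, hy z' ⟨hz', by rw [heq]; simpa using hh'⟩]
  have e1 : superSum t (Z * (H : Set _)) Y =
      ∑ z ∈ fZ.toFinset, (sgnPrime t z : RatFun m n) * act z (superSum t (H : Set _) Y) := by
    rw [superSum_eq_sum fZH, sum_of_forall_mem_iff fZ.toFinset fH.toFinset]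
    · exact Finset.sum_congr rfl fun z hz => hsum H fH hHK z (fZ.mem_toFinset.1 hz)
    · intro u
      simp [Set.mem_mul]
    · intro z hz h hh z' hz' h' hh'
      simp only [Set.Finite.mem_toFinset, SetLike.mem_coe] at hz hh hz' hh'
      exact huniq z hz h (hHK hh) z' hz' h' (hHK hh')
  have e2 : superSum t (weylGroup t m n : Set _) Y =
      ∑ z ∈ fZ.toFinset, (sgnPrime t z : RatFun m n) * act z (superSum t (K : Set _) Y) := by
    rw [superSum_eq_sum fW, sum_of_forall_mem_iff fZ.toFinset fK.toFinset]
    · exact Finset.sum_congr rfl fun z hz => hsum K fK le_rfl z (fZ.mem_toFinset.1 hz)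
    · intro u
      simp only [Set.Finite.mem_toFinset, SetLike.mem_coe]
      constructor
      · intro hu
        obtain ⟨z, ⟨hz, hzu⟩, _⟩ := hZ.2 u hu
        exact ⟨z, hz, z⁻¹ * u, hzu, by simp⟩
      · rintro ⟨z, hz, h, hh, rfl⟩
        exact mul_mem (hZ.1 hz) (hK hh)
    · intro z hz h hh z' hz' h' hh'
      simp only [Set.Finite.mem_toFinset, SetLike.mem_coe] at hz hh hz' hh'
      exact huniq z hz h hh z' hz' h' hh'
  have e3 : superSum t (K : Set _) Y = (T.ncard : RatFun m n) * superSum t (H : Set _) Y := by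
    rw [superSum_eq_sum fK, sum_of_forall_mem_iff (fT.toFinset.image (·⁻¹)) fH.toFinset]
    · rw [Finset.sum_image (fun a _ b _ h => inv_injective h), Set.ncard_eq_toFinset_card T fT,
        ← nsmul_eq_mul, ← Finset.sum_const]
      refine Finset.sum_congr rfl fun τ hτ => ?_
      have hτ' : τ⁻¹ ∈ K := inv_mem (hT.1 (fT.mem_toFinset.1 hτ))
      have : ∑ h ∈ fH.toFinset, (sgnPrime t (τ⁻¹ * h) : RatFun m n) * act (τ⁻¹ * h) Y =
          (sgnPrime t τ⁻¹ : RatFun m n) * act τ⁻¹ (superSum t (H : Set _) Y) := by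
        rw [superSum_eq_sum fH, map_sum, Finset.mul_sum]
        refine Finset.sum_congr rfl fun h hh => ?_
        have hh' : h ∈ H := fH.mem_toFinset.1 hh
        rw [X.sgnPrime_mul (hK hτ') (hK (hHK hh')), act_mul, map_mul, map_intCast, Int.cast_mul]
        ring
      rw [this, hY _ hτ']
      linear_combination (superSum t (H : Set _) Y) * sgnPrime_mul_self_cast (t := t) τ⁻¹
    · intro u
      simp only [Set.Finite.mem_toFinset, SetLike.mem_coe, Finset.mem_image]
      constructor
      · intro hu
        obtain ⟨τ, ⟨hτ, hτu⟩, _⟩ := hT.2 u⁻¹ (inv_mem hu)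
        refine ⟨τ⁻¹, ⟨τ, hτ, rfl⟩, τ * u, ?_, by simp⟩
        have := inv_mem (S := Subgroup (Weight m n ≃ₗ[ℚ] Weight m n)) hτu
        simpa using this
      · rintro ⟨_, ⟨τ, hτ, rfl⟩, h, hh, rfl⟩
        exact mul_mem (inv_mem (hT.1 hτ)) (hHK hh)
    · intro a ha h hh b hb h' hh' heq
      simp only [Set.Finite.mem_toFinset, SetLike.mem_coe, Finset.mem_image] at ha hh hb hh'
      obtain ⟨τ, hτ, rfl⟩ := ha
      obtain ⟨τ', hτ', rfl⟩ := hb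
      obtain ⟨y, _, hy⟩ := hT.2 (τ⁻¹ * h)⁻¹ (inv_mem (mul_mem (inv_mem (hT.1 hτ)) (hHK hh)))
      have h1 := hy τ ⟨hτ, by simpa using hh⟩
      have h2 := hy τ' ⟨hτ', by rw [heq]; simpa using hh'⟩
      rw [h1, h2]
  rw [e1, e2, e3, Finset.mul_sum]
  refine Finset.sum_congr rfl fun z _ => ?_
  rw [map_mul, map_natCast]
  ring

end SuperDenominator

namespace SuperDenominator

namespace OrderedBasis

variable {t : SuperType} {m n : ℕ} (X : OrderedBasis t m n)

theorem card_inE (c : Bool) :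
    (Finset.univ.filter fun i => X.inE i = c).card = if c = true then m else n := by
  have h : (Finset.univ.filter fun i => X.inE i = c).card =
      (Finset.univ.filter fun a : Fin m ⊕ Fin n => a.isLeft = c).card := by
    refine Finset.card_equiv X.idx fun i => ?_
    rw [Finset.mem_filter, Finset.mem_filter]
    exact ⟨fun h => ⟨Finset.mem_univ _, h.2⟩, fun h => ⟨Finset.mem_univ _, h.2⟩⟩
  rw [h]
  have h2 : ∀ s : Finset (Fin m ⊕ Fin n), s.card = s.toLeft.card + s.toRight.card := fun s =>
    (Finset.card_toLeft_add_card_toRight (u := s)).symm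
  rw [h2]
  have e1 : (Finset.univ.filter fun a : Fin m ⊕ Fin n => a.isLeft = c).toLeft =
      if c = true then Finset.univ else ∅ := by
    ext i; cases c <;> simp
  have e2 : (Finset.univ.filter fun a : Fin m ⊕ Fin n => a.isLeft = c).toRight =
      if c = true then ∅ else Finset.univ := by
    ext i; cases c <;> simp
  rw [e1, e2]
  cases c <;> simp

theorem bool_eq_not_of_ne {a b : Bool} (h : a ≠ b) : b = !a := by
  cases a <;> cases b <;> simp at h ⊢

theorem sn_vertex (i : Fin (m + n)) : X.sn (X.vertex i) = if X.inE i = true then 1 else 0 := by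
  rw [sn, form_vertex_left, map_sum]
  simp only [coord_vertex, eta]
  rw [Finset.sum_ite_eq']
  by_cases h : X.inE i = true <;> simp [h]

theorem sn_sub (v w : Weight m n) : X.sn (v - w) = X.sn v - X.sn w := form_sub_left _ _ _

/-- The height of `ξ_i - ξ_j`. -/
theorem ht_vertex_sub {i j : Fin (m + n)} (hij : i < j) :
    X.ht (X.vertex i - X.vertex j) = j.val - i.val := by
  have hN : 0 < m + n := i.pos
  let L : Fin (m + n) := ⟨m + n - 1, by omega⟩
  obtain ⟨c, hc⟩ : ∃ c : ℚ, ∀ α ∈ X.simpleRoots,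
      X.functional (fun k => c - k.val) α = 1 := by
    refine ⟨(m + n : ℕ) - 1 + (if t = SuperType.B then 1 else
      if X.inE L = true then 0 else 1 / 2), ?_⟩
    intro α hα
    have hLi : ∀ k : Fin (m + n), k.val + 1 = m + n → k = L := fun k hk => Fin.ext (by
      simp [L]; omega)
    have hcast : ∀ k : Fin (m + n), k.val + 1 = m + n → (k.val : ℚ) = (m + n : ℕ) - 1 :=
      fun k hk => by
        have : ((k.val + 1 : ℕ) : ℚ) = (m + n : ℕ) := congrArg _ hk
        push_cast at this ⊢; linarith
    rcases X.simpleRoots_cases hα with ⟨i, j, hij, rfl⟩ | ⟨i, rfl, hi, rfl⟩ |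
      ⟨i, rfl, hi, hE, rfl⟩ | ⟨i, j, rfl, hi, hj, hE, rfl⟩
    · have : (j.val : ℚ) = i.val + 1 := by rw [← hij]; push_cast; ring
      rw [map_sub, functional_vertex, functional_vertex, this]; ring
    · rw [functional_vertex, if_pos rfl, hcast i hi]; ring
    · rw [map_smul, functional_vertex, if_neg (by simp), ← hLi i hi, hE, hcast i hi,
        if_neg (by simp), smul_eq_mul]; ring
    · have : (j.val : ℚ) = i.val + 1 := by rw [← hi]; push_cast; ring
      rw [map_add, functional_vertex, functional_vertex, if_neg (by simp), ← hLi j hj, hE,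
        if_pos rfl]
      have := hcast j hj
      linarith
  have hlow : ∀ s : Multiset (Weight m n), (∀ α ∈ s, α ∈ X.simpleRoots) →
      X.functional (fun k => c - k.val) s.sum = s.card := by
    intro s
    induction s using Multiset.induction_on with
    | empty => simp
    | cons a s ih =>
      intro h
      rw [Multiset.sum_cons, map_add, hc a (h a (Multiset.mem_cons_self a s)),
        ih (fun α hα => h α (Multiset.mem_cons_of_mem hα)), Multiset.card_cons]
      push_cast; ring
  have hex : ∃ s : Multiset (Weight m n), (∀ α ∈ s, α ∈ X.simpleRoots) ∧
      s.sum = X.vertex i - X.vertex j :=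
    AddSubmonoid.exists_multiset_of_mem_closure (X.vertex_sub_mem_closure_of_lt hij)
  have hval : ∀ s : Multiset (Weight m n), (∀ α ∈ s, α ∈ X.simpleRoots) →
      s.sum = X.vertex i - X.vertex j → s.card = j.val - i.val := by
    intro s hs hsum
    have := hlow s hs
    rw [hsum, map_sub, functional_vertex, functional_vertex] at this
    have h2 : ((s.card + i.val : ℕ) : ℚ) = (j.val : ℕ) := by push_cast; linarith
    have h3 : s.card + i.val = j.val := by exact_mod_cast h2
    omega
  have hset : {k | ∃ s : Multiset (Weight m n), (∀ α ∈ s, α ∈ X.simpleRoots) ∧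
      s.sum = X.vertex i - X.vertex j ∧ s.card = k} = {j.val - i.val} := by
    ext k
    simp only [Set.mem_ofPred_eq, Set.mem_singleton_iff]
    constructor
    · rintro ⟨s, hs, hsum, rfl⟩
      exact hval s hs hsum
    · rintro rfl
      obtain ⟨s, hs, hsum⟩ := hex
      exact ⟨s, hs, hsum, hval s hs hsum⟩
  rw [ht, hset, csInf_singleton]

theorem closure_pos_le : AddSubmonoid.closure
    ((X.posEven ∪ X.posOdd : Finset (Weight m n)) : Set (Weight m n)) ≤
      AddSubmonoid.closure (X.simpleRoots : Set (Weight m n)) := by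
  classical
  rw [AddSubmonoid.closure_le]
  intro α hα
  rw [Finset.mem_coe, Finset.mem_union, posEven, posOdd, Finset.mem_filter,
    Finset.mem_filter] at hα
  rcases hα with h | h <;> exact h.2

theorem sub_mem_closure_pos {i j : Fin (m + n)} (hij : i ≤ j) :
    X.vertex i - X.vertex j ∈ AddSubmonoid.closure
      ((X.posEven ∪ X.posOdd : Finset (Weight m n)) : Set (Weight m n)) := by
  rcases hij.eq_or_lt with rfl | h
  · simp
  · apply AddSubmonoid.subset_closure
    rw [Finset.mem_coe, Finset.mem_union]
    by_cases hE : X.inE i = X.inE j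
    · exact Or.inl (X.mem_posEven.2 (Or.inl ⟨i, j, h, by simp [hE], Or.inl rfl⟩))
    · exact Or.inr (X.mem_posOdd.2 (Or.inl ⟨i, j, h, by simp [hE], Or.inl rfl⟩))

theorem le_iff {i j k l : Fin (m + n)} (hij : i < j) (hkl : k < l) :
    X.le (X.vertex i - X.vertex j) (X.vertex k - X.vertex l) ↔ k ≤ i ∧ j ≤ l := by
  constructor
  · intro h
    have h' := X.closure_pos_le h
    have key : ∀ p : Fin (m + n), (if i ≤ p ∧ p < j then 1 else 0 : ℚ) ≤
        if k ≤ p ∧ p < l then 1 else 0 := by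
      intro p
      have := X.functional_nonneg_of_mem_closure (f := fun q => if q ≤ p then 1 else 0)
        (by intro a b hab; dsimp only
            split_ifs with h1 h2 h2
            · exact le_rfl
            · exact absurd (hab.trans h1) h2
            · exact zero_le_one
            · exact le_rfl)
        (fun _ a => by split_ifs <;> norm_num) h'
      simp only [map_sub, functional_vertex] at this
      have e1 : (if i ≤ p ∧ p < j then 1 else 0 : ℚ) =
          (if i ≤ p then 1 else 0) - if j ≤ p then 1 else 0 := by
        by_cases a : i ≤ p <;> by_cases b : j ≤ p
        · simp [a, b]
        · simp [a, b, not_le.1 b]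
        · exact absurd (hij.le.trans b) a
        · simp [a, b]
      have e2 : (if k ≤ p ∧ p < l then 1 else 0 : ℚ) =
          (if k ≤ p then 1 else 0) - if l ≤ p then 1 else 0 := by
        by_cases a : k ≤ p <;> by_cases b : l ≤ p
        · simp [a, b]
        · simp [a, b, not_le.1 b]
        · exact absurd (hkl.le.trans b) a
        · simp [a, b]
      rw [e1, e2]; linarith
    constructor
    · have := key i
      rw [if_pos ⟨le_rfl, hij⟩] at this
      by_contra hne
      rw [if_neg (fun h => hne h.1)] at this
      norm_num at this
    · have hj0 : 0 < j.val := by have : i.val < j.val := hij; omega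
      have hjl := key ⟨j.val - 1, by omega⟩
      have hij' : i.val < j.val := hij
      rw [if_pos ⟨by rw [Fin.le_def]; simp; omega, by rw [Fin.lt_def]; simp; omega⟩] at hjl
      by_contra hne
      rw [if_neg (fun h => hne (by have := h.2; rw [Fin.lt_def] at this; rw [Fin.le_def]; simp at this; omega))] at hjl
      norm_num at hjl
  · rintro ⟨h1, h2⟩
    have := add_mem (X.sub_mem_closure_pos h1) (X.sub_mem_closure_pos h2)
    rw [le]
    convert this using 1
    abel

end OrderedBasis

namespace ArcDiagram

variable {t : SuperType} {m n : ℕ} (X : ArcDiagram t m n)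

theorem mem_supp {i : Fin (m + n)} : i ∈ X.supp ↔ ∃ a ∈ X.arcs, i = a.1 ∨ i = a.2 := by
  simp only [supp, Finset.mem_union, Finset.mem_image]
  constructor
  · rintro (⟨a, ha, rfl⟩ | ⟨a, ha, rfl⟩)
    · exact ⟨a, ha, Or.inl rfl⟩
    · exact ⟨a, ha, Or.inr rfl⟩
  · rintro ⟨a, ha, rfl | rfl⟩
    · exact Or.inl ⟨a, ha, rfl⟩
    · exact Or.inr ⟨a, ha, rfl⟩

/-- The end of an arc of the given type. -/
def endOf (c : Bool) (a : Fin (m + n) × Fin (m + n)) : Fin (m + n) :=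
  if X.inE a.1 = c then a.1 else a.2

theorem endOf_eq (c : Bool) (a : Fin (m + n) × Fin (m + n)) :
    X.endOf c a = a.1 ∨ X.endOf c a = a.2 := by
  unfold endOf; split_ifs <;> simp

theorem inE_endOf (c : Bool) {a : Fin (m + n) × Fin (m + n)} (ha : a ∈ X.arcs) :
    X.inE (X.endOf c a) = c := by
  have := X.diffType a ha
  unfold endOf
  split_ifs with h
  · exact h
  · cases h1 : X.inE a.1 <;> cases h2 : X.inE a.2 <;> cases c <;> simp_all

theorem endOf_injOn (c : Bool) : Set.InjOn (X.endOf c) X.arcs := by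
  intro a ha b hb h
  by_contra hne
  obtain ⟨h1, h2, h3, h4⟩ := X.disjoint a ha b hb hne
  rcases X.endOf_eq c a with h5 | h5 <;> rcases X.endOf_eq c b with h6 | h6 <;>
    rw [h5, h6] at h <;> contradiction

theorem eq_of_mem_ends {a b : Fin (m + n) × Fin (m + n)} (ha : a ∈ X.arcs) (hb : b ∈ X.arcs)
    {i : Fin (m + n)} (hi : i = a.1 ∨ i = a.2) (hi' : i = b.1 ∨ i = b.2) : a = b := by
  by_contra hne
  obtain ⟨h1, h2, h3, h4⟩ := X.disjoint a ha b hb hne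
  rcases hi with rfl | rfl <;> rcases hi' with h | h <;> contradiction

theorem endOf_mem_supp (c : Bool) {a : Fin (m + n) × Fin (m + n)} (ha : a ∈ X.arcs) :
    X.endOf c a ∈ X.supp := X.mem_supp.2 ⟨a, ha, X.endOf_eq c a⟩

theorem exists_endOf {i : Fin (m + n)} (hi : i ∈ X.supp) :
    ∃ a ∈ X.arcs, X.endOf (X.inE i) a = i := by
  obtain ⟨a, ha, h⟩ := X.mem_supp.1 hi
  refine ⟨a, ha, ?_⟩
  have := X.diffType a ha
  unfold endOf
  rcases h with rfl | rfl
  · rw [if_pos rfl]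
  · rw [if_neg this]

theorem mem_supp_of_inE {c : Bool} (hc : (if c = true then m else n) ≤ min m n)
    {i : Fin (m + n)} (hi : X.inE i = c) : i ∈ X.supp := by
  have hsub : X.arcs.image (X.endOf c) ⊆ Finset.univ.filter fun i => X.inE i = c := by
    intro j hj
    obtain ⟨a, ha, rfl⟩ := Finset.mem_image.1 hj
    simp [X.inE_endOf c ha]
  have heq := Finset.eq_of_subset_of_card_le hsub (by
    rw [X.card_inE, Finset.card_image_of_injOn (X.endOf_injOn c), X.card_arcs]; exact hc)
  have : i ∈ X.arcs.image (X.endOf c) := by rw [heq]; simp [hi]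
  obtain ⟨a, ha, rfl⟩ := Finset.mem_image.1 this
  exact X.endOf_mem_supp c ha

/-- The type all of whose vertices are ends of arcs. -/
theorem exists_minor : ∃ c : Bool, ∀ i, X.inE i = c → i ∈ X.supp := by
  rcases le_total m n with h | h
  · exact ⟨true, fun i => X.mem_supp_of_inE (by simp [h])⟩
  · exact ⟨false, fun i => X.mem_supp_of_inE (by simp [h])⟩

/-- The arcs inside a set of vertices. -/
def arcsIn (S : Finset (Fin (m + n))) : Finset (Fin (m + n) × Fin (m + n)) :=
  X.arcs.filter fun a => a.1 ∈ S ∧ a.2 ∈ S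

/-- A set of vertices that contains both ends or no end of every arc. -/
def ArcClosed (S : Finset (Fin (m + n))) : Prop := ∀ a ∈ X.arcs, (a.1 ∈ S ↔ a.2 ∈ S)

theorem mem_arcsIn {S : Finset (Fin (m + n))} {a : Fin (m + n) × Fin (m + n)} :
    a ∈ X.arcsIn S ↔ a ∈ X.arcs ∧ a.1 ∈ S ∧ a.2 ∈ S := Finset.mem_filter

theorem prod_eq_prod_arcsIn {M : Type*} [CommMonoid M] {S : Finset (Fin (m + n))}
    (hS : X.ArcClosed S) (f : Fin (m + n) → M) :
    ∏ i ∈ S, f i = (∏ a ∈ X.arcsIn S, f a.1 * f a.2) * ∏ i ∈ S \ X.supp, f i := by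
  have h1 : S ∩ X.supp = (X.arcsIn S).biUnion fun a => {a.1, a.2} := by
    ext i
    simp only [Finset.mem_inter, mem_supp, Finset.mem_biUnion, Finset.mem_insert,
      Finset.mem_singleton, mem_arcsIn]
    constructor
    · rintro ⟨hi, a, ha, h⟩
      refine ⟨a, ⟨ha, ?_⟩, h⟩
      have := hS a ha
      rcases h with rfl | rfl <;> tauto
    · rintro ⟨a, ⟨ha, h1, h2⟩, h⟩
      refine ⟨?_, a, ha, h⟩
      rcases h with rfl | rfl <;> assumption
  rw [← Finset.prod_inter_mul_prod_sdiff S X.supp, h1, Finset.prod_biUnion]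
  · congr 1
    refine Finset.prod_congr rfl fun a ha => ?_
    rw [Finset.prod_pair (X.lt_of_mem a (X.mem_arcsIn.1 ha).1).ne]
  · intro a ha b hb hab
    obtain ⟨h1, h2, h3, h4⟩ := X.disjoint a (X.mem_arcsIn.1 ha).1 b (X.mem_arcsIn.1 hb).1 hab
    simp only [Function.onFun, Finset.disjoint_left, Finset.mem_insert, Finset.mem_singleton]
    rintro i (rfl | rfl) <;> tauto

theorem card_eq_card_arcsIn {S : Finset (Fin (m + n))} (hS : X.ArcClosed S) (hsupp : S ⊆ X.supp) :
    S.card = 2 * (X.arcsIn S).card := by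
  have := congrArg Multiplicative.toAdd
    (X.prod_eq_prod_arcsIn hS (fun _ => Multiplicative.ofAdd (1 : ℕ)))
  rw [Finset.sdiff_eq_empty_iff_subset.2 hsupp] at this
  simp only [Finset.prod_const, Finset.card_empty, pow_zero, mul_one, toAdd_pow, toAdd_mul,
    toAdd_ofAdd, smul_eq_mul] at this
  omega

theorem image_endOf_arcsIn {S : Finset (Fin (m + n))} (c : Bool) :
    (X.arcsIn S).image (X.endOf c) ⊆ S.filter fun i => X.inE i = c := by
  intro j hj
  obtain ⟨a, ha, rfl⟩ := Finset.mem_image.1 hj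
  obtain ⟨ha, h1, h2⟩ := X.mem_arcsIn.1 ha
  rw [Finset.mem_filter]
  refine ⟨?_, X.inE_endOf c ha⟩
  rcases X.endOf_eq c a with h | h <;> rwa [h]

theorem arcClosed_Icc {a : Fin (m + n) × Fin (m + n)} (ha : a ∈ X.arcs) :
    X.ArcClosed (Finset.Icc a.1 a.2) := by
  intro b hb
  by_cases hab : a = b
  · subst hab
    have := (X.lt_of_mem a ha).le
    simp [this]
  · obtain ⟨h1, h2, h3, h4⟩ := X.disjoint a ha b hb hab
    have hlt := X.lt_of_mem b hb
    have c1 := X.noCrossing a ha b hb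
    have c2 := X.noCrossing b hb a ha
    simp only [Finset.mem_Icc]
    constructor
    · rintro ⟨h5, h6⟩
      refine ⟨h5.trans hlt.le, ?_⟩
      by_contra h7
      exact c1 ⟨lt_of_le_of_ne h5 h1, lt_of_le_of_ne h6 (Ne.symm h3), not_le.1 h7⟩
    · rintro ⟨h5, h6⟩
      refine ⟨?_, hlt.le.trans h6⟩
      by_contra h7
      exact c2 ⟨not_le.1 h7, lt_of_le_of_ne h5 h2, lt_of_le_of_ne h6 (Ne.symm h4)⟩

/-- All the vertices below an arc are ends of arcs. -/
theorem Icc_subset_supp {a : Fin (m + n) × Fin (m + n)} (ha : a ∈ X.arcs) :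
    Finset.Icc a.1 a.2 ⊆ X.supp := by
  obtain ⟨c, hc⟩ := X.exists_minor
  have hS := X.arcClosed_Icc ha
  set S := Finset.Icc a.1 a.2 with hSdef
  have h1 : S.filter (fun i => X.inE i = c) ⊆ (X.arcsIn S).image (X.endOf c) := by
    intro i hi
    rw [Finset.mem_filter] at hi
    obtain ⟨b, hb, hbi⟩ := X.exists_endOf (hc i hi.2)
    rw [hi.2] at hbi
    refine Finset.mem_image.2 ⟨b, X.mem_arcsIn.2 ⟨hb, ?_⟩, hbi⟩
    have := hS b hb
    rcases X.endOf_eq c b with h | h <;> rw [h] at hbi <;> rw [hbi] at this ⊢ <;> tauto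
  have hbal : (S.filter fun i => X.inE i = c).card = (S.filter fun i => X.inE i = !c).card := by
    have := X.balanced a ha
    cases c
    · exact this.symm
    · exact this
  have h2 : S.filter (fun i => X.inE i = !c) = (X.arcsIn S).image (X.endOf !c) := by
    symm
    apply Finset.eq_of_subset_of_card_le (X.image_endOf_arcsIn _)
    have hsub : ((X.arcsIn S) : Set (Fin (m + n) × Fin (m + n))) ⊆ X.arcs := fun b hb =>
      (X.mem_arcsIn.1 hb).1
    rw [← hbal, Finset.card_image_of_injOn ((X.endOf_injOn _).mono hsub),
      ← Finset.card_image_of_injOn ((X.endOf_injOn c).mono hsub)]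
    exact Finset.card_le_card h1
  intro i hi
  by_cases hic : X.inE i = c
  · exact hc i hic
  · have : i ∈ S.filter (fun i => X.inE i = !c) := by
      rw [Finset.mem_filter]
      exact ⟨hi, OrderedBasis.bool_eq_not_of_ne (Ne.symm hic)⟩
    rw [h2] at this
    obtain ⟨b, hb, rfl⟩ := Finset.mem_image.1 this
    exact X.endOf_mem_supp _ (X.mem_arcsIn.1 hb).1

/-- The number of arcs weakly below an arc. -/
def hook (a : Fin (m + n) × Fin (m + n)) : ℕ := (X.arcsIn (Finset.Icc a.1 a.2)).card

/-- The sum of `(ξ, ξ) ξ` over the vertices `ξ` below an arc. -/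
def below (a : Fin (m + n) × Fin (m + n)) : Weight m n :=
  ∑ i ∈ Finset.Icc a.1 a.2, X.eta i • X.vertex i

theorem eta_snd {a : Fin (m + n) × Fin (m + n)} (ha : a ∈ X.arcs) :
    X.eta a.2 = -X.eta a.1 := by
  have := X.diffType a ha
  unfold OrderedBasis.eta
  cases h1 : X.inE a.1 <;> cases h2 : X.inE a.2 <;> simp_all

theorem sn_arc {a : Fin (m + n) × Fin (m + n)} (ha : a ∈ X.arcs) :
    X.sn (X.vertex a.1 - X.vertex a.2) = X.eta a.1 := by
  have := X.diffType a ha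
  rw [OrderedBasis.sn_sub, OrderedBasis.sn_vertex, OrderedBasis.sn_vertex]
  unfold OrderedBasis.eta
  cases h1 : X.inE a.1 <;> cases h2 : X.inE a.2 <;> simp_all

theorem vertex_sub_injOn : Set.InjOn (fun a : Fin (m + n) × Fin (m + n) =>
    X.vertex a.1 - X.vertex a.2) X.arcs := by
  intro a ha b hb h
  have h1 := congrArg (X.coord a.1) h
  have hlt := (X.lt_of_mem a ha).ne'
  simp only [map_sub, OrderedBasis.coord_vertex, if_true, if_neg hlt] at h1
  have e1 : b.1 = a.1 := by
    by_contra hne; rw [if_neg hne] at h1; split_ifs at h1 <;> norm_num at h1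
  exact X.eq_of_mem_ends ha hb (Or.inl rfl) (Or.inl e1.symm)

theorem bracket_arc {a : Fin (m + n) × Fin (m + n)} (ha : a ∈ X.arcs) :
    X.bracket (X.vertex a.1 - X.vertex a.2) = X.eta a.1 • X.below a := by
  classical
  rw [bracket, isoSet, Finset.filter_image, Finset.sum_image
    (X.vertex_sub_injOn.mono (by intro b hb; exact (Finset.mem_filter.1 hb).1))]
  have hfil : (X.arcs.filter fun b => X.le (X.vertex b.1 - X.vertex b.2)
      (X.vertex a.1 - X.vertex a.2)) = X.arcsIn (Finset.Icc a.1 a.2) := by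
    ext b
    simp only [Finset.mem_filter, mem_arcsIn, Finset.mem_Icc]
    refine and_congr_right fun hb => ?_
    have hlt := X.lt_of_mem b hb
    rw [X.le_iff hlt (X.lt_of_mem a ha)]
    constructor
    · rintro ⟨h1, h2⟩
      exact ⟨⟨h1, hlt.le.trans h2⟩, h1.trans hlt.le, h2⟩
    · rintro ⟨⟨h1, _⟩, _, h2⟩
      exact ⟨h1, h2⟩
  have hsum : X.below a = ∑ b ∈ X.arcsIn (Finset.Icc a.1 a.2),
      (X.eta b.1 • X.vertex b.1 + X.eta b.2 • X.vertex b.2) := by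
    have := congrArg Multiplicative.toAdd (X.prod_eq_prod_arcsIn (X.arcClosed_Icc ha)
      (fun i => Multiplicative.ofAdd (X.eta i • X.vertex i)))
    rw [Finset.sdiff_eq_empty_iff_subset.2 (X.Icc_subset_supp ha)] at this
    simpa [below] using this
  rw [hsum, Finset.smul_sum, hfil]
  refine Finset.sum_congr rfl fun b hb => ?_
  have hb' := (X.mem_arcsIn.1 hb).1
  rw [X.sn_arc ha, X.sn_arc hb', X.eta_snd hb']
  module

theorem ht_arc {a : Fin (m + n) × Fin (m + n)} (ha : a ∈ X.arcs) :
    X.ht (X.vertex a.1 - X.vertex a.2) + 1 = 2 * X.hook a := by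
  rw [X.ht_vertex_sub (X.lt_of_mem a ha), hook,
    ← X.card_eq_card_arcsIn (X.arcClosed_Icc ha) (X.Icc_subset_supp ha), Fin.card_Icc]
  have : a.1.val < a.2.val := X.lt_of_mem a ha
  omega

theorem P_eq : X.P = (∏ a ∈ X.arcs, ((X.hook a : RatFun m n) /
    (1 - expo (-(X.eta a.1 • X.below a))))) * ∏ i, X.e i (X.coord i X.rho) := by
  rw [P, isoSet, Finset.prod_image X.vertex_sub_injOn, Finset.prod_image X.vertex_sub_injOn,
    X.expo_eq_prod X.rho]
  have h1 : ∏ a ∈ X.arcs, ((X.ht (X.vertex a.1 - X.vertex a.2) : RatFun m n) + 1) / 2 =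
      ∏ a ∈ X.arcs, (X.hook a : RatFun m n) := by
    refine Finset.prod_congr rfl fun a ha => ?_
    rw [← Nat.cast_one, ← Nat.cast_add, X.ht_arc ha]
    push_cast
    rw [mul_div_cancel_left₀]
    exact two_ne_zero
  have h2 : ∏ a ∈ X.arcs, (1 - expo (-X.bracket (X.vertex a.1 - X.vertex a.2))) =
      ∏ a ∈ X.arcs, (1 - expo (-(X.eta a.1 • X.below a))) := by
    refine Finset.prod_congr rfl fun a ha => ?_
    rw [X.bracket_arc ha]
  rw [h1, h2, Finset.prod_div_distrib]
  ring

end ArcDiagram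

end SuperDenominator

namespace SuperDenominator

/-! ### Additive maps that are alternating up to symmetrization -/

theorem card_nsmul_eq_of_alternating {ι F : Type*} [DecidableEq ι] [Field F] (L : F →+ F)
    (A : Finset ι) (γ : ι) (z : ι → F) (hz : ∀ i ∈ A, 1 - z i ≠ 0)
    (hZ : 1 - ∏ i ∈ A, z i ≠ 0) (J : F)
    (h1 : ∀ β ∈ A, L ((∏ i ∈ A.erase β, (1 - z i)⁻¹) * ((1 - ∏ i ∈ A, z i)⁻¹ * J)) =
      L ((∏ i ∈ A.erase γ, (1 - z i)⁻¹) * ((1 - ∏ i ∈ A, z i)⁻¹ * J)))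
    (h2 : ∀ S ⊆ A, 2 ≤ S.card →
      L ((∏ i ∈ A \ S, (1 - z i)⁻¹) * ((1 - ∏ i ∈ A, z i)⁻¹ * J)) = 0) :
    A.card • L ((∏ i ∈ A.erase γ, (1 - z i)⁻¹) * ((1 - ∏ i ∈ A, z i)⁻¹ * J)) =
      L ((∏ i ∈ A, (1 - z i)⁻¹) * J) := by
  set K := (1 - ∏ i ∈ A, z i)⁻¹ * J with hK
  have e1 : (∏ i ∈ A, (1 - z i)⁻¹) * J = (∏ i ∈ A, (1 - z i)⁻¹) * K -
      (∏ i ∈ A, z i) * (∏ i ∈ A, (1 - z i)⁻¹) * K := by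
    have : J = (1 - ∏ i ∈ A, z i) * K := by rw [hK, ← mul_assoc, mul_inv_cancel₀ hZ, one_mul]
    rw [this]; ring
  have e2 : (∏ i ∈ A, z i) * (∏ i ∈ A, (1 - z i)⁻¹) * K =
      ∑ S ∈ A.powerset, (-1) ^ S.card * ((∏ i ∈ A \ S, (1 - z i)⁻¹) * K) := by
    have : ∏ i ∈ A, z i = ∑ S ∈ A.powerset, (-1) ^ S.card * ∏ i ∈ S, (1 - z i) := by
      have := Finset.prod_add (fun i => -(1 - z i)) (fun _ => 1) A
      simp only [Finset.prod_const_one, mul_one, Finset.prod_neg] at this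
      rw [← this]
      exact Finset.prod_congr rfl fun i _ => by ring
    rw [this, Finset.sum_mul, Finset.sum_mul]
    refine Finset.sum_congr rfl fun S hS => ?_
    have hS' := Finset.mem_powerset.1 hS
    rw [← Finset.prod_sdiff hS']
    have : (∏ i ∈ S, (1 - z i)) * ∏ i ∈ S, (1 - z i)⁻¹ = 1 := by
      rw [← Finset.prod_mul_distrib]
      exact Finset.prod_eq_one fun i hi => mul_inv_cancel₀ (hz i (hS' hi))
    linear_combination ((-1) ^ S.card * (∏ i ∈ A \ S, (1 - z i)⁻¹) * K) * this
  have hsub : insert ∅ (A.image fun i => ({i} : Finset ι)) ⊆ A.powerset := by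
    intro S hS
    rw [Finset.mem_insert, Finset.mem_image] at hS
    rcases hS with rfl | ⟨i, hi, rfl⟩
    · simp
    · simpa using hi
  have e3 : L ((∏ i ∈ A, z i) * (∏ i ∈ A, (1 - z i)⁻¹) * K) =
      L ((∏ i ∈ A, (1 - z i)⁻¹) * K) - ∑ i ∈ A, L ((∏ i ∈ A.erase i, (1 - z i)⁻¹) * K) := by
    rw [e2, map_sum, ← Finset.sum_subset hsub, Finset.sum_insert (by simp),
      Finset.sum_image (fun a _ b _ h => Finset.singleton_injective h)]
    · rw [Finset.card_empty, pow_zero, one_mul, Finset.sdiff_empty, sub_eq_add_neg,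
        ← Finset.sum_neg_distrib]
      congr 1
      refine Finset.sum_congr rfl fun i _ => ?_
      rw [Finset.card_singleton, pow_one, neg_one_mul, map_neg, Finset.sdiff_singleton_eq_erase]
    · intro S hS hS'
      have hS'' := Finset.mem_powerset.1 hS
      rw [Finset.mem_insert, Finset.mem_image] at hS'
      push Not at hS'
      have hcard : 2 ≤ S.card := by
        by_contra hlt
        have h0 : S.card ≠ 0 := (Finset.card_pos.2 hS'.1).ne'
        have h1 : S.card = 1 := by omega
        obtain ⟨i, rfl⟩ := Finset.card_eq_one.1 h1
        exact hS'.2 i (by simpa using hS'') rfl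
      rcases neg_one_pow_eq_or F S.card with h | h <;> rw [h]
      · rw [one_mul, h2 S hS'' hcard]
      · rw [neg_one_mul, map_neg, h2 S hS'' hcard, neg_zero]
  rw [e1, map_sub, e3, sub_sub_cancel, Finset.sum_congr rfl h1, Finset.sum_const]

theorem map_prod_eq_of_exchange {ι F : Type*} [DecidableEq ι] [Field F] (L : F →+ F)
    (A : Finset ι) (f g : ι → F) (E : F) (K : ι → Subfield F)
    (h : ∀ a ∈ A, ∀ Y ∈ K a, L (f a * (E * Y)) = L (g a * (E * Y)))
    (hfg : ∀ a ∈ A, ∀ b ∈ A, b ≠ a → f b ∈ K a ∧ g b ∈ K a) {R : F} (hR : ∀ a ∈ A, R ∈ K a) :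
    L ((∏ a ∈ A, f a) * (E * R)) = L ((∏ a ∈ A, g a) * (E * R)) := by
  induction A using Finset.induction_on generalizing R with
  | empty => simp
  | insert a A ha ih =>
    have e1 : (∏ b ∈ insert a A, f b) * (E * R) = (∏ b ∈ A, f b) * (E * (f a * R)) := by
      rw [Finset.prod_insert ha]; ring
    have e2 : (∏ b ∈ insert a A, g b) * (E * R) = g a * (E * ((∏ b ∈ A, g b) * R)) := by
      rw [Finset.prod_insert ha]; ring
    have e3 : (∏ b ∈ A, g b) * (E * (f a * R)) = f a * (E * ((∏ b ∈ A, g b) * R)) := by ring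
    have hne : ∀ b ∈ A, b ≠ a := fun b hb h => ha (h ▸ hb)
    rw [e1, e2, ih (fun b hb => h b (Finset.mem_insert_of_mem hb))
      (fun b hb c hc => hfg b (Finset.mem_insert_of_mem hb) c (Finset.mem_insert_of_mem hc)), e3]
    · refine h a (Finset.mem_insert_self a A) _ (mul_mem (prod_mem fun b hb => ?_)
        (hR a (Finset.mem_insert_self a A)))
      exact (hfg a (Finset.mem_insert_self a A) b (Finset.mem_insert_of_mem hb) (hne b hb)).2
    · intro b hb
      exact mul_mem (hfg b (Finset.mem_insert_of_mem hb) a (Finset.mem_insert_self a A)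
        (hne b hb).symm).1 (hR b (Finset.mem_insert_of_mem hb))

/-- The subfield fixed by an automorphism. -/
def fixedField {F : Type*} [Field F] (τ : F ≃+* F) : Subfield F where
  carrier := {Y | τ Y = Y}
  mul_mem' := by intro a b ha hb; rw [Set.mem_ofPred_eq] at *; rw [map_mul, ha, hb]
  one_mem' := map_one τ
  add_mem' := by intro a b ha hb; rw [Set.mem_ofPred_eq] at *; rw [map_add, ha, hb]
  zero_mem' := map_zero τ
  neg_mem' := by intro a ha; rw [Set.mem_ofPred_eq] at *; rw [map_neg, ha]
  inv_mem' := by intro a ha; rw [Set.mem_ofPred_eq] at *; rw [map_inv₀, ha]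

theorem mem_fixedField {F : Type*} [Field F] {τ : F ≃+* F} {Y : F} :
    Y ∈ fixedField τ ↔ τ Y = Y := Iff.rfl

namespace OrderedBasis

variable {t : SuperType} {m n : ℕ} (X : OrderedBasis t m n)

/-- The automorphism that exchanges two vertices. -/
noncomputable def actSwap (p q : Fin (m + n)) : RatFun m n ≃+* RatFun m n :=
  act (X.perm (Equiv.swap p q))

theorem actSwap_e (p q l : Fin (m + n)) (c : ℚ) :
    X.actSwap p q (X.e l c) = X.e (Equiv.swap p q l) c := X.act_perm_e _ _ _

theorem perm_swap_apply (p q : Fin (m + n)) (v : Weight m n) :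
    X.perm (Equiv.swap p q) v =
      v - (X.coord p v - X.coord q v) • (X.vertex p - X.vertex q) := by
  have : (X.perm (Equiv.swap p q)).toLinearMap =
      LinearMap.id - (X.coord p - X.coord q).smulRight (X.vertex p - X.vertex q) := by
    refine X.basis.ext fun k => ?_
    rw [basis_apply]
    simp only [LinearEquiv.coe_coe, perm_vertex, LinearMap.sub_apply, LinearMap.id_coe, id,
      LinearMap.smulRight_apply, coord_vertex]
    rw [Equiv.swap_apply_def]
    by_cases hp : k = p
    · by_cases hq : k = q
      · subst hp; subst hq; simp
      · subst hp; simp [hq]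
    · by_cases hq : k = q
      · subst hq; simp [hp]
      · simp [hp, hq]
  exact LinearMap.congr_fun this v

/-- The functions that are fixed by the exchange of vertices of the same type in `S`. -/
noncomputable def fixSwaps (S : Finset (Fin (m + n))) : Subfield (RatFun m n) :=
  ⨅ p ∈ S, ⨅ q ∈ S, ⨅ (_ : X.inE p = X.inE q), fixedField (X.actSwap p q)

theorem mem_fixSwaps {S : Finset (Fin (m + n))} {Y : RatFun m n} : Y ∈ X.fixSwaps S ↔
    ∀ p ∈ S, ∀ q ∈ S, X.inE p = X.inE q → X.actSwap p q Y = Y := by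
  simp only [fixSwaps, Subfield.mem_iInf, mem_fixedField]

theorem fixSwaps_anti {S T : Finset (Fin (m + n))} (h : S ⊆ T) :
    X.fixSwaps T ≤ X.fixSwaps S := by
  intro Y hY
  rw [mem_fixSwaps] at *
  exact fun p hp q hq => hY p (h hp) q (h hq)

theorem expo_mem_fixSwaps {S : Finset (Fin (m + n))} {v : Weight m n}
    (h : ∀ p ∈ S, ∀ q ∈ S, X.inE p = X.inE q → X.coord p v = X.coord q v) :
    expo v ∈ X.fixSwaps S := by
  rw [mem_fixSwaps]
  intro p hp q hq hpq
  rw [actSwap, act_expo, perm_swap_apply, h p hp q hq hpq, sub_self, zero_smul, sub_zero]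

theorem e_mem_fixSwaps {S : Finset (Fin (m + n))} {l : Fin (m + n)} (hl : l ∉ S) (c : ℚ) :
    X.e l c ∈ X.fixSwaps S := by
  apply X.expo_mem_fixSwaps
  intro p hp q hq _
  have h1 : l ≠ p := fun h => hl (h ▸ hp)
  have h2 : l ≠ q := fun h => hl (h ▸ hq)
  simp [coord_vertex, h1, h2]

/-- `L` changes sign under the exchange of vertices of the same type in `S`. -/
def Alternating (L : RatFun m n →+ RatFun m n) (S : Finset (Fin (m + n))) : Prop :=
  ∀ p ∈ S, ∀ q ∈ S, p ≠ q → X.inE p = X.inE q → ∀ Y, L (X.actSwap p q Y) = -L Y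

variable {X}

theorem Alternating.eq_zero {L : RatFun m n →+ RatFun m n} {S : Finset (Fin (m + n))}
    (hL : X.Alternating L S) {p q : Fin (m + n)} (hp : p ∈ S) (hq : q ∈ S) (hpq : p ≠ q)
    (h : X.inE p = X.inE q) {Y : RatFun m n} (hY : X.actSwap p q Y = Y) : L Y = 0 := by
  have := hL p hp q hq hpq h Y
  rw [hY] at this
  exact self_eq_neg.1 this

end OrderedBasis

namespace ArcDiagram

variable {t : SuperType} {m n : ℕ} (X : ArcDiagram t m n)

/-- The power `(e^{ξ'} / e^ξ)^c`, where `ξ ∈ ℰ` and `ξ' ∈ 𝒟` are the ends of the arc `a`. -/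
noncomputable def z (a : Fin (m + n) × Fin (m + n)) (c : ℚ) : RatFun m n :=
  X.e (X.endOf true a) (-c) * X.e (X.endOf false a) c

theorem z_add (a : Fin (m + n) × Fin (m + n)) (c d : ℚ) :
    X.z a (c + d) = X.z a c * X.z a d := by
  simp only [z, neg_add, OrderedBasis.e_add]; ring

theorem z_neg (a : Fin (m + n) × Fin (m + n)) (c : ℚ) : X.z a (-c) = (X.z a c)⁻¹ := by
  simp only [z, OrderedBasis.e_neg, mul_inv]

theorem z_ne_zero (a : Fin (m + n) × Fin (m + n)) (c : ℚ) : X.z a c ≠ 0 :=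
  mul_ne_zero (X.e_ne_zero _ _) (X.e_ne_zero _ _)

theorem z_eq_expo {a : Fin (m + n) × Fin (m + n)} (ha : a ∈ X.arcs) (c : ℚ) :
    X.z a c = expo (-c • (X.eta a.1 • X.vertex a.1 + X.eta a.2 • X.vertex a.2)) := by
  have := X.diffType a ha
  unfold z endOf OrderedBasis.e OrderedBasis.eta
  rw [← expo_add]
  congr 1
  cases h1 : X.inE a.1 <;> cases h2 : X.inE a.2 <;> simp [h1, h2] at this ⊢
  abel

theorem endOf_true_ne_false {a b : Fin (m + n) × Fin (m + n)} (ha : a ∈ X.arcs)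
    (hb : b ∈ X.arcs) : X.endOf true a ≠ X.endOf false b := by
  intro h
  have h1 := X.inE_endOf true ha
  rw [h, X.inE_endOf false hb] at h1
  exact Bool.false_ne_true h1

theorem one_sub_z_ne_zero {a : Fin (m + n) × Fin (m + n)} (ha : a ∈ X.arcs) {c : ℚ}
    (hc : c ≠ 0) : 1 - X.z a c ≠ 0 := by
  rw [X.z_eq_expo ha]
  apply one_sub_expo_ne_zero
  intro h
  have := congrArg (X.coord a.1) h
  have hlt := (X.lt_of_mem a ha).ne'
  simp [OrderedBasis.coord_vertex, hlt, X.eta_ne_zero, hc] at this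

theorem endOf_ne {c : Bool} {a b : Fin (m + n) × Fin (m + n)} (ha : a ∈ X.arcs)
    (hb : b ∈ X.arcs) (hab : a ≠ b) (c' : Bool) : X.endOf c a ≠ X.endOf c' b := by
  intro h
  exact hab (X.eq_of_mem_ends ha hb (X.endOf_eq c a) (h ▸ X.endOf_eq c' b))

theorem actSwap_z_of_ne {p q : Fin (m + n)} {a : Fin (m + n) × Fin (m + n)}
    (hp : ∀ c, X.endOf c a ≠ p) (hq : ∀ c, X.endOf c a ≠ q) (c : ℚ) :
    X.actSwap p q (X.z a c) = X.z a c := by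
  rw [z, map_mul, OrderedBasis.actSwap_e, OrderedBasis.actSwap_e,
    Equiv.swap_apply_of_ne_of_ne (hp _) (hq _), Equiv.swap_apply_of_ne_of_ne (hp _) (hq _)]

/-- The automorphism that exchanges two arcs. -/
noncomputable def actArcs (a b : Fin (m + n) × Fin (m + n)) : RatFun m n ≃+* RatFun m n :=
  (X.actSwap (X.endOf false a) (X.endOf false b)).trans
    (X.actSwap (X.endOf true a) (X.endOf true b))

theorem actArcs_z {a b d : Fin (m + n) × Fin (m + n)} (ha : a ∈ X.arcs) (hb : b ∈ X.arcs)
    (hd : d ∈ X.arcs) (c : ℚ) : X.actArcs a b (X.z d c) = X.z (Equiv.swap a b d) c := by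
  have h1 : ∀ c, Equiv.swap (X.endOf c a) (X.endOf c b) (X.endOf c d) =
      X.endOf c (Equiv.swap a b d) := by
    intro c
    by_cases hda : d = a
    · subst hda; simp
    · by_cases hdb : d = b
      · subst hdb; simp
      · rw [Equiv.swap_apply_of_ne_of_ne hda hdb, Equiv.swap_apply_of_ne_of_ne
          (X.endOf_ne hd ha hda c) (X.endOf_ne hd hb hdb c)]
  have hsw : Equiv.swap a b d ∈ X.arcs := by
    rw [Equiv.swap_apply_def]; split_ifs <;> assumption
  have h2 : ∀ {d'}, d' ∈ X.arcs → Equiv.swap (X.endOf true a) (X.endOf true b) (X.endOf false d') =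
      X.endOf false d' := fun hd' => Equiv.swap_apply_of_ne_of_ne
        (X.endOf_true_ne_false ha hd').symm (X.endOf_true_ne_false hb hd').symm
  have h3 : Equiv.swap (X.endOf false a) (X.endOf false b) (X.endOf true d) =
      X.endOf true d := Equiv.swap_apply_of_ne_of_ne
        (X.endOf_true_ne_false hd ha) (X.endOf_true_ne_false hd hb)
  rw [actArcs, RingEquiv.trans_apply, z, map_mul, map_mul]
  simp only [OrderedBasis.actSwap_e, h1, h3, h2 hsw]
  rfl

/-- The sign of an arc. -/
noncomputable def sg (a : Fin (m + n) × Fin (m + n)) : RatFun m n :=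
  if X.inE a.1 = true then 1 else -1

/-- The factor of an arc once it has been separated from the other arcs. -/
noncomputable def ac (a : Fin (m + n) × Fin (m + n)) (d : ℚ) : RatFun m n :=
  X.sg a * X.z a d * (1 - X.z a 1)⁻¹

/-- The factor of an arc in `𝒫(X)`. -/
noncomputable def term (a : Fin (m + n) × Fin (m + n)) : RatFun m n :=
  (X.hook a : RatFun m n) / (1 - expo (-(X.eta a.1 • X.below a)))

theorem coord_below (a : Fin (m + n) × Fin (m + n)) (l : Fin (m + n)) :
    X.coord l (X.below a) = if l ∈ Finset.Icc a.1 a.2 then X.eta l else 0 := by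
  rw [below, map_sum]
  simp only [map_smul, OrderedBasis.coord_vertex, smul_eq_mul, mul_ite, mul_one, mul_zero]
  rw [Finset.sum_ite_eq']

theorem expo_below_mem_fixSwaps {a : Fin (m + n) × Fin (m + n)} {S : Finset (Fin (m + n))}
    (h : S ⊆ Finset.Icc a.1 a.2 ∨ Disjoint S (Finset.Icc a.1 a.2)) (c : ℚ) :
    expo (c • X.below a) ∈ X.fixSwaps S := by
  apply X.expo_mem_fixSwaps
  intro p hp q hq hpq
  rw [map_smul, map_smul, coord_below, coord_below]
  rcases h with h | h
  · rw [if_pos (h hp), if_pos (h hq), X.inE_eq_iff_eta.1 hpq]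
  · rw [Finset.disjoint_left] at h
    rw [if_neg (h hp), if_neg (h hq)]

theorem term_mem_fixSwaps {a : Fin (m + n) × Fin (m + n)} {S : Finset (Fin (m + n))}
    (h : S ⊆ Finset.Icc a.1 a.2 ∨ Disjoint S (Finset.Icc a.1 a.2)) :
    X.term a ∈ X.fixSwaps S := by
  rw [term, ← neg_smul]
  exact div_mem (natCast_mem _ _) (sub_mem (one_mem _) (X.expo_below_mem_fixSwaps h _))

theorem z_mem_fixSwaps {a : Fin (m + n) × Fin (m + n)} {S : Finset (Fin (m + n))}
    (h1 : a.1 ∉ S) (h2 : a.2 ∉ S) (c : ℚ) : X.z a c ∈ X.fixSwaps S := by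
  have : ∀ c, X.endOf c a ∉ S := by
    intro c
    rcases X.endOf_eq c a with h | h <;> rwa [h]
  exact mul_mem (X.e_mem_fixSwaps (this _) _) (X.e_mem_fixSwaps (this _) _)

theorem sg_mem (K : Subfield (RatFun m n)) (a : Fin (m + n) × Fin (m + n)) : X.sg a ∈ K := by
  unfold sg; split_ifs
  · exact one_mem _
  · exact neg_mem (one_mem _)

theorem ac_mem {K : Subfield (RatFun m n)} {a : Fin (m + n) × Fin (m + n)}
    (h : ∀ c, X.z a c ∈ K) (d : ℚ) : X.ac a d ∈ K :=
  mul_mem (mul_mem (X.sg_mem K a) (h d)) (inv_mem (sub_mem (one_mem _) (h 1)))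

theorem expo_below {a : Fin (m + n) × Fin (m + n)} (ha : a ∈ X.arcs) (c : ℚ) :
    expo (c • X.below a) = ∏ b ∈ X.arcsIn (Finset.Icc a.1 a.2), X.z b (-c) := by
  have h1 : X.below a = ∑ b ∈ X.arcsIn (Finset.Icc a.1 a.2),
      (X.eta b.1 • X.vertex b.1 + X.eta b.2 • X.vertex b.2) := by
    have := congrArg Multiplicative.toAdd (X.prod_eq_prod_arcsIn (X.arcClosed_Icc ha)
      (fun i => Multiplicative.ofAdd (X.eta i • X.vertex i)))
    rw [Finset.sdiff_eq_empty_iff_subset.2 (X.Icc_subset_supp ha)] at this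
    simpa [below] using this
  rw [h1, Finset.smul_sum, expo_sum]
  refine Finset.prod_congr rfl fun b hb => ?_
  rw [X.z_eq_expo (X.mem_arcsIn.1 hb).1, neg_neg]

theorem below_ne_zero {a : Fin (m + n) × Fin (m + n)} (ha : a ∈ X.arcs) : X.below a ≠ 0 := by
  intro h
  have := congrArg (X.coord a.1) h
  rw [coord_below, if_pos (Finset.left_mem_Icc.2 (X.lt_of_mem a ha).le), map_zero] at this
  exact X.eta_ne_zero _ this

end ArcDiagram

end SuperDenominator

namespace SuperDenominator

namespace ArcDiagram

variable {t : SuperType} {m n : ℕ} (X : ArcDiagram t m n)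

theorem endOf_mem {S : Finset (Fin (m + n))} {a : Fin (m + n) × Fin (m + n)}
    (ha : a ∈ X.arcsIn S) (c : Bool) : X.endOf c a ∈ S := by
  obtain ⟨_, h1, h2⟩ := X.mem_arcsIn.1 ha
  rcases X.endOf_eq c a with h | h <;> rwa [h]

theorem prod_z_mem_fixSwaps {a : Fin (m + n) × Fin (m + n)} (ha : a ∈ X.arcs) (c : ℚ) :
    ∏ b ∈ X.arcsIn (Finset.Icc a.1 a.2), X.z b c ∈ X.fixSwaps (Finset.Icc a.1 a.2) := by
  have := X.expo_below ha (-c)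
  rw [neg_neg] at this
  rw [← this]
  exact X.expo_below_mem_fixSwaps (Or.inl subset_rfl) _

variable {X} in
theorem map_actArcs {L : RatFun m n →+ RatFun m n} {S : Finset (Fin (m + n))}
    (hL : X.Alternating L S) {a b : Fin (m + n) × Fin (m + n)} (ha : a ∈ X.arcsIn S)
    (hb : b ∈ X.arcsIn S) (hab : a ≠ b) (Y : RatFun m n) : L (X.actArcs a b Y) = L Y := by
  have ha' := (X.mem_arcsIn.1 ha).1
  have hb' := (X.mem_arcsIn.1 hb).1
  rw [actArcs, RingEquiv.trans_apply,
    hL _ (X.endOf_mem ha _) _ (X.endOf_mem hb _) (X.endOf_ne ha' hb' hab _)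
      (by rw [X.inE_endOf _ ha', X.inE_endOf _ hb']),
    hL _ (X.endOf_mem ha _) _ (X.endOf_mem hb _) (X.endOf_ne ha' hb' hab _)
      (by rw [X.inE_endOf _ ha', X.inE_endOf _ hb']), neg_neg]

theorem actArcs_eq_self {S : Finset (Fin (m + n))} {a b : Fin (m + n) × Fin (m + n)}
    (ha : a ∈ X.arcsIn S) (hb : b ∈ X.arcsIn S) {G : RatFun m n} (hG : G ∈ X.fixSwaps S) :
    X.actArcs a b G = G := by
  rw [X.mem_fixSwaps] at hG
  have ha' := (X.mem_arcsIn.1 ha).1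
  have hb' := (X.mem_arcsIn.1 hb).1
  rw [actArcs, RingEquiv.trans_apply,
    hG _ (X.endOf_mem ha _) _ (X.endOf_mem hb _) (by rw [X.inE_endOf _ ha', X.inE_endOf _ hb']),
    hG _ (X.endOf_mem ha _) _ (X.endOf_mem hb _) (by rw [X.inE_endOf _ ha', X.inE_endOf _ hb'])]

variable {X} in
theorem card_nsmul_arc {L : RatFun m n →+ RatFun m n} {B' : Finset (Fin (m + n))}
    (hL : X.Alternating L B') {γ : Fin (m + n) × Fin (m + n)} (hγ : γ ∈ X.arcs)
    (hB : Finset.Icc γ.1 γ.2 ⊆ B') {s : ℚ} (hs : s ≠ 0) {J : RatFun m n}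
    (hJ : J ∈ X.fixSwaps (Finset.Icc γ.1 γ.2)) :
    X.hook γ • L ((∏ b ∈ (X.arcsIn (Finset.Icc γ.1 γ.2)).erase γ, (1 - X.z b s)⁻¹) *
        ((1 - ∏ b ∈ X.arcsIn (Finset.Icc γ.1 γ.2), X.z b s)⁻¹ * J)) =
      L ((∏ b ∈ X.arcsIn (Finset.Icc γ.1 γ.2), (1 - X.z b s)⁻¹) * J) := by
  set A := X.arcsIn (Finset.Icc γ.1 γ.2) with hA
  have hγA : γ ∈ A := X.mem_arcsIn.2 ⟨hγ, Finset.left_mem_Icc.2 (X.lt_of_mem γ hγ).le,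
    Finset.right_mem_Icc.2 (X.lt_of_mem γ hγ).le⟩
  have hAarcs : ∀ b ∈ A, b ∈ X.arcs := fun b hb => (X.mem_arcsIn.1 hb).1
  have hAB : A ⊆ X.arcsIn B' := by
    intro b hb
    obtain ⟨h1, h2, h3⟩ := X.mem_arcsIn.1 hb
    exact X.mem_arcsIn.2 ⟨h1, hB h2, hB h3⟩
  have hG : (1 - ∏ b ∈ A, X.z b s)⁻¹ * J ∈ X.fixSwaps (Finset.Icc γ.1 γ.2) :=
    mul_mem (inv_mem (sub_mem (one_mem _) (X.prod_z_mem_fixSwaps hγ s))) hJ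
  refine card_nsmul_eq_of_alternating L A γ (fun b => X.z b s)
    (fun b hb => X.one_sub_z_ne_zero (hAarcs b hb) hs) ?_ J ?_ ?_
  · have := X.expo_below hγ (-s)
    rw [neg_neg] at this
    rw [hA, ← this]
    exact one_sub_expo_ne_zero (smul_ne_zero (neg_ne_zero.2 hs) (X.below_ne_zero hγ))
  · intro β hβ
    by_cases hne : β = γ
    · rw [hne]
    rw [← map_actArcs hL (hAB hβ) (hAB hγA) hne, map_mul, X.actArcs_eq_self hβ hγA hG, map_prod]
    congr 2
    refine Finset.prod_equiv (Equiv.swap β γ) (fun b => ?_) (fun b hb => ?_)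
    · rw [Finset.mem_erase, Finset.mem_erase, Equiv.swap_apply_def]
      split_ifs with h1 h2
      · simp [h1]
      · subst h2
        simp [hne, hβ, Ne.symm hne, hγA]
      · simp [h1, h2]
    · rw [map_inv₀, map_sub, map_one,
        X.actArcs_z (hAarcs β hβ) hγ (hAarcs b (Finset.mem_of_mem_erase hb))]
  · intro S hS hcard
    obtain ⟨a, ha, b, hb, hab⟩ := Finset.one_lt_card.1 hcard
    have ha' := hAarcs a (hS ha)
    have hb' := hAarcs b (hS hb)
    have htt : X.inE (X.endOf true a) = X.inE (X.endOf true b) := by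
      rw [X.inE_endOf _ ha', X.inE_endOf _ hb']
    refine hL.eq_zero (X.endOf_mem (hAB (hS ha)) true) (X.endOf_mem (hAB (hS hb)) true)
      (X.endOf_ne ha' hb' hab true) htt ?_
    rw [map_mul, (X.mem_fixSwaps.1 hG) _ (X.endOf_mem (hS ha) true) _ (X.endOf_mem (hS hb) true)
      htt, map_prod]
    congr 1
    refine Finset.prod_congr rfl fun d hd => ?_
    obtain ⟨hd1, hd2⟩ := Finset.mem_sdiff.1 hd
    rw [map_inv₀, map_sub, map_one, X.actSwap_z_of_ne
      (fun c => X.endOf_ne (hAarcs d hd1) ha' (by rintro rfl; exact hd2 ha) true)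
      (fun c => X.endOf_ne (hAarcs d hd1) hb' (by rintro rfl; exact hd2 hb) true)]

theorem pot_arc {γ : Fin (m + n) × Fin (m + n)} (hγ : γ ∈ X.arcs) :
    X.pot γ.1.val = X.pot (γ.2.val + 1) := by
  have hlt : γ.1.val < γ.2.val := X.lt_of_mem γ hγ
  have h1 : (Finset.univ.filter fun l : Fin (m + n) => γ.1.val ≤ l.val) =
      Finset.Icc γ.1 γ.2 ∪ Finset.univ.filter fun l : Fin (m + n) => γ.2.val + 1 ≤ l.val := by
    ext l
    simp only [Finset.mem_filter, Finset.mem_univ, true_and, Finset.mem_union, Finset.mem_Icc,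
      Fin.le_def]
    omega
  have h2 : ∑ l ∈ Finset.Icc γ.1 γ.2, X.eta l = 0 := by
    have := X.balanced γ hγ
    have e1 : ∀ l, X.eta l = (if X.inE l = true then 1 else 0 : ℚ) -
        if X.inE l = false then 1 else 0 := by
      intro l; unfold OrderedBasis.eta; cases X.inE l <;> simp
    simp only [e1, Finset.sum_sub_distrib, Finset.sum_boole, this, sub_self]
  rw [OrderedBasis.pot, OrderedBasis.pot, h1, Finset.sum_union, h2, zero_add]
  rw [Finset.disjoint_left]
  intro l hl
  simp only [Finset.mem_Icc, Fin.le_def] at hl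
  simp only [Finset.mem_filter, Finset.mem_univ, true_and]
  omega

variable {X} in
theorem map_arc {L : RatFun m n →+ RatFun m n} {B' : Finset (Fin (m + n))}
    (hL : X.Alternating L B') {γ : Fin (m + n) × Fin (m + n)} (hγ : γ ∈ X.arcs)
    (hB : Finset.Icc γ.1 γ.2 ⊆ B') {J : RatFun m n}
    (hJ : J ∈ X.fixSwaps (Finset.Icc γ.1 γ.2)) :
    L ((∏ b ∈ (X.arcsIn (Finset.Icc γ.1 γ.2)).erase γ, X.ac b (X.pot γ.2.val)) *
        (X.term γ * (X.e γ.1 (X.coord γ.1 X.rho) * X.e γ.2 (X.coord γ.2 X.rho)) * J)) =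
      L ((∏ b ∈ X.arcsIn (Finset.Icc γ.1 γ.2), X.ac b (X.pot (γ.2.val + 1))) * J) := by
  set A := X.arcsIn (Finset.Icc γ.1 γ.2) with hA
  have hAarcs : ∀ b ∈ A, b ∈ X.arcs := fun b hb => (X.mem_arcsIn.1 hb).1
  have hγA : γ ∈ A := X.mem_arcsIn.2 ⟨hγ, Finset.left_mem_Icc.2 (X.lt_of_mem γ hγ).le,
    Finset.right_mem_Icc.2 (X.lt_of_mem γ hγ).le⟩
  have hp1 := X.pot_arc hγ
  have hp2 := X.pot_succ γ.2
  have hp3 := X.pot_succ γ.1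
  have he2 := X.eta_snd hγ
  set p := X.pot (γ.2.val + 1) with hp
  have hsg : ∀ b, X.sg b ∈ X.fixSwaps (Finset.Icc γ.1 γ.2) := fun b => X.sg_mem _ b
  have hterm : X.term γ = X.hook γ * (1 - ∏ b ∈ A, X.z b (X.eta γ.1))⁻¹ := by
    have := X.expo_below hγ (-X.eta γ.1)
    rw [neg_neg, neg_smul] at this
    rw [term, this, div_eq_mul_inv]
  have hZ : ∀ s : ℚ, s ≠ 0 → 1 - ∏ b ∈ A, X.z b s ≠ 0 := by
    intro s hs
    have := X.expo_below hγ (-s)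
    rw [neg_neg] at this
    rw [hA, ← this]
    exact one_sub_expo_ne_zero (smul_ne_zero (neg_ne_zero.2 hs) (X.below_ne_zero hγ))
  cases h : X.inE γ.1
  · have h2 : X.inE γ.2 = true := by
      have := X.diffType γ hγ
      rw [h] at this
      cases h3 : X.inE γ.2
      · exact absurd h3.symm this
      · rfl
    have hη : X.eta γ.1 = -1 := by simp [OrderedBasis.eta, h]
    have hpot : X.pot γ.2.val = p - 1 := by rw [he2, hη] at hp2; linarith
    have hee : X.e γ.1 (X.coord γ.1 X.rho) * X.e γ.2 (X.coord γ.2 X.rho) = X.z γ (p - 1) := by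
      rw [OrderedBasis.coord_rho, OrderedBasis.coord_rho, if_neg (by simp [h]), if_pos h2, hpot,
        hp3, hp1, hη, z, endOf, endOf, if_neg (by simp [h]), if_pos h, mul_comm, ← sub_eq_add_neg]
    have key := card_nsmul_arc hL hγ hB one_ne_zero
      (J := (∏ b ∈ A, X.sg b) * (∏ b ∈ A, X.z b p) * J)
      (mul_mem (mul_mem (prod_mem fun b _ => hsg b) (X.prod_z_mem_fixSwaps hγ p)) hJ)
    rw [← map_nsmul, nsmul_eq_mul] at key
    refine Eq.trans (congrArg L ?_) (key.trans (congrArg L ?_))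
    · rw [hterm, hη, hee, hpot]
      simp only [ac]
      rw [← Finset.mul_prod_erase A X.sg hγA, Finset.prod_mul_distrib, Finset.prod_mul_distrib]
      have hsγ : X.sg γ = -1 := by simp [sg, h]
      have e1 : (1 - ∏ b ∈ A, X.z b (-1))⁻¹ = -(∏ b ∈ A, X.z b 1) *
          (1 - ∏ b ∈ A, X.z b 1)⁻¹ := by
        have h1 : ∏ b ∈ A, X.z b (-1) = (∏ b ∈ A, X.z b 1)⁻¹ := by
          simp only [z_neg, Finset.prod_inv_distrib]
        have h2 : ∏ b ∈ A, X.z b 1 ≠ 0 := Finset.prod_ne_zero_iff.2 fun b _ => X.z_ne_zero b 1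
        have h3 := hZ 1 one_ne_zero
        have h4 := hZ (-1) (by norm_num)
        rw [h1] at h4 ⊢
        field_simp
        have h5 : ∏ b ∈ A, X.z b 1 - 1 ≠ 0 := by rw [← neg_ne_zero, neg_sub]; exact h3
        field_simp
        ring
      have e2 : ∏ b ∈ A, X.z b p = (∏ b ∈ A, X.z b 1) *
          (X.z γ (p - 1) * ∏ b ∈ A.erase γ, X.z b (p - 1)) := by
        rw [Finset.mul_prod_erase A (fun b => X.z b (p - 1)) hγA, ← Finset.prod_mul_distrib]
        refine Finset.prod_congr rfl fun b _ => ?_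
        rw [← z_add]; congr 1; ring
      rw [e1, e2, hsγ]
      ring
    · simp only [ac, Finset.prod_mul_distrib]; ring
  · have h2 : X.inE γ.2 = false := by
      have := X.diffType γ hγ
      rw [h] at this
      cases h3 : X.inE γ.2
      · rfl
      · exact absurd h3.symm this
    have hη : X.eta γ.1 = 1 := by simp [OrderedBasis.eta, h]
    have hpot : X.pot γ.2.val = p + 1 := by rw [he2, hη] at hp2; linarith
    have hee : X.e γ.1 (X.coord γ.1 X.rho) * X.e γ.2 (X.coord γ.2 X.rho) = X.z γ p := by
      rw [OrderedBasis.coord_rho, OrderedBasis.coord_rho, if_pos h, if_neg (by simp [h2]), hp1,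
        z, endOf, endOf, if_pos h, if_neg (by simp [h])]
    have key := card_nsmul_arc hL hγ hB (s := -1) (by norm_num)
      (J := (∏ b ∈ A, -X.sg b) * (∏ b ∈ A, X.z b (p - 1)) * J)
      (mul_mem (mul_mem (prod_mem fun b _ => neg_mem (hsg b)) (X.prod_z_mem_fixSwaps hγ _)) hJ)
    rw [← map_nsmul, nsmul_eq_mul] at key
    have e0 : ∀ b ∈ A, (1 - X.z b 1)⁻¹ = -(X.z b (-1)) * (1 - X.z b (-1))⁻¹ := by
      intro b hb
      have h1 := X.one_sub_z_ne_zero (hAarcs b hb) one_ne_zero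
      have h2 := X.one_sub_z_ne_zero (hAarcs b hb) (c := -1) (by norm_num)
      have h3 := X.z_ne_zero b 1
      rw [z_neg] at h2 ⊢
      have h5 : X.z b 1 - 1 ≠ 0 := by rw [← neg_ne_zero, neg_sub]; exact h1
      field_simp
      ring
    refine Eq.trans (congrArg L ?_) (key.trans (congrArg L ?_))
    · rw [hterm, hη, hee, hpot]
      have hsγ : X.sg γ = 1 := by simp [sg, h]
      have e1 : (1 - ∏ b ∈ A, X.z b 1)⁻¹ = -(∏ b ∈ A, X.z b (-1)) *
          (1 - ∏ b ∈ A, X.z b (-1))⁻¹ := by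
        have h1 : ∏ b ∈ A, X.z b (-1) = (∏ b ∈ A, X.z b 1)⁻¹ := by
          simp only [z_neg, Finset.prod_inv_distrib]
        have h2 : ∏ b ∈ A, X.z b 1 ≠ 0 := Finset.prod_ne_zero_iff.2 fun b _ => X.z_ne_zero b 1
        have h3 := hZ 1 one_ne_zero
        have h4 := hZ (-1) (by norm_num)
        rw [h1] at h4 ⊢
        have h5 : ∏ b ∈ A, X.z b 1 - 1 ≠ 0 := by rw [← neg_ne_zero, neg_sub]; exact h3
        field_simp
        ring
      have e2 : (∏ b ∈ A, X.z b (-1)) * X.z γ p =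
          X.z γ (p - 1) * ∏ b ∈ A.erase γ, X.z b (-1) := by
        rw [← Finset.mul_prod_erase A (fun b => X.z b (-1)) hγA, sub_eq_add_neg, z_add]; ring
      have e3 : ∏ b ∈ A.erase γ, X.ac b (p + 1) =
          (∏ b ∈ A.erase γ, -X.sg b) * (∏ b ∈ A.erase γ, X.z b p) *
            ∏ b ∈ A.erase γ, (1 - X.z b (-1))⁻¹ := by
        rw [← Finset.prod_mul_distrib, ← Finset.prod_mul_distrib]
        refine Finset.prod_congr rfl fun b hb => ?_
        have : X.z b (p + 1) * X.z b (-1) = X.z b p := by rw [← z_add]; congr 1; ring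
        rw [ac, e0 b (Finset.mem_of_mem_erase hb), ← this]
        ring
      have e4 : ∏ b ∈ A, X.z b (p - 1) = X.z γ (p - 1) * ((∏ b ∈ A.erase γ, X.z b (-1)) *
          ∏ b ∈ A.erase γ, X.z b p) := by
        rw [← Finset.mul_prod_erase A (fun b => X.z b (p - 1)) hγA, ← Finset.prod_mul_distrib]
        congr 1
        refine Finset.prod_congr rfl fun b _ => ?_
        rw [← z_add]; congr 1; ring
      rw [e1, e3, e4, ← Finset.mul_prod_erase A (fun b => -X.sg b) hγA, hsγ]
      linear_combination (-(∏ b ∈ A.erase γ, -X.sg b) * (∏ b ∈ A.erase γ, X.z b p) *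
        (∏ b ∈ A.erase γ, (1 - X.z b (-1))⁻¹) * (X.hook γ : RatFun m n) *
        (1 - ∏ b ∈ A, X.z b (-1))⁻¹ * J) * e2
    · have : ∏ b ∈ A, X.ac b p = (∏ b ∈ A, (1 - X.z b (-1))⁻¹) *
          ((∏ b ∈ A, -X.sg b) * ∏ b ∈ A, X.z b (p - 1)) := by
        rw [← Finset.prod_mul_distrib, ← Finset.prod_mul_distrib]
        refine Finset.prod_congr rfl fun b hb => ?_
        have : X.z b (p - 1) = X.z b p * X.z b (-1) := by rw [← z_add, ← sub_eq_add_neg]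
        rw [ac, e0 b hb, this]
        ring
      rw [this]; ring

/-- The vertices with positions in `[i, j)`. -/
def seg (N i j : ℕ) : Finset (Fin N) := Finset.univ.filter fun l => i ≤ l.val ∧ l.val < j

theorem mem_seg {N i j : ℕ} {l : Fin N} : l ∈ seg N i j ↔ i ≤ l.val ∧ l.val < j := by
  simp [seg]

theorem union_sdiff_supp {S T : Finset (Fin (m + n))} (h : T ⊆ X.supp) :
    (S ∪ T) \ X.supp = S \ X.supp := by
  rw [Finset.union_sdiff_distrib, Finset.sdiff_eq_empty_iff_subset.2 h, Finset.union_empty]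

variable {X} in
theorem map_shift {L : RatFun m n →+ RatFun m n} {B' : Finset (Fin (m + n))}
    (hL : X.Alternating L B') {v : Fin (m + n)} (hv : v ∈ B') (hv' : v ∉ X.supp)
    {S : Finset (Fin (m + n))} (hS : S ⊆ B') (hvS : v ∉ S) {I : RatFun m n}
    (hI : I ∈ X.fixSwaps (insert v S)) :
    L ((∏ a ∈ X.arcsIn S, X.ac a (X.pot v.val)) * (X.e v (X.coord v X.rho) *
        ((∏ l ∈ S \ X.supp, X.e l (X.coord l X.rho)) * I))) =
      L ((∏ a ∈ X.arcsIn S, X.ac a (X.pot (v.val + 1))) * (X.e v (X.coord v X.rho) *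
        ((∏ l ∈ S \ X.supp, X.e l (X.coord l X.rho)) * I))) := by
  have hvarc : ∀ a ∈ X.arcs, ∀ c, X.endOf c a ≠ v := by
    rintro a ha c rfl
    exact hv' (X.endOf_mem_supp c ha)
  have hp := X.pot_succ v
  refine map_prod_eq_of_exchange L (X.arcsIn S) _ _ _
    (fun a => fixedField (X.actSwap (X.endOf (X.inE v) a) v)) ?_ ?_ ?_
  · intro a ha Y hY
    rw [mem_fixedField] at hY
    have ha' := (X.mem_arcsIn.1 ha).1
    have hne := X.endOf_true_ne_false ha' ha'
    rw [← sub_eq_zero, ← map_sub]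
    refine hL.eq_zero (hS (X.endOf_mem ha (X.inE v))) hv (hvarc a ha' _)
      (X.inE_endOf _ ha') ?_
    have hd : ∀ d : ℚ, X.ac a d - X.ac a (d + 1) = X.sg a * X.z a d := by
      intro d
      have := X.one_sub_z_ne_zero ha' one_ne_zero
      rw [ac, ac, z_add]
      field_simp
    have hsg : ∀ τ : RatFun m n ≃+* RatFun m n, τ (X.sg a) = X.sg a := by
      intro τ; unfold sg; split_ifs <;> simp
    cases h : X.inE v
    · have hη : X.eta v = -1 := by simp [OrderedBasis.eta, h]
      have e1 : X.pot v.val = X.pot (v.val + 1) + 1 := by rw [hη] at hp; linarith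
      rw [OrderedBasis.coord_rho, if_neg (by simp [h]), e1]
      have e2 : X.ac a (X.pot (v.val + 1) + 1) * (X.e v (X.pot (v.val + 1)) * Y) -
          X.ac a (X.pot (v.val + 1)) * (X.e v (X.pot (v.val + 1)) * Y) =
          -(X.sg a * X.z a (X.pot (v.val + 1)) * X.e v (X.pot (v.val + 1)) * Y) := by
        rw [← hd]; ring
      rw [h] at hY
      rw [e2, map_neg, map_mul, map_mul, map_mul, hsg, hY, z, map_mul]
      simp only [OrderedBasis.actSwap_e, Equiv.swap_apply_left, Equiv.swap_apply_right]
      rw [Equiv.swap_apply_of_ne_of_ne hne (hvarc a ha' _)]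
      ring
    · have hη : X.eta v = 1 := by simp [OrderedBasis.eta, h]
      rw [OrderedBasis.coord_rho, if_pos h, hp, hη, ← sub_mul, hd]
      rw [h] at hY
      rw [map_mul, map_mul, map_mul, hsg, hY, z, map_mul]
      simp only [OrderedBasis.actSwap_e, Equiv.swap_apply_left, Equiv.swap_apply_right]
      rw [Equiv.swap_apply_of_ne_of_ne hne.symm (hvarc a ha' _)]
      ring
  · intro a ha b hb hba
    have ha' := (X.mem_arcsIn.1 ha).1
    have hb' := (X.mem_arcsIn.1 hb).1
    have : ∀ c, X.z b c ∈ fixedField (X.actSwap (X.endOf (X.inE v) a) v) := fun c =>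
      X.actSwap_z_of_ne (fun _ => X.endOf_ne hb' ha' hba _) (hvarc b hb') c
    exact ⟨X.ac_mem this _, X.ac_mem this _⟩
  · intro a ha
    have ha' := (X.mem_arcsIn.1 ha).1
    refine mul_mem (prod_mem fun l hl => ?_) ((X.mem_fixSwaps.1 hI) _
      (Finset.mem_insert_of_mem (X.endOf_mem ha _)) _ (Finset.mem_insert_self _ _)
      (X.inE_endOf _ ha'))
    obtain ⟨h1, h2⟩ := Finset.mem_sdiff.1 hl
    rw [mem_fixedField, OrderedBasis.actSwap_e, Equiv.swap_apply_of_ne_of_ne]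
    · rintro rfl; exact h2 (X.endOf_mem_supp _ ha')
    · rintro rfl; exact hvS h1

variable {X} in
set_option maxHeartbeats 1000000 in
/-- Inside an interval that is closed under arcs, the factors of the arcs in `𝒫(X)` may be
replaced by independent ones. -/
theorem map_seg {L : RatFun m n →+ RatFun m n} {B' : Finset (Fin (m + n))}
    (hL : X.Alternating L B') (k : ℕ) : ∀ i j : ℕ, j = i + k → j ≤ m + n →
    X.ArcClosed (seg (m + n) i j) → seg (m + n) i j ⊆ B' →
    ∀ I ∈ X.fixSwaps (seg (m + n) i j),
      L ((∏ a ∈ X.arcsIn (seg (m + n) i j), X.term a) *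
          ((∏ l ∈ seg (m + n) i j, X.e l (X.coord l X.rho)) * I)) =
        L ((∏ a ∈ X.arcsIn (seg (m + n) i j), X.ac a (X.pot j)) *
          ((∏ l ∈ seg (m + n) i j \ X.supp, X.e l (X.coord l X.rho)) * I)) := by
  induction k using Nat.strong_induction_on with
  | _ k ih =>
  intro i j hj hjN hcl hB I hI
  rcases Nat.eq_zero_or_pos k with rfl | hk
  · have h0 : seg (m + n) i j = ∅ := by
      ext l; simp only [mem_seg, Finset.notMem_empty, iff_false]; omega
    simp [h0, arcsIn]
  set v : Fin (m + n) := ⟨j - 1, by omega⟩ with hv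
  have hvj : v.val + 1 = j := by simp only [hv]; omega
  have hvS : v ∈ seg (m + n) i j := mem_seg.2 ⟨by omega, by omega⟩
  by_cases hvs : v ∈ X.supp
  · obtain ⟨γ, hγ, hvγ⟩ := X.mem_supp.1 hvs
    have hlt : γ.1.val < γ.2.val := X.lt_of_mem γ hγ
    have hγS : γ.1 ∈ seg (m + n) i j ∧ γ.2 ∈ seg (m + n) i j := by
      have := hcl γ hγ
      rcases hvγ with h | h
      · rw [h] at hvS; exact ⟨hvS, this.1 hvS⟩
      · rw [h] at hvS; exact ⟨this.2 hvS, hvS⟩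
    have hγ1 := mem_seg.1 hγS.1
    have hγ2 := mem_seg.1 hγS.2
    have hv2 : v = γ.2 := by
      rcases hvγ with h | h
      · rw [h] at hvj; omega
      · exact h
    rw [hv2] at hvj
    set S1 := seg (m + n) i γ.1.val with hS1
    set S2 := seg (m + n) (γ.1.val + 1) γ.2.val with hS2
    set SI := Finset.Icc γ.1 γ.2 with hSI
    have hsplit : seg (m + n) i j = S1 ∪ SI := by
      ext l
      simp only [hS1, hSI, mem_seg, Finset.mem_union, Finset.mem_Icc, Fin.le_def]
      omega
    have hdisj : Disjoint S1 SI := by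
      rw [Finset.disjoint_left]
      intro l hl hl'
      simp only [hS1, hSI, mem_seg, Finset.mem_Icc, Fin.le_def] at hl hl'
      omega
    have hsplit2 : SI = insert γ.1 (insert γ.2 S2) := by
      ext l
      simp only [hS2, hSI, mem_seg, Finset.mem_Icc, Fin.le_def, Finset.mem_insert, Fin.ext_iff]
      omega
    have hn1 : γ.1 ∉ insert γ.2 S2 := by
      simp only [hS2, mem_seg, Finset.mem_insert, Fin.ext_iff]; omega
    have hn2 : γ.2 ∉ S2 := by simp only [hS2, mem_seg]; omega
    have hclI := X.arcClosed_Icc hγ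
    have hcl1 : X.ArcClosed S1 := by
      intro a ha
      have h1 := hcl a ha
      have h2 := hclI a ha
      rw [hsplit, Finset.mem_union, Finset.mem_union] at h1
      rw [Finset.disjoint_left] at hdisj
      have h3 := @hdisj a.1
      have h4 := @hdisj a.2
      tauto
    have hcl2 : X.ArcClosed S2 := by
      intro a ha
      by_cases haγ : a = γ
      · subst haγ
        simp only [hS2, mem_seg]; omega
      · have h2 := hclI a ha
        obtain ⟨d1, d2, d3, d4⟩ := X.disjoint a ha γ hγ haγ
        rw [← hSI, hsplit2] at h2
        simp only [Finset.mem_insert] at h2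
        tauto
    have hI1 : ∀ a ∈ X.arcsIn S2, a ≠ γ := by
      rintro a ha rfl
      exact hn1 (Finset.mem_insert_of_mem (X.mem_arcsIn.1 ha).2.1)
    have hγI : γ ∈ X.arcsIn SI := X.mem_arcsIn.2 ⟨hγ, Finset.left_mem_Icc.2 (X.lt_of_mem γ hγ).le,
      Finset.right_mem_Icc.2 (X.lt_of_mem γ hγ).le⟩
    have harc2 : (X.arcsIn SI).erase γ = X.arcsIn S2 := by
      ext a
      rw [Finset.mem_erase, mem_arcsIn, mem_arcsIn]
      constructor
      · rintro ⟨h1, h2, h3, h4⟩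
        obtain ⟨d1, d2, d3, d4⟩ := X.disjoint a h2 γ hγ h1
        rw [hsplit2] at h3 h4
        simp only [Finset.mem_insert] at h3 h4
        tauto
      · rintro ⟨h2, h3, h4⟩
        refine ⟨hI1 a (X.mem_arcsIn.2 ⟨h2, h3, h4⟩), h2, ?_⟩
        rw [hsplit2]
        simp only [Finset.mem_insert]
        tauto
    have harc : X.arcsIn (seg (m + n) i j) = X.arcsIn S1 ∪ X.arcsIn SI := by
      ext a
      simp only [mem_arcsIn, Finset.mem_union, hsplit]
      constructor
      · rintro ⟨h1, h2 | h2, h3⟩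
        · exact Or.inl ⟨h1, h2, (hcl1 a h1).1 h2⟩
        · exact Or.inr ⟨h1, h2, (hclI a h1).1 h2⟩
      · rintro (⟨h1, h2, h3⟩ | ⟨h1, h2, h3⟩)
        · exact ⟨h1, Or.inl h2, Or.inl h3⟩
        · exact ⟨h1, Or.inr h2, Or.inr h3⟩
    have harcdisj : Disjoint (X.arcsIn S1) (X.arcsIn SI) := by
      rw [Finset.disjoint_left] at hdisj ⊢
      intro a h1 h2
      exact hdisj (X.mem_arcsIn.1 h1).2.1 (X.mem_arcsIn.1 h2).2.1
    have hS1sub : S1 ⊆ seg (m + n) i j := hsplit ▸ Finset.subset_union_left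
    have hSIsub : SI ⊆ seg (m + n) i j := hsplit ▸ Finset.subset_union_right
    have hS2sub : S2 ⊆ SI := by
      rw [hsplit2]
      exact (Finset.subset_insert _ _).trans (Finset.subset_insert _ _)
    have hterm1 : ∀ a ∈ X.arcsIn S1, X.term a ∈ X.fixSwaps SI := by
      intro a ha
      refine X.term_mem_fixSwaps (Or.inr (Finset.disjoint_left.2 fun p hp hp' => ?_))
      have := mem_seg.1 (X.mem_arcsIn.1 ha).2.2
      simp only [hSI, Finset.mem_Icc, Fin.le_def] at hp hp'
      omega
    have he1 : ∀ l ∈ S1, ∀ c, X.e l c ∈ X.fixSwaps SI := fun l hl c =>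
      X.e_mem_fixSwaps (fun h => (Finset.disjoint_left.1 hdisj) hl h) c
    set J := (∏ a ∈ X.arcsIn S1, X.term a) * ((∏ l ∈ S1, X.e l (X.coord l X.rho)) * I) with hJ
    have hJmem : J ∈ X.fixSwaps SI := mul_mem (prod_mem fun a ha => hterm1 a ha)
      (mul_mem (prod_mem fun l hl => he1 l hl _) (X.fixSwaps_anti hSIsub hI))
    have step1 := ih (γ.2.val - (γ.1.val + 1)) (by omega) (γ.1.val + 1) γ.2.val (by omega)
      (by omega) hcl2 ((hS2sub.trans hSIsub).trans hB)
      (X.term γ * (X.e γ.1 (X.coord γ.1 X.rho) * X.e γ.2 (X.coord γ.2 X.rho)) * J)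
      (mul_mem (mul_mem (X.term_mem_fixSwaps (Or.inl hS2sub)) (mul_mem
        (X.e_mem_fixSwaps (fun h => hn1 (Finset.mem_insert_of_mem h)) _)
        (X.e_mem_fixSwaps hn2 _))) (X.fixSwaps_anti hS2sub hJmem))
    have step2 := map_arc hL hγ (hSIsub.trans hB) hJmem
    have step3 := ih (γ.1.val - i) (by omega) i γ.1.val (by omega) (by omega) hcl1
      (hS1sub.trans hB) ((∏ b ∈ X.arcsIn SI, X.ac b (X.pot (γ.2.val + 1))) * I)
      (mul_mem (prod_mem fun b hb => X.ac_mem (fun c => X.z_mem_fixSwaps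
        (fun h => Finset.disjoint_left.1 hdisj h (X.mem_arcsIn.1 hb).2.1)
        (fun h => Finset.disjoint_left.1 hdisj h (X.mem_arcsIn.1 hb).2.2) c) _)
        (X.fixSwaps_anti hS1sub hI))
    have hsd : seg (m + n) i j \ X.supp = S1 \ X.supp := by
      rw [hsplit]; exact X.union_sdiff_supp (X.Icc_subset_supp hγ)
    have hsd2 : S2 \ X.supp = ∅ := Finset.sdiff_eq_empty_iff_subset.2
      (hS2sub.trans (X.Icc_subset_supp hγ))
    rw [← hSI] at step2
    rw [← hS2, hsd2, Finset.prod_empty, one_mul, ← harc2, step2] at step1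
    rw [← hS1, X.pot_arc hγ, hvj] at step3
    rw [hvj] at step1
    rw [harc, Finset.prod_union harcdisj, Finset.prod_union harcdisj, hsd, hsplit,
      Finset.prod_union hdisj, hsplit2, Finset.prod_insert hn1, Finset.prod_insert hn2,
      ← hsplit2, ← Finset.mul_prod_erase _ X.term hγI]
    refine Eq.trans (congrArg L ?_) (step1.trans (Eq.trans (congrArg L ?_)
      (step3.trans (congrArg L ?_))))
    · rw [hJ]; ring
    · rw [hJ]; ring
    · ring
  · have hsplit : seg (m + n) i j = insert v (seg (m + n) i v.val) := by
      ext l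
      simp only [mem_seg, Finset.mem_insert, Fin.ext_iff]
      omega
    have hvn : v ∉ seg (m + n) i v.val := by simp [mem_seg]
    have hva : ∀ a ∈ X.arcs, a.1 ≠ v ∧ a.2 ≠ v := fun a ha =>
      ⟨fun h => hvs (X.mem_supp.2 ⟨a, ha, Or.inl h.symm⟩),
        fun h => hvs (X.mem_supp.2 ⟨a, ha, Or.inr h.symm⟩)⟩
    have harc : X.arcsIn (seg (m + n) i j) = X.arcsIn (seg (m + n) i v.val) := by
      ext a
      simp only [mem_arcsIn, hsplit, Finset.mem_insert]
      constructor
      · rintro ⟨h1, h2, h3⟩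
        have := hva a h1
        tauto
      · tauto
    have hcl' : X.ArcClosed (seg (m + n) i v.val) := by
      intro a ha
      have h1 := hcl a ha
      have h2 := hva a ha
      simp only [hsplit, Finset.mem_insert] at h1
      tauto
    have hsub : seg (m + n) i v.val ⊆ seg (m + n) i j := hsplit ▸ Finset.subset_insert _ _
    have step1 := ih (v.val - i) (by omega) i v.val (by omega) (by omega) hcl' (hsub.trans hB)
      (X.e v (X.coord v X.rho) * I)
      (mul_mem (X.e_mem_fixSwaps hvn _) (X.fixSwaps_anti hsub hI))
    have step2 := map_shift hL (hB hvS) hvs (hsub.trans hB) hvn (hsplit ▸ hI)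
    rw [hvj] at step2
    rw [harc, hsplit, Finset.prod_insert hvn, Finset.insert_sdiff_of_notMem _ hvs,
      Finset.prod_insert (fun h => hvn (Finset.mem_sdiff.1 h).1)]
    refine Eq.trans (congrArg L ?_) (step1.trans (Eq.trans (congrArg L ?_)
      (step2.trans (congrArg L ?_)))) <;> ring

end ArcDiagram

end SuperDenominator

namespace SuperDenominator

/-! ### Averaging over sign changes -/

section FieldIdentities

variable {F : Type*} [Field F]

theorem sub_ne_zero_of_add_inv {x y : F} (hx : x ≠ 0) (hy : y ≠ 0)
    (h : (x + x⁻¹) - (y + y⁻¹) ≠ 0) : x - y ≠ 0 ∧ x * y - 1 ≠ 0 := by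
  have : (x + x⁻¹) - (y + y⁻¹) = (x - y) * (x * y - 1) * (x * y)⁻¹ := by
    field_simp; ring
  rw [this] at h
  exact ⟨fun h' => h (by simp [h']), fun h' => h (by simp [h'])⟩

theorem average_half_left {p q : F} (hp : p ≠ 0) (hq : q ≠ 0)
    (h : (p * p + (p * p)⁻¹) - (q * q + (q * q)⁻¹) ≠ 0) :
    p⁻¹ * q * (1 - (p * p)⁻¹ * (q * q))⁻¹ - p * q * (1 - (p * p) * (q * q))⁻¹ =
      (p - p⁻¹) * (q + q⁻¹) * ((p * p + (p * p)⁻¹) - (q * q + (q * q)⁻¹))⁻¹ := by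
  obtain ⟨h1, h2⟩ := sub_ne_zero_of_add_inv (mul_ne_zero hp hp) (mul_ne_zero hq hq) h
  have h1' : p ^ 2 - q ^ 2 ≠ 0 := by rwa [sq, sq]
  have h2' : p ^ 2 * q ^ 2 - 1 ≠ 0 := by rwa [sq, sq]
  have e1 : (p * p + (p * p)⁻¹) - (q * q + (q * q)⁻¹) =
      (p ^ 2 - q ^ 2) * (p ^ 2 * q ^ 2 - 1) * (p ^ 2 * q ^ 2)⁻¹ := by field_simp; ring
  have e2 : 1 - (p * p)⁻¹ * (q * q) = (p ^ 2 - q ^ 2) * (p * p)⁻¹ := by field_simp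
  have e3 : 1 - (p * p) * (q * q) = -(p ^ 2 * q ^ 2 - 1) := by ring
  rw [e1, e2, e3]
  field_simp
  ring

theorem average_half_right {p q : F} (hp : p ≠ 0) (hq : q ≠ 0)
    (h : (p * p + (p * p)⁻¹) - (q * q + (q * q)⁻¹) ≠ 0) :
    p⁻¹ * q * (1 - (p * p)⁻¹ * (q * q))⁻¹ + p⁻¹ * q⁻¹ * (1 - (p * p)⁻¹ * (q * q)⁻¹)⁻¹ =
      (p - p⁻¹) * (q + q⁻¹) * ((p * p + (p * p)⁻¹) - (q * q + (q * q)⁻¹))⁻¹ := by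
  obtain ⟨h1, h2⟩ := sub_ne_zero_of_add_inv (mul_ne_zero hp hp) (mul_ne_zero hq hq) h
  have h1' : p ^ 2 - q ^ 2 ≠ 0 := by rwa [sq, sq]
  have h2' : p ^ 2 * q ^ 2 - 1 ≠ 0 := by rwa [sq, sq]
  have e1 : (p * p + (p * p)⁻¹) - (q * q + (q * q)⁻¹) =
      (p ^ 2 - q ^ 2) * (p ^ 2 * q ^ 2 - 1) * (p ^ 2 * q ^ 2)⁻¹ := by field_simp; ring
  have e2 : 1 - (p * p)⁻¹ * (q * q) = (p ^ 2 - q ^ 2) * (p * p)⁻¹ := by field_simp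
  have e3 : 1 - (p * p)⁻¹ * (q * q)⁻¹ = (p ^ 2 * q ^ 2 - 1) * (p ^ 2 * q ^ 2)⁻¹ := by
    field_simp
  rw [e1, e2, e3]
  field_simp
  ring

theorem average_one_right {x y : F} (hx : x ≠ 0) (hy : y ≠ 0)
    (h : (x + x⁻¹) - (y + y⁻¹) ≠ 0) :
    x⁻¹ * y * (1 - x⁻¹ * y)⁻¹ - x⁻¹ * y⁻¹ * (1 - x⁻¹ * y⁻¹)⁻¹ =
      (y - y⁻¹) * ((x + x⁻¹) - (y + y⁻¹))⁻¹ := by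
  obtain ⟨h1, h2⟩ := sub_ne_zero_of_add_inv hx hy h
  have e1 : (x + x⁻¹) - (y + y⁻¹) = (x - y) * (x * y - 1) * (x * y)⁻¹ := by field_simp; ring
  have e2 : 1 - x⁻¹ * y = (x - y) * x⁻¹ := by field_simp
  have e3 : 1 - x⁻¹ * y⁻¹ = (x * y - 1) * (x * y)⁻¹ := by field_simp
  rw [e1, e2, e3]
  field_simp
  ring

theorem average_one_left {x y : F} (hx : x ≠ 0) (hy : y ≠ 0)
    (h : (x + x⁻¹) - (y + y⁻¹) ≠ 0) :
    x⁻¹ * y * (1 - x⁻¹ * y)⁻¹ + x * y * (1 - x * y)⁻¹ =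
      (y - y⁻¹) * ((x + x⁻¹) - (y + y⁻¹))⁻¹ - 1 := by
  obtain ⟨h1, h2⟩ := sub_ne_zero_of_add_inv hx hy h
  have e1 : (x + x⁻¹) - (y + y⁻¹) = (x - y) * (x * y - 1) * (x * y)⁻¹ := by field_simp; ring
  have e2 : 1 - x⁻¹ * y = (x - y) * x⁻¹ := by field_simp
  have e3 : 1 - x * y = -(x * y - 1) := by ring
  rw [e1, e2, e3]
  field_simp
  ring

end FieldIdentities

namespace OrderedBasis

variable {t : SuperType} {m n : ℕ} (X : OrderedBasis t m n)

theorem V_eq (ht : t ≠ SuperType.gl) (i : Fin (m + n)) :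
    X.V i = X.e i 1 + (X.e i 1)⁻¹ := by rw [V, if_neg ht, e_neg]

theorem V_eq_half (ht : t ≠ SuperType.gl) (i : Fin (m + n)) :
    X.V i = X.e i (1 / 2) * X.e i (1 / 2) + (X.e i (1 / 2) * X.e i (1 / 2))⁻¹ := by
  rw [X.V_eq ht, e_half_mul_self]

theorem act_flip_V (ht : t ≠ SuperType.gl) (i j : Fin (m + n)) :
    act (X.flip i) (X.V j) = X.V j := by
  rw [V, if_neg ht, map_add, act_flip_e, act_flip_e]
  split_ifs
  · rw [neg_neg, add_comm]
  · rfl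

theorem act_perm_V (σ : Equiv.Perm (Fin (m + n))) (i : Fin (m + n)) :
    act (X.perm σ) (X.V i) = X.V (σ i) := by
  rw [V, V]; split_ifs <;> simp

theorem act_perm_tailQ {σ : Equiv.Perm (Fin (m + n))} (i : Fin (m + n))
    (h : X.inE (σ i) = X.inE i) : act (X.perm σ) (X.tailQ i) = X.tailQ (σ i) := by
  have hη : X.eta (σ i) = X.eta i := X.inE_eq_iff_eta.1 h
  cases t with
  | gl => simp only [tailQ, act_perm_e, hη]
  | B => simp only [tailQ, h]; split_ifs <;> simp
  | D => simp only [tailQ, h]; split_ifs <;> simp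

end OrderedBasis

namespace ArcDiagram

open OrderedBasis (potEnd)

variable {t : SuperType} {m n : ℕ} (X : ArcDiagram t m n)

/-- The factor of an arc in a generalized Cauchy determinant. -/
noncomputable def arcQ (a : Fin (m + n) × Fin (m + n)) : RatFun m n :=
  X.tailQ a.1 * X.tailQ a.2 * (X.V a.1 - X.V a.2)⁻¹

theorem endOf_of_inE {a : Fin (m + n) × Fin (m + n)} (h : X.inE a.1 = true) :
    X.endOf true a = a.1 ∧ X.endOf false a = a.2 := by
  simp [endOf, h]

theorem endOf_of_not_inE {a : Fin (m + n) × Fin (m + n)} (h : X.inE a.1 = false) :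
    X.endOf true a = a.2 ∧ X.endOf false a = a.1 := by
  simp [endOf, h]

theorem arcQ_eq {a : Fin (m + n) × Fin (m + n)} : X.arcQ a =
    X.sg a * (X.tailQ (X.endOf true a) * X.tailQ (X.endOf false a) *
      (X.V (X.endOf true a) - X.V (X.endOf false a))⁻¹) := by
  cases h : X.inE a.1
  · obtain ⟨h1, h2⟩ := X.endOf_of_not_inE h
    have h3 : (X.V a.1 - X.V a.2)⁻¹ = -(X.V a.2 - X.V a.1)⁻¹ := by
      rw [← neg_sub]; exact inv_neg
    rw [h1, h2, arcQ, sg, if_neg (by simp [h]), h3]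
    ring
  · obtain ⟨h1, h2⟩ := X.endOf_of_inE h
    rw [h1, h2, arcQ, sg, if_pos h, one_mul]

theorem V_sub_ne_zero {a : Fin (m + n) × Fin (m + n)} (ha : a ∈ X.arcs) :
    X.V (X.endOf true a) - X.V (X.endOf false a) ≠ 0 :=
  sub_ne_zero.2 (X.V_injective.ne (X.endOf_true_ne_false ha ha))

theorem act_sg (w : Weight m n ≃ₗ[ℚ] Weight m n) (a : Fin (m + n) × Fin (m + n)) :
    act w (X.sg a) = X.sg a := by
  unfold sg; split_ifs <;> simp

theorem act_flip_ac {c : Bool} {a : Fin (m + n) × Fin (m + n)} (ha : a ∈ X.arcs) (d : ℚ) :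
    act (X.flip (X.endOf c a)) (X.ac a d) = X.sg a *
      (X.e (X.endOf true a) (if c = true then d else -d) *
        X.e (X.endOf false a) (if c = true then d else -d)) *
      (1 - X.e (X.endOf true a) (if c = true then 1 else -1) *
        X.e (X.endOf false a) (if c = true then 1 else -1))⁻¹ := by
  have hne := X.endOf_true_ne_false ha ha
  rw [ac, map_mul, map_mul, act_sg, map_inv₀, map_sub, map_one, z, z, map_mul, map_mul]
  simp only [OrderedBasis.act_flip_e]
  cases c
  · simp [hne]
  · simp [hne.symm]

theorem ac_gl (ht : t = SuperType.gl) {a : Fin (m + n) × Fin (m + n)} (ha : a ∈ X.arcs) :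
    X.ac a (potEnd t m n) = X.arcQ a := by
  subst ht
  have h1 := X.V_sub_ne_zero ha
  rw [arcQ_eq, ac, z, z]
  simp only [OrderedBasis.V, if_true, OrderedBasis.tailQ, OrderedBasis.eta, X.inE_endOf _ ha,
    potEnd] at h1 ⊢
  have e1 : (1 - 1 * ((m : ℚ) - n)) / 2 = -((1 + (m - n)) / 2) + 1 := by ring
  have e2 : (1 - (if false = true then 1 else -1) * ((m : ℚ) - n)) / 2 = (1 + (m - n)) / 2 := by
    rw [if_neg (by simp)]; ring
  rw [e1, e2, OrderedBasis.e_add, OrderedBasis.e_neg _ _ 1]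
  have hx := X.e_ne_zero (X.endOf true a) 1
  have h2 : 1 - (X.e (X.endOf true a) 1)⁻¹ * X.e (X.endOf false a) 1 =
      (X.e (X.endOf true a) 1 - X.e (X.endOf false a) 1) * (X.e (X.endOf true a) 1)⁻¹ := by
    field_simp
  rw [h2]
  field_simp

theorem ac_add_flip (ht : t ≠ SuperType.gl) (c : Bool) (hc : ¬ (t = SuperType.D ∧ c = true))
    {a : Fin (m + n) × Fin (m + n)} (ha : a ∈ X.arcs) :
    X.ac a (potEnd t m n) + (X.kap (X.endOf c a) : RatFun m n) *
      act (X.flip (X.endOf c a)) (X.ac a (potEnd t m n)) = X.arcQ a := by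
  have h1 := X.V_sub_ne_zero ha
  have hx := X.e_ne_zero (X.endOf true a)
  have hy := X.e_ne_zero (X.endOf false a)
  rw [act_flip_ac X ha, ac, arcQ_eq, OrderedBasis.kap, X.inE_endOf c ha, z, z]
  cases t with
  | gl => exact absurd rfl ht
  | B =>
    rw [X.V_eq_half ht, X.V_eq_half ht] at h1 ⊢
    simp only [OrderedBasis.tailQ, X.inE_endOf _ ha, potEnd]
    cases c
    · have := average_half_right (hx (1 / 2)) (hy (1 / 2)) h1
      simp only [if_true, Bool.false_eq_true, if_false]
      simp only [OrderedBasis.e_neg, ← OrderedBasis.e_half_mul_self _ _ 1]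
      simp [-one_div, -mul_inv_rev] at this ⊢
      linear_combination X.sg a * this
    · have := average_half_left (hx (1 / 2)) (hy (1 / 2)) h1
      simp only [if_true, Bool.false_eq_true, if_false]
      simp only [OrderedBasis.e_neg, ← OrderedBasis.e_half_mul_self _ _ 1]
      simp [-one_div, -mul_inv_rev] at this ⊢
      linear_combination X.sg a * this
  | D =>
    cases c
    · rw [X.V_eq ht, X.V_eq ht] at h1 ⊢
      have := average_one_right (hx 1) (hy 1) h1
      simp only [Bool.false_eq_true, if_false]
      simp only [OrderedBasis.e_neg, OrderedBasis.tailQ, X.inE_endOf _ ha, potEnd]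
      simp at this ⊢
      linear_combination X.sg a * this
    · exact absurd ⟨rfl, rfl⟩ hc

theorem ac_add_flip_D (ht : t = SuperType.D) {a : Fin (m + n) × Fin (m + n)} (ha : a ∈ X.arcs) :
    X.ac a (potEnd t m n) + act (X.flip (X.endOf true a)) (X.ac a (potEnd t m n)) =
      X.arcQ a - X.sg a := by
  subst ht
  have h1 := X.V_sub_ne_zero ha
  have hx := X.e_ne_zero (X.endOf true a)
  have hy := X.e_ne_zero (X.endOf false a)
  rw [act_flip_ac X ha, ac, arcQ_eq, z, z]
  rw [X.V_eq (by simp), X.V_eq (by simp)] at h1 ⊢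
  have := average_one_left (hx 1) (hy 1) h1
  simp only [OrderedBasis.e_neg, OrderedBasis.tailQ, X.inE_endOf _ ha, potEnd]
  simp at this ⊢
  linear_combination X.sg a * this

end ArcDiagram

end SuperDenominator

namespace SuperDenominator

open Polynomial in
/-- The polynomials `p_r` with `p_{r+2} = x p_{r+1} - p_r`. -/
noncomputable def recPoly (a b : ℤ) : ℕ → ℤ[X]
  | 0 => C a
  | 1 => X + C b
  | (r + 2) => X * recPoly a b (r + 1) - recPoly a b r

theorem recPoly_natDegree_le (a b : ℤ) (r : ℕ) : (recPoly a b r).natDegree ≤ r ∧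
    (recPoly a b (r + 1)).Monic ∧ (recPoly a b (r + 1)).natDegree = r + 1 := by
  induction r with
  | zero =>
    simp only [recPoly]
    exact ⟨(Polynomial.natDegree_C a).le, Polynomial.monic_X_add_C b, Polynomial.natDegree_X_add_C b⟩
  | succ r ih =>
    obtain ⟨h1, h2, h3⟩ := ih
    have h4 : (Polynomial.X * recPoly a b (r + 1)).Monic := Polynomial.monic_X.mul h2
    have h5 : (Polynomial.X * recPoly a b (r + 1)).natDegree = r + 2 := by
      rw [Polynomial.monic_X.natDegree_mul h2, Polynomial.natDegree_X, h3]; ring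
    have h6 : (recPoly a b r).natDegree < (Polynomial.X * recPoly a b (r + 1)).natDegree := by
      omega
    refine ⟨h3.le, ?_, ?_⟩
    · rw [recPoly]
      exact h4.sub_of_left (Polynomial.degree_lt_degree h6)
    · rw [recPoly, Polynomial.natDegree_sub_eq_left_of_natDegree_lt h6, h5]

theorem recPoly_eval₂ {F : Type*} [CommRing F] (a b : ℤ) (V T : F) (f : ℕ → F)
    (h0 : f 0 = T * a) (h1 : f 1 = T * (V + b)) (h2 : ∀ r, f (r + 2) = V * f (r + 1) - f r)
    (r : ℕ) : f r = T * Polynomial.eval₂ (Int.castRingHom F) V (recPoly a b r) := by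
  induction r using Nat.strong_induction_on with
  | _ r ih =>
    match r with
    | 0 => rw [recPoly, Polynomial.eval₂_C, h0]; rfl
    | 1 => rw [recPoly, Polynomial.eval₂_add, Polynomial.eval₂_C, Polynomial.eval₂_X, h1]; rfl
    | (r + 2) =>
      rw [h2, ih (r + 1) (by omega), ih r (by omega), recPoly, Polynomial.eval₂_sub,
        Polynomial.eval₂_mul, Polynomial.eval₂_X]
      ring

open Polynomial in
/-- The polynomial by which an unmatched vertex with `r` unmatched vertices to its right enters
the generalized Cauchy determinant. -/
noncomputable def unmatchedPoly (t : SuperType) (c : Bool) (r : ℕ) : ℤ[X] :=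
  match t, c with
  | .gl, _ => X ^ r
  | .B, true => recPoly 1 1 r
  | .B, false => recPoly 1 (-1) r
  | .D, true => if r = 0 then 1 else recPoly 2 0 r
  | .D, false => recPoly 1 0 r

theorem unmatchedPoly_monic (t : SuperType) (c : Bool) (r : ℕ) : (unmatchedPoly t c r).Monic ∧
    (unmatchedPoly t c r).natDegree = r := by
  have key : ∀ b, (recPoly 1 b r).Monic ∧ (recPoly 1 b r).natDegree = r := by
    intro b
    cases r with
    | zero => simp [recPoly, Polynomial.monic_one]
    | succ r => exact (recPoly_natDegree_le 1 b r).2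
  cases t with
  | gl => exact ⟨Polynomial.monic_X_pow r, Polynomial.natDegree_X_pow r⟩
  | B => cases c <;> exact key _
  | D =>
    cases c
    · exact key _
    · simp only [unmatchedPoly]
      cases r with
      | zero => simp [Polynomial.monic_one]
      | succ r => rw [if_neg (by omega)]; exact (recPoly_natDegree_le 2 0 r).2

namespace OrderedBasis

variable {t : SuperType} {m n : ℕ} (X : OrderedBasis t m n)

/-- The exponent of the factor of one vertex in the superdenominator. -/
def tailExp (i : Fin (m + n)) : ℚ := if X.inE i = true then 1 - potEnd t m n else potEnd t m n

/-- The sign by which the sign changes of a vertex are averaged. -/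
def avgSign (i : Fin (m + n)) : ℚ := if t = SuperType.D ∧ X.inE i = true then 1 else X.kap i

theorem tailQ_gl (ht : t = SuperType.gl) (i : Fin (m + n)) : X.tailQ i = X.e i (X.tailExp i) := by
  subst ht
  simp only [tailQ, tailExp, potEnd, eta]
  congr 1
  split_ifs <;> ring

theorem average_vertex (ht : t ≠ SuperType.gl) (i : Fin (m + n)) (r : ℕ)
    (hr : t = SuperType.D → X.inE i = true → r ≠ 0) :
    X.e i (r + X.tailExp i) + (X.avgSign i : RatFun m n) * X.e i (-(r + X.tailExp i)) =
      X.tailQ i * Polynomial.eval₂ (Int.castRingHom _) (X.V i) (unmatchedPoly t (X.inE i) r) := by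
  have hrec : ∀ s : ℕ, X.e i ((s + 2 : ℕ) + X.tailExp i) +
      (X.avgSign i : RatFun m n) * X.e i (-((s + 2 : ℕ) + X.tailExp i)) =
      X.V i * (X.e i ((s + 1 : ℕ) + X.tailExp i) +
        (X.avgSign i : RatFun m n) * X.e i (-((s + 1 : ℕ) + X.tailExp i))) -
      (X.e i (s + X.tailExp i) + (X.avgSign i : RatFun m n) * X.e i (-(s + X.tailExp i))) := by
    intro s
    have e1 : ((s + 2 : ℕ) : ℚ) + X.tailExp i = s + X.tailExp i + 1 + 1 := by push_cast; ring
    have e2 : ((s + 1 : ℕ) : ℚ) + X.tailExp i = s + X.tailExp i + 1 := by push_cast; ring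
    have hx := X.e_ne_zero i 1
    have hy := X.e_ne_zero i (s + X.tailExp i)
    generalize (s : ℚ) + X.tailExp i = d at *
    rw [e1, e2, X.V_eq ht, e_neg, e_neg, e_neg, e_add _ _ (d + 1) 1, e_add _ _ d 1]
    field_simp
    ring
  have key : ∀ a b : ℤ, X.e i (X.tailExp i) + (X.avgSign i : RatFun m n) *
      X.e i (-(X.tailExp i)) = X.tailQ i * a → X.e i (1 + X.tailExp i) +
      (X.avgSign i : RatFun m n) * X.e i (-(1 + X.tailExp i)) = X.tailQ i * (X.V i + b) →
      X.e i (r + X.tailExp i) + (X.avgSign i : RatFun m n) * X.e i (-(r + X.tailExp i)) =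
        X.tailQ i * Polynomial.eval₂ (Int.castRingHom _) (X.V i) (recPoly a b r) := by
    intro a b h0 h1
    refine recPoly_eval₂ a b (X.V i) (X.tailQ i) (fun r => X.e i (r + X.tailExp i) +
      (X.avgSign i : RatFun m n) * X.e i (-(r + X.tailExp i))) ?_ ?_ hrec r
    · simpa using h0
    · simpa using h1
  have hp := X.e_ne_zero i (1 / 2)
  have hp1 := X.e_ne_zero i 1
  have e3 : X.e i (3 / 2) = X.e i (1 / 2) * X.e i (1 / 2) * X.e i (1 / 2) := by
    rw [← e_add, ← e_add]; norm_num
  cases t with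
  | gl => exact absurd rfl ht
  | B =>
    cases h : X.inE i
    · refine key 1 (-1) ?_ ?_
      · simp [tailExp, avgSign, kap, tailQ, potEnd, h]
      · simp only [tailExp, avgSign, kap, tailQ, potEnd, h, X.V_eq_half ht]
        norm_num
        rw [e_neg, e_neg, e3]
        field_simp
        ring
    · have hBD : ¬ SuperType.B = SuperType.D := by simp
      refine key 1 1 ?_ ?_
      · simp [tailExp, avgSign, kap, tailQ, potEnd, h]; norm_num; ring
      · simp only [tailExp, avgSign, kap, tailQ, potEnd, h, X.V_eq_half ht, hBD]
        norm_num
        rw [e_neg, e_neg, e3]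
        field_simp
        ring
  | D =>
    cases h : X.inE i
    · have hDB : ¬ SuperType.D = SuperType.B := by simp
      refine key 1 0 ?_ ?_
      · simp [tailExp, avgSign, kap, tailQ, potEnd, h]; ring
      · simp only [tailExp, avgSign, kap, tailQ, potEnd, h, X.V_eq ht, hDB]
        norm_num
        have e2 : X.e i 2 = X.e i 1 * X.e i 1 := by rw [← e_add]; norm_num
        rw [e_neg, e_neg, e2]
        field_simp
        ring
    · simp only [unmatchedPoly, if_neg (hr rfl h)]
      refine key 2 0 ?_ ?_
      · simp [tailExp, avgSign, tailQ, potEnd, h, e_zero]; norm_num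
      · simp [tailExp, avgSign, tailQ, potEnd, h, X.V_eq ht, e_neg]

end OrderedBasis

namespace ArcDiagram

open OrderedBasis (potEnd)

variable {t : SuperType} {m n : ℕ} (X : ArcDiagram t m n)

/-- The number of unmatched vertices to the right of a vertex. -/
def rk (u : Fin (m + n)) : ℕ := (Finset.univ.filter fun l => u < l ∧ l ∉ X.supp).card

theorem inE_eq_of_notMem {u v : Fin (m + n)} (hu : u ∉ X.supp) (hv : v ∉ X.supp) :
    X.inE u = X.inE v := by
  obtain ⟨c, hc⟩ := X.exists_minor
  have h1 : X.inE u ≠ c := fun h => hu (hc u h)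
  have h2 : X.inE v ≠ c := fun h => hv (hc v h)
  cases c <;> simp at h1 h2 <;> rw [h1, h2]

theorem sum_eta_gt {u : Fin (m + n)} (hu : u ∉ X.supp) :
    ∑ l : Fin (m + n) with u < l, X.eta l = X.rk u * X.eta u := by
  have hcl : X.ArcClosed (Finset.univ.filter fun l => u < l) := by
    intro a ha
    simp only [Finset.mem_filter, Finset.mem_univ, true_and]
    have hlt := X.lt_of_mem a ha
    refine ⟨fun h => h.trans hlt, fun h => ?_⟩
    by_contra h'
    exact hu (X.Icc_subset_supp ha (Finset.mem_Icc.2 ⟨not_lt.1 h', h.le⟩))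
  have := congrArg Multiplicative.toAdd (X.prod_eq_prod_arcsIn hcl
      (fun i => Multiplicative.ofAdd (X.eta i)))
  rw [Finset.prod_eq_one (s := X.arcsIn _)] at this
  · have h2 : (Finset.univ.filter fun l => u < l) \ X.supp =
        Finset.univ.filter fun l => u < l ∧ l ∉ X.supp := by
      ext l; simp
    rw [one_mul, h2] at this
    simp only [toAdd_prod, toAdd_ofAdd] at this
    rw [this, rk, Finset.sum_congr rfl (g := fun _ => X.eta u), Finset.sum_const, nsmul_eq_mul]
    intro l hl
    exact (X.inE_eq_iff_eta.1 (X.inE_eq_of_notMem hu (Finset.mem_filter.1 hl).2.2)).symm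
  · intro a ha
    rw [← ofAdd_add, X.eta_snd (X.mem_arcsIn.1 ha).1, add_neg_cancel, ofAdd_zero]

theorem coord_rho_unmatched {u : Fin (m + n)} (hu : u ∉ X.supp) :
    X.coord u X.rho = X.rk u + X.tailExp u := by
  have h1 : X.pot (u.val + 1) = potEnd t m n - X.rk u * X.eta u := by
    rw [← X.sum_eta_gt hu, OrderedBasis.pot]; rfl
  have h2 := X.pot_succ u
  rw [OrderedBasis.coord_rho, OrderedBasis.tailExp]
  cases h : X.inE u
  · simp only [OrderedBasis.eta, h] at h1
    simp at h1 ⊢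
    rw [h1]; ring
  · simp only [OrderedBasis.eta, h] at h1 h2
    simp at h1 h2 ⊢
    linarith

/-- The factor of an unmatched vertex in the generalized Cauchy determinant. -/
noncomputable def vertexQ (u : Fin (m + n)) : RatFun m n :=
  X.tailQ u * Polynomial.eval₂ (Int.castRingHom _) (X.V u) (unmatchedPoly t (X.inE u) (X.rk u))

variable {X} in
theorem map_average {L : RatFun m n →+ RatFun m n} {S U : Finset (Fin (m + n))} {c : Bool}
    (hsupp : X.supp ⊆ S) (hS : ∀ u ∈ S, u ∉ X.supp → X.inE u = c)
    (K : Fin (m + n) → Subfield (RatFun m n))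
    (hK : ∀ i ∈ S, X.inE i = c → ∀ l, l ∉ insert i U → ∀ x, X.e l x ∈ K i)
    (hU : ∀ u ∈ U, u ∈ S ∧ u ∉ X.supp ∧ X.e u (X.coord u X.rho) = 1 ∧ X.vertexQ u = 1)
    (h1 : ∀ a ∈ X.arcs, ∀ Y ∈ K (X.endOf c a),
      L (2 * X.ac a (potEnd t m n) * Y) = L (X.arcQ a * Y))
    (h2 : ∀ u ∈ (S \ X.supp) \ U, ∀ Y ∈ K u,
      L (2 * X.e u (X.coord u X.rho) * Y) = L (X.vertexQ u * Y)) {I : RatFun m n}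
    (hI : ∀ i ∈ S, X.inE i = c → I ∈ K i) :
    L (2 ^ (X.arcs.card + ((S \ X.supp) \ U).card) * ((∏ a ∈ X.arcs, X.ac a (potEnd t m n)) *
        ((∏ u ∈ S \ X.supp, X.e u (X.coord u X.rho)) * I))) =
      L ((∏ a ∈ X.arcs, X.arcQ a) * ((∏ u ∈ S \ X.supp, X.vertexQ u) * I)) := by
  have hUs : U ⊆ S \ X.supp := fun u hu => Finset.mem_sdiff.2 ⟨(hU u hu).1, (hU u hu).2.1⟩
  have hV : ∀ K : Subfield (RatFun m n), ∀ l, (∀ x, X.e l x ∈ K) → X.V l ∈ K := by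
    intro K l h
    unfold OrderedBasis.V
    split_ifs
    · exact h _
    · exact add_mem (h _) (h _)
  have hT : ∀ K : Subfield (RatFun m n), ∀ l, (∀ x, X.e l x ∈ K) → X.tailQ l ∈ K := by
    intro K l h
    unfold OrderedBasis.tailQ
    split
    · exact h _
    · split_ifs
      · exact sub_mem (h _) (h _)
      · exact add_mem (h _) (h _)
    · split_ifs
      · exact one_mem _
      · exact sub_mem (h _) (h _)
  have hA : ∀ K : Subfield (RatFun m n), ∀ a, (∀ x, X.e a.1 x ∈ K) → (∀ x, X.e a.2 x ∈ K) →
      X.arcQ a ∈ K := fun K a h h' => mul_mem (mul_mem (hT K _ h) (hT K _ h'))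
        (inv_mem (sub_mem (hV K _ h) (hV K _ h')))
  have hP : ∀ K : Subfield (RatFun m n), ∀ p : Polynomial ℤ, ∀ x ∈ K,
      Polynomial.eval₂ (Int.castRingHom _) x p ∈ K := by
    intro K p x hx
    rw [Polynomial.eval₂_eq_sum_range]
    exact sum_mem fun i _ => mul_mem (intCast_mem K _) (pow_mem hx i)
  have hQ : ∀ K : Subfield (RatFun m n), ∀ u, (∀ x, X.e u x ∈ K) → X.vertexQ u ∈ K :=
    fun K u h => mul_mem (hT K _ h) (hP K _ _ (hV K _ h))
  have hacK : ∀ K : Subfield (RatFun m n), ∀ a, (∀ x, X.e a.1 x ∈ K) → (∀ x, X.e a.2 x ∈ K) →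
      ∀ d, X.ac a d ∈ K := by
    intro K a h h' d
    refine X.ac_mem (fun x => ?_) d
    have : ∀ c x, X.e (X.endOf c a) x ∈ K := by
      intro c x
      rcases X.endOf_eq c a with h'' | h'' <;> rw [h'']
      · exact h x
      · exact h' x
    exact mul_mem (this _ _) (this _ _)
  have hsuppU : ∀ l ∈ X.supp, l ∉ U := fun l hl hl' => (hU l hl').2.1 hl
  have harc : ∀ a ∈ X.arcs, a.1 ∈ X.supp ∧ a.2 ∈ X.supp := fun a ha =>
    ⟨X.mem_supp.2 ⟨a, ha, Or.inl rfl⟩, X.mem_supp.2 ⟨a, ha, Or.inr rfl⟩⟩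
  have hends : ∀ a ∈ X.arcs, ∀ b ∈ X.arcs, b ≠ a → b.1 ∉ insert (X.endOf c a) U ∧
      b.2 ∉ insert (X.endOf c a) U := by
    intro a ha b hb hba
    simp only [Finset.mem_insert, not_or]
    refine ⟨⟨fun h => ?_, hsuppU _ (harc b hb).1⟩, ⟨fun h => ?_, hsuppU _ (harc b hb).2⟩⟩
    · exact hba (X.eq_of_mem_ends hb ha (Or.inl rfl) (h ▸ X.endOf_eq c a))
    · exact hba (X.eq_of_mem_ends hb ha (Or.inr rfl) (h ▸ X.endOf_eq c a))
  have hends' : ∀ u, u ∉ X.supp → ∀ b ∈ X.arcs, b.1 ∉ insert u U ∧ b.2 ∉ insert u U := by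
    intro u hu b hb
    simp only [Finset.mem_insert, not_or]
    exact ⟨⟨fun h => hu (h ▸ (harc b hb).1), hsuppU _ (harc b hb).1⟩,
      ⟨fun h => hu (h ▸ (harc b hb).2), hsuppU _ (harc b hb).2⟩⟩
  have haS : ∀ a ∈ X.arcs, X.endOf c a ∈ S := fun a ha => hsupp (X.endOf_mem_supp c ha)
  have huS : ∀ u ∈ (S \ X.supp) \ U, u ∈ S ∧ u ∉ X.supp ∧ u ∉ U := by
    intro u hu
    rw [Finset.mem_sdiff, Finset.mem_sdiff] at hu
    exact ⟨hu.1.1, hu.1.2, hu.2⟩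
  have two : ∀ K : Subfield (RatFun m n), (2 : RatFun m n) ∈ K := fun K => ofNat_mem K 2
  have e0 : ∏ u ∈ S \ X.supp, X.e u (X.coord u X.rho) =
      ∏ u ∈ (S \ X.supp) \ U, X.e u (X.coord u X.rho) := by
    rw [← Finset.prod_sdiff hUs, Finset.prod_eq_one (s := U) fun u hu => (hU u hu).2.2.1, mul_one]
  have e0' : ∏ u ∈ S \ X.supp, X.vertexQ u = ∏ u ∈ (S \ X.supp) \ U, X.vertexQ u := by
    rw [← Finset.prod_sdiff hUs, Finset.prod_eq_one (s := U) fun u hu => (hU u hu).2.2.2, mul_one]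
  have step1 := map_prod_eq_of_exchange L X.arcs (fun a => 2 * X.ac a (potEnd t m n)) X.arcQ 1
    (fun a => K (X.endOf c a)) (fun a ha Y hY => by rw [one_mul]; exact h1 a ha Y hY)
    (fun a ha b hb hba => by
      have h := hK _ (haS a ha) (X.inE_endOf c ha)
      obtain ⟨h3, h4⟩ := hends a ha b hb hba
      exact ⟨mul_mem (two _) (hacK _ b (h _ h3) (h _ h4) _), hA _ b (h _ h3) (h _ h4)⟩)
    (R := (∏ u ∈ (S \ X.supp) \ U, 2 * X.e u (X.coord u X.rho)) * I)
    (fun a ha => mul_mem (prod_mem fun u hu => mul_mem (two _)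
      (hK _ (haS a ha) (X.inE_endOf c ha) u (by
        rw [Finset.mem_insert, not_or]
        exact ⟨fun h => (huS u hu).2.1 (h ▸ X.endOf_mem_supp c ha), (huS u hu).2.2⟩) _))
      (hI _ (haS a ha) (X.inE_endOf c ha)))
  have step2 := map_prod_eq_of_exchange L ((S \ X.supp) \ U)
    (fun u => 2 * X.e u (X.coord u X.rho)) X.vertexQ 1
    K (fun u hu Y hY => by rw [one_mul]; exact h2 u hu Y hY)
    (fun u hu v hv hvu => by
      have h := hK u (huS u hu).1 (hS u (huS u hu).1 (huS u hu).2.1) v (by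
        rw [Finset.mem_insert, not_or]; exact ⟨hvu, (huS v hv).2.2⟩)
      exact ⟨mul_mem (two _) (h _), hQ _ _ h⟩)
    (R := (∏ a ∈ X.arcs, X.arcQ a) * I)
    (fun u hu => mul_mem (prod_mem fun a ha => by
      have h := hK u (huS u hu).1 (hS u (huS u hu).1 (huS u hu).2.1)
      obtain ⟨h3, h4⟩ := hends' u (huS u hu).2.1 a ha
      exact hA _ a (h _ h3) (h _ h4))
      (hI u (huS u hu).1 (hS u (huS u hu).1 (huS u hu).2.1)))
  rw [e0, e0']
  refine Eq.trans (congrArg L ?_) (step1.trans (Eq.trans (congrArg L ?_)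
    (step2.trans (congrArg L ?_))))
  · simp only [Finset.prod_mul_distrib, Finset.prod_const]; ring
  · ring
  · ring

end ArcDiagram

end SuperDenominator

namespace SuperDenominator

/-- The number of independent sign changes of `k` vertices of type `c` that are available in the
Weyl group. -/
def flipCount (t : SuperType) (c : Bool) (k : ℕ) : ℕ :=
  if t = SuperType.gl then 0 else if t = SuperType.D ∧ c = true then k - 1 else k

namespace ArcDiagram

open OrderedBasis (potEnd)

variable {t : SuperType} {m n : ℕ} (X : ArcDiagram t m n)

/-- `L` transforms under the available sign changes of the vertices of type `c` in `S` as the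
alternating sum over the Weyl group does. -/
def FlipSkew (L : RatFun m n →+ RatFun m n) (S : Finset (Fin (m + n))) (c : Bool) : Prop :=
  (¬ (t = SuperType.D ∧ c = true) → ∀ i ∈ S, X.inE i = c → ∀ Y,
    L (act (X.flip i) Y) = (X.kap i : RatFun m n) * L Y) ∧
  (t = SuperType.D → c = true → ∀ i ∈ S, ∀ j ∈ S, i ≠ j → X.inE i = c → X.inE j = c → ∀ Y,
    L (act (X.flip i * X.flip j) Y) = L Y)

theorem kap_cast_mul_self (i : Fin (m + n)) : (X.kap i : RatFun m n) * X.kap i = 1 := by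
  rw [← Rat.cast_mul, X.kap_mul_self, Rat.cast_one]

variable {X} in
theorem map_average_flips (ht : t ≠ SuperType.gl) {L : RatFun m n →+ RatFun m n}
    {S : Finset (Fin (m + n))} {c : Bool} (hL : X.Alternating L S) (hF : X.FlipSkew L S c)
    (hsupp : X.supp ⊆ S) (hS : ∀ u ∈ S, u ∉ X.supp → X.inE u = c)
    (hD : t = SuperType.D → c = true → ∃ u ∈ S, u ∉ X.supp ∧ X.rk u = 0) {I : RatFun m n}
    (hI : I ∈ X.fixSwaps S) (hI' : ∀ i ∈ S, act (X.flip i) I = I) :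
    2 ^ flipCount t c (X.arcs.card + (S \ X.supp).card) *
        L ((∏ a ∈ X.arcs, X.ac a (potEnd t m n)) *
          ((∏ u ∈ S \ X.supp, X.e u (X.coord u X.rho)) * I)) =
      L ((∏ a ∈ X.arcs, X.arcQ a) * ((∏ u ∈ S \ X.supp, X.vertexQ u) * I)) := by
  have hpow : ∀ (k : ℕ) Y, L (2 ^ k * Y) = 2 ^ k * L Y := by
    intro k Y
    have : ((2 ^ k : ℕ) : RatFun m n) = 2 ^ k := by push_cast; rfl
    rw [← this, ← nsmul_eq_mul, map_nsmul, nsmul_eq_mul]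
  have hmemS : ∀ a ∈ X.arcs, X.endOf c a ∈ S := fun a ha => hsupp (X.endOf_mem_supp c ha)
  by_cases hc : t = SuperType.D ∧ c = true
  · obtain ⟨u, huS, hus, hrk⟩ := hD hc.1 hc.2
    obtain ⟨htD, rfl⟩ := hc
    have huE := hS u huS hus
    have hTu : X.tailExp u = 0 := by
      subst htD
      simp [OrderedBasis.tailExp, huE, potEnd]
    have hcount : flipCount t true (X.arcs.card + (S \ X.supp).card) =
        X.arcs.card + ((S \ X.supp) \ {u}).card := by
      have h1 : u ∈ S \ X.supp := Finset.mem_sdiff.2 ⟨huS, hus⟩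
      have h2 : 0 < (S \ X.supp).card := Finset.card_pos.2 ⟨u, h1⟩
      rw [flipCount, if_neg ht, if_pos ⟨htD, rfl⟩, Finset.sdiff_singleton_eq_erase,
        Finset.card_erase_of_mem h1]
      omega
    rw [← hpow, hcount]
    have hflip : ∀ i ∈ S, i ≠ u → X.inE i = true → ∀ f Y : RatFun m n,
        act (X.flip i * X.flip u) Y = Y → act (X.flip u) f = f →
        L (act (X.flip i) f * Y) = L (f * Y) := by
      intro i hi hiu hiE f Y hY hf
      rw [← hF.2 htD rfl i hi u huS hiu hiE huE (f * Y), map_mul (act _), hY, act_mul, hf]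
    refine map_average hsupp hS (U := {u}) (fun i => fixedField (act (X.flip i * X.flip u)) ⊓
      fixedField (X.actSwap i u)) ?_ ?_ ?_ ?_ ?_
    · intro i hi hiE l hl x
      simp only [Finset.mem_insert, Finset.mem_singleton, not_or] at hl
      rw [Subfield.mem_inf, mem_fixedField, mem_fixedField]
      constructor
      · rw [act_mul, OrderedBasis.act_flip_e, if_neg hl.2, OrderedBasis.act_flip_e, if_neg hl.1]
      · rw [OrderedBasis.actSwap_e, Equiv.swap_apply_of_ne_of_ne hl.1 hl.2]
    · intro v hv
      rw [Finset.mem_singleton] at hv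
      subst hv
      refine ⟨huS, hus, ?_, ?_⟩
      · rw [X.coord_rho_unmatched hus, hrk, hTu, Nat.cast_zero, add_zero, OrderedBasis.e_zero]
      · subst htD
        simp [vertexQ, huE, unmatchedPoly, hrk, OrderedBasis.tailQ]
    · intro a ha Y hY
      rw [Subfield.mem_inf, mem_fixedField, mem_fixedField] at hY
      have hau : ∀ c, X.endOf c a ≠ u := fun c h => hus (h ▸ X.endOf_mem_supp c ha)
      have hE := X.inE_endOf true ha
      have hac : act (X.flip u) (X.ac a (potEnd t m n)) = X.ac a (potEnd t m n) := by
        rw [ac, z, z, map_mul, map_mul, act_sg, map_inv₀, map_sub, map_one, map_mul, map_mul]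
        simp only [OrderedBasis.act_flip_e, hau, if_false]
      have h1 := hflip _ (hmemS a ha) (hau true) hE (X.ac a (potEnd t m n)) Y hY.1 hac
      have h2 := X.ac_add_flip_D htD ha
      have h3 : L (X.sg a * Y) = 0 := by
        refine hL.eq_zero (hmemS a ha) huS (hau true) (hE.trans huE.symm) ?_
        rw [map_mul, hY.2, OrderedBasis.actSwap, act_sg]
      have h4 : 2 * X.ac a (potEnd t m n) * Y - X.arcQ a * Y =
          (X.ac a (potEnd t m n) * Y - act (X.flip (X.endOf true a)) (X.ac a (potEnd t m n)) * Y) -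
            X.sg a * Y := by linear_combination Y * h2
      rw [← sub_eq_zero, ← map_sub, h4, map_sub, map_sub, h1, h3, sub_self, sub_zero]
    · intro v hv Y hY
      rw [Finset.mem_sdiff, Finset.mem_sdiff, Finset.mem_singleton] at hv
      obtain ⟨⟨hvS, hvs⟩, hvu⟩ := hv
      rw [Subfield.mem_inf, mem_fixedField, mem_fixedField] at hY
      have hvE := hS v hvS hvs
      have hrv : X.rk v ≠ 0 := by
        intro h0
        rw [rk, Finset.card_eq_zero, Finset.filter_eq_empty_iff] at h0 hrk
        have c1 := @h0 u (Finset.mem_univ _)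
        have c2 := @hrk v (Finset.mem_univ _)
        rcases lt_or_gt_of_ne hvu with h | h
        · exact c1 ⟨h, hus⟩
        · exact c2 ⟨h, hvs⟩
      have h1 := hflip v hvS hvu hvE (X.e v (X.coord v X.rho)) Y hY.1 (by
        rw [OrderedBasis.act_flip_e, if_neg hvu])
      have h2 := X.average_vertex ht v (X.rk v) (fun _ _ => hrv)
      rw [← X.coord_rho_unmatched hvs, OrderedBasis.avgSign, if_pos ⟨htD, hvE⟩, Rat.cast_one,
        one_mul] at h2
      rw [OrderedBasis.act_flip_e, if_pos rfl] at h1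
      rw [vertexQ, ← h2, two_mul, add_mul, add_mul, map_add, map_add, h1]
    · intro i hi hiE
      rw [Subfield.mem_inf, mem_fixedField, mem_fixedField]
      exact ⟨by rw [act_mul, hI' u huS, hI' i hi],
        X.mem_fixSwaps.1 hI i hi u huS (hiE.trans huE.symm)⟩
  · have hcount : flipCount t c (X.arcs.card + (S \ X.supp).card) =
        X.arcs.card + ((S \ X.supp) \ ∅).card := by
      rw [flipCount, if_neg ht, if_neg hc, Finset.sdiff_empty]
    rw [← hpow, hcount]
    have hflip : ∀ i ∈ S, X.inE i = c → ∀ f Y : RatFun m n, act (X.flip i) Y = Y →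
        L ((X.kap i : RatFun m n) * act (X.flip i) f * Y) = L (f * Y) := by
      intro i hi hiE f Y hY
      have h1 := hF.1 hc i hi hiE (f * Y)
      have h2 := X.kap_cast_mul_self i
      rw [map_mul, hY] at h1
      have h3 : L (act (X.flip i) f * Y) = (X.kap i : RatFun m n) * L (f * Y) := h1
      rcases (by unfold OrderedBasis.kap; split_ifs <;> simp : X.kap i = 1 ∨ X.kap i = -1)
        with h | h
      · rw [h] at h3 ⊢
        simpa using h3
      · rw [h] at h3 ⊢
        simp at h3
        simp [h3]
    refine map_average hsupp hS (U := ∅) (fun i => fixedField (act (X.flip i))) ?_ ?_ ?_ ?_ ?_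
    · intro i hi hiE l hl x
      simp only [insert_empty_eq, Finset.mem_singleton] at hl
      rw [mem_fixedField, OrderedBasis.act_flip_e, if_neg hl]
    · simp
    · intro a ha Y hY
      rw [mem_fixedField] at hY
      have h1 := hflip _ (hmemS a ha) (X.inE_endOf c ha) (X.ac a (potEnd t m n)) Y hY
      rw [← X.ac_add_flip ht c hc ha, two_mul, add_mul, add_mul, map_add, map_add, h1]
    · intro v hv Y hY
      rw [mem_fixedField] at hY
      rw [Finset.sdiff_empty, Finset.mem_sdiff] at hv
      have hvE := hS v hv.1 hv.2
      have h1 := hflip v hv.1 hvE (X.e v (X.coord v X.rho)) Y hY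
      have hc' : ¬ (t = SuperType.D ∧ X.inE v = true) := by rwa [hvE]
      have h2 := X.average_vertex ht v (X.rk v) (fun h h' => absurd ⟨h, h'⟩ hc')
      rw [← X.coord_rho_unmatched hv.2, OrderedBasis.avgSign, if_neg hc'] at h2
      rw [OrderedBasis.act_flip_e, if_pos rfl] at h1
      rw [vertexQ, ← h2, two_mul, add_mul, add_mul, map_add, map_add, h1]
    · intro i hi hiE
      exact hI' i hi

theorem tail_unmatched_gl (ht : t = SuperType.gl) {u : Fin (m + n)} (hu : u ∉ X.supp) :
    X.e u (X.coord u X.rho) = X.vertexQ u := by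
  rw [X.coord_rho_unmatched hu, vertexQ, X.tailQ_gl ht, add_comm, OrderedBasis.e_add]
  congr 1
  subst ht
  simp only [unmatchedPoly, OrderedBasis.V, if_true, Polynomial.eval₂_pow, Polynomial.eval₂_X]
  rw [OrderedBasis.e, OrderedBasis.e, one_smul]
  induction X.rk u with
  | zero => simp [expo_zero]
  | succ r ih => rw [pow_succ, ← ih, ← expo_add]; push_cast; congr 1; module

variable {X} in
/-- Averaging over the sign changes of the vertices of type `c`, in all types. -/
theorem map_separate {L : RatFun m n →+ RatFun m n} {S : Finset (Fin (m + n))} {c : Bool}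
    (hL : X.Alternating L S) (hF : t ≠ SuperType.gl → X.FlipSkew L S c)
    (hsupp : X.supp ⊆ S) (hS : ∀ u ∈ S, u ∉ X.supp → X.inE u = c)
    (hD : t = SuperType.D → c = true → ∃ u ∈ S, u ∉ X.supp ∧ X.rk u = 0) {I : RatFun m n}
    (hI : I ∈ X.fixSwaps S) (hI' : ∀ i ∈ S, act (X.flip i) I = I) :
    2 ^ flipCount t c (X.arcs.card + (S \ X.supp).card) *
        L ((∏ a ∈ X.arcs, X.ac a (potEnd t m n)) *
          ((∏ u ∈ S \ X.supp, X.e u (X.coord u X.rho)) * I)) =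
      L ((∏ a ∈ X.arcs, X.arcQ a) * ((∏ u ∈ S \ X.supp, X.vertexQ u) * I)) := by
  by_cases ht : t = SuperType.gl
  · rw [flipCount, if_pos ht, pow_zero, one_mul]
    congr 2
    · exact Finset.prod_congr rfl fun a ha => X.ac_gl ht ha
    · congr 1
      exact Finset.prod_congr rfl fun u hu => X.tail_unmatched_gl ht (Finset.mem_sdiff.1 hu).2
  · exact map_average_flips ht hL (hF ht) hsupp hS hD hI hI'

variable {X} in
theorem map_P {L : RatFun m n →+ RatFun m n} {i : ℕ} {S : Finset (Fin (m + n))} {c : Bool}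
    (hSi : S = seg (m + n) i (m + n)) (hi : i ≤ m + n)
    (hL : X.Alternating L S) (hF : t ≠ SuperType.gl → X.FlipSkew L S c)
    (hsupp : X.supp ⊆ S) (hS : ∀ u ∈ S, u ∉ X.supp → X.inE u = c)
    (hD : t = SuperType.D → c = true → ∃ u ∈ S, u ∉ X.supp) :
    2 ^ flipCount t c (X.arcs.card + (S \ X.supp).card) * L X.P =
      L ((∏ a ∈ X.arcs, X.arcQ a) * ((∏ u ∈ S \ X.supp, X.vertexQ u) *
        ∏ l ∈ Sᶜ, X.e l (X.coord l X.rho))) := by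
  have harc : X.arcsIn S = X.arcs := by
    ext a
    rw [mem_arcsIn]
    exact ⟨fun h => h.1, fun h => ⟨h, hsupp (X.mem_supp.2 ⟨a, h, Or.inl rfl⟩),
      hsupp (X.mem_supp.2 ⟨a, h, Or.inr rfl⟩)⟩⟩
  have hcl : X.ArcClosed S := fun a ha =>
    ⟨fun _ => hsupp (X.mem_supp.2 ⟨a, ha, Or.inr rfl⟩),
      fun _ => hsupp (X.mem_supp.2 ⟨a, ha, Or.inl rfl⟩)⟩
  have hI : ∏ l ∈ Sᶜ, X.e l (X.coord l X.rho) ∈ X.fixSwaps S :=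
    prod_mem fun l hl => X.e_mem_fixSwaps (Finset.mem_compl.1 hl) _
  have hI' : ∀ i ∈ S, act (X.flip i) (∏ l ∈ Sᶜ, X.e l (X.coord l X.rho)) =
      ∏ l ∈ Sᶜ, X.e l (X.coord l X.rho) := by
    intro i hi
    rw [map_prod]
    refine Finset.prod_congr rfl fun l hl => ?_
    rw [OrderedBasis.act_flip_e, if_neg]
    rintro rfl
    exact Finset.mem_compl.1 hl hi
  have h1 := map_seg hL (m + n - i) i (m + n) (by omega) le_rfl (hSi ▸ hcl) (hSi ▸ subset_rfl)
    _ (hSi ▸ hI)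
  rw [← hSi, harc, OrderedBasis.pot_last] at h1
  rw [← map_separate hL hF hsupp hS ?_ hI hI', ← h1, P_eq]
  · congr 2
    rw [← Finset.prod_mul_prod_compl S]
    rfl
  · intro ht hc
    obtain ⟨u, hu, hus⟩ := hD ht hc
    obtain ⟨v, hv, hvmax⟩ := Finset.exists_max_image (Finset.univ \ X.supp) id
      ⟨u, Finset.mem_sdiff.2 ⟨Finset.mem_univ _, hus⟩⟩
    have hvs := (Finset.mem_sdiff.1 hv).2
    have huv : u ≤ v := hvmax u (Finset.mem_sdiff.2 ⟨Finset.mem_univ _, hus⟩)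
    refine ⟨v, ?_, hvs, ?_⟩
    · rw [hSi, mem_seg] at hu ⊢
      exact ⟨hu.1.trans huv, v.isLt⟩
    · rw [rk, Finset.card_eq_zero, Finset.filter_eq_empty_iff]
      rintro w _ ⟨h1, h2⟩
      exact not_le.2 h1 (hvmax w (Finset.mem_sdiff.2 ⟨Finset.mem_univ _, h2⟩))

end ArcDiagram

end SuperDenominator

namespace SuperDenominator

/-! ### Products over pairs -/

section PairProd

variable {ι M : Type*} [LinearOrder ι] [CommMonoid M]

/-- The product of `g i j` over the pairs `i < j` in `S`. -/
def pairProd (S : Finset ι) (g : ι → ι → M) : M :=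
  ∏ p ∈ (S ×ˢ S).filter (fun p => p.1 < p.2), g p.1 p.2

theorem pairProd_congr {S : Finset ι} {g h : ι → ι → M}
    (H : ∀ i ∈ S, ∀ j ∈ S, i < j → g i j = h i j) : pairProd S g = pairProd S h := by
  refine Finset.prod_congr rfl fun p hp => ?_
  rw [Finset.mem_filter, Finset.mem_product] at hp
  exact H _ hp.1.1 _ hp.1.2 hp.2

theorem pairProd_mul (S : Finset ι) (g h : ι → ι → M) :
    pairProd S (fun i j => g i j * h i j) = pairProd S g * pairProd S h :=
  Finset.prod_mul_distrib

@[simp] theorem pairProd_empty (g : ι → ι → M) : pairProd (∅ : Finset ι) g = 1 := by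
  simp [pairProd]

theorem pairProd_insert {S : Finset ι} {v : ι} (hv : v ∉ S) {g : ι → ι → M}
    (hg : ∀ i j, g i j = g j i) :
    pairProd (insert v S) g = pairProd S g * ∏ i ∈ S, g v i := by
  have h1 : (insert v S ×ˢ insert v S).filter (fun p => p.1 < p.2) =
      (S ×ˢ S).filter (fun p => p.1 < p.2) ∪ S.image fun i => if v < i then (v, i) else (i, v) := by
    ext ⟨a, b⟩
    simp only [Finset.mem_filter, Finset.mem_product, Finset.mem_insert, Finset.mem_union,
      Finset.mem_image]
    constructor
    · rintro ⟨⟨rfl | ha, rfl | hb⟩, hlt⟩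
      · exact absurd hlt (lt_irrefl _)
      · exact Or.inr ⟨b, hb, if_pos hlt⟩
      · exact Or.inr ⟨a, ha, if_neg (not_lt.2 hlt.le)⟩
      · exact Or.inl ⟨⟨ha, hb⟩, hlt⟩
    · rintro (⟨⟨ha, hb⟩, hlt⟩ | ⟨i, hi, h⟩)
      · exact ⟨⟨Or.inr ha, Or.inr hb⟩, hlt⟩
      · have hne : i ≠ v := fun h => hv (h ▸ hi)
        split_ifs at h with h2 <;> obtain ⟨rfl, rfl⟩ := Prod.mk.inj h
        · exact ⟨⟨Or.inl rfl, Or.inr hi⟩, h2⟩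
        · exact ⟨⟨Or.inr hi, Or.inl rfl⟩, lt_of_le_of_ne (not_lt.1 h2) hne⟩
  rw [pairProd, h1, Finset.prod_union, Finset.prod_image]
  · congr 1
    refine Finset.prod_congr rfl fun i _ => ?_
    split_ifs
    · rfl
    · exact hg _ _
  · intro i hi j hj h
    have hi' : i ≠ v := fun h => hv (h ▸ hi)
    have hj' : j ≠ v := fun h => hv (h ▸ hj)
    simp only at h
    split_ifs at h <;> simp_all
  · rw [Finset.disjoint_left]
    rintro p hp hp'
    rw [Finset.mem_filter, Finset.mem_product] at hp
    obtain ⟨i, hi, rfl⟩ := Finset.mem_image.1 hp'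
    split_ifs at hp
    · exact hv hp.1.1
    · exact hv hp.1.2

theorem pairProd_union {S T : Finset ι} (h : Disjoint S T) {g : ι → ι → M}
    (hg : ∀ i j, g i j = g j i) :
    pairProd (S ∪ T) g = pairProd S g * pairProd T g * ∏ i ∈ S, ∏ j ∈ T, g i j := by
  induction T using Finset.induction_on with
  | empty => simp
  | insert v T hv ih =>
    rw [Finset.disjoint_insert_right] at h
    have hvS : v ∉ S ∪ T := by simp [hv, h.1]
    rw [Finset.union_insert, pairProd_insert hvS hg, ih h.2, pairProd_insert hv hg,
      Finset.prod_union h.2]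
    simp only [Finset.prod_insert hv, Finset.prod_mul_distrib]
    rw [Finset.prod_congr rfl fun i _ => hg i v]
    ac_rfl

theorem pairProd_image {S : Finset ι} {φ : ι → ι} (hφ : Set.InjOn φ S) {g : ι → ι → M}
    (hg : ∀ i j, g i j = g j i) :
    pairProd (S.image φ) g = pairProd S (fun i j => g (φ i) (φ j)) := by
  induction S using Finset.induction_on with
  | empty => simp
  | insert v S hv ih =>
    have h1 : φ v ∉ S.image φ := by
      intro h
      obtain ⟨i, hi, h⟩ := Finset.mem_image.1 h
      exact hv (hφ (by simp [hi]) (by simp) h ▸ hi)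
    have h2 : Set.InjOn φ S := hφ.mono (by simp)
    rw [Finset.image_insert, pairProd_insert h1 hg, ih h2, pairProd_insert hv (fun i j => hg _ _),
      Finset.prod_image h2]

theorem prod_erase_eq_pairProd (S : Finset ι) (f : ι → ι → M) :
    ∏ i ∈ S, ∏ j ∈ S.erase i, f i j = pairProd S fun i j => f i j * f j i := by
  induction S using Finset.induction_on with
  | empty => simp
  | insert v S hv ih =>
    rw [pairProd_insert hv (fun i j => mul_comm _ _), ← ih, Finset.prod_insert hv,
      Finset.erase_insert hv]
    have : ∀ i ∈ S, ∏ j ∈ (insert v S).erase i, f i j = f i v * ∏ j ∈ S.erase i, f i j := by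
      intro i hi
      have hne : v ≠ i := fun h => hv (h ▸ hi)
      rw [Finset.erase_insert_of_ne hne, Finset.prod_insert (fun h => hv (Finset.mem_of_mem_erase h))]
    rw [Finset.prod_congr rfl this, Finset.prod_mul_distrib, Finset.prod_mul_distrib]
    ac_rfl

end PairProd

/-! ### Generalized Vandermonde determinants -/

section Vandermonde

variable {η F : Type*} [LinearOrder η] [Fintype η] [Field F]

theorem pairProd_univ_orderIso {M : Type*} [CommMonoid M] {N : ℕ} (e : Fin N ≃o η)
    (g : η → η → M) :
    ∏ i : Fin N, ∏ j ∈ Finset.Ioi i, g (e i) (e j) = pairProd Finset.univ g := by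
  rw [pairProd, Finset.prod_sigma']
  refine Finset.prod_bij' (fun p _ => (e p.1, e p.2)) (fun p _ => ⟨e.symm p.1, e.symm p.2⟩)
    ?_ ?_ ?_ ?_ ?_
  · rintro ⟨i, j⟩ h; simpa using h
  · rintro ⟨i, j⟩ h; simpa using h
  · rintro ⟨i, j⟩ h; simp
  · rintro ⟨i, j⟩ h; simp
  · rintro ⟨i, j⟩ h; rfl

theorem exists_det_eval_eq (f : η → Polynomial F) (hf : ∀ i, (f i).natDegree < Fintype.card η) :
    ∃ c : F, ∀ x : η → F, Matrix.det (Matrix.of fun j i => (f i).eval (x j)) =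
      c * pairProd Finset.univ fun i j => x i - x j := by
  let e : Fin (Fintype.card η) ≃o η := Fintype.orderIsoFinOfCardEq η rfl
  let G : Matrix (Fin (Fintype.card η)) (Fin (Fintype.card η)) F :=
    Matrix.of fun l i => (f (e i)).coeff l
  refine ⟨G.det * pairProd (Finset.univ : Finset η) fun _ _ => -1, fun x => ?_⟩
  have h1 : (Matrix.of fun j i => (f i).eval (x j)).submatrix e.toEquiv e.toEquiv =
      Matrix.vandermonde (fun i => x (e i)) * G := by
    ext j i
    rw [Matrix.mul_apply, Matrix.submatrix_apply, Matrix.of_apply,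
      Polynomial.eval_eq_sum_range' (hf _), Finset.sum_range]
    refine Finset.sum_congr rfl fun l _ => ?_
    rw [Matrix.vandermonde_apply]
    exact mul_comm _ _
  rw [← Matrix.det_submatrix_equiv_self e.toEquiv, h1, Matrix.det_mul, Matrix.det_vandermonde,
    pairProd_univ_orderIso e (fun i j => x j - x i), mul_comm, mul_assoc, ← pairProd_mul]
  simp

theorem det_eval_monic (f : η → Polynomial F) (hf : ∀ i, (f i).Monic)
    (hd : ∀ i, (f i).natDegree = (Finset.univ.filter fun j => i < j).card) (x : η → F) :
    Matrix.det (Matrix.of fun j i => (f i).eval (x j)) =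
      pairProd Finset.univ fun i j => x i - x j := by
  let e : Fin (Fintype.card η) ≃o η := Fintype.orderIsoFinOfCardEq η rfl
  have hcard : ∀ i : Fin (Fintype.card η), (f (e i.rev)).natDegree = i := by
    intro i
    have : (Finset.univ.filter fun j => e i.rev < j) = (Finset.Ioi i.rev).map e.toEquiv.toEmbedding := by
      ext j
      simp only [Finset.mem_filter, Finset.mem_univ, true_and, Finset.mem_map_equiv,
        Finset.mem_Ioi]
      exact (e.lt_symm_apply).symm
    rw [hd, this, Finset.card_map, Fin.card_Ioi, Fin.val_rev]
    omega
  rw [← Matrix.det_submatrix_equiv_self (Fin.revPerm.trans e.toEquiv)]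
  have h1 := Matrix.det_eval_matrixOfPolynomials_eq_det_vandermonde
    (fun i => x (e i.rev)) (fun i => f (e i.rev)) hcard (fun i => hf _)
  refine Eq.trans ?_ (h1.symm.trans ?_)
  · congr 1
  · rw [Matrix.det_vandermonde, ← pairProd_univ_orderIso e (fun i j => x i - x j),
      Finset.prod_sigma', Finset.prod_sigma']
    refine Finset.prod_bij' (fun p _ => ⟨p.2.rev, p.1.rev⟩) (fun p _ => ⟨p.2.rev, p.1.rev⟩)
      ?_ ?_ ?_ ?_ ?_
    · rintro ⟨i, j⟩ h; simpa using h
    · rintro ⟨i, j⟩ h; simpa using h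
    · rintro ⟨i, j⟩ h; simp
    · rintro ⟨i, j⟩ h; simp
    · rintro ⟨i, j⟩ h; rfl

end Vandermonde

end SuperDenominator

namespace SuperDenominator

/-! ### A generalized Cauchy determinant -/

section Cauchy

variable {ι F : Type*} [LinearOrder ι] [Field F]

/-- The sign of the relative position of `i` and `j`. -/
def posSign (F : Type*) [Field F] (i j : ι) : F := if i < j then 1 else -1

theorem posSign_mul_self (i j : ι) : posSign F i j * posSign F i j = 1 := by
  unfold posSign; split_ifs <;> simp

/-- The difference of `x i` and `x j` in which the smaller index comes first. -/
def ordSub (x : ι → F) (i j : ι) : F := if i < j then x i - x j else x j - x i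

theorem ordSub_eq {x : ι → F} {i j : ι} : ordSub x i j = posSign F i j * (x i - x j) := by
  unfold ordSub posSign; split_ifs <;> ring

theorem ordSub_comm (x : ι → F) (i j : ι) : ordSub x i j = ordSub x j i := by
  unfold ordSub
  rcases lt_trichotomy i j with h | rfl | h
  · rw [if_pos h, if_neg (not_lt.2 h.le)]
  · rfl
  · rw [if_pos h, if_neg (not_lt.2 h.le)]

theorem pairProd_ordSub (S : Finset ι) (x : ι → F) :
    pairProd S (ordSub x) = pairProd S fun i j => x i - x j :=
  pairProd_congr fun i _ j _ h => by rw [ordSub, if_pos h]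

variable [Fintype ι]

theorem pairProd_subtype {M : Type*} [CommMonoid M] (Q : ι → Prop) [DecidablePred Q]
    (g : ι → ι → M) : pairProd (Finset.univ : Finset {i // Q i}) (fun i j => g i j) =
      pairProd (Finset.univ.filter Q) g := by
  unfold pairProd
  refine Finset.prod_bij' (fun p _ => (p.1.1, p.2.1))
    (fun p hp => (⟨p.1, ?_⟩, ⟨p.2, ?_⟩)) ?_ ?_ ?_ ?_ ?_
  · simp at hp; exact hp.1.1
  · simp at hp; exact hp.1.2
  · rintro ⟨⟨i, hi⟩, ⟨j, hj⟩⟩ h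
    simp at h ⊢
    exact ⟨⟨hi, hj⟩, h⟩
  · rintro ⟨i, j⟩ h
    simp at h ⊢
    exact h.2
  · rintro ⟨i, j⟩ h; rfl
  · rintro ⟨i, j⟩ h; rfl
  · rintro ⟨i, j⟩ h; rfl

variable (P : ι → Prop) [DecidablePred P] (κ : ι → ι) (x : ι → F) (p : ι → Polynomial F)

/-- The entries of the generalized Cauchy determinant: `κ` is the matching, and the indices that
are fixed by `κ` are unmatched. -/
noncomputable def cauchyEntry (i : ι) (y : F) : F :=
  if κ i = i then (p i).eval y else posSign F i (κ i) * (y - x (κ i))⁻¹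

open Polynomial in
/-- The numerators of the entries, as polynomials. -/
noncomputable def cauchyNum (i : ι) : F[X] :=
  if κ i = i then p i * ∏ d with ¬ P d, (X - C (x d)) else
    ∏ d ∈ (Finset.univ.filter fun d => ¬ P d).erase (κ i), (X - C (x d))

variable {P κ x p}

theorem cauchyEntry_mul (hx : Function.Injective x) (hC : ∀ i, P i → κ i = i ∨ ¬ P (κ i))
    {i j : ι} (hi : P i) (hj : P j) :
    (∏ d with ¬ P d, (x j - x d)) * cauchyEntry κ x p i (x j) =
      (if κ i = i then 1 else posSign F i (κ i)) * (cauchyNum P κ x p i).eval (x j) := by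
  unfold cauchyEntry cauchyNum
  split_ifs with h
  · rw [Polynomial.eval_mul, Polynomial.eval_prod]
    simp [mul_comm]
  · have h1 : κ i ∈ Finset.univ.filter fun d => ¬ P d := by
      simpa using (hC i hi).resolve_left h
    rw [← Finset.mul_prod_erase _ _ h1, Polynomial.eval_prod]
    simp only [Polynomial.eval_sub, Polynomial.eval_X, Polynomial.eval_C]
    have h2 : x j - x (κ i) ≠ 0 := by
      rw [sub_ne_zero]
      refine hx.ne ?_
      rintro rfl
      exact (Finset.mem_filter.1 h1).2 hj
    field_simp

theorem det_cauchyNum (hκ : Function.Involutive κ)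
    (hm : ∀ d, ¬ P d → P (κ d)) (hC : ∀ i, P i → κ i = i ∨ ¬ P (κ i))
    (hp : ∀ i, P i → κ i = i → (p i).Monic ∧
      (p i).natDegree = (Finset.univ.filter fun j => P j ∧ κ j = j ∧ i < j).card) :
    Matrix.det (Matrix.of fun (j i : {i // P i}) => (cauchyNum P κ x p i).eval (x (κ j))) =
      (∏ d with ¬ P d, ∏ e ∈ (Finset.univ.filter fun d => ¬ P d).erase d, (x d - x e)) *
      ((∏ u with P u ∧ κ u = u, ∏ d with ¬ P d, (x u - x d)) *
        pairProd (Finset.univ.filter fun u => P u ∧ κ u = u) (ordSub x)) := by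
  have htri := Matrix.twoBlockTriangular_det'
    (Matrix.of fun (j i : {i // P i}) => (cauchyNum P κ x p i).eval (x (κ j)))
    (fun i => κ i ≠ i) (by
      intro j hj i hi
      have hj' : ¬ P (κ j) := (hC j j.2).resolve_left hj
      rw [not_not] at hi
      rw [Matrix.of_apply, cauchyNum, if_pos hi, Polynomial.eval_mul, Polynomial.eval_prod,
        Finset.prod_eq_zero (i := κ j.1) (by simpa using hj'), mul_zero]
      simp)
  rw [htri]
  have hset : (Finset.univ.filter fun d => ¬ P d) =
      (Finset.univ : Finset {j : {i // P i} // κ j ≠ j}).image fun j => κ j.1.1 := by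
    ext d
    simp only [Finset.mem_filter, Finset.mem_univ, true_and, Finset.mem_image]
    constructor
    · intro hd
      refine ⟨⟨⟨κ d, hm d hd⟩, ?_⟩, hκ d⟩
      change κ (κ d) ≠ κ d
      rw [hκ d]
      intro h
      exact hd (h ▸ hm d hd)
    · rintro ⟨⟨j, hj⟩, rfl⟩
      exact (hC j j.2).resolve_left hj
  have hb1 : (Matrix.toSquareBlockProp
      (Matrix.of fun (j i : {i // P i}) => (cauchyNum P κ x p i).eval (x (κ j)))
      (fun i => κ i ≠ i)).det =
      ∏ d with ¬ P d, ∏ e ∈ (Finset.univ.filter fun d => ¬ P d).erase d, (x d - x e) := by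
    have hdiag : Matrix.toSquareBlockProp
        (Matrix.of fun (j i : {i // P i}) => (cauchyNum P κ x p i).eval (x (κ j)))
        (fun i => κ i ≠ i) = Matrix.diagonal fun j =>
          ∏ e ∈ (Finset.univ.filter fun d => ¬ P d).erase (κ j.1.1), (x (κ j.1.1) - x e) := by
      ext j i
      rw [Matrix.toSquareBlockProp, Matrix.toBlock_apply, Matrix.of_apply, cauchyNum, if_neg i.2,
        Polynomial.eval_prod]
      simp only [Polynomial.eval_sub, Polynomial.eval_X, Polynomial.eval_C]
      by_cases hij : j = i
      · subst hij
        rw [Matrix.diagonal_apply_eq]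
      · rw [Matrix.diagonal_apply_ne _ hij]
        refine Finset.prod_eq_zero (i := κ j.1.1) ?_ (sub_self _)
        rw [Finset.mem_erase]
        refine ⟨fun h => hij ?_, ?_⟩
        · exact Subtype.ext (Subtype.ext (hκ.injective h))
        · simpa using (hC j.1 j.1.2).resolve_left j.2
    rw [hdiag, Matrix.det_diagonal]
    conv_rhs => rw [hset]
    rw [Finset.prod_image]
    · rw [hset]
    · intro a _ b _ h
      exact Subtype.ext (Subtype.ext (hκ.injective h))
  have hb2 : (Matrix.toSquareBlockProp
      (Matrix.of fun (j i : {i // P i}) => (cauchyNum P κ x p i).eval (x (κ j)))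
      (fun i => ¬ κ i ≠ i)).det =
      (∏ u with P u ∧ κ u = u, ∏ d with ¬ P d, (x u - x d)) *
        pairProd (Finset.univ.filter fun u => P u ∧ κ u = u) (ordSub x) := by
    have h1 : Matrix.toSquareBlockProp
        (Matrix.of fun (j i : {i // P i}) => (cauchyNum P κ x p i).eval (x (κ j)))
        (fun i => ¬ κ i ≠ i) = Matrix.of fun j i => (∏ d with ¬ P d, (x j.1.1 - x d)) *
          Matrix.of (fun (j i : {j : {i // P i} // ¬ κ j ≠ j}) => (p i.1.1).eval (x j.1.1)) j i := by
      ext j i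
      have hi := not_not.1 i.2
      have hj := not_not.1 j.2
      rw [Matrix.toSquareBlockProp, Matrix.toBlock_apply, Matrix.of_apply, cauchyNum, if_pos hi,
        Polynomial.eval_mul, Polynomial.eval_prod, hj, Matrix.of_apply, Matrix.of_apply]
      simp [mul_comm]
    let e : {j : {i // P i} // ¬ κ j ≠ j} ≃o {u // P u ∧ κ u = u} :=
      { toFun := fun j => ⟨j.1.1, j.1.2, not_not.1 j.2⟩
        invFun := fun u => ⟨⟨u.1, u.2.1⟩, not_not.2 u.2.2⟩
        left_inv := fun _ => rfl
        right_inv := fun _ => rfl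
        map_rel_iff' := Iff.rfl }
    rw [h1, Matrix.det_mul_column]
    have h2 : ∏ j : {j : {i // P i} // ¬ κ j ≠ j}, ∏ d with ¬ P d, (x j.1.1 - x d) =
        ∏ u with P u ∧ κ u = u, ∏ d with ¬ P d, (x u - x d) := by
      rw [← Finset.prod_subtype_eq_prod_filter, Finset.subtype_univ]
      exact Fintype.prod_equiv e.toEquiv _ _ fun _ => rfl
    have h3 : Matrix.det (Matrix.of fun (j i : {j : {i // P i} // ¬ κ j ≠ j}) =>
        (p i.1.1).eval (x j.1.1)) =
        pairProd (Finset.univ.filter fun u => P u ∧ κ u = u) (ordSub x) := by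
      have h4 := det_eval_monic (fun u : {u // P u ∧ κ u = u} => p u.1)
        (fun u => (hp u u.2.1 u.2.2).1) (fun u => by
          rw [(hp u u.2.1 u.2.2).2]
          refine Finset.card_bij' (fun j hj => ⟨j, ?_⟩) (fun j _ => j.1) ?_ ?_ ?_ ?_
          · simp only [Finset.mem_filter, Finset.mem_univ, true_and] at hj; exact ⟨hj.1, hj.2.1⟩
          · intro j hj; simp only [Finset.mem_filter, Finset.mem_univ, true_and] at hj ⊢
            exact hj.2.2
          · intro j hj; simp only [Finset.mem_filter, Finset.mem_univ, true_and] at hj ⊢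
            exact ⟨j.2.1, j.2.2, hj⟩
          · intro j hj; rfl
          · intro j hj; rfl) (fun u => x u.1)
      rw [pairProd_ordSub, ← pairProd_subtype (fun u => P u ∧ κ u = u) (fun i j => x i - x j),
        ← h4]
      refine Eq.trans ?_ (Matrix.det_submatrix_equiv_self e.toEquiv _)
      congr!
    rw [h2, h3]
  rw [hb1, hb2]

theorem natDegree_cauchyNum (hκ : Function.Involutive κ)
    (hm : ∀ d, ¬ P d → P (κ d)) (hC : ∀ i, P i → κ i = i ∨ ¬ P (κ i))
    (hp : ∀ i, P i → κ i = i → (p i).Monic ∧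
      (p i).natDegree = (Finset.univ.filter fun j => P j ∧ κ j = j ∧ i < j).card)
    {i : ι} (hi : P i) : (cauchyNum P κ x p i).natDegree < (Finset.univ.filter P).card := by
  have hinj : (Finset.univ.filter fun d => ¬ P d).image κ ⊆
      Finset.univ.filter fun j => P j ∧ κ j ≠ j := by
    intro j hj
    obtain ⟨d, hd, rfl⟩ := Finset.mem_image.1 hj
    have hd' := (Finset.mem_filter.1 hd).2
    refine Finset.mem_filter.2 ⟨Finset.mem_univ _, hm d hd', ?_⟩
    rw [hκ d]
    intro h
    exact hd' (h ▸ hm d hd')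
  have hcard := Finset.card_le_card hinj
  rw [Finset.card_image_of_injective _ hκ.injective] at hcard
  unfold cauchyNum
  split_ifs with h
  · have h1 : (∏ d with ¬ P d, (Polynomial.X - Polynomial.C (x d))).Monic :=
      Polynomial.monic_prod_of_monic _ _ fun d _ => Polynomial.monic_X_sub_C _
    have h2 : (Finset.univ.filter P).card = (Finset.univ.filter fun j => P j ∧ κ j ≠ j).card +
        (Finset.univ.filter fun j => P j ∧ κ j = j).card := by
      rw [← Finset.filter_filter, ← Finset.filter_filter, add_comm]
      exact (Finset.card_filter_add_card_filter_not _).symm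
    have h3 : (Finset.univ.filter fun j => P j ∧ κ j = j ∧ i < j).card <
        (Finset.univ.filter fun j => P j ∧ κ j = j).card := by
      apply Finset.card_lt_card
      refine ⟨fun j hj => ?_, fun hs => ?_⟩
      · simp only [Finset.mem_filter, Finset.mem_univ, true_and] at hj ⊢
        exact ⟨hj.1, hj.2.1⟩
      · have := @hs i (by simp [hi, h])
        simp at this
    rw [(hp i hi h).1.natDegree_mul h1, (hp i hi h).2,
      Polynomial.natDegree_prod_of_monic _ _ fun d _ => Polynomial.monic_X_sub_C _]
    simp only [Polynomial.natDegree_X_sub_C, Finset.sum_const, smul_eq_mul, mul_one]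
    omega
  · have h1 : κ i ∈ Finset.univ.filter fun d => ¬ P d := by simpa using (hC i hi).resolve_left h
    rw [Polynomial.natDegree_prod_of_monic _ _ fun d _ => Polynomial.monic_X_sub_C _]
    simp only [Polynomial.natDegree_X_sub_C, Finset.sum_const, smul_eq_mul, mul_one]
    have h2 := Finset.card_erase_lt_of_mem h1
    have h3 : (Finset.univ.filter fun j => P j ∧ κ j ≠ j).card ≤ (Finset.univ.filter P).card :=
      Finset.card_le_card fun j hj => by simp at hj ⊢; exact hj.1
    omega

theorem det_cauchyEntry (hx : Function.Injective x) (hκ : Function.Involutive κ)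
    (hm : ∀ d, ¬ P d → P (κ d)) (hC : ∀ i, P i → κ i = i ∨ ¬ P (κ i))
    (hp : ∀ i, P i → κ i = i → (p i).Monic ∧
      (p i).natDegree = (Finset.univ.filter fun j => P j ∧ κ j = j ∧ i < j).card)
    (hu : ∀ u, P u → κ u = u → ∀ d, ¬ P d → (u < d ↔ u < κ d))
    (hd : ∀ d e, ¬ P d → ¬ P e → d < e →
      posSign F (κ d) e * posSign F (κ e) d = -posSign F (κ d) (κ e)) :
    Matrix.det (Matrix.of fun (j i : {i // P i}) => cauchyEntry κ x p i (x j)) =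
      pairProd Finset.univ fun i j => if P i ↔ P j then ordSub x i j else (ordSub x i j)⁻¹ := by
  set m := Finset.univ.filter fun d => ¬ P d with hmdef
  set U := Finset.univ.filter fun u => P u ∧ κ u = u with hU
  set C := Finset.univ.filter P with hCdef
  have hdisj : Disjoint C m := Finset.disjoint_filter_filter_not _ _ _
  have huniv : (Finset.univ : Finset ι) = C ∪ m := (Finset.filter_union_filter_not_eq _ _).symm
  have hCU : C = U ∪ m.image κ := by
    ext i
    simp only [hCdef, hU, hmdef, Finset.mem_filter, Finset.mem_univ, true_and, Finset.mem_union,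
      Finset.mem_image]
    constructor
    · intro hi
      rcases hC i hi with h | h
      · exact Or.inl ⟨hi, h⟩
      · exact Or.inr ⟨κ i, h, hκ i⟩
    · rintro (h | ⟨d, hd, rfl⟩)
      · exact h.1
      · exact hm d hd
  have hUm : Disjoint U (m.image κ) := by
    rw [Finset.disjoint_left]
    intro i hi hi'
    obtain ⟨d, hd, rfl⟩ := Finset.mem_image.1 hi'
    have h1 := (Finset.mem_filter.1 hi).2.2
    rw [hκ d] at h1
    exact (Finset.mem_filter.1 hd).2 (h1 ▸ hm d (Finset.mem_filter.1 hd).2)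
  have hmP : ∀ d ∈ m, ¬ P d := fun d hd => (Finset.mem_filter.1 hd).2
  have hκm : ∀ d ∈ m, κ (κ d) ≠ κ d := by
    intro d hd h
    rw [hκ d] at h
    exact hmP d hd (h ▸ hm d (hmP d hd))
  have id1 : (∏ j ∈ C, ∏ d ∈ m, (x j - x d)) *
      Matrix.det (Matrix.of fun (j i : {i // P i}) => cauchyEntry κ x p i (x j)) =
      (∏ d ∈ m, posSign F (κ d) d) *
        Matrix.det (Matrix.of fun (j i : {i // P i}) => (cauchyNum P κ x p i).eval (x j)) := by
    have h1 : ∏ j ∈ C, ∏ d ∈ m, (x j - x d) = ∏ j : {i // P i}, ∏ d ∈ m, (x j - x d) :=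
      (Finset.prod_subtype C (by simp [hCdef]) _)
    have h2 : ∏ d ∈ m, posSign F (κ d) d =
        ∏ i : {i // P i}, if κ i = i then 1 else posSign F i.1 (κ i) := by
      rw [← Finset.prod_subtype C (by simp [hCdef])
        (fun i => if κ i = i then 1 else posSign F i (κ i)), hCU, Finset.prod_union hUm,
        Finset.prod_eq_one (fun u hu => if_pos (Finset.mem_filter.1 hu).2.2), one_mul,
        Finset.prod_image (fun a _ b _ h => hκ.injective h)]
      refine Finset.prod_congr rfl fun d hd => ?_
      rw [if_neg (hκm d hd), hκ d]
    rw [h1, h2, ← Matrix.det_mul_column, ← Matrix.det_mul_row]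
    congr 1
    ext j i
    exact cauchyEntry_mul hx hC i.2 j.2
  obtain ⟨γ, hγ⟩ := exists_det_eval_eq (fun i : {i // P i} => cauchyNum P κ x p i)
    (fun i => by
      rw [Fintype.card_subtype]; exact natDegree_cauchyNum hκ hm hC hp i.2)
  have hγ' : ∀ y : ι → F, Matrix.det (Matrix.of fun (j i : {i // P i}) =>
      (cauchyNum P κ x p i).eval (y j)) = γ * pairProd C fun i j => y i - y j := by
    intro y
    refine Eq.trans ?_ ((hγ (fun i => y i)).trans ?_)
    · congr!
    · rw [← pairProd_subtype P (fun i j => y i - y j)]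
  have id2 := det_cauchyNum (x := x) hκ hm hC hp
  rw [hγ' (fun j => x (κ j))] at id2
  rw [hγ' x] at id1
  have e1 : pairProd C (fun i j => x (κ i) - x (κ j)) =
      pairProd U (ordSub x) * pairProd m (fun d e => ordSub (fun i => x (κ i)) (κ d) (κ e)) *
        ∏ u ∈ U, ∏ d ∈ m, posSign F u d * (x u - x d) := by
    rw [← pairProd_ordSub C (fun i => x (κ i)), hCU, pairProd_union hUm (ordSub_comm _),
      pairProd_image (hκ.injective.injOn) (ordSub_comm _)]
    congr 1
    · congr 1
      refine pairProd_congr fun i hi j hj _ => ?_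
      simp only [ordSub, (Finset.mem_filter.1 hi).2.2, (Finset.mem_filter.1 hj).2.2]
    · refine Finset.prod_congr rfl fun u hu' => ?_
      rw [Finset.prod_image (fun a _ b _ h => hκ.injective h)]
      refine Finset.prod_congr rfl fun d hd' => ?_
      have h1 := (Finset.mem_filter.1 hu').2
      have h2 := hu u h1.1 h1.2 d (hmP d hd')
      rw [ordSub_eq, h1.2, hκ d]
      congr 1
      simp only [posSign, h2]
  have e2 : pairProd (Finset.univ : Finset ι)
      (fun i j => if P i ↔ P j then ordSub x i j else (ordSub x i j)⁻¹) =
      pairProd C (fun i j => x i - x j) * pairProd m (ordSub x) *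
        ∏ i ∈ C, ∏ d ∈ m, (posSign F i d * (x i - x d))⁻¹ := by
    rw [huniv, pairProd_union hdisj]
    · rw [← pairProd_ordSub C x]
      congr 1
      · congr 1
        · refine pairProd_congr fun i hi j hj _ => ?_
          rw [if_pos (iff_of_true (Finset.mem_filter.1 hi).2 (Finset.mem_filter.1 hj).2)]
        · refine pairProd_congr fun i hi j hj _ => ?_
          rw [if_pos (iff_of_false (hmP i hi) (hmP j hj))]
      · refine Finset.prod_congr rfl fun i hi => Finset.prod_congr rfl fun d hd => ?_
        have h1 := (Finset.mem_filter.1 hi).2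
        have h2 := hmP d hd
        rw [if_neg (by tauto), ordSub_eq]
    · intro i j
      rw [ordSub_comm x i j]
      simp only [iff_comm]
  have e3 : (∏ d ∈ m, posSign F (κ d) d) * ∏ d ∈ m, ∏ e ∈ m.erase d, (x d - x e) =
      (∏ d ∈ m, ∏ e ∈ m, posSign F (κ d) e) * pairProd m (ordSub x) *
        pairProd m (fun d e => ordSub (fun i => x (κ i)) (κ d) (κ e)) := by
    have h1 : ∏ d ∈ m, ∏ e ∈ m, posSign F (κ d) e =
        (∏ d ∈ m, posSign F (κ d) d) * ∏ d ∈ m, ∏ e ∈ m.erase d, posSign F (κ d) e := by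
      rw [← Finset.prod_mul_distrib]
      exact Finset.prod_congr rfl fun d hd => (Finset.mul_prod_erase _ _ hd).symm
    rw [h1, mul_assoc, mul_assoc, prod_erase_eq_pairProd, prod_erase_eq_pairProd, ← pairProd_mul,
      ← pairProd_mul]
    congr 1
    refine pairProd_congr fun d hd' e he hlt => ?_
    have h2 := hd d e (hmP d hd') (hmP e he) hlt
    have h3 := posSign_mul_self (F := F) (κ d) (κ e)
    have h4 : posSign F d e = 1 := if_pos hlt
    rw [h2, ordSub_eq, ordSub_eq, hκ d, hκ e, h4]
    linear_combination (x d - x e) * (x d - x e) * h3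
  have e4 : (∏ i ∈ C, ∏ d ∈ m, posSign F i d) =
      (∏ u ∈ U, ∏ d ∈ m, posSign F u d) * ∏ d ∈ m, ∏ e ∈ m, posSign F (κ d) e := by
    rw [hCU, Finset.prod_union hUm, Finset.prod_image (fun a _ b _ h => hκ.injective h)]
  have hne : ∏ i ∈ C, ∏ d ∈ m, (x i - x d) ≠ 0 :=
    Finset.prod_ne_zero_iff.2 fun i hi => Finset.prod_ne_zero_iff.2 fun d hd' =>
      sub_ne_zero.2 (hx.ne fun h => (Finset.disjoint_left.1 hdisj) hi (h ▸ hd'))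
  have hE : (∏ u ∈ U, ∏ d ∈ m, posSign F u d) * ∏ u ∈ U, ∏ d ∈ m, posSign F u d = 1 := by
    simp only [← Finset.prod_mul_distrib, posSign_mul_self, Finset.prod_const_one]
  have hE' : (∏ i ∈ C, ∏ d ∈ m, posSign F i d)⁻¹ = ∏ i ∈ C, ∏ d ∈ m, posSign F i d := by
    apply inv_eq_of_mul_eq_one_left
    simp only [← Finset.prod_mul_distrib, posSign_mul_self, Finset.prod_const_one]
  have hΔ : pairProd C (fun i j => x (κ i) - x (κ j)) ≠ 0 := by
    refine Finset.prod_ne_zero_iff.2 fun q hq => sub_ne_zero.2 (hx.ne (hκ.injective.ne ?_))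
    exact (Finset.mem_filter.1 hq).2.ne
  rw [e2]
  simp only [mul_inv, Finset.prod_mul_distrib, Finset.prod_inv_distrib] at e1 ⊢
  rw [hE', e4]
  apply mul_left_cancel₀ hne
  rw [id1]
  apply mul_left_cancel₀ hΔ
  rw [mul_left_comm (∏ i ∈ C, ∏ d ∈ m, (x i - x d)), mul_left_comm (∏ i ∈ C, ∏ d ∈ m, (x i - x d)),
    mul_inv_cancel₀ hne]
  linear_combination (∏ d ∈ m, posSign F (κ d) d) * pairProd C (fun i j => x i - x j) * id2 +
    pairProd C (fun i j => x i - x j) * ((∏ u ∈ U, ∏ d ∈ m, (x u - x d)) *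
      pairProd U (ordSub x)) * e3 -
    pairProd C (fun i j => x i - x j) * pairProd m (ordSub x) *
      (∏ u ∈ U, ∏ d ∈ m, posSign F u d) * (∏ d ∈ m, ∏ e ∈ m, posSign F (κ d) e) * e1 -
    pairProd C (fun i j => x i - x j) * ((∏ u ∈ U, ∏ d ∈ m, (x u - x d)) *
      pairProd U (ordSub x)) * (∏ d ∈ m, ∏ e ∈ m, posSign F (κ d) e) * pairProd m (ordSub x) *
      pairProd m (fun d e => ordSub (fun i => x (κ i)) (κ d) (κ e)) * hE

end Cauchy

end SuperDenominator

namespace SuperDenominator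

namespace ArcDiagram

variable {t : SuperType} {m n : ℕ} (X : ArcDiagram t m n)

/-- The other end of the arc at a vertex, or the vertex itself if it is unmatched. -/
noncomputable def partner (i : Fin (m + n)) : Fin (m + n) :=
  if h : i ∈ X.supp then X.endOf (!X.inE i) (X.exists_endOf h).choose else i

theorem partner_of_notMem {i : Fin (m + n)} (h : i ∉ X.supp) : X.partner i = i := dif_neg h

theorem partner_endOf {a : Fin (m + n) × Fin (m + n)} (ha : a ∈ X.arcs) (c : Bool) :
    X.partner (X.endOf c a) = X.endOf (!c) a := by
  have h := X.endOf_mem_supp c ha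
  rw [partner, dif_pos h]
  generalize hb : (X.exists_endOf h).choose = b
  obtain ⟨h1, h2⟩ := (X.exists_endOf h).choose_spec
  rw [hb] at h1 h2
  rw [X.inE_endOf c ha] at h2 ⊢
  rw [X.endOf_injOn c h1 ha h2]

theorem partner_involutive : Function.Involutive X.partner := by
  intro i
  by_cases h : i ∈ X.supp
  · obtain ⟨a, ha, h1⟩ := X.exists_endOf h
    rw [← h1, X.partner_endOf ha, X.partner_endOf ha, Bool.not_not]
  · rw [X.partner_of_notMem h, X.partner_of_notMem h]

theorem inE_partner {i : Fin (m + n)} (h : i ∈ X.supp) : X.inE (X.partner i) = !X.inE i := by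
  obtain ⟨a, ha, h1⟩ := X.exists_endOf h
  rw [← h1, X.partner_endOf ha, X.inE_endOf _ ha, h1]

theorem partner_eq_self_iff {i : Fin (m + n)} : X.partner i = i ↔ i ∉ X.supp := by
  refine ⟨fun h h' => ?_, X.partner_of_notMem⟩
  have := X.inE_partner h'
  rw [h] at this
  cases hi : X.inE i <;> simp [hi] at this

theorem lt_iff_lt_partner {u d : Fin (m + n)} (hu : u ∉ X.supp) (hd : d ∈ X.supp) :
    u < d ↔ u < X.partner d := by
  have key : ∀ a ∈ X.arcs, (u < a.1 ↔ u < a.2) := by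
    intro a ha
    have hlt := X.lt_of_mem a ha
    refine ⟨fun h => h.trans hlt, fun h => ?_⟩
    by_contra h'
    exact hu (X.Icc_subset_supp ha (Finset.mem_Icc.2 ⟨not_lt.1 h', h.le⟩))
  obtain ⟨a, ha, h1⟩ := X.exists_endOf hd
  rw [← h1, X.partner_endOf ha]
  have := key a ha
  unfold endOf
  have hdt := X.diffType a ha
  cases h1 : X.inE a.1 <;> cases h2 : X.inE a.2 <;> cases h3 : X.inE d <;>
    simp_all

theorem posSign_partner {d e : Fin (m + n)} (hd : d ∈ X.supp) (he : e ∈ X.supp)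
    (hde : X.inE d = X.inE e) (hlt : d < e) {F : Type*} [Field F] :
    posSign F (X.partner d) e * posSign F (X.partner e) d =
      -posSign F (X.partner d) (X.partner e) := by
  obtain ⟨a, ha, h1⟩ := X.exists_endOf hd
  obtain ⟨b, hb, h2⟩ := X.exists_endOf he
  have hab : a ≠ b := by
    rintro rfl
    rw [hde, h2] at h1
    exact hlt.ne' h1
  obtain ⟨d1, d2, d3, d4⟩ := X.disjoint a ha b hb hab
  have hla := X.lt_of_mem a ha
  have hlb := X.lt_of_mem b hb
  have c1 := X.noCrossing a ha b hb
  have c2 := X.noCrossing b hb a ha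
  have hpd : X.partner d = X.endOf (!X.inE d) a := by rw [← h1, X.partner_endOf ha, h1]
  have hpe : X.partner e = X.endOf (!X.inE d) b := by rw [hde, ← h2, X.partner_endOf hb, h2]
  have key : (X.partner d < e ↔ X.partner e < d) ↔ ¬ X.partner d < X.partner e := by
    have ea : (d = a.1 ∧ X.partner d = a.2) ∨ (d = a.2 ∧ X.partner d = a.1) := by
      rw [hpd]
      rw [← h1]
      unfold endOf
      have hdt := X.diffType a ha
      cases h4 : X.inE a.1 <;> cases h5 : X.inE a.2 <;> cases h3 : X.inE d <;> simp_all
    have eb : (e = b.1 ∧ X.partner e = b.2) ∨ (e = b.2 ∧ X.partner e = b.1) := by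
      rw [hpe]
      rw [← h2, ← hde]
      unfold endOf
      have hdt := X.diffType b hb
      cases h4 : X.inE b.1 <;> cases h5 : X.inE b.2 <;> cases h3 : X.inE d <;> simp_all
    simp only [Fin.lt_def, ne_eq, Fin.ext_iff] at *
    omega
  unfold posSign
  by_cases k1 : X.partner d < e <;> by_cases k2 : X.partner e < d <;>
    by_cases k3 : X.partner d < X.partner e <;> simp [k1, k2, k3] at key ⊢

/-- The polynomials of the unmatched vertices, over the field of rational functions. -/
noncomputable def rkPoly (c : Bool) (i : Fin (m + n)) : Polynomial (RatFun m n) :=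
  (unmatchedPoly t c (X.rk i)).map (Int.castRingHom _)

theorem cauchyEntry_endOf {a : Fin (m + n) × Fin (m + n)} (ha : a ∈ X.arcs) (c : Bool)
    (y : RatFun m n) :
    cauchyEntry X.partner X.V (X.rkPoly c) (X.endOf c a) y =
      if X.inE a.1 = c then (y - X.V (X.endOf (!c) a))⁻¹ else (X.V (X.endOf (!c) a) - y)⁻¹ := by
  have h1 : X.partner (X.endOf c a) ≠ X.endOf c a := by
    rw [Ne, partner_eq_self_iff, not_not]; exact X.endOf_mem_supp c ha
  rw [cauchyEntry, if_neg h1, X.partner_endOf ha, posSign]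
  have hdt := X.diffType a ha
  have hlt := X.lt_of_mem a ha
  by_cases h : X.inE a.1 = c
  · have e1 : X.endOf c a = a.1 := if_pos h
    have e2 : X.endOf (!c) a = a.2 := if_neg (by rw [h]; simp)
    rw [if_pos h, e1, e2, if_pos hlt, one_mul]
  · have e1 : X.endOf c a = a.2 := if_neg h
    have e2 : X.endOf (!c) a = a.1 := if_pos (OrderedBasis.bool_eq_not_of_ne (Ne.symm h))
    rw [if_neg h, e1, e2, if_neg (not_lt.2 hlt.le), neg_one_mul, ← neg_sub y]
    exact neg_inv

theorem det_cauchyEntry_eq {c : Bool} (hc : ∀ u, u ∉ X.supp → X.inE u = c) :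
    Matrix.det (Matrix.of fun (j i : {i // X.inE i = c}) =>
      cauchyEntry X.partner X.V (X.rkPoly c) i (X.V j)) =
      ∏ p : Fin (m + n) × Fin (m + n) with p.1 < p.2, X.pairQ p.1 p.2 := by
  have hsupp : ∀ d, X.inE d ≠ c → d ∈ X.supp := fun d hd => by
    by_contra h; exact hd (hc d h)
  rw [det_cauchyEntry X.V_injective X.partner_involutive]
  · rw [pairProd, Finset.univ_product_univ]
    refine Finset.prod_congr rfl fun p hp => ?_
    have hlt := (Finset.mem_filter.1 hp).2
    rw [OrderedBasis.pairQ, ordSub, if_pos hlt]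
    have : (X.inE p.1 = c ↔ X.inE p.2 = c) ↔ X.inE p.1 = X.inE p.2 := by
      cases X.inE p.1 <;> cases X.inE p.2 <;> cases c <;> simp
    simp only [this]
  · intro d hd
    rw [X.inE_partner (hsupp d hd)]
    exact (OrderedBasis.bool_eq_not_of_ne hd).symm
  · intro i hi
    by_cases h : i ∈ X.supp
    · right
      rw [X.inE_partner h, hi]
      simp
    · exact Or.inl (X.partner_of_notMem h)
  · intro i hi hκ
    rw [partner_eq_self_iff] at hκ
    have h1 := unmatchedPoly_monic t c (X.rk i)
    refine ⟨h1.1.map _, ?_⟩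
    rw [rkPoly, h1.1.natDegree_map, h1.2, rk]
    congr 1
    ext j
    simp only [Finset.mem_filter, Finset.mem_univ, true_and, partner_eq_self_iff]
    have := hc j
    tauto
  · intro u hu hκ d hd
    exact X.lt_iff_lt_partner (X.partner_eq_self_iff.1 hκ) (hsupp d hd)
  · intro d e hd he hlt
    refine X.posSign_partner (hsupp d hd) (hsupp e he) ?_ hlt
    rw [OrderedBasis.bool_eq_not_of_ne (Ne.symm hd), OrderedBasis.bool_eq_not_of_ne (Ne.symm he)]

theorem prod_matched {M : Type*} [CommMonoid M] {c : Bool} (hc : ∀ u, u ∉ X.supp → X.inE u = c)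
    (f : Fin (m + n) → M) : ∏ i : {i // X.inE i = c}, f i =
      (∏ a ∈ X.arcs, f (X.endOf c a)) * ∏ u ∈ Finset.univ \ X.supp, f u := by
  have h1 : (Finset.univ.filter fun i => X.inE i = c) =
      X.arcs.image (X.endOf c) ∪ Finset.univ \ X.supp := by
    ext i
    simp only [Finset.mem_filter, Finset.mem_univ, true_and, Finset.mem_union, Finset.mem_image,
      Finset.mem_sdiff]
    constructor
    · intro hi
      by_cases h : i ∈ X.supp
      · obtain ⟨a, ha, h2⟩ := X.exists_endOf h
        exact Or.inl ⟨a, ha, hi ▸ h2⟩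
      · exact Or.inr h
    · rintro (⟨a, ha, rfl⟩ | h)
      · exact X.inE_endOf c ha
      · exact hc i h
  rw [← Finset.prod_subtype (Finset.univ.filter fun i => X.inE i = c) (by simp) f, h1,
    Finset.prod_union, Finset.prod_image (X.endOf_injOn c)]
  rw [Finset.disjoint_left]
  intro i hi hi'
  obtain ⟨a, ha, rfl⟩ := Finset.mem_image.1 hi
  exact (Finset.mem_sdiff.1 hi').2 (X.endOf_mem_supp c ha)

/-- The product of the factors of a generalized Cauchy determinant on its diagonal. -/
noncomputable def cauchyQ : RatFun m n :=
  (∏ a ∈ X.arcs, X.arcQ a) * ∏ u ∈ Finset.univ \ X.supp, X.vertexQ u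

theorem cauchyQ_eq : X.cauchyQ = (∏ i, X.tailQ i) * ((∏ a ∈ X.arcs, (X.V a.1 - X.V a.2)⁻¹) *
    ∏ u ∈ Finset.univ \ X.supp,
      Polynomial.eval₂ (Int.castRingHom _) (X.V u) (unmatchedPoly t (X.inE u) (X.rk u))) := by
  have hcl : X.ArcClosed Finset.univ := fun a _ => by simp
  have harc : X.arcsIn Finset.univ = X.arcs := by ext a; simp [mem_arcsIn]
  rw [X.prod_eq_prod_arcsIn hcl X.tailQ, harc, cauchyQ]
  simp only [arcQ, vertexQ, Finset.prod_mul_distrib]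
  ring

theorem sum_perm_cauchyQ {c : Bool} (hc : ∀ u, u ∉ X.supp → X.inE u = c) :
    ∑ σ : Equiv.Perm {i // X.inE i = c}, ((Equiv.Perm.sign σ : ℤ) : RatFun m n) *
      act (X.perm (Equiv.Perm.ofSubtype σ)) X.cauchyQ = expo X.rho * X.superDenominator := by
  rw [X.expo_rho_mul_superDenominator_eq, ← X.det_cauchyEntry_eq hc, Matrix.det_apply',
    Finset.mul_sum]
  refine Finset.sum_congr rfl fun σ _ => ?_
  rw [mul_left_comm]
  congr 1
  have hσ : ∀ i, X.inE (Equiv.Perm.ofSubtype σ i) = X.inE i := by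
    intro i
    by_cases h : X.inE i = c
    · rw [Equiv.Perm.ofSubtype_apply_of_mem σ h, h]
      exact (σ ⟨i, h⟩).2
    · rw [Equiv.Perm.ofSubtype_apply_of_not_mem σ h]
  have hfix : ∀ a ∈ X.arcs, Equiv.Perm.ofSubtype σ (X.endOf (!c) a) = X.endOf (!c) a := by
    intro a ha
    apply Equiv.Perm.ofSubtype_apply_of_not_mem
    rw [X.inE_endOf _ ha]
    simp
  have h1 : ∀ i : {i // X.inE i = c}, Matrix.of (fun (j i : {i // X.inE i = c}) =>
      cauchyEntry X.partner X.V (X.rkPoly c) i (X.V j)) (σ i) i =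
      cauchyEntry X.partner X.V (X.rkPoly c) i.1 (X.V (Equiv.Perm.ofSubtype σ i.1)) := by
    intro i
    rw [Equiv.Perm.ofSubtype_apply_coe]
    rfl
  rw [cauchyQ_eq, map_mul, map_mul, Finset.prod_congr rfl fun i _ => h1 i,
    X.prod_matched hc (fun i => cauchyEntry X.partner X.V (X.rkPoly c) i
      (X.V (Equiv.Perm.ofSubtype σ i)))]
  congr 1
  · rw [map_prod, Finset.prod_congr rfl fun i _ => X.act_perm_tailQ i (hσ i)]
    exact Equiv.prod_comp _ _
  · congr 1
    · rw [map_prod]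
      refine Finset.prod_congr rfl fun a ha => ?_
      have hdt := X.diffType a ha
      rw [map_inv₀, map_sub, OrderedBasis.act_perm_V, OrderedBasis.act_perm_V,
        X.cauchyEntry_endOf ha, ← hfix a ha]
      split_ifs with h
      · have e1 : X.endOf c a = a.1 := if_pos h
        have e2 : X.endOf (!c) a = a.2 := if_neg (by rw [h]; simp)
        rw [e1, e2]
      · have e1 : X.endOf c a = a.2 := if_neg h
        have e2 : X.endOf (!c) a = a.1 := if_pos (OrderedBasis.bool_eq_not_of_ne (Ne.symm h))
        rw [e1, e2]
    · rw [map_prod]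
      refine Finset.prod_congr rfl fun u hu => ?_
      have hu' := (Finset.mem_sdiff.1 hu).2
      rw [cauchyEntry, if_pos (X.partner_of_notMem hu'), rkPoly, Polynomial.eval_map, hc u hu']
      have : ((act (X.perm (Equiv.Perm.ofSubtype σ)) : RatFun m n →+* RatFun m n).comp
          (Int.castRingHom _)) = Int.castRingHom _ := RingHom.ext_int _ _
      have h2 := Polynomial.hom_eval₂ (unmatchedPoly t c (X.rk u)) (Int.castRingHom (RatFun m n))
        (act (X.perm (Equiv.Perm.ofSubtype σ)) : RatFun m n →+* RatFun m n) (X.V u)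
      rw [this] at h2
      refine h2.trans ?_
      congr 1
      exact X.act_perm_V _ _

end ArcDiagram

end SuperDenominator

namespace SuperDenominator

namespace OrderedBasis

variable {t : SuperType} {m n : ℕ} (X : OrderedBasis t m n)

theorem form_self_pair {i j : Fin (m + n)} (hij : i ≠ j) (h : X.inE i = X.inE j) (a b : ℚ) :
    form (a • X.vertex i + b • X.vertex j) (a • X.vertex i + b • X.vertex j) =
      (a * a + b * b) * X.eta i := by
  simp only [form_add_left, form_add_right, form_smul_left, form_smul_right, form_vertex,
    if_true, if_neg hij, if_neg hij.symm, ← X.inE_eq_iff_eta.1 h]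
  ring

/-- The reflections in even roots, in terms of permutations and sign changes of the vertices. -/
theorem reflection_cases {α : Weight m n} (hα : α ∈ evenRoots t m n) :
    ∃ i j, X.inE i = X.inE j ∧ X.coord i α ≠ 0 ∧ X.coord j α ≠ 0 ∧
      (∀ k, X.coord k α ≠ 0 → k = i ∨ k = j) ∧
      (∃ k : ℚ, 0 < k ∧ form α α = k * X.eta i) ∧
      ((i ≠ j ∧ reflection α = X.perm (Equiv.swap i j)) ∨
      (t ≠ SuperType.gl ∧ i ≠ j ∧
        reflection α = X.flip i * X.flip j * X.perm (Equiv.swap i j)) ∨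
      (t ≠ SuperType.gl ∧ i = j ∧ ¬ (t = SuperType.D ∧ X.inE i = true) ∧
        reflection α = X.flip i)) := by
  rcases X.evenRoots_cases hα with ⟨i, j, hij, h, s, hs, rfl⟩ | ⟨i, hi, ht, h⟩ | ⟨i, hi, ht, h⟩
  · obtain ⟨h1, h2⟩ := pairSigns_cases hs
    have h0 : s.1 ≠ 0 := by rcases h1 with h | h <;> rw [h] <;> norm_num
    have h3 : s.2 ≠ 0 := by
      rcases h2 with h | ⟨_, h⟩ <;> rw [h]
      · exact neg_ne_zero.2 h0
      · exact h0
    refine ⟨i, j, h, ?_, ?_, fun k hk => ?_, ⟨_, ?_, X.form_self_pair hij h _ _⟩, ?_⟩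
    · simpa [coord_vertex, hij.symm] using h0
    · simpa [coord_vertex, hij] using h3
    · by_contra! hne
      simp [coord_vertex, hne.1.symm, hne.2.symm] at hk
    · have := mul_self_pos.2 h0
      have := mul_self_pos.2 h3
      linarith
    · rcases X.reflection_pair_eq hij h hs with ⟨_, h4⟩ | ⟨ht, _, h4⟩
      · exact Or.inl ⟨hij, h4⟩
      · exact Or.inr (Or.inl ⟨ht, hij, h4⟩)
  · have hf : form α α = 1 * X.eta i := by
      rcases h with rfl | rfl <;> simp [form_neg_left, form_neg_right, form_vertex]
    refine ⟨i, i, rfl, ?_, ?_, fun k => ?_, ⟨1, one_pos, hf⟩, Or.inr (Or.inr ⟨by simp [ht], rfl,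
      by simp [ht], X.reflection_smul_vertex one_ne_zero h⟩)⟩ <;>
    · rcases h with rfl | rfl <;> simp [coord_vertex, eq_comm]
  · have hf : form α α = 4 * X.eta i := by
      rcases h with rfl | rfl <;>
        simp only [form_neg_left, form_neg_right, form_vertex, form_smul_left, form_smul_right,
          if_true] <;> ring
    refine ⟨i, i, rfl, ?_, ?_, fun k => ?_, ⟨4, by norm_num, hf⟩, Or.inr (Or.inr ⟨ht, rfl,
      by simp [hi], X.reflection_smul_vertex two_ne_zero h⟩)⟩ <;>
    · rcases h with rfl | rfl <;> simp [coord_vertex, eq_comm]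

theorem reflection_mem_weylGroup {α : Weight m n} (hα : α ∈ evenRoots t m n) :
    reflection α ∈ weylGroup t m n :=
  Subgroup.subset_closure ⟨α, hα, rfl⟩

theorem sgnPrime_cast {w : Weight m n ≃ₗ[ℚ] Weight m n} (hw : w ∈ weylGroup t m n) :
    (sgnPrime t w : RatFun m n) = (X.chi w : ℚ) := by
  rw [← X.sgnPrime_eq_chi hw, Rat.cast_intCast]

theorem chi_perm {σ : Equiv.Perm (Fin (m + n))} (hσ : ∀ i, X.inE (σ i) = X.inE i) :
    X.chi (X.perm σ) = ((Equiv.Perm.sign σ : ℤ) : ℚ) := by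
  have := X.chi_mul_perm 1 hσ
  rwa [one_mul, X.chi_one, mul_one] at this

theorem chi_flip (i : Fin (m + n)) : X.chi (X.flip i) = X.kap i := by
  have := X.chi_mul_flip 1 i
  rwa [one_mul, X.chi_one, mul_one] at this

theorem chi_flip_mul_flip {i j : Fin (m + n)} (h : X.inE i = X.inE j) :
    X.chi (X.flip i * X.flip j) = 1 := by
  rw [X.chi_mul_flip, X.chi_flip, X.kap_congr h, X.kap_mul_self]

theorem perm_swap_mem {i j : Fin (m + n)} (h : X.inE i = X.inE j) :
    X.perm (Equiv.swap i j) ∈ weylGroup t m n := by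
  by_cases hij : i = j
  · have h1 : Equiv.swap j j = 1 := Equiv.swap_self j
    rw [hij, h1, map_one]
    exact one_mem _
  · rw [← X.reflection_vertex_sub hij h]
    exact reflection_mem_weylGroup (X.sub_mem_evenRoots hij h)

theorem flip_mul_flip_eq {i j : Fin (m + n)} (hij : i ≠ j) (h : X.inE i = X.inE j) :
    X.flip i * X.flip j =
      reflection (X.vertex i + X.vertex j) * reflection (X.vertex i - X.vertex j) := by
  rw [X.reflection_vertex_add hij h, X.reflection_vertex_sub hij h, mul_assoc, ← map_mul,
    Equiv.swap_mul_self, map_one, mul_one]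

theorem flip_mul_flip_mem (ht : t ≠ SuperType.gl) {i j : Fin (m + n)} (hij : i ≠ j)
    (h : X.inE i = X.inE j) : X.flip i * X.flip j ∈ weylGroup t m n := by
  rw [X.flip_mul_flip_eq hij h]
  exact mul_mem (reflection_mem_weylGroup (X.add_mem_evenRoots ht hij h))
    (reflection_mem_weylGroup (X.sub_mem_evenRoots hij h))

theorem exists_reflection_eq_flip (ht : t ≠ SuperType.gl) {i : Fin (m + n)}
    (h : ¬ (t = SuperType.D ∧ X.inE i = true)) :
    ∃ c : ℚ, c ≠ 0 ∧ c • X.vertex i ∈ evenRoots t m n ∧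
      reflection (c • X.vertex i) = X.flip i := by
  cases hi : X.inE i with
  | false =>
    exact ⟨2, two_ne_zero, X.two_smul_vertex_mem_evenRoots ht hi,
      X.reflection_smul_vertex two_ne_zero (Or.inl rfl)⟩
  | true =>
    have hB : t = SuperType.B := by
      cases t <;> simp_all
    refine ⟨1, one_ne_zero, ?_, X.reflection_smul_vertex one_ne_zero (Or.inl rfl)⟩
    rw [one_smul]
    exact X.vertex_mem_evenRoots hB hi

theorem flip_mem (ht : t ≠ SuperType.gl) {i : Fin (m + n)}
    (h : ¬ (t = SuperType.D ∧ X.inE i = true)) : X.flip i ∈ weylGroup t m n := by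
  obtain ⟨c, _, h1, h2⟩ := X.exists_reflection_eq_flip ht h
  rw [← h2]
  exact reflection_mem_weylGroup h1

theorem reflectionGroup_mono {A B : Set (Weight m n)} (h : A ⊆ B) :
    reflectionGroup A ≤ reflectionGroup B := Subgroup.closure_mono (Set.image_mono h)

theorem act_eq_of_generators {A : Set (Weight m n)} (hA : A ⊆ evenRoots t m n) {Y : RatFun m n}
    (h : ∀ α ∈ A, act (reflection α) Y = (X.chi (reflection α) : RatFun m n) * Y)
    {w : Weight m n ≃ₗ[ℚ] Weight m n} (hw : w ∈ reflectionGroup A) :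
    act w Y = (sgnPrime t w : RatFun m n) * Y := by
  have hle : reflectionGroup A ≤ weylGroup t m n := reflectionGroup_mono hA
  have hw' : w ∈ Subgroup.closure (reflection '' A) := hw
  clear hw
  induction hw' using Subgroup.closure_induction'' with
  | mem x hx =>
    obtain ⟨α, hα, rfl⟩ := hx
    rw [h α hα, X.sgnPrime_cast (reflection_mem_weylGroup (hA hα))]
  | inv_mem x hx =>
    obtain ⟨α, hα, rfl⟩ := hx
    rw [reflection_inv, h α hα, X.sgnPrime_cast (reflection_mem_weylGroup (hA hα))]
  | one => rw [act_one, X.sgnPrime_cast (one_mem _), X.chi_one, Rat.cast_one, one_mul]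
  | mul x y hx hy h1 h2 =>
    rw [act_mul, h2, map_mul, map_intCast, h1, X.sgnPrime_mul (hle hx) (hle hy), Int.cast_mul]
    ring

/-! ### The superdenominator is skew -/

theorem act_perm_pairs {σ : Equiv.Perm (Fin (m + n))} (hσ : ∀ i, X.inE (σ i) = X.inE i) :
    act (X.perm σ) (∏ p : Fin (m + n) × Fin (m + n) with p.1 < p.2, X.pairQ p.1 p.2) =
      ((Equiv.Perm.sign σ : ℤ) : RatFun m n) *
        ∏ p : Fin (m + n) × Fin (m + n) with p.1 < p.2, X.pairQ p.1 p.2 := by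
  have hconv : ∀ f : Fin (m + n) → Fin (m + n) → RatFun m n,
      ∏ p : Fin (m + n) × Fin (m + n) with p.1 < p.2, f p.1 p.2 =
        ∏ j, ∏ i ∈ Finset.Iio j, f i j := by
    intro f
    rw [Finset.prod_filter, Fintype.prod_prod_type_right]
    refine Finset.prod_congr rfl fun j _ => ?_
    rw [← Finset.prod_filter]
    congr 1
    ext i
    simp
  have hact : ∀ i j, act (X.perm σ) (X.pairQ i j) = X.pairQ (σ i) (σ j) := by
    intro i j
    rw [pairQ, pairQ, hσ, hσ]
    split_ifs <;> simp [X.act_perm_V]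
  have hanti : ∀ i j, X.pairQ i j = -X.pairQ j i := by
    intro i j
    rw [pairQ, pairQ]
    by_cases h : X.inE i = X.inE j
    · rw [if_pos h, if_pos h.symm, neg_sub]
    · rw [if_neg h, if_neg (Ne.symm h), ← inv_neg, neg_sub]
  rw [map_prod, hconv (fun i j => act (X.perm σ) (X.pairQ i j)), hconv X.pairQ]
  simp only [hact]
  exact Equiv.Perm.prod_Iio_comp_eq_sign_mul_prod σ hanti

theorem act_flip_pairs (ht : t ≠ SuperType.gl) (i : Fin (m + n)) :
    act (X.flip i) (∏ p : Fin (m + n) × Fin (m + n) with p.1 < p.2, X.pairQ p.1 p.2) =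
      ∏ p : Fin (m + n) × Fin (m + n) with p.1 < p.2, X.pairQ p.1 p.2 := by
  rw [map_prod]
  refine Finset.prod_congr rfl fun p _ => ?_
  rw [pairQ]
  split_ifs <;> simp [X.act_flip_V ht]

/-- The sign by which `flip i` acts on the superdenominator. -/
def tau (i : Fin (m + n)) : ℚ := if t = SuperType.D ∧ X.inE i = true then 1 else X.kap i

theorem tau_mul_tau {i j : Fin (m + n)} (h : X.inE i = X.inE j) : X.tau i * X.tau j = 1 := by
  unfold tau
  rw [h, X.kap_congr h]
  split_ifs
  · norm_num
  · exact X.kap_mul_self j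

theorem act_flip_tailQ (ht : t ≠ SuperType.gl) (i j : Fin (m + n)) :
    act (X.flip i) (X.tailQ j) =
      if j = i then (X.tau i : RatFun m n) * X.tailQ j else X.tailQ j := by
  by_cases hij : j = i
  · subst hij
    rw [if_pos rfl, tau, kap]
    cases t with
    | gl => exact absurd rfl ht
    | B =>
      simp only [tailQ]
      cases h : X.inE j <;> simp [act_flip_e, add_comm]
    | D =>
      simp only [tailQ]
      cases h : X.inE j <;> simp [act_flip_e]
  · rw [if_neg hij]
    cases t with
    | gl => exact absurd rfl ht
    | B => simp only [tailQ]; split_ifs <;> simp [act_flip_e, hij]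
    | D => simp only [tailQ]; split_ifs <;> simp [act_flip_e, hij]

theorem act_flip_prod_tailQ (ht : t ≠ SuperType.gl) (i : Fin (m + n)) :
    act (X.flip i) (∏ j, X.tailQ j) = (X.tau i : RatFun m n) * ∏ j, X.tailQ j := by
  have h2 : ∀ j, act (X.flip i) (X.tailQ j) =
      (if j = i then (X.tau i : RatFun m n) else 1) * X.tailQ j := by
    intro j
    rw [X.act_flip_tailQ ht]
    split_ifs <;> ring
  rw [map_prod, Finset.prod_congr rfl fun j _ => h2 j, Finset.prod_mul_distrib,
    Finset.prod_ite_eq' Finset.univ i]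
  simp

theorem act_perm_Q {σ : Equiv.Perm (Fin (m + n))} (hσ : ∀ i, X.inE (σ i) = X.inE i) :
    act (X.perm σ) (expo X.rho * X.superDenominator) =
      ((Equiv.Perm.sign σ : ℤ) : RatFun m n) * (expo X.rho * X.superDenominator) := by
  rw [expo_rho_mul_superDenominator_eq, map_mul, X.act_perm_pairs hσ, map_prod,
    Finset.prod_congr rfl fun j _ => X.act_perm_tailQ j (hσ j), Equiv.prod_comp σ X.tailQ]
  ring

theorem act_flip_Q (ht : t ≠ SuperType.gl) (i : Fin (m + n)) :
    act (X.flip i) (expo X.rho * X.superDenominator) =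
      (X.tau i : RatFun m n) * (expo X.rho * X.superDenominator) := by
  rw [expo_rho_mul_superDenominator_eq, map_mul, X.act_flip_pairs ht, X.act_flip_prod_tailQ ht]
  ring

theorem act_Q {w : Weight m n ≃ₗ[ℚ] Weight m n} (hw : w ∈ weylGroup t m n) :
    act w (expo X.rho * X.superDenominator) =
      (sgnPrime t w : RatFun m n) * (expo X.rho * X.superDenominator) := by
  refine X.act_eq_of_generators subset_rfl (fun α hα => ?_) hw
  obtain ⟨i, j, hE, -, -, -, -, h | ⟨ht, hij, h⟩ | ⟨ht, rfl, hD, h⟩⟩ := X.reflection_cases hα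
  · rw [h.2, X.act_perm_Q (X.inE_swap hE), X.chi_perm (X.inE_swap hE)]
    simp
  · rw [h, act_mul, X.act_perm_Q (X.inE_swap hE), map_mul, act_mul, act_mul, X.act_flip_Q ht,
      map_mul, X.act_flip_Q ht, X.chi_mul_perm _ (X.inE_swap hE), X.chi_flip_mul_flip hE]
    simp only [map_intCast, map_ratCast]
    have := X.tau_mul_tau hE
    have h2 : (X.tau i : RatFun m n) * X.tau j = 1 := by exact_mod_cast this
    rw [← mul_assoc (X.tau j : RatFun m n), mul_comm (X.tau j : RatFun m n), h2]
    simp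
  · rw [h, X.act_flip_Q ht, X.chi_flip, tau, if_neg hD]

theorem superSum_Q : superSum t (weylGroup t m n : Set (Weight m n ≃ₗ[ℚ] Weight m n))
    (expo X.rho * X.superDenominator) =
      (Nat.card (weylGroup t m n) : RatFun m n) * (expo X.rho * X.superDenominator) := by
  have hU := weylGroup_finite t m n
  have h : ∀ w ∈ hU.toFinset, (sgnPrime t w : RatFun m n) *
      act w (expo X.rho * X.superDenominator) = expo X.rho * X.superDenominator := by
    intro w hw
    rw [X.act_Q (hU.mem_toFinset.1 hw), ← mul_assoc, sgnPrime_mul_self_cast, one_mul]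
  rw [superSum_eq_sum hU, Finset.sum_congr rfl h, Finset.sum_const, nsmul_eq_mul]
  congr 2
  rw [← Set.ncard_eq_toFinset_card _ hU]
  rfl

end OrderedBasis

end SuperDenominator

namespace SuperDenominator

theorem relIndex_mul_card {Γ : Type*} [Group Γ] {H K : Subgroup Γ} (h : H ≤ K) :
    H.relIndex K * Nat.card H = Nat.card K := by
  rw [Subgroup.relIndex, ← Nat.card_congr (Subgroup.subgroupOfEquivOfLe h).toEquiv, mul_comm,
    Subgroup.card_mul_index]

/-- The even roots of positive (`c = true`) or negative (`c = false`) norm. -/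
def rootPart (t : SuperType) (m n : ℕ) (c : Bool) : Finset (Weight m n) :=
  (evenRoots t m n).filter fun α => if c = true then 0 < form α α else form α α < 0

/-- The sign vectors on `ι` that occur in the Weyl group of the part `c` of the even roots. -/
def signSub (t : SuperType) (c : Bool) (ι : Type*) [Fintype ι] : Subgroup (ι → ℤˣ) where
  carrier := {s | (t = SuperType.gl → s = 1) ∧ (t = SuperType.D ∧ c = true → ∏ i, s i = 1)}
  one_mem' := ⟨fun _ => rfl, fun _ => by simp⟩
  mul_mem' {a b} ha hb := ⟨fun h => by rw [ha.1 h, hb.1 h, one_mul], fun h => by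
    simp only [Pi.mul_apply, Finset.prod_mul_distrib, ha.2 h, hb.2 h, one_mul]⟩
  inv_mem' {a} ha := ⟨fun h => by rw [ha.1 h, inv_one], fun h => by
    simp only [Pi.inv_apply, Finset.prod_inv_distrib, ha.2 h, inv_one]⟩

theorem mem_signSub {t : SuperType} {c : Bool} {ι : Type*} [Fintype ι] {s : ι → ℤˣ} :
    s ∈ signSub t c ι ↔
      (t = SuperType.gl → s = 1) ∧ (t = SuperType.D ∧ c = true → ∏ i, s i = 1) := Iff.rfl

theorem comp_mem_signSub {t : SuperType} {c : Bool} {ι : Type*} [Fintype ι] {s : ι → ℤˣ}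
    (hs : s ∈ signSub t c ι) (τ : Equiv.Perm ι) : s ∘ τ ∈ signSub t c ι := by
  refine ⟨fun h => by rw [hs.1 h]; rfl, fun h => ?_⟩
  rw [← hs.2 h]
  exact Equiv.prod_comp τ s

theorem card_signSub (t : SuperType) (c : Bool) (ι : Type*) [Fintype ι] [DecidableEq ι] :
    Nat.card (signSub t c ι) = 2 ^ flipCount t c (Fintype.card ι) := by
  have hall : Nat.card (ι → ℤˣ) = 2 ^ Fintype.card ι := by
    rw [Nat.card_eq_fintype_card, Fintype.card_fun, Fintype.card_units_int]
  unfold flipCount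
  by_cases h1 : t = SuperType.gl
  · have : signSub t c ι = ⊥ := by
      ext s
      rw [mem_signSub, Subgroup.mem_bot]
      exact ⟨fun h => h.1 h1, fun h => ⟨fun _ => h, fun _ => by simp [h]⟩⟩
    rw [this, if_pos h1, Subgroup.card_bot, pow_zero]
  · rw [if_neg h1]
    split_ifs with h2
    · let f : (ι → ℤˣ) →* ℤˣ :=
        { toFun := fun s => ∏ i, s i
          map_one' := by simp
          map_mul' := fun a b => by simp [Finset.prod_mul_distrib] }
      have hf : signSub t c ι = f.ker := by
        ext s
        rw [mem_signSub, MonoidHom.mem_ker]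
        exact ⟨fun h => h.2 h2, fun h => ⟨fun h' => absurd h' h1, fun _ => h⟩⟩
      have hcard := Subgroup.card_mul_index f.ker
      rw [hall] at hcard
      rw [hf]
      cases isEmpty_or_nonempty ι with
      | inl hι =>
        have h0 : Fintype.card ι = 0 := Fintype.card_eq_zero
        rw [h0] at hcard ⊢
        simpa using Nat.eq_one_of_mul_eq_one_right hcard
      | inr hι =>
        obtain ⟨i⟩ := hι
        have hsurj : Function.Surjective f := by
          intro x
          refine ⟨Pi.mulSingle i x, ?_⟩
          exact Fintype.prod_pi_mulSingle' i x
        have h0 : 0 < Fintype.card ι := Fintype.card_pos_iff.2 ⟨i⟩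
        rw [Subgroup.index_ker, MonoidHom.range_eq_top.2 hsurj, Subgroup.card_top,
          Nat.card_eq_fintype_card (α := ℤˣ), Fintype.card_units_int] at hcard
        refine Nat.eq_of_mul_eq_mul_right two_pos ?_
        rw [hcard, ← pow_succ, Nat.sub_add_cancel h0]
    · have : signSub t c ι = ⊤ := by
        ext s
        rw [mem_signSub]
        exact ⟨fun _ => trivial, fun _ => ⟨fun h' => absurd h' h1, fun h' => absurd h' h2⟩⟩
      rw [this, Subgroup.card_top, hall]

namespace OrderedBasis

variable {t : SuperType} {m n : ℕ} (X : OrderedBasis t m n)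

/-- The linear map that multiplies the vertices by given signs. -/
noncomputable def diag (s : Fin (m + n) → ℤˣ) : Weight m n ≃ₗ[ℚ] Weight m n :=
  X.basis.equiv (X.basis.unitsSMul fun i => Units.map (Int.castRingHom ℚ).toMonoidHom (s i))
    (Equiv.refl _)

theorem diag_vertex (s : Fin (m + n) → ℤˣ) (i : Fin (m + n)) :
    X.diag s (X.vertex i) = ((s i : ℤ) : ℚ) • X.vertex i := by
  rw [diag, ← basis_apply, Module.Basis.equiv_apply, Module.Basis.unitsSMul_apply]
  rfl

/-- The simultaneous sign change of the vertices of type `c`. -/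
noncomputable def signs (c : Bool) :
    ({i // X.inE i = c} → ℤˣ) →* (Weight m n ≃ₗ[ℚ] Weight m n) where
  toFun s := X.diag fun i => if h : X.inE i = c then s ⟨i, h⟩ else 1
  map_one' := by
    apply X.equiv_ext
    intro i
    rw [diag_vertex]
    split_ifs <;> simp
  map_mul' a b := by
    apply X.equiv_ext
    intro i
    rw [LinearEquiv.mul_apply, diag_vertex, diag_vertex, map_smul, diag_vertex, smul_smul]
    split_ifs <;> simp [mul_comm]

theorem signs_vertex (c : Bool) (s : {i // X.inE i = c} → ℤˣ) (i : Fin (m + n)) :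
    X.signs c s (X.vertex i) =
      if h : X.inE i = c then ((s ⟨i, h⟩ : ℤ) : ℚ) • X.vertex i else X.vertex i := by
  have : X.signs c s = X.diag fun i => if h : X.inE i = c then s ⟨i, h⟩ else 1 := rfl
  rw [this, diag_vertex]
  split_ifs <;> simp

/-- The permutations of the vertices of type `c`. -/
noncomputable def permOf (c : Bool) :
    Equiv.Perm {i // X.inE i = c} →* (Weight m n ≃ₗ[ℚ] Weight m n) :=
  X.perm.comp Equiv.Perm.ofSubtype

theorem permOf_vertex (c : Bool) (σ : Equiv.Perm {i // X.inE i = c}) (i : Fin (m + n)) :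
    X.permOf c σ (X.vertex i) =
      if h : X.inE i = c then X.vertex (σ ⟨i, h⟩) else X.vertex i := by
  rw [permOf, MonoidHom.comp_apply, perm_vertex]
  split_ifs with h
  · rw [Equiv.Perm.ofSubtype_apply_of_mem σ h]
  · rw [Equiv.Perm.ofSubtype_apply_of_not_mem σ h]

theorem permOf_mul_signs (c : Bool) (σ : Equiv.Perm {i // X.inE i = c})
    (s : {i // X.inE i = c} → ℤˣ) :
    X.permOf c σ * X.signs c s = X.signs c (s ∘ σ.symm) * X.permOf c σ := by
  apply X.equiv_ext
  intro i
  rw [LinearEquiv.mul_apply, LinearEquiv.mul_apply, signs_vertex, permOf_vertex]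
  split_ifs with h
  · rw [map_smul, permOf_vertex, dif_pos h, signs_vertex, dif_pos (σ ⟨i, h⟩).2]
    simp
  · rw [permOf_vertex, dif_neg h, signs_vertex, dif_neg h]

theorem signs_mul_permOf_injective (c : Bool) : Function.Injective
    fun p : ({i // X.inE i = c} → ℤˣ) × Equiv.Perm {i // X.inE i = c} =>
      X.signs c p.1 * X.permOf c p.2 := by
  rintro ⟨s, σ⟩ ⟨s', σ'⟩ h
  have hv : ∀ i : {i // X.inE i = c}, ((s (σ i) : ℤ) : ℚ) • X.vertex (σ i) =
      ((s' (σ' i) : ℤ) : ℚ) • X.vertex (σ' i) := by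
    intro i
    have := congrArg (fun f : Weight m n ≃ₗ[ℚ] Weight m n => f (X.vertex i)) h
    simp only [LinearEquiv.mul_apply, permOf_vertex, dif_pos i.2] at this
    rw [signs_vertex, signs_vertex, dif_pos (σ i).2, dif_pos (σ' i).2] at this
    exact this
  have hσ : ∀ i, σ i = σ' i := by
    intro i
    by_contra hne
    have hne' : ((σ' i : {i // X.inE i = c}) : Fin (m + n)) ≠ σ i :=
      fun h => hne (Subtype.ext h.symm)
    have := congrArg (X.coord (σ i)) (hv i)
    simp [coord_vertex, hne'] at this
  have hs : ∀ i, s i = s' i := by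
    intro i
    obtain ⟨j, rfl⟩ := σ.surjective i
    have := congrArg (X.coord (σ j)) (hv j)
    rw [← hσ j] at this
    simpa [coord_vertex, Units.ext_iff] using this
  rw [Prod.mk.injEq]
  exact ⟨funext hs, Equiv.ext hσ⟩

theorem flip_eq_signs (c : Bool) {i : Fin (m + n)} (h : X.inE i = c) :
    X.flip i = X.signs c (Pi.mulSingle ⟨i, h⟩ (-1)) := by
  apply X.equiv_ext
  intro j
  rw [flip_vertex, signs_vertex]
  split_ifs with h1 h2 h2
  · subst h1; simp
  · exact absurd (h1 ▸ h) h2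
  · rw [Pi.mulSingle_eq_of_ne (by simpa [Subtype.ext_iff] using h1)]; simp
  · rfl

theorem swap_eq_permOf (c : Bool) {i j : Fin (m + n)} (hi : X.inE i = c) (hj : X.inE j = c) :
    X.perm (Equiv.swap i j) = X.permOf c (Equiv.swap ⟨i, hi⟩ ⟨j, hj⟩) := by
  rw [permOf, MonoidHom.comp_apply, Equiv.Perm.ofSubtype_swap_eq]

theorem mem_rootPart {c : Bool} {α : Weight m n} {i : Fin (m + n)} (hα : α ∈ evenRoots t m n)
    (h : ∃ k : ℚ, 0 < k ∧ form α α = k * X.eta i) :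
    α ∈ rootPart t m n c ↔ X.inE i = c := by
  obtain ⟨k, hk, h⟩ := h
  rw [rootPart, Finset.mem_filter, h, eta]
  cases c <;> cases X.inE i <;> simp [hα, hk, hk.le]

theorem flip_mem_part {c : Bool} (ht : t ≠ SuperType.gl) {i : Fin (m + n)} (h : X.inE i = c)
    (hD : ¬ (t = SuperType.D ∧ c = true)) :
    X.flip i ∈ reflectionGroup (rootPart t m n c : Set (Weight m n)) := by
  obtain ⟨k, h0, h1, h2⟩ := X.exists_reflection_eq_flip ht (h ▸ hD)
  rw [← h2]
  refine Subgroup.subset_closure ⟨_, ?_, rfl⟩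
  rw [Finset.mem_coe, X.mem_rootPart (i := i) h1 ⟨k * k, mul_self_pos.2 h0, ?_⟩]
  · exact h
  · rw [form_smul_left, form_smul_right, form_vertex, if_pos rfl, mul_assoc]

theorem sub_mem_part {c : Bool} {i j : Fin (m + n)} (hij : i ≠ j) (hi : X.inE i = c)
    (hj : X.inE j = c) :
    reflection (X.vertex i - X.vertex j) ∈
      reflectionGroup (rootPart t m n c : Set (Weight m n)) := by
  refine Subgroup.subset_closure ⟨_, ?_, rfl⟩
  rw [Finset.mem_coe, X.mem_rootPart (i := i) (X.sub_mem_evenRoots hij (hi.trans hj.symm))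
    ⟨2, two_pos, ?_⟩]
  · exact hi
  · have := X.form_self_pair hij (hi.trans hj.symm) 1 (-1)
    simp only [one_smul, neg_smul, ← sub_eq_add_neg] at this
    rw [this]; norm_num

theorem add_mem_part {c : Bool} (ht : t ≠ SuperType.gl) {i j : Fin (m + n)} (hij : i ≠ j)
    (hi : X.inE i = c) (hj : X.inE j = c) :
    reflection (X.vertex i + X.vertex j) ∈
      reflectionGroup (rootPart t m n c : Set (Weight m n)) := by
  refine Subgroup.subset_closure ⟨_, ?_, rfl⟩
  rw [Finset.mem_coe, X.mem_rootPart (i := i) (X.add_mem_evenRoots ht hij (hi.trans hj.symm))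
    ⟨2, two_pos, ?_⟩]
  · exact hi
  · have := X.form_self_pair hij (hi.trans hj.symm) 1 1
    simp only [one_smul] at this
    rw [this]; norm_num

theorem signs_mem_part {c : Bool} {s : {i // X.inE i = c} → ℤˣ} (hs : s ∈ signSub t c _) :
    X.signs c s ∈ reflectionGroup (rootPart t m n c : Set (Weight m n)) := by
  by_cases ht : t = SuperType.gl
  · rw [hs.1 ht, map_one]
    exact one_mem _
  by_cases hD : t = SuperType.D ∧ c = true
  · cases isEmpty_or_nonempty {i // X.inE i = c} with
    | inl h =>
      rw [Subsingleton.elim s 1, map_one]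
      exact one_mem _
    | inr h =>
      obtain ⟨i₀⟩ := h
      have h1 : s = ∏ i, (Pi.mulSingle i (s i) * Pi.mulSingle i₀ (s i)) := by
        have h2 : ∏ i, (Pi.mulSingle i₀ (s i) : {i // X.inE i = c} → ℤˣ) = 1 := by
          have := map_prod (MonoidHom.mulSingle (fun _ : {i // X.inE i = c} => ℤˣ) i₀) s
            Finset.univ
          rw [hs.2 hD, map_one] at this
          exact this.symm
        rw [Finset.prod_mul_distrib, h2, mul_one, Finset.univ_prod_mulSingle]
      rw [h1, ← Subgroup.mem_comap]
      refine Subgroup.prod_mem _ fun i _ => ?_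
      rw [Subgroup.mem_comap]
      rcases Int.units_eq_one_or (s i) with h | h
      · simp [h, one_mem]
      · rw [h]
        by_cases hi : i = i₀
        · rw [hi, ← Pi.mulSingle_mul]
          simp [one_mem]
        · have hne : (i : Fin (m + n)) ≠ i₀ := fun h => hi (Subtype.ext h)
          rw [map_mul, ← X.flip_eq_signs c i.2, ← X.flip_eq_signs c i₀.2,
            X.flip_mul_flip_eq hne (i.2.trans i₀.2.symm)]
          exact mul_mem (X.add_mem_part ht hne i.2 i₀.2) (X.sub_mem_part hne i.2 i₀.2)
  · rw [← Finset.univ_prod_mulSingle s, ← Subgroup.mem_comap]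
    refine Subgroup.prod_mem _ fun i _ => ?_
    rw [Subgroup.mem_comap]
    rcases Int.units_eq_one_or (s i) with h | h
    · simp [h, one_mem]
    · rw [h, ← X.flip_eq_signs c i.2]
      exact X.flip_mem_part ht i.2 hD

theorem permOf_mem_part {c : Bool} (σ : Equiv.Perm {i // X.inE i = c}) :
    X.permOf c σ ∈ reflectionGroup (rootPart t m n c : Set (Weight m n)) := by
  induction σ using Equiv.Perm.swap_induction_on with
  | one => rw [map_one]; exact one_mem _
  | swap_mul f x y hxy ih =>
    rw [map_mul]
    refine mul_mem ?_ ih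
    have hne : (x : Fin (m + n)) ≠ y := fun h => hxy (Subtype.ext h)
    rw [← X.swap_eq_permOf c x.2 y.2, ← X.reflection_vertex_sub hne (x.2.trans y.2.symm)]
    exact X.sub_mem_part hne x.2 y.2

theorem mem_part_iff {c : Bool} {w : Weight m n ≃ₗ[ℚ] Weight m n} :
    w ∈ reflectionGroup (rootPart t m n c : Set (Weight m n)) ↔
      ∃ p : signSub t c {i // X.inE i = c} × Equiv.Perm {i // X.inE i = c},
        X.signs c p.1 * X.permOf c p.2 = w := by
  constructor
  · intro hw
    have hw' : w ∈ Subgroup.closure (reflection '' (rootPart t m n c : Set (Weight m n))) := hw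
    clear hw
    have hgen : ∀ α ∈ rootPart t m n c,
        ∃ p : signSub t c {i // X.inE i = c} × Equiv.Perm {i // X.inE i = c},
          X.signs c p.1 * X.permOf c p.2 = reflection α := by
      intro α hα'
      have hα := (Finset.mem_filter.1 hα').1
      obtain ⟨i, j, hE, -, -, -, hk, hr⟩ := X.reflection_cases hα
      have hi := (X.mem_rootPart hα hk).1 hα'
      have hj := hE.symm.trans hi
      rcases hr with ⟨-, h⟩ | ⟨ht, hij, h⟩ | ⟨ht, rfl, hD, h⟩
      · exact ⟨(1, Equiv.swap ⟨i, hi⟩ ⟨j, hj⟩), by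
          rw [h, X.swap_eq_permOf c hi hj]; simp⟩
      · refine ⟨(⟨Pi.mulSingle ⟨i, hi⟩ (-1) * Pi.mulSingle ⟨j, hj⟩ (-1),
          fun h => absurd h ht, fun _ => ?_⟩, Equiv.swap ⟨i, hi⟩ ⟨j, hj⟩), ?_⟩
        · simp only [Pi.mul_apply, Finset.prod_mul_distrib]
          rw [Fintype.prod_pi_mulSingle', Fintype.prod_pi_mulSingle']
          rfl
        · rw [h, X.swap_eq_permOf c hi hj, X.flip_eq_signs c hi, X.flip_eq_signs c hj, ← map_mul]
      · refine ⟨(⟨Pi.mulSingle ⟨i, hi⟩ (-1), fun h => absurd h ht, fun h => absurd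
          ⟨h.1, hi.trans h.2⟩ hD⟩, 1), ?_⟩
        rw [h, X.flip_eq_signs c hi, map_one, mul_one]
    induction hw' using Subgroup.closure_induction'' with
    | mem x hx =>
      obtain ⟨α, hα, rfl⟩ := hx
      exact hgen α hα
    | inv_mem x hx =>
      obtain ⟨α, hα, rfl⟩ := hx
      rw [reflection_inv]
      exact hgen α hα
    | one => exact ⟨1, by simp⟩
    | mul x y _ _ hx hy =>
      obtain ⟨⟨s, σ⟩, rfl⟩ := hx
      obtain ⟨⟨s', σ'⟩, rfl⟩ := hy
      refine ⟨(⟨s * ((s' : _ → ℤˣ) ∘ σ.symm), mul_mem s.2 (comp_mem_signSub s'.2 _)⟩, σ * σ'), ?_⟩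
      rw [map_mul, map_mul, mul_assoc, mul_assoc, ← mul_assoc (X.permOf c σ) (X.signs c s'),
        X.permOf_mul_signs, mul_assoc]
  · rintro ⟨⟨s, σ⟩, rfl⟩
    exact mul_mem (X.signs_mem_part s.2) (X.permOf_mem_part σ)

theorem card_part (c : Bool) :
    Nat.card (reflectionGroup (rootPart t m n c : Set (Weight m n))) =
      2 ^ flipCount t c (Fintype.card {i // X.inE i = c}) *
        (Fintype.card {i // X.inE i = c}).factorial := by
  have hbij : Nat.card (reflectionGroup (rootPart t m n c : Set (Weight m n))) =
      Nat.card (signSub t c {i // X.inE i = c} × Equiv.Perm {i // X.inE i = c}) := by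
    symm
    refine Nat.card_congr (Equiv.ofBijective
      (fun p => ⟨X.signs c p.1 * X.permOf c p.2, X.mem_part_iff.2 ⟨p, rfl⟩⟩) ⟨?_, ?_⟩)
    · rintro ⟨s, σ⟩ ⟨s', σ'⟩ h
      have := X.signs_mul_permOf_injective c (a₁ := (s, σ)) (a₂ := (s', σ'))
        (congrArg Subtype.val h)
      rw [Prod.mk.injEq] at this ⊢
      exact ⟨Subtype.ext this.1, this.2⟩
    · rintro ⟨w, hw⟩
      obtain ⟨p, hp⟩ := X.mem_part_iff.1 hw
      exact ⟨p, Subtype.ext hp⟩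
  rw [hbij, Nat.card_prod, card_signSub, Nat.card_perm, Nat.card_eq_fintype_card]

end OrderedBasis

end SuperDenominator

namespace SuperDenominator

/-- The type of the vertices that span the roots in `sharpRoots`. -/
def majorType : SuperType → ℕ → ℕ → Bool
  | .gl, m, n => decide (n ≤ m)
  | .B, m, n => decide (n < m)
  | .D, m, n => decide (n < m)

theorem majorType_spec (t : SuperType) (m n : ℕ) :
    (majorType t m n = true → n ≤ m) ∧ (majorType t m n = false → m ≤ n) ∧
      (t = SuperType.D → majorType t m n = true → n < m) := by
  cases t <;> simp [majorType] <;> omega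

theorem sharpRoots_eq (t : SuperType) (m n : ℕ) :
    sharpRoots t m n = rootPart t m n (majorType t m n) := by
  refine Finset.filter_congr fun α _ => ?_
  have key : ∀ d : ℤ, ∀ c : Bool, (c = true ↔ 0 ≤ d) →
      ((if d = 0 then 0 < form α α else 0 < (d : ℚ) * form α α) ↔
        if c = true then 0 < form α α else form α α < 0) := by
    intro d c hc
    rcases lt_trichotomy d 0 with h | h | h
    · rw [if_neg h.ne, if_neg (fun h' => absurd (hc.1 h') (not_le.2 h))]
      have : (d : ℚ) < 0 := by exact_mod_cast h
      rw [mul_pos_iff]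
      constructor
      · rintro (h' | h')
        · exact absurd h'.1 (not_lt.2 this.le)
        · exact h'.2
      · exact fun h' => Or.inr ⟨this, h'⟩
    · rw [if_pos h, if_pos (hc.2 h.ge)]
    · rw [if_neg h.ne', if_pos (hc.2 h.le)]
      have : (0 : ℚ) < d := by exact_mod_cast h
      exact mul_pos_iff_of_pos_left this
  apply key
  cases t <;> simp [majorType, dualCoxeter] <;> omega

theorem constC_mul_card (t : SuperType) (m n : ℕ) :
    constC t m n * Nat.card (reflectionGroup
      (rootPart t m n (majorType t m n) : Set (Weight m n))) = Nat.card (weylGroup t m n) := by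
  rw [constC, sharpRoots_eq]
  exact relIndex_mul_card (OrderedBasis.reflectionGroup_mono (Finset.filter_subset _ _))

namespace ArcDiagram

variable {t : SuperType} {m n : ℕ} (X : ArcDiagram t m n)

theorem alternating_superSum {K : Subgroup (Weight m n ≃ₗ[ℚ] Weight m n)}
    (hK : K ≤ weylGroup t m n) (hU : (K : Set (Weight m n ≃ₗ[ℚ] Weight m n)).Finite)
    {S : Finset (Fin (m + n))} (h : ∀ p ∈ S, ∀ q ∈ S, p ≠ q → X.inE p = X.inE q →
      X.perm (Equiv.swap p q) ∈ K) : X.Alternating (superSumHom t hU) S := by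
  intro p hp q hq hpq hE Y
  rw [OrderedBasis.actSwap, superSumHom_apply, superSumHom_apply,
    superSum_act X.toOrderedBasis hK (h p hp q hq hpq hE),
    X.sgnPrime_cast (hK (h p hp q hq hpq hE)), X.chi_perm (X.inE_swap hE),
    Equiv.Perm.sign_swap hpq]
  simp

theorem flipSkew_superSum {K : Subgroup (Weight m n ≃ₗ[ℚ] Weight m n)}
    (hK : K ≤ weylGroup t m n) (hU : (K : Set (Weight m n ≃ₗ[ℚ] Weight m n)).Finite)
    {S : Finset (Fin (m + n))} {c : Bool}
    (h1 : ¬ (t = SuperType.D ∧ c = true) → ∀ i ∈ S, X.inE i = c → X.flip i ∈ K)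
    (h2 : ∀ i ∈ S, ∀ j ∈ S, i ≠ j → X.inE i = c → X.inE j = c → X.flip i * X.flip j ∈ K) :
    X.FlipSkew (superSumHom t hU) S c := by
  refine ⟨fun hD i hi hic Y => ?_, fun ht hc i hi j hj hij hic hjc Y => ?_⟩
  · have := h1 hD i hi hic
    rw [superSumHom_apply, superSumHom_apply, superSum_act X.toOrderedBasis hK this,
      X.sgnPrime_cast (hK this), X.chi_flip]
  · have := h2 i hi j hj hij hic hjc
    rw [superSumHom_apply, superSumHom_apply, superSum_act X.toOrderedBasis hK this,
      X.sgnPrime_cast (hK this), X.chi_flip_mul_flip (hic.trans hjc.symm), Rat.cast_one, one_mul]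

theorem inE_of_notMem_supp {c : Bool} (hc : (if c = true then n else m) ≤ min m n)
    {u : Fin (m + n)} (hu : u ∉ X.supp) : X.inE u = c := by
  by_contra h
  refine hu (X.mem_supp_of_inE (c := !c) ?_ (OrderedBasis.bool_eq_not_of_ne (Ne.symm h)))
  cases c <;> simpa using hc

theorem arcClosed_supp : X.ArcClosed X.supp := fun a ha =>
  ⟨fun _ => X.mem_supp.2 ⟨a, ha, Or.inr rfl⟩, fun _ => X.mem_supp.2 ⟨a, ha, Or.inl rfl⟩⟩

theorem arcsIn_supp : X.arcsIn X.supp = X.arcs :=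
  Finset.filter_true_of_mem fun a ha =>
    ⟨X.mem_supp.2 ⟨a, ha, Or.inl rfl⟩, X.mem_supp.2 ⟨a, ha, Or.inr rfl⟩⟩

theorem card_type {c : Bool} (hc : (if c = true then n else m) ≤ min m n) :
    X.arcs.card + (Finset.univ \ X.supp).card = Fintype.card {i // X.inE i = c} := by
  have h1 := X.card_inE c
  rw [Fintype.card_subtype, h1]
  have h2 := Finset.card_sdiff_add_card_eq_card (Finset.subset_univ X.supp)
  have h3 := X.card_eq_card_arcsIn X.arcClosed_supp subset_rfl
  rw [X.arcsIn_supp, X.card_arcs] at h3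
  rw [Finset.card_univ, Fintype.card_fin] at h2
  rw [X.card_arcs]
  cases c <;> simp at hc ⊢ <;> omega

theorem factorial_mul_superSum_cauchyQ {c : Bool} (hc : ∀ u, u ∉ X.supp → X.inE u = c) :
    ((Fintype.card {i // X.inE i = c}).factorial : RatFun m n) *
        superSum t (weylGroup t m n : Set (Weight m n ≃ₗ[ℚ] Weight m n)) X.cauchyQ =
      (Nat.card (weylGroup t m n) : RatFun m n) * (expo X.rho * X.superDenominator) := by
  have hU := weylGroup_finite t m n
  rw [← X.superSum_Q, ← X.sum_perm_cauchyQ hc, ← superSumHom_apply hU, ← superSumHom_apply hU,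
    map_sum]
  have key : ∀ σ : Equiv.Perm {i // X.inE i = c},
      superSumHom t hU (((Equiv.Perm.sign σ : ℤ) : RatFun m n) *
        act (X.perm (Equiv.Perm.ofSubtype σ)) X.cauchyQ) = superSumHom t hU X.cauchyQ := by
    intro σ
    have hσ : X.perm (Equiv.Perm.ofSubtype σ) ∈ weylGroup t m n :=
      OrderedBasis.reflectionGroup_mono (Finset.filter_subset _ _) (X.permOf_mem_part σ)
    have hE : ∀ i, X.inE (Equiv.Perm.ofSubtype σ i) = X.inE i := by
      intro i
      by_cases h : X.inE i = c
      · rw [Equiv.Perm.ofSubtype_apply_of_mem σ h, h]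
        exact (σ ⟨i, h⟩).2
      · rw [Equiv.Perm.ofSubtype_apply_of_not_mem σ h]
    rw [superSumHom_apply, superSumHom_apply, superSum_mul_left hU (fun w _ => map_intCast _ _),
      superSum_act X.toOrderedBasis le_rfl hσ, X.sgnPrime_cast hσ, X.chi_perm hE,
      Equiv.Perm.sign_ofSubtype, ← mul_assoc, Rat.cast_intCast, ← Int.cast_mul,
      Int.units_coe_mul_self, Int.cast_one, one_mul]
  rw [Finset.sum_congr rfl fun σ _ => key σ, Finset.sum_const, Finset.card_univ,
    Fintype.card_perm, nsmul_eq_mul]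

theorem superSum_weylGroup_P :
    superSum t (weylGroup t m n : Set (Weight m n ≃ₗ[ℚ] Weight m n)) X.P =
      (constC t m n : RatFun m n) * (expo X.rho * X.superDenominator) := by
  obtain ⟨hm1, hm2, hm3⟩ := majorType_spec t m n
  have hcard := constC_mul_card t m n
  generalize majorType t m n = c at hm1 hm2 hm3 hcard
  have hc : (if c = true then n else m) ≤ min m n := by
    cases c <;> simp at hm1 hm2 ⊢ <;> assumption
  have hU := weylGroup_finite t m n
  have h1 : 2 ^ flipCount t c (Fintype.card {i // X.inE i = c}) * superSumHom t hU X.P =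
      superSumHom t hU X.cauchyQ := by
    have hmap := map_P (X := X) (L := superSumHom t hU) (S := Finset.univ) (i := 0) (c := c)
      (by ext i; simp [mem_seg]) (Nat.zero_le _)
      (X.alternating_superSum le_rfl hU fun p _ q _ _ hE => X.perm_swap_mem hE)
      (fun ht => X.flipSkew_superSum le_rfl hU
        (fun hD i _ hi => X.flip_mem ht (hi ▸ hD))
        (fun i _ j _ hij hi hj => X.flip_mul_flip_mem ht hij (hi.trans hj.symm)))
      (Finset.subset_univ _) (fun u _ hu => X.inE_of_notMem_supp hc hu) ?_
    · rw [X.card_type hc] at hmap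
      rw [hmap, cauchyQ]
      simp
    · intro ht hct
      have h3 := X.card_type hc
      rw [Fintype.card_subtype, X.card_inE, X.card_arcs, if_pos hct] at h3
      have h4 := hm3 ht hct
      have : 0 < (Finset.univ \ X.supp).card := by omega
      obtain ⟨u, hu⟩ := Finset.card_pos.1 this
      exact ⟨u, Finset.mem_univ _, (Finset.mem_sdiff.1 hu).2⟩
  have h2 := X.factorial_mul_superSum_cauchyQ fun u hu => X.inE_of_notMem_supp hc hu
  rw [X.card_part] at hcard
  rw [← hcard, ← superSumHom_apply hU, ← h1] at h2
  push_cast at h2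
  have h5 : ((Fintype.card {i // X.inE i = c}).factorial : RatFun m n) ≠ 0 :=
    Nat.cast_ne_zero.2 (Nat.factorial_ne_zero _)
  have h6 : (2 : RatFun m n) ^ flipCount t c (Fintype.card {i // X.inE i = c}) ≠ 0 :=
    pow_ne_zero _ two_ne_zero
  refine mul_left_cancel₀ (mul_ne_zero h5 h6) ?_
  rw [← superSumHom_apply hU]
  linear_combination h2

end ArcDiagram

end SuperDenominator

namespace SuperDenominator

theorem form_of_mem_reflectionGroup {m n : ℕ} {A : Set (Weight m n)}
    {w : Weight m n ≃ₗ[ℚ] Weight m n} (hw : w ∈ reflectionGroup A) (x y : Weight m n) :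
    form (w x) (w y) = form x y := by
  have hw' : w ∈ Subgroup.closure (reflection '' A) := hw
  clear hw
  induction hw' using Subgroup.closure_induction'' generalizing x y with
  | mem g hg =>
    obtain ⟨α, -, rfl⟩ := hg
    exact form_reflection α x y
  | inv_mem g hg =>
    obtain ⟨α, -, rfl⟩ := hg
    rw [reflection_inv]
    exact form_reflection α x y
  | one => rfl
  | mul g h _ _ hg hh => exact (hg _ _).trans (hh _ _)

namespace OrderedBasis

variable {t : SuperType} {m n : ℕ} (X : OrderedBasis t m n)

/-! ### The root subsystem of a set of vertices -/

theorem mem_span_vertex {B' : Finset (Fin (m + n))} {v : Weight m n} :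
    v ∈ Submodule.span ℚ (X.vertex '' (B' : Set (Fin (m + n)))) ↔ ∀ k ∉ B', X.coord k v = 0 := by
  constructor
  · intro h k hk
    have : Submodule.span ℚ (X.vertex '' (B' : Set (Fin (m + n)))) ≤ LinearMap.ker (X.coord k) := by
      rw [Submodule.span_le]
      rintro _ ⟨i, hi, rfl⟩
      have hik : i ≠ k := fun h => hk (h ▸ hi)
      simp [coord_vertex, hik]
    exact this h
  · intro h
    rw [← X.sum_coord v]
    refine Submodule.sum_mem _ fun k _ => ?_
    by_cases hk : k ∈ B'
    · exact Submodule.smul_mem _ _ (Submodule.subset_span ⟨k, hk, rfl⟩)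
    · rw [h k hk, zero_smul]
      exact zero_mem _

theorem mem_simpleRootsIn {B' : Finset (Fin (m + n))} {α : Weight m n} :
    α ∈ X.simpleRootsIn B' ↔ α ∈ X.simpleRoots ∧ ∀ k ∉ B', X.coord k α = 0 := by
  classical
  rw [simpleRootsIn, Finset.mem_filter, mem_span_vertex]

theorem mem_evenRootsIn_iff_span {B' : Finset (Fin (m + n))} {α : Weight m n} :
    α ∈ X.evenRootsIn B' ↔ α ∈ evenRoots t m n ∧
      α ∈ Submodule.span ℚ (X.simpleRootsIn B' : Set (Weight m n)) := by
  classical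
  rw [evenRootsIn, Finset.mem_filter]

theorem evenRootsIn_subset (B' : Finset (Fin (m + n))) :
    X.evenRootsIn B' ⊆ evenRoots t m n := fun _ h => (X.mem_evenRootsIn_iff_span.1 h).1

theorem form_eq_zero {α β : Weight m n} (h : ∀ k, X.coord k α = 0 ∨ X.coord k β = 0) :
    form α β = 0 := by
  have key : ∀ s : Finset (Fin (m + n)),
      form (∑ k ∈ s, X.coord k α • X.vertex k) β = 0 := by
    intro s
    induction s using Finset.induction_on with
    | empty => simp [form]
    | insert a s ha ih =>
      rw [Finset.sum_insert ha, form_add_left, ih, form_smul_left, form_vertex_left]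
      rcases h a with h | h <;> rw [h] <;> ring
  rw [← X.sum_coord α]
  exact key _

theorem val_le_of_simpleRoots {α : Weight m n} (hα : α ∈ X.simpleRoots) {k l : Fin (m + n)}
    (hk : X.coord k α ≠ 0) (hl : X.coord l α ≠ 0) : l.val ≤ k.val + 1 := by
  have h2 : ∀ (i j : Fin (m + n)) (c : ℚ), α = X.vertex i + c • X.vertex j →
      ∀ k, X.coord k α ≠ 0 → k = i ∨ k = j := by
    rintro i j c rfl k hk
    by_contra! hne
    simp [coord_vertex, hne.1.symm, hne.2.symm] at hk
  have h1 : ∀ (i : Fin (m + n)) (c : ℚ), α = c • X.vertex i → ∀ k, X.coord k α ≠ 0 → k = i := by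
    rintro i c rfl k hk
    by_contra hne
    simp [coord_vertex, Ne.symm hne] at hk
  rcases X.simpleRoots_cases hα with ⟨i, j, hij, h⟩ | ⟨i, -, -, h⟩ | ⟨i, -, -, -, h⟩ |
    ⟨i, j, -, hij, -, -, h⟩
  · have h' := h2 i j (-1) (by rw [h]; module)
    rcases h' k hk with rfl | rfl <;> rcases h' l hl with rfl | rfl <;> omega
  · have h' := h1 i 1 (by rw [h]; module)
    rw [h' k hk, h' l hl]; omega
  · have h' := h1 i 2 h
    rw [h' k hk, h' l hl]; omega
  · have h' := h2 i j 1 (by rw [h]; module)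
    rcases h' k hk with rfl | rfl <;> rcases h' l hl with rfl | rfl <;> omega

variable {X} {B' : Finset (Fin (m + n))}

theorem mem_of_lt_of_lt (hCov : X.CoveredIn B') (hIrr : X.IrreducibleIn B')
    {i k j : Fin (m + n)} (hi : i ∈ B') (hj : j ∈ B') (hik : i < k) (hkj : k < j) : k ∈ B' := by
  classical
  by_contra hk
  have hmem : ∀ α ∈ X.simpleRootsIn B', ∀ l, X.coord l α ≠ 0 → l ≠ k := by
    rintro α hα l hl rfl
    exact hl ((X.mem_simpleRootsIn.1 hα).2 l hk)
  have hval : ∀ α ∈ X.simpleRootsIn B', ∀ l, X.coord l α ≠ 0 → l.val ≠ k.val := fun α hα l hl h =>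
    hmem α hα l hl (Fin.ext h)
  let A := (X.simpleRootsIn B').filter fun α => ∀ l, X.coord l α ≠ 0 → k.val < l.val
  obtain ⟨α, hα, hαi⟩ := hCov i hi
  obtain ⟨β, hβ, hβj⟩ := hCov j hj
  rw [apply_idx_ne_zero] at hαi hβj
  have hik' : i.val < k.val := hik
  have hkj' : k.val < j.val := hkj
  obtain ⟨γ, hγ, δ, hδ, hne⟩ := hIrr.2 A (Finset.filter_subset _ _) ⟨β, Finset.mem_filter.2
    ⟨hβ, fun l hl => by
      have h1 := X.val_le_of_simpleRoots (X.mem_simpleRootsIn.1 hβ).1 hl hβj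
      have h2 := hval β hβ l hl
      omega⟩⟩ (fun h => by
      rw [← h] at hα
      have := (Finset.mem_filter.1 hα).2 i hαi
      omega)
  obtain ⟨hδ1, hδ2⟩ := Finset.mem_sdiff.1 hδ
  have h3 : ∃ l, X.coord l δ ≠ 0 ∧ l.val ≤ k.val := by
    by_contra! h
    exact hδ2 (Finset.mem_filter.2 ⟨hδ1, h⟩)
  obtain ⟨l, hl, hlk⟩ := h3
  refine hne (X.form_eq_zero fun p => ?_)
  by_contra! hp
  have h4 := (Finset.mem_filter.1 hγ).2 p hp.1
  have h5 := X.val_le_of_simpleRoots (X.mem_simpleRootsIn.1 hδ1).1 hl hp.2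
  have h6 := hval δ hδ1 l hl
  omega

theorem span_simpleRootsIn_le : Submodule.span ℚ (X.simpleRootsIn B' : Set (Weight m n)) ≤
    Submodule.span ℚ (X.vertex '' (B' : Set (Fin (m + n)))) := by
  rw [Submodule.span_le]
  intro α hα
  exact X.mem_span_vertex.2 (X.mem_simpleRootsIn.1 hα).2

theorem mem_of_coord_ne_zero {α : Weight m n} (hα : α ∈ X.evenRootsIn B') {k : Fin (m + n)}
    (hk : X.coord k α ≠ 0) : k ∈ B' := by
  by_contra h
  exact hk (X.mem_span_vertex.1 (span_simpleRootsIn_le (X.mem_evenRootsIn_iff_span.1 hα).2) k h)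

theorem vertex_sub_mem_span_of_lt (hCov : X.CoveredIn B') (hIrr : X.IrreducibleIn B')
    {i j : Fin (m + n)} (hi : i ∈ B') (hj : j ∈ B') (hij : i < j) :
    X.vertex i - X.vertex j ∈ Submodule.span ℚ (X.simpleRootsIn B' : Set (Weight m n)) := by
  have key : ∀ (d : ℕ) (j : Fin (m + n)), j ∈ B' → j.val = i.val + d →
      X.vertex i - X.vertex j ∈ Submodule.span ℚ (X.simpleRootsIn B' : Set (Weight m n)) := by
    intro d
    induction d with
    | zero =>
      intro j _ h
      rw [show j = i from Fin.ext h, sub_self]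
      exact zero_mem _
    | succ d ih =>
      intro j hj h
      let k : Fin (m + n) := ⟨i.val + d, by omega⟩
      have hk : k ∈ B' := by
        rcases Nat.eq_zero_or_pos d with h0 | h0
        · have : k = i := Fin.ext (by simp [k, h0])
          rwa [this]
        · exact mem_of_lt_of_lt hCov hIrr hi hj (Fin.lt_def.2 (by simp [k]; omega))
            (Fin.lt_def.2 (by simp [k]; omega))
      have h1 := ih k hk rfl
      have h2 : X.vertex k - X.vertex j ∈ X.simpleRootsIn B' := by
        rw [mem_simpleRootsIn]
        refine ⟨?_, fun l hl => ?_⟩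
        · rw [simpleRoots.eq_def]
          refine Finset.mem_union_left _ (Finset.mem_image.2 ⟨(k, j), ?_, rfl⟩)
          simp [k]; omega
        · have hlk : k ≠ l := fun h => hl (h ▸ hk)
          have hlj : j ≠ l := fun h => hl (h ▸ hj)
          simp [coord_vertex, hlk, hlj]
      have := add_mem h1 (Submodule.subset_span h2)
      rwa [sub_add_sub_cancel] at this
  have hij' : i.val < j.val := hij
  exact key (j.val - i.val) j hj (by omega)

theorem vertex_sub_mem_evenRootsIn (hCov : X.CoveredIn B') (hIrr : X.IrreducibleIn B')
    {i j : Fin (m + n)} (hi : i ∈ B') (hj : j ∈ B') (hij : i ≠ j) (h : X.inE i = X.inE j) :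
    X.vertex i - X.vertex j ∈ X.evenRootsIn B' := by
  rw [mem_evenRootsIn_iff_span]
  refine ⟨X.sub_mem_evenRoots hij h, ?_⟩
  rcases lt_or_gt_of_ne hij with h' | h'
  · exact vertex_sub_mem_span_of_lt hCov hIrr hi hj h'
  · rw [← neg_sub]
    exact neg_mem (vertex_sub_mem_span_of_lt hCov hIrr hj hi h')

theorem permIn_le (hCov : X.CoveredIn B') (hIrr : X.IrreducibleIn B') :
    X.permIn B' ≤ X.weylIn B' := by
  refine reflectionGroup_mono ?_
  rintro _ ⟨i, hi, j, hj, hij, h, rfl⟩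
  exact vertex_sub_mem_evenRootsIn hCov hIrr hi hj hij h

theorem sharpIn_le (c : Bool) : X.sharpIn B' c ≤ X.weylIn B' :=
  reflectionGroup_mono (Finset.filter_subset _ _)

theorem weylIn_le : X.weylIn B' ≤ weylGroup t m n :=
  reflectionGroup_mono (X.evenRootsIn_subset B')

theorem swap_mem_permIn {i j : Fin (m + n)} (hi : i ∈ B') (hj : j ∈ B') (hij : i ≠ j)
    (h : X.inE i = X.inE j) : X.perm (Equiv.swap i j) ∈ X.permIn B' := by
  rw [← X.reflection_vertex_sub hij h]
  exact Subgroup.subset_closure ⟨_, ⟨i, hi, j, hj, hij, h, rfl⟩, rfl⟩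

theorem weylIn_le_permIn (hnt : t = SuperType.gl ∨ ∀ L ∈ B', L.val + 1 ≠ m + n) :
    X.weylIn B' ≤ X.permIn B' := by
  have hS : ∀ α ∈ X.simpleRootsIn B', X.functional (fun _ => 1) α = 0 := by
    intro α hα
    obtain ⟨h1, h2⟩ := X.mem_simpleRootsIn.1 hα
    have h3 : ∀ k, X.coord k α ≠ 0 → k ∈ B' := fun k hk => by
      by_contra h
      exact hk (h2 k h)
    rcases X.simpleRoots_cases h1 with ⟨i, j, hij, h⟩ | ⟨i, ht, hi, h⟩ | ⟨i, ht, hi, -, h⟩ |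
      ⟨i, j, ht, hij, hj, -, h⟩
    · rw [h]; simp
    · rcases hnt with h' | h'
      · rw [h'] at ht; cases ht
      · exact absurd hi (h' i (h3 i (by rw [h]; simp [coord_vertex])))
    · rcases hnt with h' | h'
      · rw [h'] at ht; cases ht
      · exact absurd hi (h' i (h3 i (by rw [h]; simp [coord_vertex])))
    · rcases hnt with h' | h'
      · rw [h'] at ht; cases ht
      · have hne : i ≠ j := by rintro rfl; omega
        exact absurd hj (h' j (h3 j (by rw [h]; simp [coord_vertex, hne])))
  have hspan : Submodule.span ℚ (X.simpleRootsIn B' : Set (Weight m n)) ≤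
      LinearMap.ker (X.functional fun _ => 1) := Submodule.span_le.2 hS
  refine (Subgroup.closure_le _).2 ?_
  rintro _ ⟨α, hα, rfl⟩
  have hf : X.functional (fun _ => 1) α = 0 := hspan (X.mem_evenRootsIn_iff_span.1 hα).2
  rcases X.evenRoots_cases (X.evenRootsIn_subset B' hα) with ⟨i, j, hij, h, s, hs, rfl⟩ |
    ⟨i, -, -, h⟩ | ⟨i, -, -, h⟩
  · have h0 : s.1 ≠ 0 := by rcases (pairSigns_cases hs).1 with h | h <;> rw [h] <;> norm_num
    rcases X.reflection_pair_eq hij h hs with ⟨h1, h2⟩ | ⟨-, h1, -⟩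
    · rw [h2]
      refine swap_mem_permIn (mem_of_coord_ne_zero hα ?_) (mem_of_coord_ne_zero hα ?_) hij h
      · simpa [coord_vertex, hij.symm] using h0
      · simpa [coord_vertex, hij, h1] using h0
    · simp [h1] at hf
      exact absurd hf h0
  · rcases h with rfl | rfl <;> simp at hf
  · rcases h with rfl | rfl <;> simp at hf

/-! ### The subsystems that contain the last simple root -/

theorem vertex_mem_span (hCov : X.CoveredIn B') (hIrr : X.IrreducibleIn B')
    (ht : t ≠ SuperType.gl) {L : Fin (m + n)} (hL : L ∈ B') (hLv : L.val + 1 = m + n)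
    {i : Fin (m + n)} (hi : i ∈ B') :
    X.vertex i ∈ Submodule.span ℚ (X.simpleRootsIn B' : Set (Weight m n)) := by
  have hsup : ∀ l ∉ B', X.coord l (X.vertex L) = 0 := fun l hl => by
    have hlL : L ≠ l := fun h => hl (h ▸ hL)
    simp [coord_vertex, hlL]
  have h0 : X.vertex L ∈ Submodule.span ℚ (X.simpleRootsIn B' : Set (Weight m n)) := by
    cases t with
    | gl => exact absurd rfl ht
    | B => exact Submodule.subset_span (X.mem_simpleRootsIn.2 ⟨X.simpleRoots_B hLv, hsup⟩)
    | D =>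
      cases hE : X.inE L with
      | false =>
        have h1 : (2 : ℚ) • X.vertex L ∈ X.simpleRootsIn B' :=
          X.mem_simpleRootsIn.2 ⟨X.simpleRoots_D hLv hE, fun l hl => by rw [map_smul, hsup l hl,
            smul_zero]⟩
        have := Submodule.smul_mem _ (1 / 2 : ℚ) (Submodule.subset_span h1 :
          _ ∈ Submodule.span ℚ (X.simpleRootsIn B' : Set (Weight m n)))
        rwa [smul_smul, div_mul_cancel₀ _ two_ne_zero, one_smul] at this
      | true =>
        obtain ⟨i, hi, hiL⟩ : ∃ i ∈ B', i.val + 1 = L.val := by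
          obtain ⟨α, hα, hαL⟩ := hCov L hL
          rw [apply_idx_ne_zero] at hαL
          obtain ⟨h1, h2⟩ := X.mem_simpleRootsIn.1 hα
          have h3 : ∀ k, X.coord k α ≠ 0 → k ∈ B' := fun k hk => by
            by_contra h
            exact hk (h2 k h)
          rcases X.simpleRoots_cases h1 with ⟨i, j, hij, h⟩ | ⟨i, ht, -, -⟩ | ⟨i, -, hi, hE', -⟩ |
            ⟨i, j, -, hij, hj, -, h⟩
          · have hne : i ≠ j := by rintro rfl; omega
            have hiL : i ≠ L := by rintro rfl; have := j.2; omega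
            have hjL : j = L := by
              by_contra hjL
              rw [h] at hαL
              simp [coord_vertex, hiL, hjL] at hαL
            exact ⟨i, h3 i (by rw [h]; simp [coord_vertex, hne.symm]), by rw [← hjL, hij]⟩
          · cases ht
          · have : i = L := Fin.ext (by omega)
            rw [this, hE] at hE'
            cases hE'
          · have hne : i ≠ j := by rintro rfl; omega
            exact ⟨i, h3 i (by rw [h]; simp [coord_vertex, hne.symm]), by omega⟩
        have hne : i < L := Fin.lt_def.2 (by omega)
        have h1 : X.vertex i + X.vertex L ∈ X.simpleRootsIn B' :=
          X.mem_simpleRootsIn.2 ⟨X.simpleRoots_D' hiL hLv hE, fun l hl => by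
            have hil : i ≠ l := fun h => hl (h ▸ hi)
            rw [map_add, hsup l hl, coord_vertex, if_neg hil, add_zero]⟩
        have h2 := vertex_sub_mem_span_of_lt hCov hIrr hi hL hne
        have := Submodule.smul_mem _ (1 / 2 : ℚ) (sub_mem (Submodule.subset_span h1 :
          _ ∈ Submodule.span ℚ (X.simpleRootsIn B' : Set (Weight m n))) h2)
        convert this using 1
        module
  by_cases hiL : i = L
  · rw [hiL]; exact h0
  · have : i < L := Fin.lt_def.2 (by
      have := i.2
      have : i.val ≠ L.val := fun h => hiL (Fin.ext h)
      omega)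
    have := add_mem (vertex_sub_mem_span_of_lt hCov hIrr hi hL this) h0
    rwa [sub_add_cancel] at this

theorem mem_evenRootsIn (hCov : X.CoveredIn B') (hIrr : X.IrreducibleIn B')
    (ht : t ≠ SuperType.gl) {L : Fin (m + n)} (hL : L ∈ B') (hLv : L.val + 1 = m + n)
    {α : Weight m n} :
    α ∈ X.evenRootsIn B' ↔ α ∈ evenRoots t m n ∧ ∀ k, X.coord k α ≠ 0 → k ∈ B' := by
  refine ⟨fun h => ⟨X.evenRootsIn_subset B' h, fun k hk => mem_of_coord_ne_zero h hk⟩,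
    fun h => X.mem_evenRootsIn_iff_span.2 ⟨h.1, ?_⟩⟩
  rw [← X.sum_coord α]
  refine Submodule.sum_mem _ fun k _ => ?_
  by_cases hk : X.coord k α = 0
  · rw [hk, zero_smul]; exact zero_mem _
  · exact Submodule.smul_mem _ _ (vertex_mem_span hCov hIrr ht hL hLv (h.2 k hk))

theorem eq_seg (hCov : X.CoveredIn B') (hIrr : X.IrreducibleIn B')
    {L : Fin (m + n)} (hL : L ∈ B') (hLv : L.val + 1 = m + n) :
    ∃ a ≤ m + n, B' = ArcDiagram.seg (m + n) a (m + n) := by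
  have hne : B'.Nonempty := ⟨L, hL⟩
  refine ⟨(B'.min' hne).val, (B'.min' hne).2.le, ?_⟩
  ext k
  rw [ArcDiagram.mem_seg]
  refine ⟨fun hk => ⟨B'.min'_le k hk, k.2⟩, fun hk => ?_⟩
  by_cases h1 : k = B'.min' hne
  · rw [h1]; exact B'.min'_mem hne
  · by_cases h2 : k = L
    · rwa [h2]
    · refine mem_of_lt_of_lt hCov hIrr (B'.min'_mem hne) hL (lt_of_le_of_ne hk.1 (Ne.symm h1))
        (Fin.lt_def.2 ?_)
      have : k.val ≠ L.val := fun h => h2 (Fin.ext h)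
      omega

end OrderedBasis

end SuperDenominator

namespace SuperDenominator

namespace OrderedBasis

variable {t : SuperType} {m n : ℕ} (X : OrderedBasis t m n)

theorem mem_evenPart {B' : Finset (Fin (m + n))} {c : Bool} {α : Weight m n} :
    α ∈ X.evenPart B' c ↔ α ∈ X.evenRootsIn B' ∧ α ∈ rootPart t m n c := by
  rw [evenPart, rootPart, Finset.mem_filter, Finset.mem_filter]
  exact ⟨fun h => ⟨h.1, X.evenRootsIn_subset B' h.1, h.2⟩, fun h => ⟨h.1, h.2.2⟩⟩

/-- A parametrization of the even roots that are spanned by vertices of one type. -/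
def rootOf (κ : ℚ) (p : (Fin (m + n) × Fin (m + n)) × ℚ) : Weight m n :=
  p.2 • (if p.1.1 < p.1.2 then X.vertex p.1.1 - X.vertex p.1.2
    else if p.1.2 < p.1.1 then X.vertex p.1.1 + X.vertex p.1.2 else κ • X.vertex p.1.1)

theorem rootOf_injOn {κ : ℚ} (hκ : 0 < κ) :
    Set.InjOn (X.rootOf κ) {p | p.2 = 1 ∨ p.2 = -1} := by
  rintro ⟨⟨i, j⟩, s⟩ hs ⟨⟨i', j'⟩, s'⟩ hs' h
  have hc : ∀ k, X.coord k (X.rootOf κ ((i, j), s)) = X.coord k (X.rootOf κ ((i', j'), s')) :=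
    fun k => by rw [h]
  have h1 := hc i
  have h2 := hc j
  have h3 := hc i'
  have h4 := hc j'
  simp only [Set.mem_ofPred_eq] at hs hs'
  simp only [rootOf] at h1 h2 h3 h4
  clear hc h
  have hκ' : κ ≠ 0 := hκ.ne'
  split_ifs at h1 h2 h3 h4 <;>
    simp only [map_smul, map_add, map_sub, coord_vertex, smul_eq_mul] at h1 h2 h3 h4 <;>
    rcases hs with rfl | rfl <;> rcases hs' with rfl | rfl <;>
    grind

theorem card_evenPart {B' : Finset (Fin (m + n))} (hCov : X.CoveredIn B')
    (hIrr : X.IrreducibleIn B') (ht : t ≠ SuperType.gl) {L : Fin (m + n)} (hL : L ∈ B')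
    (hLv : L.val + 1 = m + n) (c : Bool) :
    (X.evenPart B' c).card = (if t = SuperType.D ∧ c = true then
      (B'.filter fun i => X.inE i = c).card * (B'.filter fun i => X.inE i = c).card -
        (B'.filter fun i => X.inE i = c).card else
      (B'.filter fun i => X.inE i = c).card * (B'.filter fun i => X.inE i = c).card) * 2 := by
  set C := B'.filter fun i => X.inE i = c with hC
  set κ : ℚ := if t = SuperType.B ∧ c = true then 1 else 2 with hκ
  have hκ0 : 0 < κ := by rw [hκ]; split_ifs <;> norm_num
  set D := if t = SuperType.D ∧ c = true then C.offDiag else C ×ˢ C with hD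
  have hDcard : D.card = if t = SuperType.D ∧ c = true then C.card * C.card - C.card else
      C.card * C.card := by
    rw [hD]
    split_ifs
    · exact C.offDiag_card
    · exact Finset.card_product C C
  have hDm : ∀ p : Fin (m + n) × Fin (m + n), p ∈ D ↔ p.1 ∈ C ∧ p.2 ∈ C ∧
      (t = SuperType.D ∧ c = true → p.1 ≠ p.2) := by
    intro p
    rw [hD]
    split_ifs with h
    · rw [Finset.mem_offDiag]; tauto
    · rw [Finset.mem_product]; tauto
  have hCm : ∀ i, i ∈ C ↔ i ∈ B' ∧ X.inE i = c := fun i => Finset.mem_filter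
  have himage : X.evenPart B' c = (D ×ˢ ({1, -1} : Finset ℚ)).image (X.rootOf κ) := by
    ext α
    rw [mem_evenPart, mem_evenRootsIn hCov hIrr ht hL hLv, Finset.mem_image]
    constructor
    · rintro ⟨⟨hα, hsupp⟩, hpart⟩
      rcases X.evenRoots_cases hα with ⟨i, j, hij, hE, s, hs, rfl⟩ | ⟨i, hi, hB, h⟩ |
        ⟨i, hi, -, h⟩
      · obtain ⟨h1, h2⟩ := pairSigns_cases hs
        have h0 : s.1 ≠ 0 := by rcases h1 with h | h <;> rw [h] <;> norm_num
        have h3 : s.2 ≠ 0 := by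
          rcases h2 with h | ⟨_, h⟩ <;> rw [h]
          · exact neg_ne_zero.2 h0
          · exact h0
        have hiB : i ∈ B' := hsupp i (by simpa [coord_vertex, hij.symm] using h0)
        have hjB : j ∈ B' := hsupp j (by simpa [coord_vertex, hij] using h3)
        have hic : X.inE i = c := (X.mem_rootPart hα ⟨_, by
          have := mul_self_pos.2 h0
          have := mul_self_pos.2 h3
          linarith, X.form_self_pair hij hE _ _⟩).1 hpart
        have hiC := (hCm i).2 ⟨hiB, hic⟩
        have hjC := (hCm j).2 ⟨hjB, hE ▸ hic⟩
        have hs1 : s.1 ∈ ({1, -1} : Finset ℚ) := by simpa using h1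
        have hs2 : -s.1 ∈ ({1, -1} : Finset ℚ) := by
          rcases h1 with h | h <;> rw [h] <;> simp
        rcases lt_or_gt_of_ne hij with hlt | hlt
        · rcases h2 with h2 | ⟨-, h2⟩
          · refine ⟨((i, j), s.1), Finset.mem_product.2 ⟨(hDm _).2 ⟨hiC, hjC, fun _ => hij⟩, hs1⟩, ?_⟩
            simp only [rootOf, if_pos hlt, h2]; module
          · refine ⟨((j, i), s.1), Finset.mem_product.2
              ⟨(hDm _).2 ⟨hjC, hiC, fun _ => hij.symm⟩, hs1⟩, ?_⟩
            simp only [rootOf, if_neg hlt.not_gt, if_pos hlt, h2]; module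
        · rcases h2 with h2 | ⟨-, h2⟩
          · refine ⟨((j, i), -s.1), Finset.mem_product.2
              ⟨(hDm _).2 ⟨hjC, hiC, fun _ => hij.symm⟩, hs2⟩, ?_⟩
            simp only [rootOf, if_pos hlt, h2]; module
          · refine ⟨((i, j), s.1), Finset.mem_product.2 ⟨(hDm _).2 ⟨hiC, hjC, fun _ => hij⟩, hs1⟩, ?_⟩
            simp only [rootOf, if_neg hlt.not_gt, if_pos hlt, h2]; module
      · have hic : X.inE i = c := (X.mem_rootPart hα ⟨1, one_pos, by
          rcases h with rfl | rfl <;> simp [form_neg_left, form_neg_right, form_vertex]⟩).1 hpart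
        have hκ1 : κ = 1 := by rw [hκ, if_pos ⟨hB, hic ▸ hi⟩]
        have hiC := (hCm i).2 ⟨hsupp i (by rcases h with rfl | rfl <;> simp [coord_vertex]), hic⟩
        have hDi : (i, i) ∈ D := (hDm _).2 ⟨hiC, hiC, fun h => by rw [h.1] at hB; cases hB⟩
        rcases h with rfl | rfl
        · exact ⟨((i, i), 1), Finset.mem_product.2 ⟨hDi, by simp⟩, by simp [rootOf, hκ1]⟩
        · exact ⟨((i, i), -1), Finset.mem_product.2 ⟨hDi, by simp⟩, by simp [rootOf, hκ1]⟩
      · have hic : X.inE i = c := (X.mem_rootPart hα ⟨4, by norm_num, by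
          rcases h with rfl | rfl <;>
            simp only [form_neg_left, form_neg_right, form_vertex, form_smul_left,
              form_smul_right, if_true] <;> ring⟩).1 hpart
        have hcf : ¬ c = true := by rw [← hic, hi]; simp
        have hκ2 : κ = 2 := by rw [hκ, if_neg fun h => hcf h.2]
        have hiC := (hCm i).2 ⟨hsupp i (by rcases h with rfl | rfl <;> simp [coord_vertex]), hic⟩
        have hDi : (i, i) ∈ D := (hDm _).2 ⟨hiC, hiC, fun h => absurd h.2 hcf⟩
        rcases h with rfl | rfl
        · exact ⟨((i, i), 1), Finset.mem_product.2 ⟨hDi, by simp⟩, by simp [rootOf, hκ2]⟩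
        · exact ⟨((i, i), -1), Finset.mem_product.2 ⟨hDi, by simp⟩, by simp [rootOf, hκ2]⟩
    · rintro ⟨⟨⟨i, j⟩, s⟩, hp, rfl⟩
      obtain ⟨hp1, hp2⟩ := Finset.mem_product.1 hp
      obtain ⟨hiC, hjC, hne⟩ := (hDm _).1 hp1
      obtain ⟨hiB, hic⟩ := (hCm _).1 hiC
      obtain ⟨hjB, hjc⟩ := (hCm _).1 hjC
      simp only at hiB hic hjB hjc hne hp2
      have hs : s = 1 ∨ s = -1 := by simpa using hp2
      have hneg : ∀ β : Weight m n, (β ∈ evenRoots t m n ∧ -β ∈ evenRoots t m n) →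
          s • β ∈ evenRoots t m n := by
        rintro β ⟨h1, h2⟩
        rcases hs with rfl | rfl
        · rwa [one_smul]
        · rwa [neg_one_smul]
      have hss : s * s = 1 := by rcases hs with rfl | rfl <;> norm_num
      have hE : X.inE i = X.inE j := hic.trans hjc.symm
      have hpair : ∀ a b : ℚ, s ≠ 0 → (a, b) ∈ pairSigns t → (-a, -b) ∈ pairSigns t → i ≠ j →
          s • (a • X.vertex i + b • X.vertex j) ∈ evenRoots t m n := by
        intro a b _ h1 h2 hij
        refine hneg _ ⟨X.pair_mem_evenRoots hij hE h1, ?_⟩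
        have := X.pair_mem_evenRoots hij hE h2
        convert this using 1
        module
      have hs0 : s ≠ 0 := by rcases hs with rfl | rfl <;> norm_num
      have hsg : ∀ a b : ℚ, (a = 1 ∨ a = -1) → (b = 1 ∨ b = -1) → (a, b) ∈ pairSigns t := by
        intro a b ha hb
        rcases ha with rfl | rfl <;> rcases hb with rfl | rfl <;>
          cases t <;> simp [pairSigns] at ht ⊢
      have main : X.rootOf κ ((i, j), s) ∈ evenRoots t m n ∧
          (∃ k : ℚ, 0 < k ∧ form (X.rootOf κ ((i, j), s)) (X.rootOf κ ((i, j), s)) =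
            k * X.eta i) ∧ ∀ k, X.coord k (X.rootOf κ ((i, j), s)) ≠ 0 → k = i ∨ k = j := by
        simp only [rootOf]
        rcases lt_trichotomy i j with hij | rfl | hij
        · rw [if_pos hij]
          have e1 : X.vertex i - X.vertex j = (1 : ℚ) • X.vertex i + (-1 : ℚ) • X.vertex j := by
            module
          rw [e1]
          refine ⟨hpair 1 (-1) hs0 (hsg _ _ (by simp) (by simp)) (hsg _ _ (by simp) (by simp))
            hij.ne, ⟨2, two_pos, ?_⟩, fun k hk => ?_⟩
          · rw [form_smul_left, form_smul_right, X.form_self_pair hij.ne hE]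
            linear_combination 2 * X.eta i * hss
          · by_contra! hn
            simp [coord_vertex, hn.1.symm, hn.2.symm] at hk
        · rw [if_neg (lt_irrefl i), if_neg (lt_irrefl i)]
          have hD' : ¬ (t = SuperType.D ∧ c = true) := fun h => hne h rfl
          refine ⟨?_, ⟨κ * κ, mul_pos hκ0 hκ0, ?_⟩, fun k hk => ?_⟩
          · rw [hκ]
            split_ifs with hB
            · refine hneg _ ?_
              rw [evenRoots.eq_def]
              obtain ⟨hB, hc⟩ := hB
              subst hB
              constructor
              · exact Finset.mem_union_right _ (Finset.mem_union_left _
                  (X.mem_multEps.2 ⟨i, hic.trans hc, Or.inl rfl⟩))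
              · exact Finset.mem_union_right _ (Finset.mem_union_left _
                  (X.mem_multEps.2 ⟨i, hic.trans hc, Or.inr rfl⟩))
            · have hc : c = false := by
                cases t <;> cases c <;> simp_all
              refine hneg _ ?_
              rw [evenRoots.eq_def]
              cases t with
              | gl => exact absurd rfl ht
              | B =>
                exact ⟨Finset.mem_union_right _ (Finset.mem_union_right _
                  (X.mem_multDelta.2 ⟨i, hic.trans hc, Or.inl rfl⟩)),
                  Finset.mem_union_right _ (Finset.mem_union_right _
                  (X.mem_multDelta.2 ⟨i, hic.trans hc, Or.inr rfl⟩))⟩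
              | D =>
                exact ⟨Finset.mem_union_right _
                  (X.mem_multDelta.2 ⟨i, hic.trans hc, Or.inl rfl⟩),
                  Finset.mem_union_right _
                  (X.mem_multDelta.2 ⟨i, hic.trans hc, Or.inr rfl⟩)⟩
          · simp only [form_smul_left, form_smul_right, form_vertex, if_true]
            linear_combination κ * κ * X.eta i * hss
          · by_contra! hn
            simp [coord_vertex, hn.1.symm] at hk
        · rw [if_neg hij.not_gt, if_pos hij]
          have e1 : X.vertex i + X.vertex j = (1 : ℚ) • X.vertex i + (1 : ℚ) • X.vertex j := by
            module
          rw [e1]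
          refine ⟨hpair 1 1 hs0 (hsg _ _ (by simp) (by simp)) (hsg _ _ (by simp) (by simp))
            hij.ne', ⟨2, two_pos, ?_⟩, fun k hk => ?_⟩
          · rw [form_smul_left, form_smul_right, X.form_self_pair hij.ne' hE]
            linear_combination 2 * X.eta i * hss
          · by_contra! hn
            simp [coord_vertex, hn.1.symm, hn.2.symm] at hk
      obtain ⟨h1, h2, h3⟩ := main
      refine ⟨⟨h1, fun k hk => ?_⟩, (X.mem_rootPart h1 h2).2 hic⟩
      rcases h3 k hk with rfl | rfl
      · exact hiB
      · exact hjB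
  rw [himage, Finset.card_image_of_injOn, Finset.card_product, hDcard]
  · congr 1
  · refine (X.rootOf_injOn hκ0).mono ?_
    rintro ⟨p, s⟩ hp
    simpa using (Finset.mem_product.1 hp).2

end OrderedBasis

end SuperDenominator

namespace SuperDenominator

namespace OrderedBasis

variable {t : SuperType} {m n : ℕ} {X : OrderedBasis t m n} {B' : Finset (Fin (m + n))} {c : Bool}

theorem of_mem_evenPart {α : Weight m n} (hα : α ∈ X.evenPart B' c) {k : Fin (m + n)}
    (hk : X.coord k α ≠ 0) : X.inE k = c := by
  obtain ⟨h1, h2⟩ := X.mem_evenPart.1 hα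
  obtain ⟨i, j, hE, -, -, hs, hf, -⟩ := X.reflection_cases (X.evenRootsIn_subset B' h1)
  have hi := (X.mem_rootPart (X.evenRootsIn_subset B' h1) hf).1 h2
  rcases hs k hk with rfl | rfl
  · exact hi
  · exact hE ▸ hi

theorem form_vertex_evenPart {α : Weight m n} (hα : α ∈ X.evenPart B' c) {k : Fin (m + n)}
    (hk : X.inE k ≠ c) : form (X.vertex k) α = 0 := by
  rw [form_vertex_left]
  by_cases h : X.coord k α = 0
  · rw [h, mul_zero]
  · exact absurd (of_mem_evenPart hα h) hk

theorem sharpIn_vertex {w : Weight m n ≃ₗ[ℚ] Weight m n} (hw : w ∈ X.sharpIn B' c)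
    {k : Fin (m + n)} (hk : X.inE k ≠ c) : w (X.vertex k) = X.vertex k := by
  have hw' : w ∈ Subgroup.closure (reflection '' (X.evenPart B' c : Set (Weight m n))) := hw
  clear hw
  have hgen : ∀ α ∈ X.evenPart B' c, reflection α (X.vertex k) = X.vertex k := fun α hα => by
    rw [reflection_apply, form_vertex_evenPart hα hk, mul_zero, zero_div, zero_smul, sub_zero]
  induction hw' using Subgroup.closure_induction'' with
  | mem g hg =>
    obtain ⟨α, hα, rfl⟩ := hg
    exact hgen α hα
  | inv_mem g hg =>
    obtain ⟨α, hα, rfl⟩ := hg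
    rw [reflection_inv]
    exact hgen α hα
  | one => rfl
  | mul g h _ _ hg hh => rw [LinearEquiv.mul_apply, hh, hg]

theorem permIn_vertex {w : Weight m n ≃ₗ[ℚ] Weight m n} (hw : w ∈ X.permIn B')
    {k : Fin (m + n)} (hk : k ∈ B') :
    ∃ l ∈ B', X.inE l = X.inE k ∧ w (X.vertex k) = X.vertex l := by
  rw [permIn, reflectionGroup] at hw
  have hgen : ∀ i ∈ B', ∀ j ∈ B', i ≠ j → X.inE i = X.inE j → ∀ k ∈ B',
      ∃ l ∈ B', X.inE l = X.inE k ∧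
        reflection (X.vertex i - X.vertex j) (X.vertex k) = X.vertex l := by
    intro i hi j hj hij h k hk
    refine ⟨Equiv.swap i j k, ?_, X.inE_swap h k, ?_⟩
    · rw [Equiv.swap_apply_def]
      split_ifs <;> assumption
    · rw [X.reflection_vertex_sub hij h, perm_vertex]
  induction hw using Subgroup.closure_induction'' generalizing k with
  | mem g hg =>
    obtain ⟨_, ⟨i, hi, j, hj, hij, h, rfl⟩, rfl⟩ := hg
    exact hgen i hi j hj hij h k hk
  | inv_mem g hg =>
    obtain ⟨_, ⟨i, hi, j, hj, hij, h, rfl⟩, rfl⟩ := hg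
    rw [reflection_inv]
    exact hgen i hi j hj hij h k hk
  | one => exact ⟨k, hk, rfl, rfl⟩
  | mul g h _ _ hg hh =>
    obtain ⟨l, hl, h1, h2⟩ := hh hk
    obtain ⟨p, hp, h3, h4⟩ := hg hl
    exact ⟨p, hp, h3.trans h1, by rw [LinearEquiv.mul_apply, h2, h4]⟩

theorem permIn_le_normalizer (hCov : X.CoveredIn B') (hIrr : X.IrreducibleIn B') :
    X.permIn B' ≤ Subgroup.normalizer (X.sharpIn B' c : Set (Weight m n ≃ₗ[ℚ] Weight m n)) := by
  rw [Subgroup.le_normalizer_iff]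
  intro p hp
  rw [permIn, reflectionGroup] at hp
  have hgen : ∀ i ∈ B', ∀ j ∈ B', i ≠ j → X.inE i = X.inE j → ∀ k ∈ X.sharpIn B' c,
      reflection (X.vertex i - X.vertex j) * k * (reflection (X.vertex i - X.vertex j))⁻¹ ∈
        X.sharpIn B' c := by
    intro i hi j hj hij h
    by_cases hic : X.inE i = c
    · have : reflection (X.vertex i - X.vertex j) ∈ X.sharpIn B' c := by
        refine Subgroup.subset_closure ⟨_, ?_, rfl⟩
        rw [Finset.mem_coe, mem_evenPart, X.mem_rootPart (i := i) (X.sub_mem_evenRoots hij h)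
          ⟨2, two_pos, ?_⟩]
        · exact ⟨vertex_sub_mem_evenRootsIn hCov hIrr hi hj hij h, hic⟩
        · have := X.form_self_pair hij h 1 (-1)
          simp only [one_smul, neg_smul, ← sub_eq_add_neg] at this
          rw [this]; norm_num
      exact fun k hk => mul_mem (mul_mem this hk) (inv_mem this)
    · have hle : X.sharpIn B' c ≤
          Subgroup.centralizer {reflection (X.vertex i - X.vertex j)} := by
        refine (Subgroup.closure_le _).2 ?_
        rintro _ ⟨α, hα, rfl⟩
        rw [SetLike.mem_coe, Subgroup.mem_centralizer_singleton_iff]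
        have h1 := reflection_conj (form_reflection (X.vertex i - X.vertex j)) α
        have h2 : reflection (X.vertex i - X.vertex j) α = α := by
          rw [reflection_apply, form_comm, form_sub_left, form_vertex_evenPart hα hic,
            form_vertex_evenPart hα (h ▸ hic), sub_self, mul_zero, zero_div, zero_smul, sub_zero]
        rw [h2, mul_inv_eq_iff_eq_mul] at h1
        exact h1.symm
      intro k hk
      have h1 := Subgroup.mem_centralizer_singleton_iff.1 (hle hk)
      rw [show reflection (X.vertex i - X.vertex j) * k = k * reflection (X.vertex i - X.vertex j)
        from h1.symm, mul_inv_cancel_right]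
      exact hk
  induction hp using Subgroup.closure_induction'' with
  | mem g hg =>
    obtain ⟨_, ⟨i, hi, j, hj, hij, h, rfl⟩, rfl⟩ := hg
    exact hgen i hi j hj hij h
  | inv_mem g hg =>
    obtain ⟨_, ⟨i, hi, j, hj, hij, h, rfl⟩, rfl⟩ := hg
    have := hgen i hi j hj hij h
    rwa [reflection_inv] at this ⊢
  | one => intro k hk; simpa using hk
  | mul g h _ _ hg hh =>
    intro k hk
    have := hg _ (hh k hk)
    simpa only [mul_inv_rev, mul_assoc] using this

theorem coe_permIn_sup_sharpIn (hCov : X.CoveredIn B') (hIrr : X.IrreducibleIn B') :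
    ((X.permIn B' ⊔ X.sharpIn B' c : Subgroup (Weight m n ≃ₗ[ℚ] Weight m n)) :
      Set (Weight m n ≃ₗ[ℚ] Weight m n)) = (X.permIn B' : Set _) * (X.sharpIn B' c : Set _) :=
  Subgroup.coe_mul_of_left_le_normalizer_right _ _ (permIn_le_normalizer hCov hIrr)

theorem permIn_sup_sharpIn_le (hCov : X.CoveredIn B') (hIrr : X.IrreducibleIn B') :
    X.permIn B' ⊔ X.sharpIn B' c ≤ X.weylIn B' :=
  sup_le (permIn_le hCov hIrr) (sharpIn_le c)

/-- An element of the group moves the sign changes of the vertices of the other type around. -/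
theorem exists_flip_mul (hCov : X.CoveredIn B') (hIrr : X.IrreducibleIn B')
    {w : Weight m n ≃ₗ[ℚ] Weight m n} (hw : w ∈ X.permIn B' ⊔ X.sharpIn B' c)
    {i : Fin (m + n)} (hi : i ∈ B') (hic : X.inE i ≠ c) :
    ∃ j ∈ B', X.inE j = X.inE i ∧ X.flip i * w = w * X.flip j := by
  have hw' : w ∈ (X.permIn B' : Set (Weight m n ≃ₗ[ℚ] Weight m n)) *
      (X.sharpIn B' c : Set _) := by
    rw [← coe_permIn_sup_sharpIn hCov hIrr]; exact hw
  obtain ⟨p, hp, s, hs, rfl⟩ := Set.mem_mul.1 hw'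
  obtain ⟨j, hj, hE, h⟩ := permIn_vertex (inv_mem hp) hi
  refine ⟨j, hj, hE, ?_⟩
  have h1 : (p * s) (X.vertex j) = X.vertex i := by
    rw [LinearEquiv.mul_apply, sharpIn_vertex hs (hE ▸ hic), ← h, ← LinearEquiv.mul_apply,
      mul_inv_cancel]
    rfl
  have h2 := reflection_conj (form_of_mem_reflectionGroup
    (weylIn_le (permIn_sup_sharpIn_le hCov hIrr hw))) (X.vertex j)
  rw [h1, mul_inv_eq_iff_eq_mul] at h2
  exact h2.symm

theorem tau_congr (X : OrderedBasis t m n) {i j : Fin (m + n)} (h : X.inE i = X.inE j) :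
    X.tau i = X.tau j := by
  rw [tau, tau, h, X.kap_congr h]

theorem act_flip_superSum (hCov : X.CoveredIn B') (hIrr : X.IrreducibleIn B') {G : RatFun m n}
    (hG : ∀ j ∈ B', X.inE j ≠ c → act (X.flip j) G = (X.tau j : RatFun m n) * G)
    {i : Fin (m + n)} (hi : i ∈ B') (hic : X.inE i ≠ c) :
    act (X.flip i) (superSum t ((X.permIn B' ⊔ X.sharpIn B' c :
        Subgroup (Weight m n ≃ₗ[ℚ] Weight m n)) : Set _) G) =
      (X.tau i : RatFun m n) * superSum t ((X.permIn B' ⊔ X.sharpIn B' c :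
        Subgroup (Weight m n ≃ₗ[ℚ] Weight m n)) : Set _) G := by
  have hU : ((X.permIn B' ⊔ X.sharpIn B' c : Subgroup (Weight m n ≃ₗ[ℚ] Weight m n)) :
      Set (Weight m n ≃ₗ[ℚ] Weight m n)).Finite :=
    finite_of_subset_weylGroup ((permIn_sup_sharpIn_le hCov hIrr).trans weylIn_le)
  rw [superSum_eq_sum hU, map_sum, Finset.mul_sum]
  refine Finset.sum_congr rfl fun w hw => ?_
  obtain ⟨j, hj, hE, h⟩ := exists_flip_mul hCov hIrr (hU.mem_toFinset.1 hw) hi hic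
  rw [map_mul, map_intCast, ← act_mul, h, act_mul, hG j hj (hE ▸ hic), map_mul, map_ratCast,
    X.tau_congr hE]
  ring

end OrderedBasis

namespace ArcDiagram

variable {t : SuperType} {m n : ℕ} {X : ArcDiagram t m n} {B' : Finset (Fin (m + n))} {c : Bool}

theorem card_filter_inE (hSupp : X.supp ⊆ B') (c : Bool) :
    (B'.filter fun i => X.inE i = c).card =
      X.arcs.card + ((B' \ X.supp).filter fun i => X.inE i = c).card := by
  have h : (B'.filter fun i => X.inE i = c) =
      X.arcs.image (X.endOf c) ∪ (B' \ X.supp).filter fun i => X.inE i = c := by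
    ext i
    simp only [Finset.mem_filter, Finset.mem_union, Finset.mem_image, Finset.mem_sdiff]
    constructor
    · rintro ⟨hi, hic⟩
      by_cases hs : i ∈ X.supp
      · obtain ⟨a, ha, h⟩ := X.exists_endOf hs
        exact Or.inl ⟨a, ha, hic ▸ h⟩
      · exact Or.inr ⟨⟨hi, hs⟩, hic⟩
    · rintro (⟨a, ha, rfl⟩ | ⟨⟨hi, -⟩, hic⟩)
      · exact ⟨hSupp (X.endOf_mem_supp c ha), X.inE_endOf c ha⟩
      · exact ⟨hi, hic⟩
  rw [h, Finset.card_union_of_disjoint, Finset.card_image_of_injOn (X.endOf_injOn c)]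
  rw [Finset.disjoint_left]
  intro i hi hi'
  obtain ⟨a, ha, rfl⟩ := Finset.mem_image.1 hi
  exact (Finset.mem_sdiff.1 (Finset.mem_filter.1 hi').1).2 (X.endOf_mem_supp c ha)

/-- In the presence of the last simple root, the part of the root system that is not the smallest
one is the part that corresponds to the unmatched vertices. -/
theorem inE_eq_of_notSmallest (hSupp : X.supp ⊆ B') (hCov : X.CoveredIn B')
    (hIrr : X.IrreducibleIn B') (hc : X.NotSmallest B' c) (ht : t ≠ SuperType.gl)
    {L : Fin (m + n)} (hL : L ∈ B') (hLv : L.val + 1 = m + n) :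
    ∀ u ∈ B', u ∉ X.supp → X.inE u = c := by
  intro u hu hus
  by_contra hne
  have hux : X.inE u = !c := OrderedBasis.bool_eq_not_of_ne (Ne.symm hne)
  have hmin : ∀ i, X.inE i = c → i ∈ X.supp := by
    obtain ⟨y, hy⟩ := X.exists_minor
    have : y = c := by
      by_contra h
      exact hus (hy u (by rw [hux, OrderedBasis.bool_eq_not_of_ne (Ne.symm h)]))
    rwa [this] at hy
  have hkc : (B'.filter fun i => X.inE i = c).card = X.arcs.card := by
    have h1 : (B' \ X.supp).filter (fun i => X.inE i = c) = ∅ :=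
      Finset.filter_eq_empty_iff.2 fun i hi h => (Finset.mem_sdiff.1 hi).2 (hmin i h)
    rw [card_filter_inE hSupp c, h1, Finset.card_empty, add_zero]
  obtain ⟨r, hr⟩ : ∃ r, (B'.filter fun i => X.inE i = !c).card = X.arcs.card + (r + 1) := by
    have h1 : 0 < ((B' \ X.supp).filter fun i => X.inE i = !c).card :=
      Finset.card_pos.2 ⟨u, Finset.mem_filter.2 ⟨Finset.mem_sdiff.2 ⟨hu, hus⟩, hux⟩⟩
    exact ⟨((B' \ X.supp).filter fun i => X.inE i = !c).card - 1, by
      rw [card_filter_inE hSupp, Nat.sub_add_cancel h1]⟩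
  have hle := hc
  rw [OrderedBasis.NotSmallest, X.card_evenPart hCov hIrr ht hL hLv,
    X.card_evenPart hCov hIrr ht hL hLv, hkc, hr] at hle
  generalize hp : X.arcs.card = p at *
  by_cases hD : t = SuperType.D
  · cases c with
    | true =>
      simp only [hD, Bool.not_true, Bool.false_eq_true, and_false, if_false, and_self, if_true]
        at hle
      have : p * p - p ≤ p * p := Nat.sub_le _ _
      nlinarith
    | false =>
      simp only [hD, Bool.not_false, and_self, if_true, Bool.false_eq_true, and_false, if_false]
        at hle
      have h1 : (p + (r + 1)) * (p + (r + 1)) - (p + (r + 1)) = (p + (r + 1)) * (p + r) := by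
        rw [← Nat.mul_sub_one]; rfl
      rw [h1] at hle
      have hp0 : p = 0 := by nlinarith
      subst hp0
      have hr0 : r = 0 := by nlinarith
      subst hr0
      obtain ⟨α, hα, -⟩ := hCov u hu
      obtain ⟨h2, h3⟩ := X.mem_simpleRootsIn.1 hα
      have h4 : ∀ k, X.coord k α ≠ 0 → k ∈ B' ∧ X.inE k = true := fun k hk => by
        have hkB : k ∈ B' := by
          by_contra h
          exact hk (h3 k h)
        refine ⟨hkB, ?_⟩
        by_contra hkE
        have : k ∈ B'.filter fun i => X.inE i = false :=
          Finset.mem_filter.2 ⟨hkB, by simpa using hkE⟩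
        rw [Finset.card_eq_zero.1 hkc] at this
        simp at this
      have h5 : ∀ k l, X.coord k α ≠ 0 → X.coord l α ≠ 0 → k = l := fun k l hk hl =>
        Finset.card_le_one.1 hr.le k (Finset.mem_filter.2 (h4 k hk)) l
          (Finset.mem_filter.2 (h4 l hl))
      rcases X.simpleRoots_cases h2 with ⟨i, j, hij, h⟩ | ⟨i, hB, -, h⟩ | ⟨i, -, -, hE, h⟩ |
        ⟨i, j, -, hij, -, -, h⟩
      · have hne : i ≠ j := by rintro rfl; omega
        exact hne (h5 i j (by rw [h]; simp [OrderedBasis.coord_vertex, hne.symm])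
          (by rw [h]; simp [OrderedBasis.coord_vertex, hne]))
      · rw [hD] at hB; cases hB
      · have := (h4 i (by rw [h]; simp [OrderedBasis.coord_vertex])).2
        rw [hE] at this; cases this
      · have hne : i ≠ j := by rintro rfl; omega
        exact hne (h5 i j (by rw [h]; simp [OrderedBasis.coord_vertex, hne.symm])
          (by rw [h]; simp [OrderedBasis.coord_vertex, hne]))
  · simp only [hD, false_and, if_false] at hle
    nlinarith

theorem exists_notMem_supp (hSupp : X.supp ⊆ B') (hCov : X.CoveredIn B')
    (hIrr : X.IrreducibleIn B') (hc : X.NotSmallest B' c)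
    {L : Fin (m + n)} (hL : L ∈ B') (hLv : L.val + 1 = m + n) (hD : t = SuperType.D)
    (hct : c = true) : ∃ u ∈ B', u ∉ X.supp := by
  by_contra! hall
  have hk : ∀ d, (B'.filter fun i => X.inE i = d).card = X.arcs.card := by
    intro d
    rw [card_filter_inE hSupp, Finset.sdiff_eq_empty_iff_subset.2 hall]
    simp
  have ht : t ≠ SuperType.gl := by rw [hD]; simp
  have hle := hc
  rw [OrderedBasis.NotSmallest, X.card_evenPart hCov hIrr ht hL hLv,
    X.card_evenPart hCov hIrr ht hL hLv, hk, hk] at hle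
  subst hct
  simp only [hD, Bool.not_true, Bool.false_eq_true, and_false, if_false, and_self, if_true] at hle
  have hp : 0 < X.arcs.card := by
    rw [← hk (X.inE L)]
    exact Finset.card_pos.2 ⟨L, Finset.mem_filter.2 ⟨hL, rfl⟩⟩
  have := Nat.mul_pos hp hp
  omega

theorem act_flip_matched (ht : t ≠ SuperType.gl) {i : Fin (m + n)} (hi : i ∈ X.supp)
    (hSupp : X.supp ⊆ B') :
    act (X.flip i) ((∏ a ∈ X.arcs, X.arcQ a) * ((∏ u ∈ B' \ X.supp, X.vertexQ u) *
        ∏ l ∈ B'ᶜ, X.e l (X.coord l X.rho))) =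
      (X.tau i : RatFun m n) * ((∏ a ∈ X.arcs, X.arcQ a) * ((∏ u ∈ B' \ X.supp, X.vertexQ u) *
        ∏ l ∈ B'ᶜ, X.e l (X.coord l X.rho))) := by
  have h1 : act (X.flip i) (∏ a ∈ X.arcs, X.arcQ a) =
      (X.tau i : RatFun m n) * ∏ a ∈ X.arcs, X.arcQ a := by
    have h2 : ∏ a ∈ X.arcs, X.arcQ a = (∏ j ∈ X.supp, X.tailQ j) *
        ∏ a ∈ X.arcs, (X.V a.1 - X.V a.2)⁻¹ := by
      rw [X.prod_eq_prod_arcsIn X.arcClosed_supp, X.arcsIn_supp, sdiff_self,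
        Finset.bot_eq_empty, Finset.prod_empty, mul_one, ← Finset.prod_mul_distrib]
      rfl
    have h3 : ∀ j, act (X.flip i) (X.tailQ j) =
        (if j = i then (X.tau i : RatFun m n) else 1) * X.tailQ j := by
      intro j
      rw [X.act_flip_tailQ ht]
      split_ifs with h
      · rw [h]
      · rw [one_mul]
    rw [h2, map_mul, map_prod, map_prod, Finset.prod_congr rfl fun j _ => h3 j,
      Finset.prod_mul_distrib, Finset.prod_ite_eq' X.supp i, if_pos hi]
    simp only [map_inv₀, map_sub, X.act_flip_V ht]
    ring
  have h4 : act (X.flip i) (∏ u ∈ B' \ X.supp, X.vertexQ u) = ∏ u ∈ B' \ X.supp, X.vertexQ u := by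
    rw [map_prod]
    refine Finset.prod_congr rfl fun u hu => ?_
    have hui : u ≠ i := fun h => (Finset.mem_sdiff.1 hu).2 (h ▸ hi)
    rw [vertexQ, map_mul, X.act_flip_tailQ ht, if_neg hui]
    congr 1
    have h5 := Polynomial.hom_eval₂ (unmatchedPoly t (X.inE u) (X.rk u))
      (Int.castRingHom (RatFun m n)) (act (X.flip i) : RatFun m n →+* RatFun m n) (X.V u)
    rw [show ((act (X.flip i) : RatFun m n →+* RatFun m n).comp (Int.castRingHom _)) =
      Int.castRingHom _ from RingHom.ext_int _ _] at h5
    refine h5.trans ?_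
    congr 1
    exact X.act_flip_V ht i u
  have h6 : act (X.flip i) (∏ l ∈ B'ᶜ, X.e l (X.coord l X.rho)) =
      ∏ l ∈ B'ᶜ, X.e l (X.coord l X.rho) := by
    rw [map_prod]
    refine Finset.prod_congr rfl fun l hl => ?_
    have hli : l ≠ i := fun h => Finset.mem_compl.1 hl (h ▸ hSupp hi)
    rw [X.act_flip_e, if_neg hli]
  rw [map_mul, map_mul, h1, h4, h6]
  ring

/-- In the presence of the last simple root, the alternating sum is skew under the whole Weyl group
of the subsystem. -/
theorem act_superSum_P (hSupp : X.supp ⊆ B') (hCov : X.CoveredIn B')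
    (hIrr : X.IrreducibleIn B') (hc : X.NotSmallest B' c) (ht : t ≠ SuperType.gl)
    {L : Fin (m + n)} (hL : L ∈ B') (hLv : L.val + 1 = m + n)
    {w : Weight m n ≃ₗ[ℚ] Weight m n} (hw : w ∈ X.weylIn B') :
    act w (superSum t ((X.permIn B' ⊔ X.sharpIn B' c :
        Subgroup (Weight m n ≃ₗ[ℚ] Weight m n)) : Set _) X.P) =
      (sgnPrime t w : RatFun m n) * superSum t ((X.permIn B' ⊔ X.sharpIn B' c :
        Subgroup (Weight m n ≃ₗ[ℚ] Weight m n)) : Set _) X.P := by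
  have hmaj := inE_eq_of_notSmallest hSupp hCov hIrr hc ht hL hLv
  have hex := exists_notMem_supp hSupp hCov hIrr hc hL hLv
  have hH : X.permIn B' ⊔ X.sharpIn B' c ≤ weylGroup t m n :=
    (OrderedBasis.permIn_sup_sharpIn_le hCov hIrr).trans OrderedBasis.weylIn_le
  have hU := finite_of_subset_weylGroup (t := t) hH
  have hsharp : ∀ α ∈ evenRoots t m n, (∀ k, X.coord k α ≠ 0 → k ∈ B') →
      α ∈ rootPart t m n c → reflection α ∈ X.permIn B' ⊔ X.sharpIn B' c := fun α h1 h2 h3 =>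
    Subgroup.mem_sup_right (Subgroup.subset_closure ⟨α, X.mem_evenPart.2
      ⟨(OrderedBasis.mem_evenRootsIn hCov hIrr ht hL hLv).2 ⟨h1, h2⟩, h3⟩, rfl⟩)
  have hswap : ∀ p ∈ B', ∀ q ∈ B', p ≠ q → X.inE p = X.inE q →
      X.perm (Equiv.swap p q) ∈ X.permIn B' ⊔ X.sharpIn B' c := fun p hp q hq hpq h =>
    Subgroup.mem_sup_left (OrderedBasis.swap_mem_permIn hp hq hpq h)
  have hflips : ∀ i ∈ B', ∀ j ∈ B', i ≠ j → X.inE i = c → X.inE j = c →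
      X.flip i * X.flip j ∈ X.permIn B' ⊔ X.sharpIn B' c := by
    intro i hi j hj hij hic hjc
    have hE := hic.trans hjc.symm
    rw [X.flip_mul_flip_eq hij hE, X.reflection_vertex_sub hij hE]
    refine mul_mem (hsharp _ (X.add_mem_evenRoots ht hij hE) (fun k hk => ?_) ?_)
      (hswap i hi j hj hij hE)
    · by_contra hkB
      have h1 : i ≠ k := fun h => hkB (h ▸ hi)
      have h2 : j ≠ k := fun h => hkB (h ▸ hj)
      simp [OrderedBasis.coord_vertex, h1, h2] at hk
    · rw [X.mem_rootPart (i := i) (X.add_mem_evenRoots ht hij hE) ⟨2, two_pos, ?_⟩]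
      · exact hic
      · have := X.form_self_pair hij hE 1 1
        simp only [one_smul] at this
        rw [this]; norm_num
  have hflip : ¬ (t = SuperType.D ∧ c = true) → ∀ i ∈ B', X.inE i = c →
      X.flip i ∈ X.permIn B' ⊔ X.sharpIn B' c := by
    intro hD i hi hic
    obtain ⟨k, h0, h1, h2⟩ := X.exists_reflection_eq_flip ht (hic.symm ▸ hD)
    rw [← h2]
    refine hsharp _ h1 (fun l hl => ?_) ((X.mem_rootPart h1 ⟨k * k, mul_self_pos.2 h0, ?_⟩).2 hic)
    · by_contra hlB
      have h3 : i ≠ l := fun h => hlB (h ▸ hi)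
      simp [OrderedBasis.coord_vertex, h3] at hl
    · rw [form_smul_left, form_smul_right, X.form_vertex, if_pos rfl, mul_assoc]
  obtain ⟨a, ha, hseg⟩ := OrderedBasis.eq_seg hCov hIrr hL hLv
  have hmap := map_P (X := X) (L := superSumHom t hU) (S := B') (i := a) (c := c) hseg ha
    (X.alternating_superSum hH hU hswap) (fun _ => X.flipSkew_superSum hH hU hflip hflips)
    hSupp hmaj hex
  rw [superSumHom_apply, superSumHom_apply] at hmap
  have hminor : ∀ i ∈ B', X.inE i ≠ c → act (X.flip i) (superSum t ((X.permIn B' ⊔ X.sharpIn B' c :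
      Subgroup (Weight m n ≃ₗ[ℚ] Weight m n)) : Set _) X.P) = (X.tau i : RatFun m n) *
        superSum t ((X.permIn B' ⊔ X.sharpIn B' c :
          Subgroup (Weight m n ≃ₗ[ℚ] Weight m n)) : Set _) X.P := by
    intro i hi hic
    have h1 := OrderedBasis.act_flip_superSum hCov hIrr (c := c) (fun j hj hjc =>
      act_flip_matched ht (by
        by_contra h
        exact hjc (hmaj j hj h)) hSupp) hi hic
    have h2 : (2 : RatFun m n) ^ flipCount t c (X.arcs.card + (B' \ X.supp).card) ≠ 0 :=
      pow_ne_zero _ two_ne_zero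
    rw [← hmap, map_mul, map_pow, map_ofNat] at h1
    refine mul_left_cancel₀ h2 ?_
    rw [h1]
    ring
  refine X.act_eq_of_generators (A := (X.evenRootsIn B' : Set (Weight m n)))
    (X.evenRootsIn_subset B') (fun α hα => ?_) hw
  have hαe := X.evenRootsIn_subset B' hα
  have hαs : ∀ k, X.coord k α ≠ 0 → k ∈ B' := fun k hk => OrderedBasis.mem_of_coord_ne_zero hα hk
  obtain ⟨i, j, hE, hi, hj, -, hk, hr⟩ := X.reflection_cases hαe
  have hin : reflection α ∈ X.permIn B' ⊔ X.sharpIn B' c →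
      act (reflection α) (superSum t ((X.permIn B' ⊔ X.sharpIn B' c :
        Subgroup (Weight m n ≃ₗ[ℚ] Weight m n)) : Set _) X.P) = (X.chi (reflection α) : RatFun m n) *
        superSum t ((X.permIn B' ⊔ X.sharpIn B' c :
          Subgroup (Weight m n ≃ₗ[ℚ] Weight m n)) : Set _) X.P := fun h => by
    rw [act_superSum X.toOrderedBasis hH h, X.sgnPrime_cast (hH h)]
  by_cases hic : X.inE i = c
  · exact hin (hsharp α hαe hαs ((X.mem_rootPart hαe hk).2 hic))
  rcases hr with ⟨hij, h⟩ | ⟨-, hij, h⟩ | ⟨-, rfl, hD, h⟩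
  · exact hin (h ▸ hswap i (hαs i hi) j (hαs j hj) hij hE)
  · have hs := hswap i (hαs i hi) j (hαs j hj) hij hE
    rw [h, act_mul, act_superSum X.toOrderedBasis hH hs, X.sgnPrime_cast (hH hs), map_mul,
      map_ratCast, act_mul, hminor j (hαs j hj) (hE ▸ hic), map_mul, map_ratCast,
      hminor i (hαs i hi) hic, X.chi_mul_perm _ (X.inE_swap hE), X.chi_flip_mul_flip hE,
      X.chi_perm (X.inE_swap hE)]
    have h2 : (X.tau i : RatFun m n) * X.tau j = 1 := by exact_mod_cast X.tau_mul_tau hE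
    rw [mul_one]
    linear_combination (((((Equiv.Perm.sign (Equiv.swap i j) : ℤ)) : ℚ)) : RatFun m n) *
      superSum t ((X.permIn B' ⊔ X.sharpIn B' c :
          Subgroup (Weight m n ≃ₗ[ℚ] Weight m n)) : Set _) X.P * h2
  · rw [h, hminor i (hαs i hi) hic, X.chi_flip, OrderedBasis.tau, if_neg hD]

end ArcDiagram

end SuperDenominator

theorem proposition3 (t : SuperDenominator.SuperType) (m n : ℕ)
    (X : SuperDenominator.ArcDiagram t m n) (B' : Finset (Fin (m + n)))
    (hSupp : X.supp ⊆ B') (hCov : X.CoveredIn B') (hIrr : X.IrreducibleIn B')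
    (c : Bool) (hc : X.NotSmallest B' c)
    (Z T : Set (SuperDenominator.Weight m n ≃ₗ[ℚ] SuperDenominator.Weight m n))
    (hT : SuperDenominator.IsRightReps
      ((X.permIn B' : Set (SuperDenominator.Weight m n ≃ₗ[ℚ] SuperDenominator.Weight m n)) *
        (X.sharpIn B' c : Set (SuperDenominator.Weight m n ≃ₗ[ℚ] SuperDenominator.Weight m n)))
      (X.weylIn B') T)
    (hZ : SuperDenominator.IsLeftReps (SuperDenominator.weylGroup t m n) (X.weylIn B') Z) :
    SuperDenominator.superSum t
      (Z * (X.permIn B' : Set (SuperDenominator.Weight m n ≃ₗ[ℚ] SuperDenominator.Weight m n)) *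
        (X.sharpIn B' c : Set (SuperDenominator.Weight m n ≃ₗ[ℚ] SuperDenominator.Weight m n)))
      X.P
    = (SuperDenominator.constC t m n : SuperDenominator.RatFun m n) / (T.ncard : ℕ) *
        (SuperDenominator.expo X.rho * X.superDenominator) := by
  have hle := SuperDenominator.OrderedBasis.permIn_sup_sharpIn_le (c := c) hCov hIrr
  have hW : X.weylIn B' ≤ SuperDenominator.weylGroup t m n :=
    SuperDenominator.OrderedBasis.weylIn_le
  have hskew : ∀ w ∈ X.weylIn B', SuperDenominator.act w (SuperDenominator.superSum t
      ((X.permIn B' ⊔ X.sharpIn B' c : Subgroup _) : Set _) X.P) =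
        (SuperDenominator.sgnPrime t w : SuperDenominator.RatFun m n) *
        SuperDenominator.superSum t ((X.permIn B' ⊔ X.sharpIn B' c : Subgroup _) : Set _) X.P := by
    intro w hw
    by_cases hnt : t = SuperDenominator.SuperType.gl ∨ ∀ L ∈ B', L.val + 1 ≠ m + n
    · have heq : X.permIn B' ⊔ X.sharpIn B' c = X.weylIn B' :=
        le_antisymm hle ((SuperDenominator.OrderedBasis.weylIn_le_permIn hnt).trans le_sup_left)
      rw [heq]
      exact SuperDenominator.act_superSum X.toOrderedBasis hW hw X.P
    · push Not at hnt
      obtain ⟨ht, L, hL, hLv⟩ := hnt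
      exact SuperDenominator.ArcDiagram.act_superSum_P hSupp hCov hIrr hc ht hL hLv hw
  have hcoe := SuperDenominator.OrderedBasis.coe_permIn_sup_sharpIn (c := c) hCov hIrr
  rw [← hcoe] at hT
  have hT0 : (T.ncard : SuperDenominator.RatFun m n) ≠ 0 := by
    obtain ⟨τ, hτ, -⟩ := hT.2 1 (one_mem _)
    exact Nat.cast_ne_zero.2 (Set.ncard_ne_zero_of_mem hτ.1
      (SuperDenominator.finite_of_subset_weylGroup (t := t) (hT.1.trans hW)))
  have hmain := SuperDenominator.ncard_mul_superSum X.toOrderedBasis hW hle hT hZ hskew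
  rw [X.superSum_weylGroup_P] at hmain
  rw [mul_assoc, ← hcoe, div_mul_eq_mul_div, eq_div_iff hT0, ← hmain, mul_comm]
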